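/- Let $k$ be a field of characteristic $0$, let $\mathcal H,\mathcal K$ be Hopf algebras over $k$ with bijective antipodes, and let $M$, $N$ be (left-left) stable anti-Yetter-Drinfeld (SAYD) modules over $\mathcal H$, $\mathcal K$: left modules and left comodules with $(hm)^{(-1)}\otimes (hm)^{(0)}=h^{(1)}m^{(-1)}S^{-1}(h^{(3)})\otimes h^{(2)}m^{(0)}$ and $m^{(-1)}m^{(0)}=m$, and similarly for $N$. **Notation.** *Cyclic module.* $\widetilde C_n(\mathcal H,M)=\mathcal H^{\otimes(n+1)}\,\square_{\mathcal H}\,M$ ($\mathcal H^{\otimes (n+1)}$ with the diagonal coaction), with $\delta_i(h_0\otimes\dots\otimes h_n\otimes m)=h_0\otimes\dots\otimes h_ih_{i+1}\otimes\dots\otimes h_n\otimes m$ for $i<n$, $\delta_n(h_0\otimes\dots\otimes h_n\otimes m)=h_n^{(1)}h_0\otimes h_1\otimes\dots\otimes h_{n-1}\otimes h_n^{(2)}m$, $\sigma_i(h_0\otimes\dots\otimes h_n\otimes m)=h_0\otimes\dots\otimes h_i\otimes 1\otimes h_{i+1}\otimes\dots\otimes h_n\otimes m$, and $\tau_n(h_0\otimes\dots\otimes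 h_n\otimes m)=h_n^{(1)}\otimes h_0\otimes\dots\otimes h_{n-1}\otimes h_n^{(2)}m$. $M\otimes N$ is a SAYD module over $\mathcal H\otimes\mathcal K$ componentwise. *Homology.* To a cyclic module $X$ belongs its normalized mixed complex $(X_*/\text{degenerate},b,B)$, with $b=\sum_i(-1)^i\delta_i$ and $B=(1-\lambda)s_{-1}\sum_{i=0}^{n}\lambda^i$ in degree $n$, where $\lambda=(-1)^n\tau_n$ and $s_{-1}=\tau_{n+1}\sigma_n$. For a mixed complex $C$ let $\mathrm{Tot}\,\mathcal B C=k[u]\otimes C$ with $\deg u=2$ and differential $u^rx\mapsto u^rbx+u^{r-1}Bx$ (with $u^{-1}=0$), and let $S(u^rx)=u^{r-1}x$. A chain of degree $p$ is written $(x_p,x_{p-2},\dots)$, with $x_{p-2r}$ the coefficient of $u^r$. $HC_*(C)$ is the homology of $\mathrm{Tot}\,\mathcal BC$, and $\widetilde{HC}_*(\mathcal H,M)=HC_*(\widetilde C(\mathcal H,M))$. For mixed complexes $C,C'$ the tensor product $C\otimes C'$ is the mixed complex with $b(x\otimes y)=bx\otimes y+(-1)^{|x|}x\otimes by$ and $B(x\otimes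 y)=Bx\otimes y+(-1)^{|x|}x\otimes By$. *Künneth sequence.* The sequence of complexes $$0\to \mathrm{Tot}\,\mathcal B(C\otimes C')\xrightarrow{\ I\ }\mathrm{Tot}\,\mathcal BC\otimes\mathrm{Tot}\,\mathcal BC'\xrightarrow{S\otimes 1-1\otimes S}(\mathrm{Tot}\,\mathcal BC\otimes\mathrm{Tot}\,\mathcal BC')[2]\to0,$$ with $I(v^m(x\otimes y))=\sum_{r+s=m}u^rx\otimes u'^sy$ and with the differential of the last complex not changed in sign by the shift, is exact; its connecting homomorphism is a map $\partial_0:\bigoplus_{i+j=n}HC_i(C)\otimes HC_j(C')\to HC_{n+1}(C\otimes C')$. *Shuffles.* For cyclic modules $X,Y$ let $(X\times Y)_n=X_n\otimes Y_n$. On normalized complexes, $sh_{p,q}(x\otimes y)=x\times y\in (X\times Y)_{p+q}$ is the usual shuffle product: the sum over the permutations $\sigma$ of $\{0,\dots,p+q-1\}$ that are increasing on the first $p$ and on the last $q$ elements of $$\mathrm{sign}(\sigma)\;s_{\sigma(p+q-1)}\cdots s_{\sigma(p)}x\otimes s_{\sigma(p-1)}\cdots s_{\sigma(0)}y.$$ The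 cyclic shuffle is $$sh'_{p,q}(x\otimes y)=(-1)^p\sum_{i=0}^{p}\sum_{j=0}^{q}(-1)^{pi+qj}\,\bigl(s_{-1}\tau^ix\bigr)\times_{i,j}\bigl(s_{-1}\tau^jy\bigr)\in(X\times Y)_{p+q+2},$$ where $\times_{i,j}$ is the part of the shuffle product given by the $(p+1,q+1)$-shuffles $\sigma$ with $\sigma(i)<\sigma(p+1+j)$. Put $\widetilde{Sh}(v^mz)=v^m\,sh(z)+v^{m-1}\,sh'(z)$, a map $\mathrm{Tot}\,\mathcal B(X\otimes Y)\to\mathrm{Tot}\,\mathcal B(X\times Y)$. *Rearrangement.* Let $\Omega^{-1}:\widetilde C(\mathcal H,M)\times\widetilde C(\mathcal K,N)\to\widetilde C(\mathcal H\otimes\mathcal K,M\otimes N)$ be $(h_0\otimes\dots\otimes h_n\otimes m)\otimes(k_0\otimes\dots\otimes k_n\otimes r)\mapsto(h_0\otimes k_0)\otimes\dots\otimes(h_n\otimes k_n)\otimes(m\otimes r)$. **Claim.** 1. $\widetilde{Sh}$ and the map induced by $\Omega^{-1}$ on the complexes $\mathrm{Tot}\,\mathcal B$ are chain maps. Hence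 the boundary map of the Künneth long exact sequence $$\partial=\Omega^{-1}_*\circ\widetilde{Sh}_*\circ\partial_0:\ \bigoplus_{i+j=n}\widetilde{HC}_i(\mathcal H,M)\otimes\widetilde{HC}_j(\mathcal K,N)\to\widetilde{HC}_{n+1}(\mathcal H\otimes\mathcal K,M\otimes N)$$ is defined. 2. For all $p,q\ge0$ the map $(x_p,x_{p-2},\dots)\star(y_q,y_{q-2},\dots)=\Omega^{-1}(Bx_p\times y_q,\;Bx_p\times y_{q-2},\dots)$ takes pairs of cycles to cycles and induces a bilinear product $\star:\widetilde{HC}_p(\mathcal H,M)\times\widetilde{HC}_q(\mathcal K,N)\to\widetilde{HC}_{p+q+1}(\mathcal H\otimes\mathcal K,M\otimes N)$. 3. For all $p,q\ge 0$, $x\in\widetilde{HC}_p(\mathcal H,M)$ and $y\in\widetilde{HC}_q(\mathcal K,N)$, $$\partial(x\otimes y)=x\star y .$$ -/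

import Mathlib

open scoped TensorProduct DirectSum

universe u w

namespace HopfCyclic

/-! ### Cyclic modules -/

/-- A cyclic module over `k`: modules `X n` with faces `d n i : X (n + 1) → X n` for `i ≤ n + 1`,
degeneracies `s n i : X n → X (n + 1)` for `i ≤ n`, and (unsigned) cyclic operators `t n`.
Only the indices `i` in these ranges are meaningful. -/
structure CyclicModule (k : Type w) [CommRing k] where
  X : ℕ → Type u
  [addCommGroup : ∀ n, AddCommGroup (X n)]
  [module : ∀ n, Module k (X n)]
  d : ∀ n : ℕ, ℕ → X (n + 1) →ₗ[k] X n
  s : ∀ n : ℕ, ℕ → X n →ₗ[k] X (n + 1)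
  t : ∀ n : ℕ, X n →ₗ[k] X n
  d_d : ∀ n i j, i ≤ j → j ≤ n + 1 → ∀ x, d n i (d (n + 1) (j + 1) x) = d n j (d (n + 1) i x)
  s_s : ∀ n i j, i ≤ j → j ≤ n → ∀ x, s (n + 1) i (s n j x) = s (n + 1) (j + 1) (s n i x)
  d_s_lt : ∀ n i j, i ≤ j → j ≤ n → ∀ x, d (n + 1) i (s (n + 1) (j + 1) x) = s n j (d n i x)
  d_s_self : ∀ n i, i ≤ n → ∀ x, d n i (s n i x) = x
  d_s_succ : ∀ n i, i ≤ n → ∀ x, d n (i + 1) (s n i x) = x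
  d_s_gt : ∀ n i j, j < i → i ≤ n + 1 → ∀ x, d (n + 1) (i + 1) (s (n + 1) j x) = s n j (d n i x)
  d_t_zero : ∀ n x, d n 0 (t (n + 1) x) = d n (n + 1) x
  d_t_succ : ∀ n i, i ≤ n → ∀ x, d n (i + 1) (t (n + 1) x) = t n (d n i x)
  s_t_zero : ∀ n x, s n 0 (t n x) = t (n + 1) (t (n + 1) (s n n x))
  s_t_succ : ∀ n i, i < n → ∀ x, s n (i + 1) (t n x) = t (n + 1) (s n i x)
  t_pow : ∀ n, t n ^ (n + 1) = 1

attribute [instance] CyclicModule.addCommGroup CyclicModule.module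

/-! ### The cyclic module of a Hopf algebra with coefficients -/

section Words

variable (k : Type w) [Field k] (H : Type u) [Ring H] [HopfAlgebra k H]
  (M : Type u) [AddCommGroup M] [Module k M]

/-- `words k H M n` is `H ⊗ (H ⊗ ⋯ ⊗ (H ⊗ M))` with `n` factors `H`. -/
noncomputable def words : ℕ → ModuleCat.{u} k
  | 0 => ModuleCat.of k M
  | n + 1 => ModuleCat.of k (H ⊗[k] words n)

variable {k H M}

/-- The bilinear map `(h, w) ↦ h ⊗ w`. -/
noncomputable def cons (n : ℕ) : H →ₗ[k] words k H M n →ₗ[k] words k H M (n + 1) :=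
  TensorProduct.mk k H (words k H M n)

/-- The linear map on `H ⊗ w` given by a bilinear map. -/
noncomputable def liftCons {P : Type*} [AddCommGroup P] [Module k P] {n : ℕ}
    (f : H →ₗ[k] words k H M n →ₗ[k] P) : words k H M (n + 1) →ₗ[k] P :=
  TensorProduct.lift f

theorem liftCons_cons {P : Type*} [AddCommGroup P] [Module k P] {n : ℕ}
    (f : H →ₗ[k] words k H M n →ₗ[k] P) (h : H) (x : words k H M n) :
    liftCons f (cons n h x) = f h x :=
  TensorProduct.lift.tmul h x

theorem words_induction {n : ℕ} {p : words k H M (n + 1) → Prop} (x : words k H M (n + 1))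
    (h0 : p 0) (hc : ∀ h y, p (cons n h y)) (ha : ∀ y z, p y → p z → p (y + z)) : p x :=
  TensorProduct.induction_on (motive := p) x h0 hc ha

/-- `id ⊗ f`. -/
noncomputable def lft {m n : ℕ} (f : words k H M m →ₗ[k] words k H M n) :
    words k H M (m + 1) →ₗ[k] words k H M (n + 1) :=
  liftCons ((cons n).compl₂ f)

theorem lft_cons {m n : ℕ} (f : words k H M m →ₗ[k] words k H M n) (h : H) (x : words k H M m) :
    lft f (cons m h x) = cons n h (f x) := by
  rw [lft, liftCons_cons]; rfl

/-- `a ⊗ b ⊗ w ↦ b ⊗ a ⊗ w`. -/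
noncomputable def swp (n : ℕ) : words k H M (n + 2) →ₗ[k] words k H M (n + 2) :=
  (TensorProduct.leftComm k H H (words k H M n)).toLinearMap

theorem swp_cons (n : ℕ) (a b : H) (x : words k H M n) :
    swp n (cons (n + 1) a (cons n b x)) = cons (n + 1) b (cons n a x) :=
  TensorProduct.leftComm_tmul (R := k) a b x

/-- `a ⊗ b ⊗ w ↦ ab ⊗ w`. -/
noncomputable def mulFst (n : ℕ) : words k H M (n + 2) →ₗ[k] words k H M (n + 1) :=
  (TensorProduct.map (LinearMap.mul' k H) LinearMap.id) ∘ₗ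
    (TensorProduct.assoc k H H (words k H M n)).symm.toLinearMap

theorem mulFst_cons (n : ℕ) (a b : H) (x : words k H M n) :
    mulFst n (cons (n + 1) a (cons n b x)) = cons n (a * b) x := rfl

/-- The face `h_0 ⊗ ⋯ ⊗ h_{n+1} ⊗ m ↦ h_0 ⊗ ⋯ ⊗ h_i h_{i+1} ⊗ ⋯ ⊗ h_{n+1} ⊗ m`, for `i ≤ n`. -/
noncomputable def innerFace : ∀ n : ℕ, ℕ → (words k H M (n + 2) →ₗ[k] words k H M (n + 1))
  | n, 0 => mulFst n
  | 0, _ + 1 => 0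
  | n + 1, i + 1 => lft (innerFace n i)

/-- The degeneracy inserting `1` after `h_i`, for `i ≤ n`. -/
noncomputable def degen : ∀ n : ℕ, ℕ → (words k H M (n + 1) →ₗ[k] words k H M (n + 2))
  | n, 0 => lft (cons n 1)
  | 0, _ + 1 => 0
  | n + 1, i + 1 => lft (degen n i)

/-- The cyclic operator `h_0 ⊗ ⋯ ⊗ h_n ⊗ m ↦ h_n⁽¹⁾ ⊗ h_0 ⊗ ⋯ ⊗ h_{n-1} ⊗ h_n⁽²⁾ m`, for an action
`a` of `H` on `M`. -/
noncomputable def rot (a : H →ₐ[k] Module.End k M) :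
    ∀ n : ℕ, words k H M (n + 1) →ₗ[k] words k H M (n + 1)
  | 0 => (TensorProduct.map LinearMap.id (TensorProduct.lift a.toLinearMap) ∘ₗ
      (TensorProduct.assoc k H H M).toLinearMap ∘ₗ
      TensorProduct.map Coalgebra.comul LinearMap.id : H ⊗[k] M →ₗ[k] H ⊗[k] M)
  | n + 1 => swp n ∘ₗ lft (rot a n)

/-- The face `d_i`; the last one is
`h_0 ⊗ ⋯ ⊗ h_{n+1} ⊗ m ↦ h_{n+1}⁽¹⁾ h_0 ⊗ h_1 ⊗ ⋯ ⊗ h_n ⊗ h_{n+1}⁽²⁾ m`. -/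
noncomputable def face (a : H →ₐ[k] Module.End k M) (n i : ℕ) :
    words k H M (n + 2) →ₗ[k] words k H M (n + 1) :=
  if i ≤ n then innerFace n i else mulFst n ∘ₗ rot a (n + 1)

/-- `a ⊗ b` acts by `c ⊗ w ↦ bc ⊗ (a ⊗ w)`. -/
noncomputable def mulCons (n : ℕ) :
    H ⊗[k] H →ₗ[k] (H ⊗[k] words k H M n →ₗ[k] H ⊗[k] words k H M (n + 1)) :=
  TensorProduct.lift (((TensorProduct.mapBilinear (RingHom.id k) H (words k H M n) H
    (words k H M (n + 1))).compl₁₂ (LinearMap.mul k H) (cons n)).flip)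

theorem mulCons_tmul (n : ℕ) (a b c : H) (x : words k H M n) :
    mulCons n (a ⊗ₜ[k] b) (c ⊗ₜ[k] x) = (b * c) ⊗ₜ[k] cons n a x := rfl

/-- The right coaction of `H` on the factor `H^{⊗ n}` of the words, written on the left:
`h_1 ⊗ ⋯ ⊗ h_n ⊗ m ↦ h_1⁽²⁾ ⋯ h_n⁽²⁾ ⊗ (h_1⁽¹⁾ ⊗ ⋯ ⊗ h_n⁽¹⁾ ⊗ m)`. -/
noncomputable def diagCoact : ∀ n : ℕ, words k H M n →ₗ[k] H ⊗[k] words k H M n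
  | 0 => TensorProduct.mk k H (words k H M 0) 1
  | n + 1 => liftCons ((mulCons n ∘ₗ Coalgebra.comul).compl₂ (diagCoact n))

theorem diagCoact_cons (n : ℕ) (h : H) (x : words k H M n) :
    diagCoact (n + 1) (cons n h x) = mulCons n (Coalgebra.comul h) (diagCoact n x) := by
  rw [diagCoact, liftCons_cons]; rfl

/-- The left coaction `ρ` on the factor `M` of the words:
`h_1 ⊗ ⋯ ⊗ h_n ⊗ m ↦ m⁽⁻¹⁾ ⊗ (h_1 ⊗ ⋯ ⊗ h_n ⊗ m⁽⁰⁾)`. -/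
noncomputable def coeffCoact (ρ : M →ₗ[k] H ⊗[k] M) :
    ∀ n : ℕ, words k H M n →ₗ[k] H ⊗[k] words k H M n
  | 0 => ρ
  | n + 1 => liftCons (((TensorProduct.mapBilinear (RingHom.id k) H (words k H M n) H
      (words k H M (n + 1))) LinearMap.id ∘ₗ cons n).compl₂ (coeffCoact ρ n))

theorem coeffCoact_cons (ρ : M →ₗ[k] H ⊗[k] M) (n : ℕ) (h : H) (x : words k H M n) :
    coeffCoact ρ (n + 1) (cons n h x) =
      TensorProduct.map LinearMap.id (cons n h) (coeffCoact ρ n x) := by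
  rw [coeffCoact, liftCons_cons]; rfl

/-- The cotensor product `H^{⊗ n} □_H M`. -/
noncomputable def cotensor (ρ : M →ₗ[k] H ⊗[k] M) (n : ℕ) : Submodule k (words k H M n) :=
  LinearMap.eqLocus (diagCoact n) (coeffCoact ρ n)

end Words

section SAYD

variable {k : Type w} [Field k] {H : Type u} [Ring H] [HopfAlgebra k H]
  {M : Type u} [AddCommGroup M] [Module k M]

/-- The inverse of a bijective antipode. -/
noncomputable def antipodeInv (hS : Function.Bijective (HopfAlgebra.antipode k (A := H))) :
    H →ₗ[k] H :=
  (LinearEquiv.ofBijective (HopfAlgebra.antipode k (A := H)) hS).symm.toLinearMap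

/-- `h₁ ⊗ h₂ ⊗ h₃` acts on `H ⊗ M` by `c ⊗ m ↦ h₁ c S⁻¹(h₃) ⊗ h₂ m`. -/
noncomputable def aydMap (hS : Function.Bijective (HopfAlgebra.antipode k (A := H)))
    (a : H →ₐ[k] Module.End k M) :
    H ⊗[k] (H ⊗[k] H) →ₗ[k] (H ⊗[k] M →ₗ[k] H ⊗[k] M) :=
  TensorProduct.lift (LinearMap.mk₂ k
    (fun x (q : H ⊗[k] H) => TensorProduct.lift
      ((TensorProduct.mapBilinear (RingHom.id k) H M H M).compl₁₂
        (LinearMap.compRight k (LinearMap.mulLeft k x) ∘ₗ (LinearMap.mul k H).flip ∘ₗ antipodeInv hS)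
        a.toLinearMap) (TensorProduct.comm k H H q))
    (fun x y q => by induction q with
      | zero => simp
      | tmul b c => ext; simp [add_mul, TensorProduct.add_tmul]
      | add p q hp hq => simp only [map_add, hp, hq]; abel)
    (fun r x q => by induction q with
      | zero => simp
      | tmul b c => ext; simp [TensorProduct.smul_tmul']
      | add p q hp hq => simp only [map_add, hp, hq, smul_add])
    (fun x p q => by simp only [map_add])
    (fun r x q => by simp only [map_smul]))

theorem aydMap_tmul (hS : Function.Bijective (HopfAlgebra.antipode k (A := H)))
    (a : H →ₐ[k] Module.End k M) (x y z c : H) (m : M) :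
    aydMap hS a (x ⊗ₜ (y ⊗ₜ z)) (c ⊗ₜ m) = (x * (c * antipodeInv hS z)) ⊗ₜ a y m := rfl

variable (k H M) in
/-- The structure of a left-left stable anti-Yetter-Drinfeld module on `M` over a Hopf algebra `H`
with bijective antipode: a left module and left comodule with
`(hm)⁽⁻¹⁾ ⊗ (hm)⁽⁰⁾ = h⁽¹⁾ m⁽⁻¹⁾ S⁻¹(h⁽³⁾) ⊗ h⁽²⁾ m⁽⁰⁾` and `m⁽⁻¹⁾ m⁽⁰⁾ = m`. -/
structure SAYD (hS : Function.Bijective (HopfAlgebra.antipode k (A := H))) where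
  act : H →ₐ[k] Module.End k M
  coact : M →ₗ[k] H ⊗[k] M
  coassoc : (TensorProduct.assoc k H H M).toLinearMap ∘ₗ
      TensorProduct.map Coalgebra.comul LinearMap.id ∘ₗ coact =
    TensorProduct.map LinearMap.id coact ∘ₗ coact
  counit : (TensorProduct.lid k M).toLinearMap ∘ₗ
      TensorProduct.map Coalgebra.counit LinearMap.id ∘ₗ coact = LinearMap.id
  ayd : ∀ h m, coact (act h m) =
    aydMap hS act (TensorProduct.map LinearMap.id Coalgebra.comul (Coalgebra.comul (R := k) h))
      (coact m)
  stable : ∀ m, TensorProduct.lift act.toLinearMap (coact m) = m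

end SAYD
end HopfCyclic

namespace HopfCyclic

section WordLemmas

variable {k : Type w} [Field k] {H : Type u} [Ring H] [HopfAlgebra k H]
  {M : Type u} [AddCommGroup M] [Module k M]

theorem words_ext {P : Type*} [AddCommGroup P] [Module k P] {n : ℕ}
    (f g : words k H M (n + 1) →ₗ[k] P) (h : ∀ a y, f (cons n a y) = g (cons n a y))
    (x : words k H M (n + 1)) : f x = g x := by
  induction x using words_induction with
  | h0 => simp
  | hc a y => exact h a y
  | ha y z hy hz => rw [map_add, map_add, hy, hz]

theorem words_ext_two {P : Type*} [AddCommGroup P] [Module k P] {n : ℕ}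
    (f g : words k H M (n + 2) →ₗ[k] P)
    (h : ∀ a b y, f (cons (n + 1) a (cons n b y)) = g (cons (n + 1) a (cons n b y)))
    (x : words k H M (n + 2)) : f x = g x :=
  words_ext f g (fun a y => words_ext (f ∘ₗ cons (n + 1) a) (g ∘ₗ cons (n + 1) a)
    (fun b z => h a b z) y) x

theorem innerFace_zero (n : ℕ) : innerFace (k := k) (H := H) (M := M) n 0 = mulFst n := by
  cases n <;> rfl

theorem degen_zero (n : ℕ) : degen (k := k) (H := H) (M := M) n 0 = lft (cons n 1) := by
  cases n <;> rfl

theorem innerFace_cons (n i : ℕ) (h : H) (x : words k H M (n + 2)) :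
    innerFace (n + 1) (i + 1) (cons (n + 2) h x) = cons (n + 1) h (innerFace n i x) :=
  lft_cons _ _ _

theorem degen_cons (n i : ℕ) (h : H) (x : words k H M (n + 1)) :
    degen (n + 1) (i + 1) (cons (n + 1) h x) = cons (n + 2) h (degen n i x) :=
  lft_cons _ _ _

theorem degen_zero_cons (n : ℕ) (h : H) (x : words k H M n) :
    degen n 0 (cons n h x) = cons (n + 1) h (cons n 1 x) := by
  rw [degen_zero]; exact lft_cons _ _ _

variable (a : H →ₐ[k] Module.End k M)

theorem rot_cons (n : ℕ) (h : H) (x : words k H M (n + 1)) :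
    rot a (n + 1) (cons (n + 1) h x) = swp n (cons (n + 1) h (rot a n x)) := by
  rw [rot, LinearMap.comp_apply, lft_cons]

/-- The action on words of length zero. -/
noncomputable def slot (h : H) : words k H M 0 →ₗ[k] words k H M 0 := a h

theorem slot_mul (h g : H) (x : words k H M 0) : slot a (h * g) x = slot a h (slot a g x) := by
  change a (h * g) _ = a h (a g _)
  rw [map_mul]; rfl

theorem slot_one (x : words k H M 0) : slot a (1 : H) x = x := by
  change a 1 _ = _
  rw [map_one]; rfl

theorem rot_zero_aux (h : H) (m : M) {ι : Type*} (r : Coalgebra.Repr k h ι) :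
    TensorProduct.map LinearMap.id (TensorProduct.lift a.toLinearMap)
      (TensorProduct.assoc k H H M (Coalgebra.comul (R := k) h ⊗ₜ m)) =
    ∑ i ∈ r.index, r.left i ⊗ₜ[k] a (r.right i) m := by
  rw [← r.eq]
  simp only [TensorProduct.sum_tmul, map_sum, TensorProduct.assoc_tmul, TensorProduct.map_tmul]
  rfl

theorem rot_zero (h : H) (m : words k H M 0) {ι : Type*} (r : Coalgebra.Repr k h ι) :
    rot a 0 (cons 0 h m) = ∑ i ∈ r.index, cons 0 (r.left i) (slot a (r.right i) m) :=
  rot_zero_aux a h m r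

theorem rot_zero_mul (h g : H) (m : words k H M 0) {ι κ : Type*} (r : Coalgebra.Repr k h ι)
    (q : Coalgebra.Repr k g κ) :
    rot a 0 (cons 0 (h * g) m) = ∑ i ∈ r.index, ∑ j ∈ q.index,
      cons 0 (r.left i * q.left j) (slot a (r.right i * q.right j) m) := by
  refine (rot_zero_aux a (h * g) m (r.mul q)).trans ?_
  exact Finset.sum_product _ _ _

theorem innerFace_innerFace (n i j : ℕ) (hij : i ≤ j) (hj : j ≤ n) (x : words k H M (n + 3)) :
    innerFace n i (innerFace (n + 1) (j + 1) x) = innerFace n j (innerFace (n + 1) i x) := by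
  induction n generalizing i j with
  | zero =>
    obtain rfl : j = 0 := by omega
    obtain rfl : i = 0 := by omega
    refine words_ext_two (innerFace 0 0 ∘ₗ innerFace 1 1) (innerFace 0 0 ∘ₗ innerFace 1 0)
      (fun b c y => ?_) x
    refine words_ext (innerFace 0 0 ∘ₗ innerFace 1 1 ∘ₗ cons 2 b ∘ₗ cons 1 c)
      (innerFace 0 0 ∘ₗ innerFace 1 0 ∘ₗ cons 2 b ∘ₗ cons 1 c) (fun e z => ?_) y
    simp only [LinearMap.comp_apply, innerFace_cons, innerFace_zero, mulFst_cons, mul_assoc]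
  | succ n ih =>
    refine words_ext (innerFace (n + 1) i ∘ₗ innerFace (n + 2) (j + 1))
      (innerFace (n + 1) j ∘ₗ innerFace (n + 2) i) (fun b y => ?_) x
    rcases j with _ | j
    · obtain rfl : i = 0 := by omega
      refine words_ext_two (innerFace (n + 1) 0 ∘ₗ innerFace (n + 2) 1 ∘ₗ cons (n + 3) b)
        (innerFace (n + 1) 0 ∘ₗ innerFace (n + 2) 0 ∘ₗ cons (n + 3) b) (fun c e z => ?_) y
      simp only [LinearMap.comp_apply, innerFace_cons, innerFace_zero, mulFst_cons, mul_assoc]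
    · rcases i with _ | i
      · refine words_ext (innerFace (n + 1) 0 ∘ₗ innerFace (n + 2) (j + 2) ∘ₗ cons (n + 3) b)
          (innerFace (n + 1) (j + 1) ∘ₗ innerFace (n + 2) 0 ∘ₗ cons (n + 3) b) (fun c z => ?_) y
        simp only [LinearMap.comp_apply, innerFace_cons, innerFace_zero, mulFst_cons]
      · simp only [LinearMap.comp_apply, innerFace_cons]
        rw [ih i j (by omega) (by omega)]

theorem degen_degen (n i j : ℕ) (hij : i ≤ j) (hj : j ≤ n) (x : words k H M (n + 1)) :
    degen (n + 1) i (degen n j x) = degen (n + 1) (j + 1) (degen n i x) := by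
  induction n generalizing i j with
  | zero =>
    obtain rfl : j = 0 := by omega
    obtain rfl : i = 0 := by omega
    refine words_ext (degen 1 0 ∘ₗ degen 0 0) (degen 1 1 ∘ₗ degen 0 0) (fun b y => ?_) x
    simp only [LinearMap.comp_apply, degen_cons, degen_zero_cons]
  | succ n ih =>
    refine words_ext (degen (n + 2) i ∘ₗ degen (n + 1) j)
      (degen (n + 2) (j + 1) ∘ₗ degen (n + 1) i) (fun b y => ?_) x
    rcases i with _ | i
    · rcases j with _ | j
      · simp only [LinearMap.comp_apply, degen_cons, degen_zero_cons]
      · simp only [LinearMap.comp_apply, degen_cons, degen_zero_cons]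
    · obtain ⟨j, rfl⟩ : ∃ j', j = j' + 1 := ⟨j - 1, by omega⟩
      simp only [LinearMap.comp_apply, degen_cons]
      rw [ih i j (by omega) (by omega)]

theorem innerFace_degen_lt (n i j : ℕ) (hij : i ≤ j) (hj : j ≤ n) (hi : i ≤ n)
    (x : words k H M (n + 2)) :
    innerFace (n + 1) i (degen (n + 1) (j + 1) x) = degen n j (innerFace n i x) := by
  induction n generalizing i j with
  | zero =>
    obtain rfl : j = 0 := by omega
    obtain rfl : i = 0 := by omega
    refine words_ext_two (innerFace 1 0 ∘ₗ degen 1 1) (degen 0 0 ∘ₗ innerFace 0 0)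
      (fun b c y => ?_) x
    simp only [LinearMap.comp_apply, innerFace_zero, mulFst_cons, degen_cons, degen_zero_cons]
  | succ n ih =>
    refine words_ext_two (innerFace (n + 2) i ∘ₗ degen (n + 2) (j + 1))
      (degen (n + 1) j ∘ₗ innerFace (n + 1) i) (fun b c y => ?_) x
    rcases i with _ | i
    · rcases j with _ | j
      · simp only [LinearMap.comp_apply, innerFace_zero, mulFst_cons, degen_cons, degen_zero_cons]
      · simp only [LinearMap.comp_apply, innerFace_zero, mulFst_cons, degen_cons]
    · obtain ⟨j, rfl⟩ : ∃ j', j = j' + 1 := ⟨j - 1, by omega⟩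
      generalize cons (n + 1) c y = v
      rw [LinearMap.comp_apply, LinearMap.comp_apply, degen_cons, innerFace_cons, innerFace_cons,
        degen_cons, ih i j (by omega) (by omega) (by omega)]

theorem innerFace_degen_self (n i : ℕ) (hi : i ≤ n) (x : words k H M (n + 1)) :
    innerFace n i (degen n i x) = x := by
  induction n generalizing i with
  | zero =>
    obtain rfl : i = 0 := by omega
    refine words_ext (innerFace 0 0 ∘ₗ degen 0 0) LinearMap.id (fun b y => ?_) x
    simp only [LinearMap.comp_apply, innerFace_zero, mulFst_cons, degen_zero_cons, mul_one,
      LinearMap.id_apply]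
  | succ n ih =>
    refine words_ext (innerFace (n + 1) i ∘ₗ degen (n + 1) i) LinearMap.id (fun b y => ?_) x
    rcases i with _ | i
    · simp only [LinearMap.comp_apply, innerFace_zero, mulFst_cons, degen_zero_cons, mul_one,
        LinearMap.id_apply]
    · simp only [LinearMap.comp_apply, innerFace_cons, degen_cons, LinearMap.id_apply]
      rw [ih i (by omega)]

theorem innerFace_degen_succ (n i : ℕ) (hi : i < n) (x : words k H M (n + 1)) :
    innerFace n (i + 1) (degen n i x) = x := by
  induction n generalizing i with
  | zero => omega
  | succ n ih =>
    rcases i with _ | i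
    · refine words_ext_two (innerFace (n + 1) 1 ∘ₗ degen (n + 1) 0) LinearMap.id
        (fun b c y => ?_) x
      simp only [LinearMap.comp_apply, innerFace_cons, innerFace_zero, mulFst_cons,
        degen_zero_cons, one_mul, LinearMap.id_apply]
    · refine words_ext (innerFace (n + 1) (i + 2) ∘ₗ degen (n + 1) (i + 1)) LinearMap.id
        (fun b y => ?_) x
      simp only [LinearMap.comp_apply, innerFace_cons, degen_cons, LinearMap.id_apply]
      rw [ih i (by omega)]

theorem innerFace_degen_gt (n i j : ℕ) (hij : j < i) (hi : i ≤ n) (x : words k H M (n + 2)) :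
    innerFace (n + 1) (i + 1) (degen (n + 1) j x) = degen n j (innerFace n i x) := by
  induction n generalizing i j with
  | zero => omega
  | succ n ih =>
    obtain ⟨i, rfl⟩ : ∃ i', i = i' + 1 := ⟨i - 1, by omega⟩
    refine words_ext_two (innerFace (n + 2) (i + 2) ∘ₗ degen (n + 2) j)
      (degen (n + 1) j ∘ₗ innerFace (n + 1) (i + 1)) (fun b c y => ?_) x
    rcases j with _ | j
    · simp only [LinearMap.comp_apply, innerFace_cons, degen_zero_cons]
    · simp only [LinearMap.comp_apply, innerFace_cons, degen_cons]
      rw [ih i j (by omega) (by omega)]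

theorem rot_degen_last (n : ℕ) (x : words k H M (n + 1)) :
    rot a (n + 1) (degen n n x) = cons (n + 1) 1 x := by
  induction n with
  | zero =>
    refine words_ext (rot a 1 ∘ₗ degen 0 0) (cons 1 1) (fun b y => ?_) x
    rw [LinearMap.comp_apply, degen_zero_cons, rot_cons]
    have : rot a 0 (cons 0 1 y) = cons 0 1 y := by
      change (TensorProduct.map LinearMap.id (TensorProduct.lift a.toLinearMap))
        (TensorProduct.assoc k H H M (Coalgebra.comul (R := k) (1 : H) ⊗ₜ (y : M))) = _
      rw [Bialgebra.comul_one, Algebra.TensorProduct.one_def]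
      refine Eq.trans ?_ (congrArg (cons 0 (1 : H)) (slot_one a y))
      rfl
    rw [this, swp_cons]
  | succ n ih =>
    refine words_ext (rot a (n + 2) ∘ₗ degen (n + 1) (n + 1)) (cons (n + 2) 1) (fun b y => ?_) x
    rw [LinearMap.comp_apply, degen_cons, rot_cons, ih, swp_cons]

theorem mulFst_rot_degen_last (n : ℕ) (x : words k H M (n + 1)) :
    mulFst n (rot a (n + 1) (degen n n x)) = x := by
  rw [rot_degen_last]
  refine words_ext (mulFst n ∘ₗ cons (n + 1) 1) LinearMap.id (fun b y => ?_) x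
  rw [LinearMap.comp_apply, mulFst_cons, one_mul, LinearMap.id_apply]

theorem innerFace_succ_rot (n i : ℕ) (hi : i < n) (x : words k H M (n + 2)) :
    innerFace n (i + 1) (rot a (n + 1) x) = rot a n (innerFace n i x) := by
  induction n generalizing i with
  | zero => omega
  | succ n ih =>
    refine words_ext_two (innerFace (n + 1) (i + 1) ∘ₗ rot a (n + 2))
      (rot a (n + 1) ∘ₗ innerFace (n + 1) i) (fun b c y => ?_) x
    rcases i with _ | i
    · simp only [LinearMap.comp_apply, rot_cons, innerFace_zero, mulFst_cons]
      generalize rot a n y = z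
      refine words_ext (innerFace (n + 1) 1 ∘ₗ swp (n + 1) ∘ₗ cons (n + 2) b ∘ₗ swp n ∘ₗ cons (n + 1) c)
        (swp n ∘ₗ cons (n + 1) (b * c)) (fun e v => ?_) z
      simp only [LinearMap.comp_apply, swp_cons, innerFace_cons, innerFace_zero, mulFst_cons]
    · generalize cons (n + 1) c y = v
      rw [LinearMap.comp_apply, LinearMap.comp_apply, rot_cons, innerFace_cons, rot_cons,
        ← ih i (by omega)]
      generalize rot a (n + 1) v = z
      refine words_ext_two (innerFace (n + 1) (i + 2) ∘ₗ swp (n + 1) ∘ₗ cons (n + 2) b)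
        (swp n ∘ₗ cons (n + 1) b ∘ₗ innerFace n (i + 1)) (fun e f v => ?_) z
      obtain ⟨n, rfl⟩ : ∃ n', n = n' + 1 := ⟨n - 1, by omega⟩
      simp only [LinearMap.comp_apply, swp_cons, innerFace_cons]

theorem mulFst_rot_rot (n : ℕ) (x : words k H M (n + 2)) :
    mulFst n (rot a (n + 1) (rot a (n + 1) x)) = rot a n (innerFace n n x) := by
  induction n with
  | zero =>
    refine words_ext_two (mulFst 0 ∘ₗ rot a 1 ∘ₗ rot a 1) (rot a 0 ∘ₗ innerFace 0 0)
      (fun b c y => ?_) x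
    simp only [LinearMap.comp_apply, rot_cons, innerFace_zero, mulFst_cons]
    rw [rot_zero a c y (Coalgebra.Repr.arbitrary k c),
      rot_zero_mul a b c y (Coalgebra.Repr.arbitrary k b) (Coalgebra.Repr.arbitrary k c)]
    simp only [map_sum, swp_cons, rot_cons]
    simp only [rot_zero a b _ (Coalgebra.Repr.arbitrary k b), map_sum, swp_cons, mulFst_cons]
    rw [Finset.sum_comm]
    simp only [slot_mul]
  | succ n ih =>
    refine words_ext (mulFst (n + 1) ∘ₗ rot a (n + 2) ∘ₗ rot a (n + 2))
      (rot a (n + 1) ∘ₗ innerFace (n + 1) (n + 1)) (fun b y => ?_) x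
    simp only [LinearMap.comp_apply, rot_cons (n := n + 1), innerFace_cons]
    rw [rot_cons, ← ih]
    generalize rot a (n + 1) y = z
    refine words_ext (mulFst (n + 1) ∘ₗ rot a (n + 2) ∘ₗ swp (n + 1) ∘ₗ cons (n + 2) b)
      (swp n ∘ₗ cons (n + 1) b ∘ₗ mulFst n ∘ₗ rot a (n + 1)) (fun e v => ?_) z
    simp only [LinearMap.comp_apply, swp_cons, rot_cons]
    generalize rot a n v = u
    refine words_ext (mulFst (n + 1) ∘ₗ swp (n + 1) ∘ₗ cons (n + 2) e ∘ₗ swp n ∘ₗ cons (n + 1) b)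
      (swp n ∘ₗ cons (n + 1) b ∘ₗ mulFst n ∘ₗ swp n ∘ₗ cons (n + 1) e) (fun f v => ?_) u
    simp only [LinearMap.comp_apply, swp_cons, mulFst_cons]

theorem degen_succ_rot (n i : ℕ) (hi : i < n) (x : words k H M (n + 1)) :
    degen n (i + 1) (rot a n x) = rot a (n + 1) (degen n i x) := by
  induction n generalizing i with
  | zero => omega
  | succ n ih =>
    refine words_ext (degen (n + 1) (i + 1) ∘ₗ rot a (n + 1))
      (rot a (n + 2) ∘ₗ degen (n + 1) i) (fun b y => ?_) x
    rcases i with _ | i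
    · simp only [LinearMap.comp_apply, rot_cons, degen_zero_cons]
      generalize rot a n y = z
      refine words_ext (degen (n + 1) 1 ∘ₗ swp n ∘ₗ cons (n + 1) b)
        (swp (n + 1) ∘ₗ cons (n + 2) b ∘ₗ swp n ∘ₗ cons (n + 1) 1) (fun e v => ?_) z
      simp only [LinearMap.comp_apply, swp_cons, degen_cons, degen_zero_cons]
    · simp only [LinearMap.comp_apply, degen_cons]
      rw [rot_cons, rot_cons, ← ih i (by omega)]
      generalize rot a n y = z
      obtain ⟨n, rfl⟩ : ∃ n', n = n' + 1 := ⟨n - 1, by omega⟩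
      refine words_ext_two (degen (n + 2) (i + 2) ∘ₗ swp (n + 1) ∘ₗ cons (n + 2) b)
        (swp (n + 2) ∘ₗ cons (n + 3) b ∘ₗ degen (n + 1) (i + 1)) (fun e f v => ?_) z
      simp only [LinearMap.comp_apply, swp_cons, degen_cons]

theorem degen_zero_rot (n : ℕ) (x : words k H M (n + 1)) :
    degen n 0 (rot a n x) = rot a (n + 1) (rot a (n + 1) (degen n n x)) := by
  rw [rot_degen_last, rot_cons]
  refine words_ext (degen n 0) (swp n ∘ₗ cons (n + 1) 1) (fun b y => ?_) _
  rw [degen_zero_cons, LinearMap.comp_apply, swp_cons]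

end WordLemmas
end HopfCyclic

namespace HopfCyclic

section CotensorStable

variable {k : Type w} [Field k] {H : Type u} [Ring H] [HopfAlgebra k H]
  {M : Type u} [AddCommGroup M] [Module k M]

theorem mulCons_lTensor {m n : ℕ} (f : words k H M m →ₗ[k] words k H M n) (q : H ⊗[k] H)
    (v : H ⊗[k] words k H M m) :
    mulCons n q (LinearMap.lTensor H f v) = LinearMap.lTensor H (lft f) (mulCons m q v) := by
  induction q with
  | zero => simp
  | add p q hp hq => simp only [map_add, LinearMap.add_apply, hp, hq]
  | tmul a b =>
    induction v with
    | zero => simp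
    | add p q hp hq => simp only [map_add, hp, hq]
    | tmul c y => simp only [LinearMap.lTensor_tmul, mulCons_tmul, lft_cons]

theorem mulCons_mulFst (n : ℕ) (p q : H ⊗[k] H) (v : H ⊗[k] words k H M n) :
    LinearMap.lTensor H (mulFst n) (mulCons (n + 1) p (mulCons n q v)) = mulCons n (p * q) v := by
  induction p with
  | zero => simp
  | add p p' hp hq => simp only [map_add, add_mul, LinearMap.add_apply, hp, hq]
  | tmul a b =>
    induction q with
    | zero => simp
    | add p p' hp hq => simp only [map_add, mul_add, LinearMap.add_apply, hp, hq]
    | tmul c e =>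
      induction v with
      | zero => simp
      | add p q hp hq => simp only [map_add, hp, hq]
      | tmul g y =>
        simp only [LinearMap.lTensor_tmul, mulCons_tmul, mulFst_cons,
          Algebra.TensorProduct.tmul_mul_tmul, mul_assoc]

theorem mulCons_one (n : ℕ) (v : H ⊗[k] words k H M n) :
    mulCons n (1 : H ⊗[k] H) v = LinearMap.lTensor H (cons n 1) v := by
  rw [Algebra.TensorProduct.one_def]
  induction v with
  | zero => simp
  | add p q hp hq => simp only [map_add, hp, hq]
  | tmul g y => simp only [LinearMap.lTensor_tmul, mulCons_tmul, one_mul]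

theorem diagCoact_lft {m n : ℕ} (f : words k H M m →ₗ[k] words k H M n)
    (hf : ∀ x, diagCoact n (f x) = LinearMap.lTensor H f (diagCoact m x))
    (x : words k H M (m + 1)) :
    diagCoact (n + 1) (lft f x) = LinearMap.lTensor H (lft f) (diagCoact (m + 1) x) := by
  refine words_ext (diagCoact (n + 1) ∘ₗ lft f)
    (LinearMap.lTensor H (lft f) ∘ₗ diagCoact (m + 1)) (fun h y => ?_) x
  simp only [LinearMap.comp_apply, lft_cons, diagCoact_cons, hf, mulCons_lTensor]

theorem coeffCoact_lft (ρ : M →ₗ[k] H ⊗[k] M) {m n : ℕ} (f : words k H M m →ₗ[k] words k H M n)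
    (hf : ∀ x, coeffCoact ρ n (f x) = LinearMap.lTensor H f (coeffCoact ρ m x))
    (x : words k H M (m + 1)) :
    coeffCoact ρ (n + 1) (lft f x) = LinearMap.lTensor H (lft f) (coeffCoact ρ (m + 1) x) := by
  refine words_ext (coeffCoact ρ (n + 1) ∘ₗ lft f)
    (LinearMap.lTensor H (lft f) ∘ₗ coeffCoact ρ (m + 1)) (fun h y => ?_) x
  simp only [LinearMap.comp_apply, lft_cons, coeffCoact_cons, hf]
  generalize coeffCoact ρ m y = v
  induction v with
  | zero => simp
  | add p q hp hq => simp only [map_add, hp, hq]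
  | tmul g y => simp only [LinearMap.lTensor_tmul, TensorProduct.map_tmul, lft_cons]

theorem diagCoact_innerFace (n i : ℕ) (x : words k H M (n + 2)) :
    diagCoact (n + 1) (innerFace n i x) =
      LinearMap.lTensor H (innerFace n i) (diagCoact (n + 2) x) := by
  have h0 : ∀ (n : ℕ) (x : words k H M (n + 2)), diagCoact (n + 1) (mulFst n x) =
      LinearMap.lTensor H (mulFst n) (diagCoact (n + 2) x) := by
    intro n x
    refine words_ext_two (diagCoact (n + 1) ∘ₗ mulFst n)
      (LinearMap.lTensor H (mulFst n) ∘ₗ diagCoact (n + 2)) (fun a b y => ?_) x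
    simp only [LinearMap.comp_apply, mulFst_cons, diagCoact_cons, mulCons_mulFst,
      Bialgebra.comul_mul]
  induction n generalizing i with
  | zero =>
    rcases i with _ | i
    · exact h0 0 x
    · simp [innerFace]
  | succ n ih =>
    rcases i with _ | i
    · exact h0 (n + 1) x
    · exact diagCoact_lft (innerFace n i) (ih i) x

theorem coeffCoact_innerFace (ρ : M →ₗ[k] H ⊗[k] M) (n i : ℕ) (x : words k H M (n + 2)) :
    coeffCoact ρ (n + 1) (innerFace n i x) =
      LinearMap.lTensor H (innerFace n i) (coeffCoact ρ (n + 2) x) := by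
  have h0 : ∀ (n : ℕ) (x : words k H M (n + 2)), coeffCoact ρ (n + 1) (mulFst n x) =
      LinearMap.lTensor H (mulFst n) (coeffCoact ρ (n + 2) x) := by
    intro n x
    refine words_ext_two (coeffCoact ρ (n + 1) ∘ₗ mulFst n)
      (LinearMap.lTensor H (mulFst n) ∘ₗ coeffCoact ρ (n + 2)) (fun a b y => ?_) x
    simp only [LinearMap.comp_apply, mulFst_cons, coeffCoact_cons]
    generalize coeffCoact ρ n y = v
    induction v with
    | zero => simp
    | add p q hp hq => simp only [map_add, hp, hq]
    | tmul g y =>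
      simp only [LinearMap.lTensor_tmul, TensorProduct.map_tmul, mulFst_cons, LinearMap.id_apply]
  induction n generalizing i with
  | zero =>
    rcases i with _ | i
    · exact h0 0 x
    · simp [innerFace]
  | succ n ih =>
    rcases i with _ | i
    · exact h0 (n + 1) x
    · exact coeffCoact_lft ρ (innerFace n i) (ih i) x

theorem diagCoact_degen (n i : ℕ) (x : words k H M (n + 1)) :
    diagCoact (n + 2) (degen n i x) = LinearMap.lTensor H (degen n i) (diagCoact (n + 1) x) := by
  have h0 : ∀ (n : ℕ) (x : words k H M n), diagCoact (n + 1) (cons n 1 x) =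
      LinearMap.lTensor H (cons n 1) (diagCoact n x) := by
    intro n x
    rw [diagCoact_cons, Bialgebra.comul_one, mulCons_one]
  induction n generalizing i with
  | zero =>
    rcases i with _ | i
    · exact diagCoact_lft (cons 0 1) (h0 0) x
    · simp [degen]
  | succ n ih =>
    rcases i with _ | i
    · exact diagCoact_lft (cons (n + 1) 1) (h0 (n + 1)) x
    · exact diagCoact_lft (degen n i) (ih i) x

theorem coeffCoact_degen (ρ : M →ₗ[k] H ⊗[k] M) (n i : ℕ) (x : words k H M (n + 1)) :
    coeffCoact ρ (n + 2) (degen n i x) =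
      LinearMap.lTensor H (degen n i) (coeffCoact ρ (n + 1) x) := by
  induction n generalizing i with
  | zero =>
    rcases i with _ | i
    · exact coeffCoact_lft ρ (cons 0 1) (coeffCoact_cons ρ 0 1) x
    · simp [degen]
  | succ n ih =>
    rcases i with _ | i
    · exact coeffCoact_lft ρ (cons (n + 1) 1) (coeffCoact_cons ρ (n + 1) 1) x
    · exact coeffCoact_lft ρ (degen n i) (ih i) x

/-! The cyclic operator preserves the cotensor product. -/

/-- `h ↦ h⁽¹⁾ ⊗ h⁽²⁾ ⊗ h⁽³⁾`. -/
noncomputable def comulTwo : H →ₗ[k] H ⊗[k] (H ⊗[k] H) :=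
  TensorProduct.map LinearMap.id Coalgebra.comul ∘ₗ Coalgebra.comul (R := k)

/-- `h ⊗ c ⊗ m ↦ h⁽²⁾ c S⁻¹(h⁽⁴⁾) ⊗ h⁽¹⁾ ⊗ h⁽³⁾ m`, without the first exchange. -/
noncomputable def twistZero (hS : Function.Bijective (HopfAlgebra.antipode k (A := H)))
    (a : H →ₐ[k] Module.End k M) : H ⊗[k] (H ⊗[k] M) →ₗ[k] H ⊗[k] (H ⊗[k] M) :=
  (TensorProduct.leftComm k H H M).toLinearMap ∘ₗ
    TensorProduct.map LinearMap.id
      (TensorProduct.lift (aydMap hS a) ∘ₗ TensorProduct.map comulTwo LinearMap.id) ∘ₗ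
    (TensorProduct.assoc k H H (H ⊗[k] M)).toLinearMap ∘ₗ
    TensorProduct.map Coalgebra.comul LinearMap.id

theorem twistZero_tmul (hS : Function.Bijective (HopfAlgebra.antipode k (A := H)))
    (a : H →ₐ[k] Module.End k M) (h : H) (v : H ⊗[k] M) {ι : Type*}
    (r : Coalgebra.Repr k h ι) :
    twistZero hS a (h ⊗ₜ v) = ∑ i ∈ r.index, TensorProduct.leftComm k H H M
      (r.left i ⊗ₜ aydMap hS a (comulTwo (r.right i)) v) := by
  simp only [twistZero, LinearMap.comp_apply, TensorProduct.map_tmul, ← r.eq,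
    TensorProduct.sum_tmul, map_sum, LinearEquiv.coe_coe, TensorProduct.assoc_tmul,
    TensorProduct.lift.tmul, LinearMap.id_apply]

/-- `c ⊗ (h ⊗ w) ↦ h ⊗ (c ⊗ w)`. -/
noncomputable def pull (n : ℕ) :
    H ⊗[k] words k H M (n + 1) →ₗ[k] H ⊗[k] (H ⊗[k] words k H M n) :=
  (TensorProduct.leftComm k H H (words k H M n)).toLinearMap

/-- `h ⊗ (c ⊗ w) ↦ c ⊗ (h ⊗ w)`. -/
noncomputable def push (n : ℕ) :
    H ⊗[k] (H ⊗[k] words k H M n) →ₗ[k] H ⊗[k] words k H M (n + 1) :=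
  (TensorProduct.leftComm k H H (words k H M n)).toLinearMap

theorem push_tmul (n : ℕ) (h : H) (v : H ⊗[k] words k H M n) :
    push n (h ⊗ₜ v) = LinearMap.lTensor H (cons n h) v := by
  induction v with
  | zero => rw [TensorProduct.tmul_zero, map_zero, map_zero]
  | add p q hp hq => rw [TensorProduct.tmul_add, map_add, map_add, hp, hq]
  | tmul c y => rfl

theorem pull_lTensor (n : ℕ) (h : H) (v : H ⊗[k] words k H M n) :
    pull n (LinearMap.lTensor H (cons n h) v) = h ⊗ₜ v := by
  induction v with
  | zero => rw [TensorProduct.tmul_zero, map_zero, map_zero]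
  | add p q hp hq => rw [TensorProduct.tmul_add, map_add, map_add, hp, hq]
  | tmul c y => rfl

/-- The operator induced by the cyclic operator on the coacted words. -/
noncomputable def twist (hS : Function.Bijective (HopfAlgebra.antipode k (A := H)))
    (a : H →ₐ[k] Module.End k M) :
    ∀ n : ℕ, H ⊗[k] words k H M (n + 1) →ₗ[k] H ⊗[k] words k H M (n + 1)
  | 0 => twistZero hS a ∘ₗ (TensorProduct.leftComm k H H M).toLinearMap
  | n + 1 => LinearMap.lTensor H (swp n) ∘ₗ push (n + 1) ∘ₗ
      LinearMap.lTensor H (twist hS a n) ∘ₗ pull (n + 1)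

variable (hS : Function.Bijective (HopfAlgebra.antipode k (A := H)))
  (a : H →ₐ[k] Module.End k M)

theorem twist_succ (n : ℕ) (h : H) (v : H ⊗[k] words k H M (n + 1)) :
    twist hS a (n + 1) (LinearMap.lTensor H (cons (n + 1) h) v) =
      LinearMap.lTensor H (swp n) (LinearMap.lTensor H (cons (n + 1) h) (twist hS a n v)) := by
  simp only [twist, LinearMap.comp_apply]
  rw [pull_lTensor, LinearMap.lTensor_tmul, push_tmul]

/-- `aydMap` on words of length zero. -/
noncomputable def aydSlot (q : H ⊗[k] (H ⊗[k] H)) :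
    H ⊗[k] words k H M 0 →ₗ[k] H ⊗[k] words k H M 0 := aydMap hS a q

theorem twist_zero (h : H) (v : H ⊗[k] words k H M 0) {ι : Type*} (r : Coalgebra.Repr k h ι) :
    twist hS a 0 (LinearMap.lTensor H (cons 0 h) v) = ∑ i ∈ r.index,
      LinearMap.lTensor H (cons 0 (r.left i)) (aydSlot hS a (comulTwo (r.right i)) v) := by
  refine (congrArg (twistZero hS a) (pull_lTensor 0 h v)).trans ?_
  refine (twistZero_tmul hS a h v r).trans ?_
  refine Finset.sum_congr rfl fun i _ => ?_
  exact push_tmul 0 _ _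

theorem coeffCoact_rot (ρ : M →ₗ[k] H ⊗[k] M)
    (hρ : ∀ h m, ρ (a h m) = aydMap hS a (comulTwo h) (ρ m)) (n : ℕ) (x : words k H M (n + 1)) :
    coeffCoact ρ (n + 1) (rot a n x) = twist hS a n (coeffCoact ρ (n + 1) x) := by
  induction n with
  | zero =>
    refine words_ext (coeffCoact ρ 1 ∘ₗ rot a 0) (twist hS a 0 ∘ₗ coeffCoact ρ 1)
      (fun h m => ?_) x
    simp only [LinearMap.comp_apply]
    rw [rot_zero a h m (Coalgebra.Repr.arbitrary k h), coeffCoact_cons, map_sum]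
    refine Eq.trans ?_ (twist_zero hS a h (coeffCoact ρ 0 m) (Coalgebra.Repr.arbitrary k h)).symm
    refine Finset.sum_congr rfl fun i _ => ?_
    rw [coeffCoact_cons]
    exact congrArg _ (hρ _ _)
  | succ n ih =>
    refine words_ext (coeffCoact ρ (n + 2) ∘ₗ rot a (n + 1))
      (twist hS a (n + 1) ∘ₗ coeffCoact ρ (n + 2)) (fun h y => ?_) x
    simp only [LinearMap.comp_apply]
    rw [rot_cons, coeffCoact_cons]
    refine Eq.trans ?_ (twist_succ hS a n h (coeffCoact ρ (n + 1) y)).symm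
    rw [← ih]
    generalize rot a n y = z
    refine words_ext (coeffCoact ρ (n + 2) ∘ₗ swp n ∘ₗ cons (n + 1) h)
      (LinearMap.lTensor H (swp n) ∘ₗ LinearMap.lTensor H (cons (n + 1) h) ∘ₗ
        coeffCoact ρ (n + 1)) (fun b v => ?_) z
    simp only [LinearMap.comp_apply, swp_cons, coeffCoact_cons]
    generalize coeffCoact ρ n v = q
    induction q with
    | zero => simp
    | add p q hp hq => simp only [map_add, hp, hq]
    | tmul g y => simp only [LinearMap.lTensor_tmul, TensorProduct.map_tmul, swp_cons, LinearMap.id_apply]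

theorem mul_antipodeInv (h : H) {ι : Type*} (r : Coalgebra.Repr k h ι) :
    ∑ i ∈ r.index, r.right i * antipodeInv hS (r.left i) =
      algebraMap k H (Coalgebra.counit (R := k) h) := by
  apply hS.1
  have hinv : ∀ x, HopfAlgebra.antipode k (antipodeInv hS x) = x := fun x =>
    (LinearEquiv.ofBijective (HopfAlgebra.antipode k (A := H)) hS).apply_symm_apply x
  rw [map_sum]
  simp only [HopfAlgebra.antipode_mul_antidistrib, hinv]
  rw [HopfAlgebra.sum_mul_antipode_eq_algebraMap_counit r, Algebra.algebraMap_eq_smul_one,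
    map_smul, HopfAlgebra.antipode_one]

/-- `x ⊗ y ⊗ c ↦ x e c ⊗ y m`. -/
noncomputable def cancelMap (e : H) (m : M) : H ⊗[k] (H ⊗[k] H) →ₗ[k] H ⊗[k] M :=
  TensorProduct.map (LinearMap.mul' k H ∘ₗ TensorProduct.map LinearMap.id (LinearMap.mulLeft k e))
      (LinearMap.flip a.toLinearMap m) ∘ₗ
    (TensorProduct.assoc k H H H).symm.toLinearMap ∘ₗ
    TensorProduct.map LinearMap.id (TensorProduct.comm k H H).toLinearMap

/-- `z ⊗ w ↦ w S⁻¹(z)`. -/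
noncomputable def mulInv : H ⊗[k] H →ₗ[k] H :=
  LinearMap.mul' k H ∘ₗ TensorProduct.map LinearMap.id (antipodeInv hS) ∘ₗ
    (TensorProduct.comm k H H).toLinearMap

theorem mulInv_comul :
    mulInv hS ∘ₗ Coalgebra.comul = Algebra.linearMap k H ∘ₗ Coalgebra.counit (R := k) := by
  ext h
  simp only [LinearMap.comp_apply, mulInv, ← (Coalgebra.Repr.arbitrary k h).eq, map_sum]
  exact mul_antipodeInv hS h (Coalgebra.Repr.arbitrary k h)

theorem aydMap_cancel_aux (e : H) (m : M) (q : (H ⊗[k] (H ⊗[k] H)) ⊗[k] H) :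
    TensorProduct.lift (aydMap hS a) (TensorProduct.map LinearMap.id
      (LinearMap.flip (TensorProduct.mk k H M) m ∘ₗ LinearMap.mulLeft k e) q) =
    cancelMap a e m (TensorProduct.map LinearMap.id (TensorProduct.map LinearMap.id (mulInv hS))
      (TensorProduct.map LinearMap.id (TensorProduct.assoc k H H H).toLinearMap
        (TensorProduct.assoc k H (H ⊗[k] H) H q))) := by
  induction q with
  | zero => simp
  | add p q hp hq => simp only [map_add, hp, hq]
  | tmul p w =>
    induction p with
    | zero => simp
    | add p q hp hq => simp only [map_add, TensorProduct.add_tmul, hp, hq]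
    | tmul x p =>
      induction p with
      | zero => simp
      | add p q hp hq => simp only [map_add, TensorProduct.add_tmul, TensorProduct.tmul_add, hp, hq]
      | tmul y z =>
        change (x * (e * w * antipodeInv hS z)) ⊗ₜ[k] a y m =
          (x * (e * (w * antipodeInv hS z))) ⊗ₜ[k] a y m
        rw [mul_assoc e]

theorem comulTwo_assoc (b : H) :
    TensorProduct.map LinearMap.id (TensorProduct.assoc k H H H).toLinearMap
      (TensorProduct.assoc k H (H ⊗[k] H) H
        (TensorProduct.map comulTwo LinearMap.id (Coalgebra.comul (R := k) b))) =
    TensorProduct.map LinearMap.id comulTwo (Coalgebra.comul (R := k) b) := by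
  have : TensorProduct.map LinearMap.id (TensorProduct.assoc k H H H).toLinearMap ∘ₗ
      (TensorProduct.assoc k H (H ⊗[k] H) H).toLinearMap ∘ₗ
        TensorProduct.map comulTwo LinearMap.id ∘ₗ (Coalgebra.comul (R := k) (A := H)) =
    TensorProduct.map LinearMap.id comulTwo ∘ₗ (Coalgebra.comul (R := k)) := by
    simp only [comulTwo, coassoc_simps]
  exact congrArg (fun f => f b) this

theorem aydMap_cancel (e : H) (m : M) (b : H) :
    TensorProduct.lift (aydMap hS a) (TensorProduct.map comulTwo
      (LinearMap.flip (TensorProduct.mk k H M) m ∘ₗ LinearMap.mulLeft k e)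
      (Coalgebra.comul (R := k) b)) =
    TensorProduct.map (LinearMap.mulRight k e) (LinearMap.flip a.toLinearMap m)
      (Coalgebra.comul (R := k) b) := by
  have h1 := aydMap_cancel_aux hS a e m
    (TensorProduct.map comulTwo LinearMap.id (Coalgebra.comul (R := k) b))
  rw [comulTwo_assoc, TensorProduct.map_map, TensorProduct.map_map, LinearMap.id_comp,
    LinearMap.comp_id] at h1
  rw [h1]
  have h2 : TensorProduct.map LinearMap.id (mulInv hS) ∘ₗ comulTwo =
      LinearMap.flip (TensorProduct.mk k H H) 1 := by
    have : TensorProduct.map LinearMap.id (mulInv hS) ∘ₗ comulTwo =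
        TensorProduct.map LinearMap.id (Algebra.linearMap k H) ∘ₗ
          (LinearMap.lTensor H (Coalgebra.counit (R := k)) ∘ₗ Coalgebra.comul) := by
      rw [comulTwo, ← LinearMap.comp_assoc, ← TensorProduct.map_comp, mulInv_comul,
        LinearMap.lTensor, ← LinearMap.comp_assoc, ← TensorProduct.map_comp]
    rw [this, Coalgebra.lTensor_counit_comp_comul]
    ext h
    simp
  rw [h2]
  generalize Coalgebra.comul (R := k) b = q
  induction q with
  | zero => simp
  | add p q hp hq => simp only [map_add, hp, hq]
  | tmul x y =>
    change (x * (e * 1)) ⊗ₜ[k] a y m = (x * e) ⊗ₜ[k] a y m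
    rw [mul_one]

theorem twistZero_comul (e : H) (m : M) (b : H) :
    twistZero hS a (TensorProduct.map LinearMap.id
      (LinearMap.flip (TensorProduct.mk k H M) m ∘ₗ LinearMap.mulLeft k e)
      (Coalgebra.comul (R := k) b)) =
    TensorProduct.leftComm k H H M (TensorProduct.map LinearMap.id
      (TensorProduct.map (LinearMap.mulRight k e) (LinearMap.flip a.toLinearMap m))
      (TensorProduct.assoc k H H H (TensorProduct.map Coalgebra.comul LinearMap.id
        (Coalgebra.comul (R := k) b)))) := by
  have hass : ∀ q : H ⊗[k] H, TensorProduct.assoc k H H (H ⊗[k] M) (TensorProduct.map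
      Coalgebra.comul LinearMap.id (TensorProduct.map LinearMap.id
      (LinearMap.flip (TensorProduct.mk k H M) m ∘ₗ LinearMap.mulLeft k e) q)) =
      TensorProduct.map LinearMap.id (TensorProduct.map LinearMap.id
        (LinearMap.flip (TensorProduct.mk k H M) m ∘ₗ LinearMap.mulLeft k e))
        (TensorProduct.assoc k H H H (TensorProduct.map Coalgebra.comul LinearMap.id q)) := by
    intro q
    induction q with
    | zero => simp
    | add p q hp hq => simp only [map_add, hp, hq]
    | tmul x y =>
      simp only [TensorProduct.map_tmul, LinearMap.id_apply]
      generalize Coalgebra.comul (R := k) x = p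
      induction p with
      | zero => simp
      | add p q hp hq => simp only [map_add, TensorProduct.add_tmul, hp, hq]
      | tmul z w => rfl
  have hco : TensorProduct.assoc k H H H (TensorProduct.map Coalgebra.comul LinearMap.id
        (Coalgebra.comul (R := k) b)) =
      TensorProduct.map LinearMap.id Coalgebra.comul (Coalgebra.comul (R := k) b) :=
    Coalgebra.coassoc_apply b
  simp only [twistZero, LinearMap.comp_apply, LinearEquiv.coe_coe]
  rw [hass, hco]
  congr 1
  generalize Coalgebra.comul (R := k) b = q
  induction q with
  | zero => simp
  | add p q hp hq => simp only [map_add, hp, hq]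
  | tmul x y =>
    simp only [TensorProduct.map_tmul, LinearMap.id_apply, LinearMap.comp_apply]
    rw [TensorProduct.map_map, LinearMap.id_comp, LinearMap.comp_id, aydMap_cancel]

end CotensorStable
end HopfCyclic

namespace HopfCyclic

section RotDiag

variable {k : Type w} [Field k] {H : Type u} [Ring H] [HopfAlgebra k H]
  {M : Type u} [AddCommGroup M] [Module k M]

/-- The diagonal coaction with `1 ⊗ e` inserted after the first letter. -/
noncomputable def diagCoactIns (e : H) (n : ℕ) :
    words k H M (n + 1) →ₗ[k] H ⊗[k] words k H M (n + 1) :=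
  liftCons ((mulCons n ∘ₗ LinearMap.mulRight k ((1 : H) ⊗ₜ[k] e) ∘ₗ Coalgebra.comul).compl₂
    (diagCoact n))

theorem diagCoactIns_cons (e : H) (n : ℕ) (h : H) (x : words k H M n) :
    diagCoactIns e n (cons n h x) =
      mulCons n (Coalgebra.comul (R := k) h * (1 ⊗ₜ e)) (diagCoact n x) := by
  rw [diagCoactIns, liftCons_cons]; rfl

theorem diagCoactIns_one (n : ℕ) (x : words k H M (n + 1)) :
    diagCoactIns 1 n x = diagCoact (n + 1) x := by
  refine words_ext (diagCoactIns 1 n) (diagCoact (n + 1)) (fun h y => ?_) x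
  rw [diagCoactIns_cons, diagCoact_cons, ← Algebra.TensorProduct.one_def, mul_one]

theorem mulCons_rTensor (n : ℕ) (e p q : H) (v : H ⊗[k] words k H M n) :
    LinearMap.rTensor _ (LinearMap.mulLeft k e) (mulCons n (p ⊗ₜ q) v) =
      LinearMap.lTensor H (cons n p) (LinearMap.rTensor _ (LinearMap.mulLeft k (e * q)) v) := by
  induction v with
  | zero => simp
  | add p q hp hq => simp only [map_add, hp, hq]
  | tmul c y =>
    simp only [mulCons_tmul, LinearMap.rTensor_tmul, LinearMap.lTensor_tmul,
      LinearMap.mulLeft_apply, mul_assoc]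

theorem mulCons_swp (n : ℕ) (e l r : H) (q : H ⊗[k] H) (v : H ⊗[k] words k H M n) :
    LinearMap.lTensor H (swp n) (LinearMap.lTensor H (cons (n + 1) l)
      (mulCons n (q * (1 ⊗ₜ (e * r))) v)) =
    mulCons (n + 1) (q * (1 ⊗ₜ e)) (mulCons n (l ⊗ₜ r) v) := by
  induction q with
  | zero => simp
  | add p q hp hq => simp only [map_add, add_mul, LinearMap.add_apply, hp, hq]
  | tmul a b =>
    induction v with
    | zero => simp
    | add p q hp hq => simp only [map_add, hp, hq]
    | tmul c y =>
      simp only [Algebra.TensorProduct.tmul_mul_tmul, mulCons_tmul, LinearMap.lTensor_tmul,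
        swp_cons, mul_assoc, mul_one]

variable (hS : Function.Bijective (HopfAlgebra.antipode k (A := H)))
  (a : H →ₐ[k] Module.End k M)

/-- `h ↦ h m` for words of length zero. -/
noncomputable def slotAt (m : words k H M 0) : H →ₗ[k] words k H M 0 :=
  LinearMap.flip (a.toLinearMap : H →ₗ[k] M →ₗ[k] M) m

theorem twist_zero_diag (e : H) (b : H) (m : words k H M 0) :
    twist hS a 0 (LinearMap.rTensor _ (LinearMap.mulLeft k e) (diagCoact 1 (cons 0 b m))) =
      diagCoactIns e 0 (rot a 0 (cons 0 b m)) := by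
  have h1 : pull 0 (LinearMap.rTensor _ (LinearMap.mulLeft k e) (diagCoact 1 (cons 0 b m))) =
      TensorProduct.map LinearMap.id
        (LinearMap.flip (TensorProduct.mk k H (words k H M 0)) m ∘ₗ LinearMap.mulLeft k e)
        (Coalgebra.comul (R := k) b) := by
    rw [diagCoact_cons]
    generalize Coalgebra.comul (R := k) b = q
    induction q with
    | zero => simp
    | add p q hp hq => simp only [map_add, LinearMap.add_apply, hp, hq]
    | tmul x y =>
      rw [mulCons_rTensor, pull_lTensor]
      change x ⊗ₜ ((e * y * 1) ⊗ₜ m) = x ⊗ₜ ((e * y) ⊗ₜ m)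
      rw [mul_one]
  have h2 := twistZero_comul hS a e (m : M) b
  refine (congrArg (twistZero hS a) h1).trans (h2.trans ?_)
  have h3 : ∀ q : H ⊗[k] H, push 0 (TensorProduct.map LinearMap.id
      (TensorProduct.map (LinearMap.mulRight k e) (slotAt a m))
      (TensorProduct.assoc k H H H (TensorProduct.map Coalgebra.comul LinearMap.id q))) =
      diagCoactIns e 0 (TensorProduct.lift ((cons 0).compl₂ (slotAt a m)) q) := by
    intro q
    induction q with
    | zero => simp
    | add p q hp hq => simp only [map_add, hp, hq]
    | tmul x y =>
      rw [TensorProduct.lift.tmul, LinearMap.compl₂_apply, diagCoactIns_cons,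
        TensorProduct.map_tmul, LinearMap.id_apply]
      generalize Coalgebra.comul (R := k) x = p
      induction p with
      | zero => simp
      | add p q hp hq =>
        simp only [map_add, TensorProduct.add_tmul, add_mul, LinearMap.add_apply, hp, hq]
      | tmul z w =>
        rw [TensorProduct.assoc_tmul, TensorProduct.map_tmul, push_tmul,
          TensorProduct.map_tmul, LinearMap.lTensor_tmul, Algebra.TensorProduct.tmul_mul_tmul]
        change (w * e) ⊗ₜ cons 0 z _ = mulCons 0 _ (1 ⊗ₜ _)
        rw [mulCons_tmul, mul_one, mul_one]
  refine (h3 _).trans (congrArg _ ?_)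
  rw [rot_zero a b m (Coalgebra.Repr.arbitrary k b), ← (Coalgebra.Repr.arbitrary k b).eq, map_sum]
  rfl

theorem twist_diag (n : ℕ) (e : H) (x : words k H M (n + 1)) :
    twist hS a n (LinearMap.rTensor _ (LinearMap.mulLeft k e) (diagCoact (n + 1) x)) =
      diagCoactIns e n (rot a n x) := by
  induction n generalizing e with
  | zero =>
    exact words_ext (twist hS a 0 ∘ₗ LinearMap.rTensor _ (LinearMap.mulLeft k e) ∘ₗ diagCoact 1)
      (diagCoactIns e 0 ∘ₗ rot a 0) (fun b m => twist_zero_diag hS a e b m) x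
  | succ n ih =>
    refine words_ext (twist hS a (n + 1) ∘ₗ LinearMap.rTensor _ (LinearMap.mulLeft k e) ∘ₗ
      diagCoact (n + 2)) (diagCoactIns e (n + 1) ∘ₗ rot a (n + 1)) (fun h y => ?_) x
    simp only [LinearMap.comp_apply, diagCoact_cons, rot_cons]
    rw [← (Coalgebra.Repr.arbitrary k h).eq]
    simp only [map_sum, LinearMap.sum_apply, mulCons_rTensor, twist_succ, ih]
    generalize rot a n y = z
    induction z using words_induction with
    | h0 => simp
    | ha p q hp hq => simp only [map_add, Finset.sum_add_distrib, hp, hq]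
    | hc b v =>
      rw [swp_cons, diagCoactIns_cons, diagCoact_cons, ← (Coalgebra.Repr.arbitrary k h).eq]
      simp only [map_sum, LinearMap.sum_apply, diagCoactIns_cons, mulCons_swp]

theorem diagCoact_rot (n : ℕ) (x : words k H M (n + 1)) :
    diagCoact (n + 1) (rot a n x) = twist hS a n (diagCoact (n + 1) x) := by
  rw [← diagCoactIns_one, ← twist_diag hS a n 1 x]
  simp

end RotDiag
end HopfCyclic

namespace HopfCyclic

section RotPow

variable {k : Type w} [Field k] {H : Type u} [Ring H] [HopfAlgebra k H]
  {M : Type u} [AddCommGroup M] [Module k M]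

/-- Insert `h` at position `j ≤ n`. -/
noncomputable def insAt (h : H) : ∀ n : ℕ, ℕ → (words k H M n →ₗ[k] words k H M (n + 1))
  | n, 0 => cons n h
  | 0, _ + 1 => 0
  | n + 1, j + 1 => lft (insAt h n j)

theorem insAt_zero (h : H) (n : ℕ) : insAt (k := k) (M := M) h n 0 = cons n h := by
  cases n <;> rfl

theorem insAt_cons (h g : H) (n j : ℕ) (x : words k H M n) :
    insAt h (n + 1) (j + 1) (cons n g x) = cons (n + 1) g (insAt h n j x) :=
  lft_cons _ _ _

variable (a : H →ₐ[k] Module.End k M)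

theorem rot_insAt (h : H) (n j : ℕ) (hj : j ≤ n) (x : words k H M (n + 1)) :
    rot a (n + 1) (insAt h (n + 1) j x) = insAt h (n + 1) (j + 1) (rot a n x) := by
  induction n generalizing j with
  | zero =>
    obtain rfl : j = 0 := by omega
    rw [insAt_zero, rot_cons]
    generalize rot a 0 x = z
    refine words_ext (swp 0 ∘ₗ cons 1 h) (insAt h 1 1) (fun b y => ?_) z
    rw [LinearMap.comp_apply, swp_cons, insAt_cons, insAt_zero]
  | succ n ih =>
    rcases j with _ | j
    · rw [insAt_zero, rot_cons]
      generalize rot a (n + 1) x = z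
      refine words_ext (swp (n + 1) ∘ₗ cons (n + 2) h) (insAt h (n + 2) 1) (fun b y => ?_) z
      rw [LinearMap.comp_apply, swp_cons, insAt_cons, insAt_zero]
    · refine words_ext (rot a (n + 2) ∘ₗ insAt h (n + 2) (j + 1))
        (insAt h (n + 2) (j + 2) ∘ₗ rot a (n + 1)) (fun b y => ?_) x
      rw [LinearMap.comp_apply, LinearMap.comp_apply, insAt_cons, rot_cons, rot_cons,
        ih j (by omega)]
      generalize rot a n y = z
      refine words_ext (swp (n + 1) ∘ₗ cons (n + 2) b ∘ₗ insAt h (n + 1) (j + 1))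
        (insAt h (n + 2) (j + 2) ∘ₗ swp n ∘ₗ cons (n + 1) b) (fun c v => ?_) z
      simp only [LinearMap.comp_apply, swp_cons, insAt_cons]

theorem rot_pow_cons (h : H) (n j : ℕ) (hj : j ≤ n + 1) (x : words k H M (n + 1)) :
    (rot a (n + 1) ^ j) (cons (n + 1) h x) = insAt h (n + 1) j ((rot a n ^ j) x) := by
  induction j with
  | zero => rw [insAt_zero]; rfl
  | succ j ih =>
    rw [pow_succ', pow_succ', Module.End.mul_apply, Module.End.mul_apply, ih (by omega),
      rot_insAt a h n j (by omega)]

/-- The action of `H` on the factor `M` of the words. -/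
noncomputable def slotAct : ∀ n : ℕ, H →ₗ[k] words k H M n →ₗ[k] words k H M n
  | 0 => a.toLinearMap
  | n + 1 => ((TensorProduct.mapBilinear (RingHom.id k) H (words k H M n) H (words k H M n))
      LinearMap.id ∘ₗ slotAct n)

theorem slotAct_cons (n : ℕ) (g h : H) (x : words k H M n) :
    slotAct a (n + 1) g (cons n h x) = cons n h (slotAct a n g x) := rfl

/-- `h ⊗ x ↦ h⁽¹⁾ ⊗ h⁽²⁾ x`. -/
noncomputable def moveFst (n : ℕ) : H ⊗[k] H →ₗ[k] words k H M n →ₗ[k] words k H M (n + 1) :=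
  TensorProduct.lift ((LinearMap.llcomp k (words k H M n) (words k H M n)
    (words k H M (n + 1)) ∘ₗ cons n).compl₂ (slotAct a n))

theorem moveFst_tmul (n : ℕ) (g h : H) (x : words k H M n) :
    moveFst a n (g ⊗ₜ h) x = cons n g (slotAct a n h x) := rfl

theorem rot_insAt_last (h : H) (n : ℕ) (x : words k H M n) :
    rot a n (insAt h n n x) = moveFst a n (Coalgebra.comul h) x := by
  induction n with
  | zero =>
    rw [insAt_zero, rot_zero a h x (Coalgebra.Repr.arbitrary k h),
      ← (Coalgebra.Repr.arbitrary k h).eq, map_sum, LinearMap.sum_apply]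
    rfl
  | succ n ih =>
    refine words_ext (rot a (n + 1) ∘ₗ insAt h (n + 1) (n + 1))
      (moveFst a (n + 1) (Coalgebra.comul h)) (fun b y => ?_) x
    rw [LinearMap.comp_apply, insAt_cons, rot_cons, ih]
    generalize Coalgebra.comul (R := k) h = q
    induction q with
    | zero => simp
    | add p q hp hq => simp only [map_add, LinearMap.add_apply, hp, hq]
    | tmul c e => rw [moveFst_tmul, moveFst_tmul, swp_cons, slotAct_cons]

/-- `g ⊗ x ↦ g x`, the action on the factor `M`. -/
noncomputable def slotMul (n : ℕ) : H ⊗[k] words k H M n →ₗ[k] words k H M n :=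
  TensorProduct.lift (slotAct a n)

theorem slotAct_mul (n : ℕ) (g h : H) (x : words k H M n) :
    slotAct a n (g * h) x = slotAct a n g (slotAct a n h x) := by
  induction n with
  | zero => exact slot_mul a g h x
  | succ n ih =>
    refine words_ext (slotAct a (n + 1) (g * h)) (slotAct a (n + 1) g ∘ₗ slotAct a (n + 1) h)
      (fun b y => ?_) x
    rw [LinearMap.comp_apply, slotAct_cons, slotAct_cons, slotAct_cons, ih]

theorem slotMul_mulCons (n : ℕ) (q : H ⊗[k] H) (v : H ⊗[k] words k H M n) :
    slotMul a (n + 1) (mulCons n q v) = moveFst a n q (slotMul a n v) := by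
  induction q with
  | zero => simp
  | add p q hp hq => simp only [map_add, LinearMap.add_apply, hp, hq]
  | tmul b c =>
    induction v with
    | zero => simp
    | add p q hp hq => simp only [map_add, hp, hq]
    | tmul e y =>
      rw [mulCons_tmul, moveFst_tmul, slotMul, slotMul, TensorProduct.lift.tmul,
        TensorProduct.lift.tmul, slotAct_cons, slotAct_mul]

theorem rot_pow (n : ℕ) (x : words k H M (n + 1)) :
    (rot a n ^ (n + 1)) x = slotMul a (n + 1) (diagCoact (n + 1) x) := by
  induction n with
  | zero =>
    refine words_ext (rot a 0 ^ 1) (slotMul a 1 ∘ₗ diagCoact 1) (fun b y => ?_) x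
    rw [LinearMap.comp_apply, diagCoact_cons, slotMul_mulCons, pow_one]
    have h1 := rot_insAt_last a b 0 y
    rw [insAt_zero] at h1
    rw [h1]
    refine congrArg _ ?_
    exact (slot_one a y).symm
  | succ n ih =>
    refine words_ext (rot a (n + 1) ^ (n + 2)) (slotMul a (n + 2) ∘ₗ diagCoact (n + 2))
      (fun b y => ?_) x
    rw [LinearMap.comp_apply, diagCoact_cons, slotMul_mulCons, pow_succ', Module.End.mul_apply,
      rot_pow_cons a b n (n + 1) le_rfl, rot_insAt_last, ih]

theorem slotMul_coeffCoact (ρ : M →ₗ[k] H ⊗[k] M)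
    (hs : ∀ m, TensorProduct.lift a.toLinearMap (ρ m) = m) (n : ℕ) (x : words k H M n) :
    slotMul a n (coeffCoact ρ n x) = x := by
  induction n with
  | zero => exact hs x
  | succ n ih =>
    refine words_ext (slotMul a (n + 1) ∘ₗ coeffCoact ρ (n + 1)) LinearMap.id (fun b y => ?_) x
    rw [LinearMap.comp_apply, coeffCoact_cons, LinearMap.id_apply]
    conv_rhs => rw [← ih y]
    generalize coeffCoact ρ n y = q
    induction q with
    | zero => simp
    | add p q hp hq => simp only [map_add, hp, hq]
    | tmul c e =>
      rw [TensorProduct.map_tmul, slotMul, slotMul, TensorProduct.lift.tmul,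
        TensorProduct.lift.tmul, slotAct_cons, LinearMap.id_apply]

end RotPow

section Module

variable {k : Type w} [Field k] {H : Type u} [Ring H] [HopfAlgebra k H]
  {M : Type u} [AddCommGroup M] [Module k M]
  {hS : Function.Bijective (HopfAlgebra.antipode k (A := H))}

theorem mem_cotensor {ρ : M →ₗ[k] H ⊗[k] M} {n : ℕ} {x : words k H M n} :
    x ∈ cotensor ρ n ↔ diagCoact n x = coeffCoact ρ n x := Iff.rfl

theorem innerFace_mem (ρ : M →ₗ[k] H ⊗[k] M) (n i : ℕ) :
    ∀ x ∈ cotensor ρ (n + 2), innerFace n i x ∈ cotensor ρ (n + 1) := by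
  intro x hx
  rw [mem_cotensor] at hx ⊢
  rw [diagCoact_innerFace, coeffCoact_innerFace, hx]

theorem degen_mem (ρ : M →ₗ[k] H ⊗[k] M) (n i : ℕ) :
    ∀ x ∈ cotensor ρ (n + 1), degen n i x ∈ cotensor ρ (n + 2) := by
  intro x hx
  rw [mem_cotensor] at hx ⊢
  rw [diagCoact_degen, coeffCoact_degen, hx]

theorem rot_mem (A : SAYD k H M hS) (n : ℕ) :
    ∀ x ∈ cotensor A.coact (n + 1), rot A.act n x ∈ cotensor A.coact (n + 1) := by
  intro x hx
  rw [mem_cotensor] at hx ⊢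
  rw [diagCoact_rot hS, coeffCoact_rot hS A.act A.coact A.ayd, hx]

theorem face_mem (A : SAYD k H M hS) (n i : ℕ) :
    ∀ x ∈ cotensor A.coact (n + 2), face A.act n i x ∈ cotensor A.coact (n + 1) := by
  intro x hx
  rw [face]
  split_ifs
  · exact innerFace_mem _ n i x hx
  · have := innerFace_mem A.coact n 0 _ (rot_mem A (n + 1) x hx)
    rwa [innerFace_zero] at this

theorem rot_pow_eq (A : SAYD k H M hS) (n : ℕ) (x : words k H M (n + 1))
    (hx : x ∈ cotensor A.coact (n + 1)) : (rot A.act n ^ (n + 1)) x = x := by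
  rw [rot_pow, mem_cotensor.1 hx, slotMul_coeffCoact _ _ A.stable]

theorem face_of_le (a : H →ₐ[k] Module.End k M) {n i : ℕ} (h : i ≤ n) :
    face a n i = innerFace n i := if_pos h

theorem face_last (a : H →ₐ[k] Module.End k M) (n : ℕ) (x : words k H M (n + 2)) :
    face a n (n + 1) x = mulFst n (rot a (n + 1) x) := by
  rw [face, if_neg (by omega)]; rfl

theorem face_zero (a : H →ₐ[k] Module.End k M) (n : ℕ) : face a n 0 = mulFst n := by
  rw [face_of_le a (Nat.zero_le n), innerFace_zero]

theorem face_rot_zero (a : H →ₐ[k] Module.End k M) (n : ℕ) (x : words k H M (n + 2)) :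
    face a n 0 (rot a (n + 1) x) = face a n (n + 1) x := by
  rw [face_zero, face_last]

theorem face_rot_succ (a : H →ₐ[k] Module.End k M) (n i : ℕ) (hi : i ≤ n)
    (x : words k H M (n + 2)) :
    face a n (i + 1) (rot a (n + 1) x) = rot a n (face a n i x) := by
  rcases hi.lt_or_eq with h | rfl
  · rw [face_of_le a (show i + 1 ≤ n by omega), face_of_le a hi, innerFace_succ_rot a n i h]
  · rw [face_last, face_of_le a le_rfl, mulFst_rot_rot]

theorem face_face (a : H →ₐ[k] Module.End k M) (n i j : ℕ) (hij : i ≤ j) (hj : j ≤ n + 1)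
    (x : words k H M (n + 3)) :
    face a n i (face a (n + 1) (j + 1) x) = face a n j (face a (n + 1) i x) := by
  have inner : ∀ (i j : ℕ) (_ : i ≤ j) (_ : j ≤ n) (x : words k H M (n + 3)),
      face a n i (face a (n + 1) (j + 1) x) = face a n j (face a (n + 1) i x) := by
    intro i j hij hj x
    rw [face_of_le a (show j + 1 ≤ n + 1 by omega), face_of_le a (show i ≤ n by omega),
      face_of_le a hj, face_of_le a (show i ≤ n + 1 by omega), innerFace_innerFace n i j hij hj]
  rcases hj.lt_or_eq with h | rfl
  · exact inner i j hij (by omega) x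
  · rw [← face_rot_zero a (n + 1)]
    rcases hij.lt_or_eq with h | rfl
    · rw [← inner 0 i (Nat.zero_le _) (by omega), face_rot_succ a (n + 1) i (by omega),
        face_rot_zero]
    · rw [← face_rot_zero a n, ← face_rot_zero a n, ← face_rot_succ a (n + 1) (n + 1) le_rfl,
        ← face_rot_succ a (n + 1) 0 (by omega), inner 0 0 le_rfl (by omega),
        ← face_rot_zero a (n + 1)]

theorem face_degen_lt (a : H →ₐ[k] Module.End k M) (n i j : ℕ) (hij : i ≤ j) (hj : j ≤ n)
    (x : words k H M (n + 2)) :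
    face a (n + 1) i (degen (n + 1) (j + 1) x) = degen n j (face a n i x) := by
  rw [face_of_le a (show i ≤ n + 1 by omega), face_of_le a (show i ≤ n by omega),
    innerFace_degen_lt n i j hij hj (by omega)]

theorem face_degen_self (a : H →ₐ[k] Module.End k M) (n i : ℕ) (hi : i ≤ n)
    (x : words k H M (n + 1)) : face a n i (degen n i x) = x := by
  rw [face_of_le a hi, innerFace_degen_self n i hi]

theorem face_degen_succ (a : H →ₐ[k] Module.End k M) (n i : ℕ) (hi : i ≤ n)
    (x : words k H M (n + 1)) : face a n (i + 1) (degen n i x) = x := by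
  rcases hi.lt_or_eq with h | rfl
  · rw [face_of_le a (show i + 1 ≤ n by omega), innerFace_degen_succ n i h]
  · rw [face_last, mulFst_rot_degen_last]

theorem face_degen_gt (a : H →ₐ[k] Module.End k M) (n i j : ℕ) (hij : j < i) (hi : i ≤ n + 1)
    (x : words k H M (n + 2)) :
    face a (n + 1) (i + 1) (degen (n + 1) j x) = degen n j (face a n i x) := by
  rcases hi.lt_or_eq with h | rfl
  · rw [face_of_le a (show i + 1 ≤ n + 1 by omega), face_of_le a (show i ≤ n by omega),
      innerFace_degen_gt n i j hij (by omega)]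
  · rw [← face_rot_zero, ← degen_succ_rot a (n + 1) j (by omega),
      face_degen_lt a n 0 j (Nat.zero_le _) (by omega), face_rot_zero]

/-- The cyclic module `C̃_n(H, M) = H^{⊗ (n + 1)} □_H M` of a Hopf algebra with coefficients in a
stable anti-Yetter-Drinfeld module. -/
noncomputable def hopfCyclic (A : SAYD k H M hS) : CyclicModule.{u, w} k where
  X n := cotensor A.coact (n + 1)
  d n i := (face A.act n i).restrict (face_mem A n i)
  s n i := (degen n i).restrict (degen_mem A.coact n i)
  t n := (rot A.act n).restrict (rot_mem A n)
  d_d n i j hij hj x := Subtype.ext (face_face A.act n i j hij hj x.1)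
  s_s n i j hij hj x := Subtype.ext (degen_degen n i j hij hj x.1)
  d_s_lt n i j hij hj x := Subtype.ext (face_degen_lt A.act n i j hij hj x.1)
  d_s_self n i hi x := Subtype.ext (face_degen_self A.act n i hi x.1)
  d_s_succ n i hi x := Subtype.ext (face_degen_succ A.act n i hi x.1)
  d_s_gt n i j hij hi x := Subtype.ext (face_degen_gt A.act n i j hij hi x.1)
  d_t_zero n x := Subtype.ext (face_rot_zero A.act n x.1)
  d_t_succ n i hi x := Subtype.ext (face_rot_succ A.act n i hi x.1)
  s_t_zero n x := Subtype.ext (degen_zero_rot A.act n x.1)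
  s_t_succ n i hi x := Subtype.ext (degen_succ_rot A.act n i hi x.1)
  t_pow n := by
    ext x
    rw [Module.End.pow_restrict]
    exact rot_pow_eq A n x x.2

end Module
end HopfCyclic

namespace HopfCyclic

section Tensor

variable {k : Type w} [Field k] {H K : Type u} [Ring H] [HopfAlgebra k H] [Ring K]
  [HopfAlgebra k K] {M N : Type u} [AddCommGroup M] [Module k M] [AddCommGroup N] [Module k N]

theorem antipode_tensor_bijective
    (hS : Function.Bijective (HopfAlgebra.antipode k (A := H)))
    (hT : Function.Bijective (HopfAlgebra.antipode k (A := K))) :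
    Function.Bijective (HopfAlgebra.antipode k (A := H ⊗[k] K)) :=
  (TensorProduct.congr (LinearEquiv.ofBijective _ hS) (LinearEquiv.ofBijective _ hT)).bijective

variable {hS : Function.Bijective (HopfAlgebra.antipode k (A := H))}
  {hT : Function.Bijective (HopfAlgebra.antipode k (A := K))}

theorem antipodeInv_tmul (x : H) (y : K) :
    antipodeInv (antipode_tensor_bijective hS hT) (x ⊗ₜ y) =
      antipodeInv hS x ⊗ₜ antipodeInv hT y := by
  apply (antipode_tensor_bijective hS hT).1
  have h1 : ∀ x, HopfAlgebra.antipode k (antipodeInv hS x) = x := fun x =>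
    (LinearEquiv.ofBijective (HopfAlgebra.antipode k (A := H)) hS).apply_symm_apply x
  have h2 : ∀ x, HopfAlgebra.antipode k (antipodeInv hT x) = x := fun x =>
    (LinearEquiv.ofBijective (HopfAlgebra.antipode k (A := K)) hT).apply_symm_apply x
  have h3 : HopfAlgebra.antipode k (antipodeInv (antipode_tensor_bijective hS hT) (x ⊗ₜ y)) =
      x ⊗ₜ[k] y := (LinearEquiv.ofBijective (HopfAlgebra.antipode k (A := H ⊗[k] K))
        (antipode_tensor_bijective hS hT)).apply_symm_apply _
  rw [h3]
  change _ = HopfAlgebra.antipode k (antipodeInv hS x) ⊗ₜ HopfAlgebra.antipode k (antipodeInv hT y)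
  rw [h1, h2]

/-- The componentwise action of `H ⊗ K` on `M ⊗ N`. -/
noncomputable def tensorAct (a : H →ₐ[k] Module.End k M) (b : K →ₐ[k] Module.End k N) :
    H ⊗[k] K →ₐ[k] Module.End k (M ⊗[k] N) :=
  (Module.endTensorEndAlgHom (R := k) (S := k) (A := k) (M := M) (N := N)).comp
    (Algebra.TensorProduct.map a b)

theorem tensorAct_tmul (a : H →ₐ[k] Module.End k M) (b : K →ₐ[k] Module.End k N) (h : H) (g : K)
    (m : M) (n : N) : tensorAct a b (h ⊗ₜ g) (m ⊗ₜ n) = a h m ⊗ₜ b g n := rfl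

/-- The left coaction `m ⊗ n ↦ (m⁽⁻¹⁾ ⊗ n⁽⁻¹⁾) ⊗ (m⁽⁰⁾ ⊗ n⁽⁰⁾)` of `H ⊗ K` on `M ⊗ N`. -/
noncomputable def tensorCoact (ρ : M →ₗ[k] H ⊗[k] M) (σ : N →ₗ[k] K ⊗[k] N) :
    M ⊗[k] N →ₗ[k] (H ⊗[k] K) ⊗[k] (M ⊗[k] N) :=
  (TensorProduct.tensorTensorTensorComm k H M K N).toLinearMap ∘ₗ TensorProduct.map ρ σ

theorem tensorCoact_tmul (ρ : M →ₗ[k] H ⊗[k] M) (σ : N →ₗ[k] K ⊗[k] N) (m : M) (n : N) :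
    tensorCoact ρ σ (m ⊗ₜ n) =
      TensorProduct.tensorTensorTensorComm k H M K N (ρ m ⊗ₜ σ n) := rfl

theorem comul_tensor (h : H) (g : K) :
    Coalgebra.comul (R := k) (h ⊗ₜ[k] g) = TensorProduct.tensorTensorTensorComm k H H K K
      (Coalgebra.comul (R := k) h ⊗ₜ Coalgebra.comul (R := k) g) := rfl

/-- `(h₁ ⊗ h₂ ⊗ m) ⊗ (g₁ ⊗ g₂ ⊗ n) ↦ (h₁ ⊗ g₁) ⊗ (h₂ ⊗ g₂) ⊗ (m ⊗ n)`. -/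
noncomputable def tripleComm (A B C D : Type u) [AddCommGroup A] [Module k A] [AddCommGroup B]
    [Module k B] [AddCommGroup C] [Module k C] [AddCommGroup D] [Module k D]
    (P Q : Type u) [AddCommGroup P] [Module k P] [AddCommGroup Q] [Module k Q] :
    (A ⊗[k] (B ⊗[k] P)) ⊗[k] (C ⊗[k] (D ⊗[k] Q)) →ₗ[k]
      (A ⊗[k] C) ⊗[k] ((B ⊗[k] D) ⊗[k] (P ⊗[k] Q)) :=
  TensorProduct.map LinearMap.id
    (TensorProduct.tensorTensorTensorComm k B P D Q).toLinearMap ∘ₗ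
    (TensorProduct.tensorTensorTensorComm k A (B ⊗[k] P) C (D ⊗[k] Q)).toLinearMap

theorem map_tensorCoact (ρ : M →ₗ[k] H ⊗[k] M) (σ : N →ₗ[k] K ⊗[k] N)
    (u : H ⊗[k] M) (v : K ⊗[k] N) :
    TensorProduct.map LinearMap.id (tensorCoact ρ σ)
      (TensorProduct.tensorTensorTensorComm k H M K N (u ⊗ₜ v)) =
    tripleComm H H K K M N (TensorProduct.map LinearMap.id ρ u ⊗ₜ
      TensorProduct.map LinearMap.id σ v) := by
  induction u with
  | zero => simp
  | add p q hp hq => simp only [map_add, TensorProduct.add_tmul, hp, hq]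
  | tmul h m =>
    induction v with
    | zero => simp
    | add p q hp hq => simp only [map_add, TensorProduct.tmul_add, hp, hq]
    | tmul g n => rfl

theorem map_comul_tensor (P Q : Type u) [AddCommGroup P] [Module k P] [AddCommGroup Q]
    [Module k Q] (u : H ⊗[k] P) (v : K ⊗[k] Q) :
    TensorProduct.assoc k (H ⊗[k] K) (H ⊗[k] K) (P ⊗[k] Q)
      (TensorProduct.map (Coalgebra.comul (R := k)) LinearMap.id
        (TensorProduct.tensorTensorTensorComm k H P K Q (u ⊗ₜ v))) =
    tripleComm H H K K P Q (TensorProduct.assoc k H H P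
      (TensorProduct.map (Coalgebra.comul (R := k)) LinearMap.id u) ⊗ₜ
      TensorProduct.assoc k K K Q
        (TensorProduct.map (Coalgebra.comul (R := k)) LinearMap.id v)) := by
  induction u with
  | zero => simp
  | add p q hp hq => simp only [map_add, TensorProduct.add_tmul, hp, hq]
  | tmul h m =>
    induction v with
    | zero => simp
    | add p q hp hq => simp only [map_add, TensorProduct.tmul_add, hp, hq]
    | tmul g n =>
      simp only [TensorProduct.tensorTensorTensorComm_tmul, TensorProduct.map_tmul, comul_tensor,
        LinearMap.id_apply]
      generalize Coalgebra.comul (R := k) h = p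
      generalize Coalgebra.comul (R := k) g = q
      induction p with
      | zero => simp
      | add p q hp hq => simp only [map_add, TensorProduct.add_tmul, hp, hq]
      | tmul x y =>
        induction q with
        | zero => simp
        | add p q hp hq => simp only [map_add, TensorProduct.add_tmul, TensorProduct.tmul_add, hp, hq]
        | tmul z t => rfl

theorem comulTwo_tensor (h : H) (g : K) :
    comulTwo (k := k) (h ⊗ₜ[k] g) = tripleComm H H K K H K (comulTwo h ⊗ₜ comulTwo g) := by
  simp only [comulTwo, LinearMap.comp_apply, comul_tensor]
  generalize Coalgebra.comul (R := k) h = p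
  generalize Coalgebra.comul (R := k) g = q
  induction p with
  | zero => simp
  | add p q hp hq => simp only [map_add, TensorProduct.add_tmul, hp, hq]
  | tmul x y =>
    induction q with
    | zero => simp
    | add p q hp hq => simp only [map_add, TensorProduct.tmul_add, hp, hq]
    | tmul z t => rfl

theorem aydMap_tensor (a : H →ₐ[k] Module.End k M) (b : K →ₐ[k] Module.End k N)
    (p : H ⊗[k] (H ⊗[k] H)) (q : K ⊗[k] (K ⊗[k] K)) (u : H ⊗[k] M) (v : K ⊗[k] N) :
    aydMap (antipode_tensor_bijective hS hT) (tensorAct a b) (tripleComm H H K K H K (p ⊗ₜ q))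
      (TensorProduct.tensorTensorTensorComm k H M K N (u ⊗ₜ v)) =
    TensorProduct.tensorTensorTensorComm k H M K N (aydMap hS a p u ⊗ₜ aydMap hT b q v) := by
  induction u with
  | zero => simp
  | add p q hp hq => simp only [map_add, TensorProduct.add_tmul, hp, hq]
  | tmul c m =>
  induction v with
  | zero => simp
  | add p q hp hq => simp only [map_add, TensorProduct.tmul_add, hp, hq]
  | tmul d n =>
  induction p with
  | zero => simp
  | add p q hp hq => simp only [map_add, TensorProduct.add_tmul, LinearMap.add_apply, hp, hq]
  | tmul x p =>
  induction p with
  | zero => simp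
  | add p q hp hq =>
    simp only [map_add, TensorProduct.add_tmul, TensorProduct.tmul_add, LinearMap.add_apply, hp, hq]
  | tmul y z =>
  induction q with
  | zero => simp
  | add p q hp hq => simp only [map_add, TensorProduct.tmul_add, LinearMap.add_apply, hp, hq]
  | tmul x' p =>
  induction p with
  | zero => simp
  | add p q hp hq => simp only [map_add, TensorProduct.tmul_add, LinearMap.add_apply, hp, hq]
  | tmul y' z' =>
    change ((x ⊗ₜ[k] x') * ((c ⊗ₜ[k] d) *
      antipodeInv (antipode_tensor_bijective hS hT) (z ⊗ₜ[k] z'))) ⊗ₜ[k] (a y m ⊗ₜ[k] b y' n) =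
      ((x * (c * antipodeInv hS z)) ⊗ₜ[k] (x' * (d * antipodeInv hT z'))) ⊗ₜ[k]
        (a y m ⊗ₜ[k] b y' n)
    rw [antipodeInv_tmul, Algebra.TensorProduct.tmul_mul_tmul, Algebra.TensorProduct.tmul_mul_tmul]

/-- The tensor product of stable anti-Yetter-Drinfeld modules over `H` and `K`, over `H ⊗ K`. -/
noncomputable def SAYD.tensor (A : SAYD k H M hS) (B : SAYD k K N hT) :
    SAYD k (H ⊗[k] K) (M ⊗[k] N) (antipode_tensor_bijective hS hT) where
  act := tensorAct A.act B.act
  coact := tensorCoact A.coact B.coact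
  coassoc := by
    refine TensorProduct.ext' fun m n => ?_
    have h1 := congrArg (fun f => f m) A.coassoc
    have h2 := congrArg (fun f => f n) B.coassoc
    simp only [LinearMap.comp_apply, LinearEquiv.coe_coe] at h1 h2 ⊢
    rw [tensorCoact_tmul, map_comul_tensor, map_tensorCoact, h1, h2]
  counit := by
    refine TensorProduct.ext' fun m n => ?_
    have h1 := congrArg (fun f => f m) A.counit
    have h2 := congrArg (fun f => f n) B.counit
    simp only [LinearMap.comp_apply, LinearEquiv.coe_coe, LinearMap.id_apply] at h1 h2 ⊢
    rw [tensorCoact_tmul]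
    conv_rhs => rw [← h1, ← h2]
    generalize A.coact m = u
    generalize B.coact n = v
    induction u with
    | zero => simp
    | add p q hp hq => simp only [map_add, TensorProduct.add_tmul, hp, hq]
    | tmul h m =>
      induction v with
      | zero => simp
      | add p q hp hq => simp only [map_add, TensorProduct.tmul_add, hp, hq]
      | tmul g n =>
        simp only [TensorProduct.tensorTensorTensorComm_tmul, TensorProduct.map_tmul,
          TensorProduct.lid_tmul, LinearMap.id_apply, TensorProduct.counit_tmul,
          TensorProduct.smul_tmul_smul]
        rw [smul_eq_mul, mul_comm]
  ayd := by
    intro x y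
    change tensorCoact A.coact B.coact (tensorAct A.act B.act x y) =
      aydMap _ _ (comulTwo x) (tensorCoact A.coact B.coact y)
    induction x with
    | zero => simp
    | add p q hp hq => simp only [map_add, LinearMap.add_apply, hp, hq]
    | tmul h g =>
      induction y with
      | zero => simp
      | add p q hp hq => simp only [map_add, hp, hq]
      | tmul m n =>
        rw [tensorAct_tmul, tensorCoact_tmul, tensorCoact_tmul, comulTwo_tensor, aydMap_tensor,
          A.ayd, B.ayd]
        rfl
  stable := by
    intro y
    induction y with
    | zero => simp
    | add p q hp hq => simp only [map_add, hp, hq]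
    | tmul m n =>
      conv_rhs => rw [← A.stable m, ← B.stable n]
      rw [tensorCoact_tmul]
      generalize A.coact m = u
      generalize B.coact n = v
      induction u with
      | zero => simp
      | add p q hp hq => simp only [map_add, TensorProduct.add_tmul, hp, hq]
      | tmul h m =>
        induction v with
        | zero => simp
        | add p q hp hq => simp only [map_add, TensorProduct.tmul_add, hp, hq]
        | tmul g n => rfl

/-- The rearrangement `(h_1 ⊗ ⋯ ⊗ h_n ⊗ m) ⊗ (g_1 ⊗ ⋯ ⊗ g_n ⊗ r) ↦
(h_1 ⊗ g_1) ⊗ ⋯ ⊗ (h_n ⊗ g_n) ⊗ (m ⊗ r)`. -/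
noncomputable def mergeWords : ∀ n : ℕ,
    words k H M n ⊗[k] words k K N n →ₗ[k] words k (H ⊗[k] K) (M ⊗[k] N) n
  | 0 => (LinearMap.id : M ⊗[k] N →ₗ[k] M ⊗[k] N)
  | n + 1 => TensorProduct.map LinearMap.id (mergeWords n) ∘ₗ
      (TensorProduct.tensorTensorTensorComm k H (words k H M n) K (words k K N n)).toLinearMap

theorem mergeWords_cons (n : ℕ) (h : H) (g : K) (x : words k H M n) (y : words k K N n) :
    mergeWords (n + 1) (cons n h x ⊗ₜ cons n g y) = cons n (h ⊗ₜ g) (mergeWords n (x ⊗ₜ y)) := rfl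

theorem diagCoact_mergeWords (n : ℕ) (x : words k H M n) (y : words k K N n) :
    diagCoact n (mergeWords n (x ⊗ₜ y)) = TensorProduct.map LinearMap.id (mergeWords n)
      (TensorProduct.tensorTensorTensorComm k H (words k H M n) K (words k K N n)
        (diagCoact n x ⊗ₜ diagCoact n y)) := by
  induction n with
  | zero => rfl
  | succ n ih =>
    induction x using words_induction with
    | h0 => simp
    | ha p q hp hq => simp only [map_add, TensorProduct.add_tmul, hp, hq]
    | hc h x =>
    induction y using words_induction with
    | h0 => simp
    | ha p q hp hq => simp only [map_add, TensorProduct.tmul_add, hp, hq]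
    | hc g y =>
      rw [mergeWords_cons, diagCoact_cons, diagCoact_cons, diagCoact_cons, ih, comul_tensor]
      generalize diagCoact n x = u
      generalize diagCoact n y = v
      generalize Coalgebra.comul (R := k) h = p
      generalize Coalgebra.comul (R := k) g = q
      induction p with
      | zero => simp
      | add p q hp hq => simp only [map_add, TensorProduct.add_tmul, LinearMap.add_apply, hp, hq]
      | tmul a b =>
      induction q with
      | zero => simp
      | add p q hp hq => simp only [map_add, TensorProduct.tmul_add, LinearMap.add_apply, hp, hq]
      | tmul c d =>
      induction u with
      | zero => simp
      | add p q hp hq => simp only [map_add, TensorProduct.add_tmul, hp, hq]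
      | tmul e w =>
      induction v with
      | zero => simp
      | add p q hp hq => simp only [map_add, TensorProduct.tmul_add, hp, hq]
      | tmul f z =>
        simp only [TensorProduct.tensorTensorTensorComm_tmul, TensorProduct.map_tmul, mulCons_tmul,
          LinearMap.id_apply, Algebra.TensorProduct.tmul_mul_tmul, mergeWords_cons]

theorem coeffCoact_mergeWords (ρ : M →ₗ[k] H ⊗[k] M) (σ : N →ₗ[k] K ⊗[k] N) (n : ℕ)
    (x : words k H M n) (y : words k K N n) :
    coeffCoact (tensorCoact ρ σ) n (mergeWords n (x ⊗ₜ y)) =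
      TensorProduct.map LinearMap.id (mergeWords n)
      (TensorProduct.tensorTensorTensorComm k H (words k H M n) K (words k K N n)
        (coeffCoact ρ n x ⊗ₜ coeffCoact σ n y)) := by
  induction n with
  | zero =>
    change tensorCoact ρ σ (_ ⊗ₜ _) = TensorProduct.map LinearMap.id LinearMap.id _
    rw [TensorProduct.map_id]
    rfl
  | succ n ih =>
    induction x using words_induction with
    | h0 => simp
    | ha p q hp hq => simp only [map_add, TensorProduct.add_tmul, hp, hq]
    | hc h x =>
    induction y using words_induction with
    | h0 => simp
    | ha p q hp hq => simp only [map_add, TensorProduct.tmul_add, hp, hq]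
    | hc g y =>
      rw [mergeWords_cons, coeffCoact_cons, coeffCoact_cons, coeffCoact_cons, ih]
      generalize coeffCoact ρ n x = u
      generalize coeffCoact σ n y = v
      induction u with
      | zero => simp
      | add p q hp hq => simp only [map_add, TensorProduct.add_tmul, hp, hq]
      | tmul e w =>
      induction v with
      | zero => simp
      | add p q hp hq => simp only [map_add, TensorProduct.tmul_add, hp, hq]
      | tmul f z => rfl

theorem mergeWords_degen (n i : ℕ) (x : words k H M (n + 1)) (y : words k K N (n + 1)) :
    mergeWords (n + 2) (degen n i x ⊗ₜ degen n i y) = degen n i (mergeWords (n + 1) (x ⊗ₜ y)) := by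
  induction x using words_induction with
  | h0 => simp
  | ha p q hp hq => simp only [map_add, TensorProduct.add_tmul, hp, hq]
  | hc h x =>
  induction y using words_induction with
  | h0 => simp
  | ha p q hp hq => simp only [map_add, TensorProduct.tmul_add, hp, hq]
  | hc g y =>
  induction n generalizing i h g with
  | zero =>
    rcases i with _ | i
    · simp only [degen_zero_cons, mergeWords_cons, Algebra.TensorProduct.one_def]
    · simp [degen]
  | succ n ih =>
    rcases i with _ | i
    · simp only [degen_zero_cons, mergeWords_cons, Algebra.TensorProduct.one_def]
    · rw [degen_cons, degen_cons, mergeWords_cons, mergeWords_cons, degen_cons]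
      congr 1
      induction x using words_induction with
      | h0 => simp
      | ha p q hp hq => simp only [map_add, TensorProduct.add_tmul, hp, hq]
      | hc h x =>
      induction y using words_induction with
      | h0 => simp
      | ha p q hp hq => simp only [map_add, TensorProduct.tmul_add, hp, hq]
      | hc g y => exact ih i h x g y

/-- The inverse `C̃(H, M) × C̃(K, N) → C̃(H ⊗ K, M ⊗ N)` of the isomorphism `Ω`, in degree `n`. -/
noncomputable def omegaInv (A : SAYD k H M hS) (B : SAYD k K N hT) (n : ℕ) :
    (hopfCyclic A).X n ⊗[k] (hopfCyclic B).X n →ₗ[k] (hopfCyclic (A.tensor B)).X n :=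
  LinearMap.codRestrict (cotensor (tensorCoact A.coact B.coact) (n + 1))
    (mergeWords (n + 1) ∘ₗ TensorProduct.map (cotensor A.coact (n + 1)).subtype
      (cotensor B.coact (n + 1)).subtype) (fun q => by
    induction q with
    | zero => rw [map_zero]; exact Submodule.zero_mem _
    | add p q hp hq => rw [map_add]; exact Submodule.add_mem _ hp hq
    | tmul x y =>
      change diagCoact (n + 1) (mergeWords (n + 1) (x.1 ⊗ₜ y.1)) =
        coeffCoact (tensorCoact A.coact B.coact) (n + 1) (mergeWords (n + 1) (x.1 ⊗ₜ y.1))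
      rw [diagCoact_mergeWords, coeffCoact_mergeWords, mem_cotensor.1 x.2, mem_cotensor.1 y.2])

theorem omegaInv_s (A : SAYD k H M hS) (B : SAYD k K N hT) (n i : ℕ)
    (q : (hopfCyclic A).X n ⊗[k] (hopfCyclic B).X n) :
    omegaInv A B (n + 1) (TensorProduct.map ((hopfCyclic A).s n i) ((hopfCyclic B).s n i) q) =
      (hopfCyclic (A.tensor B)).s n i (omegaInv A B n q) := by
  induction q with
  | zero => simp
  | add p q hp hq => simp only [map_add, hp, hq]
  | tmul x y => exact Subtype.ext (mergeWords_degen n i x.1 y.1)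

end Tensor
end HopfCyclic

namespace HopfCyclic

/-! ### Mixed complexes -/

/-- A mixed complex over `k`, in nonnegative degrees. -/
structure MixedComplex (k : Type w) [CommRing k] where
  X : ℕ → Type u
  [addCommGroup : ∀ n, AddCommGroup (X n)]
  [module : ∀ n, Module k (X n)]
  b : ∀ n : ℕ, X (n + 1) →ₗ[k] X n
  B : ∀ n : ℕ, X n →ₗ[k] X (n + 1)
  b_b : ∀ n x, b n (b (n + 1) x) = 0
  B_B : ∀ n x, B (n + 1) (B n x) = 0
  b_B_zero : ∀ x, b 0 (B 0 x) = 0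
  b_B : ∀ n x, b (n + 1) (B (n + 1) x) + B n (b n x) = 0

attribute [instance] MixedComplex.addCommGroup MixedComplex.module

namespace CyclicModule

variable {k : Type w} [CommRing k] (C : CyclicModule.{u, w} k)

/-- The signed cyclic operator `(-1)ⁿ t`. -/
def lam (n : ℕ) : Module.End k (C.X n) := (-1 : ℤ) ^ n • C.t n

/-- The norm operator `∑ λ^i`. -/
def norm (n : ℕ) : Module.End k (C.X n) := ∑ i ∈ Finset.range (n + 1), C.lam n ^ i

/-- The signed face `(-1)^i d_i`. -/
def sd (n i : ℕ) : C.X (n + 1) →ₗ[k] C.X n := (-1 : ℤ) ^ i • C.d n i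

/-- The Hochschild boundary. -/
def b (n : ℕ) : C.X (n + 1) →ₗ[k] C.X n :=
  ∑ i ∈ Finset.range (n + 2), (-1 : ℤ) ^ i • C.d n i

/-- The extra degeneracy `s_{-1} = t s_n`. -/
def sExt (n : ℕ) : C.X n →ₗ[k] C.X (n + 1) := C.t (n + 1) ∘ₗ C.s n n

/-- The Connes operator `(1 - λ) s_{-1} N`. -/
def B (n : ℕ) : C.X n →ₗ[k] C.X (n + 1) :=
  (1 - C.lam (n + 1)) ∘ₗ C.sExt n ∘ₗ C.norm n

theorem lam_apply (n : ℕ) (x : C.X n) : C.lam n x = (-1 : ℤ) ^ n • C.t n x := rfl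

theorem sd_apply (n i : ℕ) (x : C.X (n + 1)) : C.sd n i x = (-1 : ℤ) ^ i • C.d n i x := rfl

theorem b_apply (n : ℕ) (x : C.X (n + 1)) :
    C.b n x = ∑ i ∈ Finset.range (n + 2), C.sd n i x := by
  rw [b, LinearMap.sum_apply]; rfl

theorem norm_apply (n : ℕ) (x : C.X n) :
    C.norm n x = ∑ i ∈ Finset.range (n + 1), (C.lam n ^ i) x := by
  rw [norm, LinearMap.sum_apply]

theorem B_apply (n : ℕ) (x : C.X n) :
    C.B n x = C.sExt n (C.norm n x) - C.lam (n + 1) (C.sExt n (C.norm n x)) := rfl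

theorem lam_pow (n : ℕ) : C.lam n ^ (n + 1) = 1 := by
  rw [lam, smul_pow, C.t_pow, ← pow_mul, Even.neg_one_pow (Nat.even_mul_succ_self n), one_smul]

theorem norm_mul_lam (n : ℕ) : C.norm n * C.lam n = C.norm n := by
  have h : C.norm n * (C.lam n - 1) = 0 := by
    rw [norm, geom_sum_mul, lam_pow, sub_self]
  rw [mul_sub, mul_one, sub_eq_zero] at h
  exact h

theorem lam_mul_norm (n : ℕ) : C.lam n * C.norm n = C.norm n := by
  have h : (C.lam n - 1) * C.norm n = 0 := by
    rw [norm, mul_geom_sum, lam_pow, sub_self]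
  rw [sub_mul, one_mul, sub_eq_zero] at h
  exact h

theorem norm_lam (n : ℕ) (x : C.X n) : C.norm n (C.lam n x) = C.norm n x :=
  congrArg (fun f => f x) (C.norm_mul_lam n)

theorem lam_norm (n : ℕ) (x : C.X n) : C.lam n (C.norm n x) = C.norm n x :=
  congrArg (fun f => f x) (C.lam_mul_norm n)

theorem sd_lam_zero (n : ℕ) (x : C.X (n + 1)) : C.sd n 0 (C.lam (n + 1) x) = C.sd n (n + 1) x := by
  rw [sd_apply, sd_apply, lam_apply, map_zsmul, C.d_t_zero, pow_zero, one_smul]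

theorem sd_lam_succ (n i : ℕ) (hi : i ≤ n) (x : C.X (n + 1)) :
    C.sd n (i + 1) (C.lam (n + 1) x) = C.lam n (C.sd n i x) := by
  rw [sd_apply, sd_apply, lam_apply, lam_apply, map_zsmul, map_zsmul, C.d_t_succ n i hi,
    smul_smul, smul_smul]
  congr 1
  ring

/-- The boundary without the last face. -/
def b' (n : ℕ) (x : C.X (n + 1)) : C.X n := ∑ i ∈ Finset.range (n + 1), C.sd n i x

theorem b_sub_lam (n : ℕ) (x : C.X (n + 1)) :
    C.b n (x - C.lam (n + 1) x) = C.b' n x - C.lam n (C.b' n x) := by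
  rw [map_sub, b_apply, b_apply, b', map_sum, Finset.sum_range_succ _ (n + 1),
    Finset.sum_range_succ' _ (n + 1), sd_lam_zero,
    Finset.sum_congr rfl (fun i hi => C.sd_lam_succ n i (by
      have := Finset.mem_range.1 hi
      omega) x)]
  abel

theorem sd_norm (n i : ℕ) (hi : i ≤ n + 1) (x : C.X (n + 1)) :
    C.sd n i (C.norm (n + 1) x) = (C.lam n ^ i) (C.sd n 0 (C.norm (n + 1) x)) := by
  induction i with
  | zero => rfl
  | succ i ih =>
    rw [← lam_norm, sd_lam_succ _ _ _ (by omega), ih (by omega), lam_norm, pow_succ']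
    rfl

theorem norm_sd (n j : ℕ) (hj : j ≤ n + 1) (x : C.X (n + 1)) :
    C.norm n (C.sd n (n + 1 - j) x) = C.norm n (C.sd n 0 ((C.lam (n + 1) ^ (j + 1)) x)) := by
  induction j generalizing x with
  | zero => rw [Nat.sub_zero, ← sd_lam_zero, zero_add, pow_one]
  | succ j ih =>
    have h := ih (by omega) (C.lam (n + 1) x)
    rw [show n + 1 - j = (n + 1 - (j + 1)) + 1 by omega, sd_lam_succ _ _ _ (by omega),
      norm_lam] at h
    rw [h, pow_succ _ (j + 1)]
    rfl

theorem b'_norm (n : ℕ) (x : C.X (n + 1)) :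
    C.b' n (C.norm (n + 1) x) = C.norm n (C.b n x) := by
  have h1 : C.b' n (C.norm (n + 1) x) = C.norm n (C.sd n 0 (C.norm (n + 1) x)) := by
    rw [b', C.norm_apply n]
    refine Finset.sum_congr rfl fun i hi => C.sd_norm n i ?_ x
    have := Finset.mem_range.1 hi
    omega
  have h2 : C.norm (n + 1) x =
      ∑ j ∈ Finset.range (n + 2), (C.lam (n + 1) ^ (j + 1)) x := by
    rw [← norm_lam, norm_apply]
    rfl
  rw [h1, b_apply, map_sum, ← Finset.sum_range_reflect, h2, map_sum, map_sum]
  refine Finset.sum_congr rfl fun j hj => ?_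
  have := Finset.mem_range.1 hj
  rw [show n + 2 - 1 - j = n + 1 - j by omega, norm_sd _ _ _ (by omega)]

theorem sd_sExt_zero (n : ℕ) (x : C.X n) : C.sd n 0 (C.sExt n x) = x := by
  rw [sd_apply, pow_zero, one_smul]
  change C.d n 0 (C.t (n + 1) (C.s n n x)) = x
  rw [C.d_t_zero, C.d_s_succ n n le_rfl]

theorem sd_sExt_succ (n i : ℕ) (hi : i ≤ n) (x : C.X (n + 1)) :
    C.sd (n + 1) (i + 1) (C.sExt (n + 1) x) = - C.sExt n (C.sd n i x) := by
  rw [sd_apply, sd_apply, map_zsmul, pow_succ', neg_one_mul, neg_smul]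
  change -((-1 : ℤ) ^ i • C.d (n + 1) (i + 1) (C.t (n + 2) (C.s (n + 1) (n + 1) x))) =
    -((-1 : ℤ) ^ i • C.t (n + 1) (C.s n n (C.d n i x)))
  rw [C.d_t_succ (n + 1) i (by omega), C.d_s_lt n i n hi le_rfl]

theorem b'_sExt_zero (x : C.X 0) : C.b' 0 (C.sExt 0 x) = x := by
  rw [b', Finset.sum_range_one, sd_sExt_zero]

theorem b'_sExt (n : ℕ) (x : C.X (n + 1)) :
    C.b' (n + 1) (C.sExt (n + 1) x) = x - C.sExt n (C.b' n x) := by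
  rw [b', b', Finset.sum_range_succ', sd_sExt_zero, map_sum,
    Finset.sum_congr rfl (fun i hi => C.sd_sExt_succ n i (by
      have := Finset.mem_range.1 hi
      omega) x), Finset.sum_neg_distrib]
  abel

theorem b_B (n : ℕ) (x : C.X (n + 1)) : C.b (n + 1) (C.B (n + 1) x) + C.B n (C.b n x) = 0 := by
  rw [B_apply, b_sub_lam, b'_sExt, b'_norm, map_sub, lam_norm, B_apply]
  abel

theorem b_B_zero (x : C.X 0) : C.b 0 (C.B 0 x) = 0 := by
  rw [B_apply, b_sub_lam, b'_sExt_zero, lam_norm, sub_self]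

theorem B_B (n : ℕ) (x : C.X n) : C.B (n + 1) (C.B n x) = 0 := by
  have h : C.norm (n + 1) (C.B n x) = 0 := by
    rw [B_apply, map_sub, norm_lam, sub_self]
  rw [B_apply, h, map_zero, map_zero, sub_zero]

theorem b_b (n : ℕ) (x : C.X (n + 2)) : C.b n (C.b (n + 1) x) = 0 := by
  simp only [b_apply, map_sum]
  rw [← Finset.sum_product']
  refine Finset.sum_involution
    (fun p _ => if p.2 < p.1 then (p.2, p.1 - 1) else (p.2 + 1, p.1)) ?_ ?_ ?_ ?_
  · rintro ⟨i, j⟩ h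
    simp only [Finset.mem_product, Finset.mem_range] at h
    by_cases hij : j < i
    · obtain ⟨i, rfl⟩ : ∃ l, i = l + 1 := ⟨i - 1, by omega⟩
      simp only [hij, if_true, Nat.add_sub_cancel]
      simp only [sd_apply, map_zsmul, smul_smul]
      rw [C.d_d n j i (by omega) (by omega), ← add_smul]
      rw [show (-1 : ℤ) ^ (i + 1) * (-1) ^ j + (-1) ^ j * (-1) ^ i = 0 by ring, zero_smul]
    · simp only [hij, if_false]
      simp only [sd_apply, map_zsmul, smul_smul]
      rw [C.d_d n i j (by omega) (by omega), ← add_smul]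
      rw [show (-1 : ℤ) ^ i * (-1) ^ j + (-1) ^ (j + 1) * (-1) ^ i = 0 by ring, zero_smul]
  · rintro ⟨i, j⟩ h _ he
    by_cases hij : j < i
    · simp only [hij, if_true, Prod.mk.injEq] at he
      omega
    · simp only [hij, if_false, Prod.mk.injEq] at he
      omega
  · rintro ⟨i, j⟩ h
    simp only [Finset.mem_product, Finset.mem_range] at h ⊢
    by_cases hij : j < i
    · simp only [hij, if_true]; omega
    · simp only [hij, if_false]; omega
  · rintro ⟨i, j⟩ h
    by_cases hij : j < i
    · simp only [hij, if_true]
      rw [if_neg (by omega), Nat.sub_add_cancel (by omega)]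
    · simp only [hij, if_false]
      rw [if_pos (by omega), Nat.add_sub_cancel]

/-! Normalization. -/

/-- The image of `s_i` in degree `n`. -/
def degenAt : ∀ n : ℕ, ℕ → Submodule k (C.X n)
  | 0, _ => ⊥
  | n + 1, i => LinearMap.range (C.s n i)

/-- The degenerate elements of degree `n`: the span of the images of `s_0, …, s_{n-1}`. -/
def degenerate (n : ℕ) : Submodule k (C.X n) := ⨆ i : Fin n, C.degenAt n i

theorem degenAt_le {n i : ℕ} (h : i < n) : C.degenAt n i ≤ C.degenerate n :=
  le_iSup (fun i : Fin n => C.degenAt n i) ⟨i, h⟩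

theorem s_mem (n i : ℕ) (h : i ≤ n) (x : C.X n) : C.s n i x ∈ C.degenerate (n + 1) :=
  C.degenAt_le (Nat.lt_succ_of_le h) ⟨x, rfl⟩

theorem degenerate_le {n : ℕ} {D : Submodule k (C.X (n + 1))}
    (h : ∀ i ≤ n, ∀ x, C.s n i x ∈ D) : C.degenerate (n + 1) ≤ D := by
  refine iSup_le fun i => ?_
  rintro _ ⟨x, rfl⟩
  exact h i (Nat.lt_succ_iff.1 i.2) x

theorem degenerate_zero : C.degenerate 0 = ⊥ := by
  rw [degenerate, iSup_of_empty]

theorem b_mem (n : ℕ) : C.degenerate (n + 1) ≤ (C.degenerate n).comap (C.b n) := by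
  refine C.degenerate_le fun i hi x => ?_
  rw [Submodule.mem_comap, b_apply]
  have hc : C.sd n i (C.s n i x) + C.sd n (i + 1) (C.s n i x) = 0 := by
    rw [sd_apply, sd_apply, C.d_s_self n i hi, C.d_s_succ n i hi, ← add_smul]
    rw [show (-1 : ℤ) ^ i + (-1) ^ (i + 1) = 0 by ring, zero_smul]
  have h1 : i ∈ Finset.range (n + 2) := Finset.mem_range.2 (by omega)
  have h2 : i + 1 ∈ (Finset.range (n + 2)).erase i :=
    Finset.mem_erase.2 ⟨by omega, Finset.mem_range.2 (by omega)⟩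
  rw [← Finset.add_sum_erase _ _ h1, ← Finset.add_sum_erase _ _ h2, ← add_assoc, hc, zero_add]
  refine Submodule.sum_mem _ fun j hj => ?_
  simp only [Finset.mem_erase, Finset.mem_range] at hj
  rw [sd_apply]
  refine zsmul_mem ?_ _
  obtain ⟨hj1, hj2, hj3⟩ := hj
  rcases n with _ | n
  · omega
  · rcases lt_or_ge j i with h | h
    · obtain ⟨i, rfl⟩ : ∃ l, i = l + 1 := ⟨i - 1, by omega⟩
      rw [C.d_s_lt n j i (by omega) (by omega)]
      exact C.s_mem _ _ (by omega) _
    · have h' : i + 1 < j := by omega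
      obtain ⟨j, rfl⟩ : ∃ l, j = l + 1 := ⟨j - 1, by omega⟩
      rw [C.d_s_gt n j i (by omega) (by omega)]
      exact C.s_mem _ _ (by omega) _

theorem sExt_s (n i : ℕ) (hi : i ≤ n) (x : C.X n) :
    C.sExt (n + 1) (C.s n i x) = C.s (n + 1) (i + 1) (C.sExt n x) := by
  change C.t (n + 2) (C.s (n + 1) (n + 1) (C.s n i x)) = C.s (n + 1) (i + 1) (C.t (n + 1) (C.s n n x))
  rw [C.s_t_succ (n + 1) i (by omega), C.s_s n i n hi le_rfl]

theorem sExt_sExt (n : ℕ) (x : C.X n) :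
    C.sExt (n + 1) (C.sExt n x) = C.s (n + 1) 0 (C.sExt n x) := by
  change C.t (n + 2) (C.s (n + 1) (n + 1) (C.t (n + 1) (C.s n n x))) =
    C.s (n + 1) 0 (C.t (n + 1) (C.s n n x))
  rw [C.s_t_zero (n + 1), C.s_t_succ (n + 1) n (by omega), C.s_s n n n le_rfl le_rfl]

theorem t_sExt (n : ℕ) (x : C.X n) : C.t (n + 1) (C.sExt n x) = C.s n 0 (C.t n x) :=
  (C.s_t_zero n x).symm

theorem t_pow_s (n i j : ℕ) (hi : i ≤ n) (x : C.X n) :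
    (∃ l, ∃ _ : l ≤ n, ∃ y, (C.t (n + 1) ^ j) (C.s n i x) = C.s n l y) ∨
      ∃ y, (C.t (n + 1) ^ j) (C.s n i x) = C.sExt n y := by
  induction j with
  | zero => exact Or.inl ⟨i, hi, x, rfl⟩
  | succ j ih =>
    rw [pow_succ', Module.End.mul_apply]
    rcases ih with ⟨l, hl, y, h⟩ | ⟨y, h⟩
    · rw [h]
      rcases hl.lt_or_eq with hl | rfl
      · exact Or.inl ⟨l + 1, hl, C.t n y, (C.s_t_succ n l hl y).symm⟩
      · exact Or.inr ⟨y, rfl⟩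
    · rw [h, t_sExt]
      exact Or.inl ⟨0, Nat.zero_le _, _, rfl⟩

/-- The operator `s_{-1} tⁱ`. -/
def extRot (n i : ℕ) : C.X n →ₗ[k] C.X (n + 1) := C.sExt n ∘ₗ C.t n ^ i

theorem extRot_mem (n i : ℕ) : C.degenerate n ≤ (C.degenerate (n + 1)).comap (C.extRot n i) := by
  rcases n with _ | n
  · rw [degenerate_zero]; exact bot_le
  · refine C.degenerate_le fun l hl x => ?_
    rw [Submodule.mem_comap]
    change C.sExt (n + 1) ((C.t (n + 1) ^ i) (C.s n l x)) ∈ _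
    rcases C.t_pow_s n l i hl x with ⟨m, hm, y, h⟩ | ⟨y, h⟩
    · rw [h, sExt_s _ _ _ hm]
      exact C.s_mem _ _ (by omega) _
    · rw [h, sExt_sExt]
      exact C.s_mem _ _ (by omega) _

theorem lam_pow_apply (n i : ℕ) (x : C.X n) :
    (C.lam n ^ i) x = ((-1 : ℤ) ^ n) ^ i • (C.t n ^ i) x := by
  rw [lam, smul_pow]; rfl

theorem B_mem (n : ℕ) : C.degenerate n ≤ (C.degenerate (n + 1)).comap (C.B n) := by
  intro x hx
  have h : C.sExt n (C.norm n x) ∈ C.degenerate (n + 1) := by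
    rw [norm_apply, map_sum]
    refine Submodule.sum_mem _ fun i _ => ?_
    rw [lam_pow_apply, map_zsmul]
    exact zsmul_mem (show C.sExt n ((C.t n ^ i) x) ∈ _ from C.extRot_mem n i hx) _
  rw [Submodule.mem_comap, B_apply, lam_apply, t_sExt]
  exact sub_mem h (zsmul_mem (C.s_mem _ _ (Nat.zero_le _) _) _)

/-- The normalized mixed complex of a cyclic module. -/
def normalized : MixedComplex.{u, w} k where
  X n := C.X n ⧸ C.degenerate n
  b n := Submodule.mapQ _ _ (C.b n) (C.b_mem n)
  B n := Submodule.mapQ _ _ (C.B n) (C.B_mem n)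
  b_b n x := by
    obtain ⟨x, rfl⟩ := Submodule.mkQ_surjective _ x
    simp only [Submodule.mkQ_apply, Submodule.mapQ_apply, b_b, Submodule.Quotient.mk_zero]
  B_B n x := by
    obtain ⟨x, rfl⟩ := Submodule.mkQ_surjective _ x
    simp only [Submodule.mkQ_apply, Submodule.mapQ_apply, B_B, Submodule.Quotient.mk_zero]
  b_B_zero x := by
    obtain ⟨x, rfl⟩ := Submodule.mkQ_surjective _ x
    simp only [Submodule.mkQ_apply, Submodule.mapQ_apply, b_B_zero, Submodule.Quotient.mk_zero]
  b_B n x := by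
    obtain ⟨x, rfl⟩ := Submodule.mkQ_surjective _ x
    simp only [Submodule.mkQ_apply, Submodule.mapQ_apply, ← Submodule.Quotient.mk_add, b_B,
      Submodule.Quotient.mk_zero]

/-- The diagonal `C × C'` of two cyclic modules, with `(C × C')_n = C_n ⊗ C'_n`. -/
noncomputable def diag (C' : CyclicModule.{u, w} k) : CyclicModule.{u, w} k where
  X n := C.X n ⊗[k] C'.X n
  d n i := TensorProduct.map (C.d n i) (C'.d n i)
  s n i := TensorProduct.map (C.s n i) (C'.s n i)
  t n := TensorProduct.map (C.t n) (C'.t n)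
  d_d n i j hij hj x := by
    induction x with
    | zero => simp only [map_zero]
    | add p q hp hq => simp only [map_add, hp, hq]
    | tmul x y => simp only [TensorProduct.map_tmul, C.d_d n i j hij hj, C'.d_d n i j hij hj]
  s_s n i j hij hj x := by
    induction x with
    | zero => simp only [map_zero]
    | add p q hp hq => simp only [map_add, hp, hq]
    | tmul x y => simp only [TensorProduct.map_tmul, C.s_s n i j hij hj, C'.s_s n i j hij hj]
  d_s_lt n i j hij hj x := by
    induction x with
    | zero => simp only [map_zero]
    | add p q hp hq => simp only [map_add, hp, hq]
    | tmul x y => simp only [TensorProduct.map_tmul, C.d_s_lt n i j hij hj, C'.d_s_lt n i j hij hj]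
  d_s_self n i hi x := by
    induction x with
    | zero => simp only [map_zero]
    | add p q hp hq => simp only [map_add, hp, hq]
    | tmul x y => simp only [TensorProduct.map_tmul, C.d_s_self n i hi, C'.d_s_self n i hi]
  d_s_succ n i hi x := by
    induction x with
    | zero => simp only [map_zero]
    | add p q hp hq => simp only [map_add, hp, hq]
    | tmul x y => simp only [TensorProduct.map_tmul, C.d_s_succ n i hi, C'.d_s_succ n i hi]
  d_s_gt n i j hij hi x := by
    induction x with
    | zero => simp only [map_zero]
    | add p q hp hq => simp only [map_add, hp, hq]
    | tmul x y => simp only [TensorProduct.map_tmul, C.d_s_gt n i j hij hi, C'.d_s_gt n i j hij hi]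
  d_t_zero n x := by
    induction x with
    | zero => simp only [map_zero]
    | add p q hp hq => simp only [map_add, hp, hq]
    | tmul x y => simp only [TensorProduct.map_tmul, C.d_t_zero, C'.d_t_zero]
  d_t_succ n i hi x := by
    induction x with
    | zero => simp only [map_zero]
    | add p q hp hq => simp only [map_add, hp, hq]
    | tmul x y => simp only [TensorProduct.map_tmul, C.d_t_succ n i hi, C'.d_t_succ n i hi]
  s_t_zero n x := by
    induction x with
    | zero => simp only [map_zero]
    | add p q hp hq => simp only [map_add, hp, hq]
    | tmul x y => simp only [TensorProduct.map_tmul, C.s_t_zero, C'.s_t_zero]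
  s_t_succ n i hi x := by
    induction x with
    | zero => simp only [map_zero]
    | add p q hp hq => simp only [map_add, hp, hq]
    | tmul x y => simp only [TensorProduct.map_tmul, C.s_t_succ n i hi, C'.s_t_succ n i hi]
  t_pow n := by
    rw [TensorProduct.map_pow, C.t_pow, C'.t_pow, TensorProduct.map_one]

end CyclicModule
end HopfCyclic

namespace HopfCyclic

/-! ### Graded tensor products -/

section Graded

variable (k : Type w) [CommRing k] (X Y : ℕ → Type u) [∀ n, AddCommGroup (X n)]
  [∀ n, Module k (X n)] [∀ n, AddCommGroup (Y n)] [∀ n, Module k (Y n)]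

/-- The degree `n` part of the graded module `X ⊗ Y` shifted up by `c`, i.e. the direct sum of
`X i ⊗ Y j` over `i + j + c = n`. -/
abbrev Tens (c n : ℕ) : Type u :=
  ⨁ p : {p : ℕ × ℕ // p.1 + p.2 + c = n}, X p.1.1 ⊗[k] Y p.1.2

variable {k X Y}

open Classical in
/-- The inclusion of `X i ⊗ Y j` in degree `n`, by convention zero unless `i + j + c = n`. -/
noncomputable def tin (c n i j : ℕ) : X i ⊗[k] Y j →ₗ[k] Tens k X Y c n :=
  if h : i + j + c = n then
    DirectSum.lof k {p : ℕ × ℕ // p.1 + p.2 + c = n} (fun p => X p.1.1 ⊗[k] Y p.1.2) ⟨(i, j), h⟩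
  else 0

open Classical in
/-- The linear map out of the degree `n` part with given components. -/
noncomputable def tensDesc {P : Type*} [AddCommGroup P] [Module k P] (c n : ℕ)
    (f : ∀ i j : ℕ, X i ⊗[k] Y j →ₗ[k] P) : Tens k X Y c n →ₗ[k] P :=
  DirectSum.toModule k _ P fun p => f p.1.1 p.1.2

theorem tensDesc_tin {P : Type*} [AddCommGroup P] [Module k P] {c n i j : ℕ}
    (h : i + j + c = n) (f : ∀ i j : ℕ, X i ⊗[k] Y j →ₗ[k] P) (z : X i ⊗[k] Y j) :
    tensDesc c n f (tin c n i j z) = f i j z := by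
  classical
  rw [tin, dif_pos h, tensDesc]
  exact DirectSum.toModule_lof k (φ := fun p : {p : ℕ × ℕ // p.1 + p.2 + c = n} => f p.1.1 p.1.2)
    ⟨(i, j), h⟩ z

theorem tin_of_ne {c n i j : ℕ} (h : i + j + c ≠ n) (z : X i ⊗[k] Y j) :
    tin c n i j z = 0 := by
  rw [tin, dif_neg h]; rfl

theorem tens_ext {P : Type*} [AddCommGroup P] [Module k P] {c n : ℕ}
    {f g : Tens k X Y c n →ₗ[k] P}
    (h : ∀ i j, i + j + c = n → ∀ (x : X i) (y : Y j),
      f (tin c n i j (x ⊗ₜ y)) = g (tin c n i j (x ⊗ₜ y))) : f = g := by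
  classical
  refine DirectSum.linearMap_ext k fun p => TensorProduct.ext' fun x y => ?_
  have := h p.1.1 p.1.2 p.2 x y
  rw [tin, dif_pos p.2] at this
  exact this

/-- `f ⊗ id` for `f` of degree `-1`. -/
noncomputable def lowerLeft (f : ∀ n, X (n + 1) →ₗ[k] X n) (c n : ℕ) :
    Tens k X Y c (n + 1) →ₗ[k] Tens k X Y c n :=
  tensDesc c (n + 1) fun i j => match i with
    | 0 => 0
    | i + 1 => tin c n i j ∘ₗ LinearMap.rTensor (Y j) (f i)

/-- `x ⊗ y ↦ (-1)^|x| x ⊗ g y` for `g` of degree `-1`. -/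
noncomputable def lowerRight (g : ∀ n, Y (n + 1) →ₗ[k] Y n) (c n : ℕ) :
    Tens k X Y c (n + 1) →ₗ[k] Tens k X Y c n :=
  tensDesc c (n + 1) fun i j => match j with
    | 0 => 0
    | j + 1 => (-1 : ℤ) ^ i • (tin c n i j ∘ₗ LinearMap.lTensor (X i) (g j))

/-- `f ⊗ id` for `f` of degree `1`. -/
noncomputable def raiseLeft (f : ∀ n, X n →ₗ[k] X (n + 1)) (c n : ℕ) :
    Tens k X Y c n →ₗ[k] Tens k X Y c (n + 1) :=
  tensDesc c n fun i j => tin c (n + 1) (i + 1) j ∘ₗ LinearMap.rTensor (Y j) (f i)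

/-- `x ⊗ y ↦ (-1)^|x| x ⊗ g y` for `g` of degree `1`. -/
noncomputable def raiseRight (g : ∀ n, Y n →ₗ[k] Y (n + 1)) (c n : ℕ) :
    Tens k X Y c n →ₗ[k] Tens k X Y c (n + 1) :=
  tensDesc c n fun i j =>
    (-1 : ℤ) ^ i • (tin c (n + 1) i (j + 1) ∘ₗ LinearMap.lTensor (X i) (g j))

/-- The differential of a tensor product of complexes. -/
noncomputable def tensD (f : ∀ n, X (n + 1) →ₗ[k] X n) (g : ∀ n, Y (n + 1) →ₗ[k] Y n) (c n : ℕ) :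
    Tens k X Y c (n + 1) →ₗ[k] Tens k X Y c n :=
  lowerLeft f c n + lowerRight g c n

theorem lowerLeft_zero (f : ∀ n, X (n + 1) →ₗ[k] X n) (c n j : ℕ) (x : X 0) (y : Y j) :
    lowerLeft f c n (tin c (n + 1) 0 j (x ⊗ₜ y)) = 0 := by
  by_cases h : 0 + j + c = n + 1
  · rw [lowerLeft, tensDesc_tin h]; rfl
  · rw [tin_of_ne h, map_zero]

theorem lowerLeft_succ (f : ∀ n, X (n + 1) →ₗ[k] X n) (c n i j : ℕ) (x : X (i + 1)) (y : Y j) :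
    lowerLeft f c n (tin c (n + 1) (i + 1) j (x ⊗ₜ y)) = tin c n i j (f i x ⊗ₜ y) := by
  by_cases h : i + 1 + j + c = n + 1
  · rw [lowerLeft, tensDesc_tin h]; rfl
  · rw [tin_of_ne h, map_zero, tin_of_ne (by omega)]

theorem lowerRight_zero (g : ∀ n, Y (n + 1) →ₗ[k] Y n) (c n i : ℕ) (x : X i) (y : Y 0) :
    lowerRight g c n (tin c (n + 1) i 0 (x ⊗ₜ y)) = 0 := by
  by_cases h : i + 0 + c = n + 1
  · rw [lowerRight, tensDesc_tin h]; rfl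
  · rw [tin_of_ne h, map_zero]

theorem lowerRight_succ (g : ∀ n, Y (n + 1) →ₗ[k] Y n) (c n i j : ℕ) (x : X i) (y : Y (j + 1)) :
    lowerRight g c n (tin c (n + 1) i (j + 1) (x ⊗ₜ y)) =
      (-1 : ℤ) ^ i • tin c n i j (x ⊗ₜ g j y) := by
  by_cases h : i + (j + 1) + c = n + 1
  · rw [lowerRight, tensDesc_tin h]; rfl
  · rw [tin_of_ne h, map_zero, tin_of_ne (by omega), smul_zero]

theorem raiseLeft_tin (f : ∀ n, X n →ₗ[k] X (n + 1)) (c n i j : ℕ) (x : X i) (y : Y j) :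
    raiseLeft f c n (tin c n i j (x ⊗ₜ y)) = tin c (n + 1) (i + 1) j (f i x ⊗ₜ y) := by
  by_cases h : i + j + c = n
  · rw [raiseLeft, tensDesc_tin h]; rfl
  · rw [tin_of_ne h, map_zero, tin_of_ne (by omega)]

theorem raiseRight_tin (g : ∀ n, Y n →ₗ[k] Y (n + 1)) (c n i j : ℕ) (x : X i) (y : Y j) :
    raiseRight g c n (tin c n i j (x ⊗ₜ y)) =
      (-1 : ℤ) ^ i • tin c (n + 1) i (j + 1) (x ⊗ₜ g j y) := by
  by_cases h : i + j + c = n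
  · rw [raiseRight, tensDesc_tin h]; rfl
  · rw [tin_of_ne h, map_zero, tin_of_ne (by omega), smul_zero]

theorem tensD_tensD (f : ∀ n, X (n + 1) →ₗ[k] X n) (g : ∀ n, Y (n + 1) →ₗ[k] Y n)
    (hf : ∀ n x, f n (f (n + 1) x) = 0) (hg : ∀ n y, g n (g (n + 1) y) = 0) (c n : ℕ)
    (z : Tens k X Y c (n + 2)) : tensD f g c n (tensD f g c (n + 1) z) = 0 := by
  suffices h : tensD f g c n ∘ₗ tensD f g c (n + 1) = 0 from congrArg (fun e => e z) h
  refine tens_ext fun i j _ x y => ?_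
  simp only [LinearMap.comp_apply, LinearMap.zero_apply, tensD, LinearMap.add_apply]
  rcases i with _ | _ | i <;> rcases j with _ | _ | j <;>
    simp only [lowerLeft_zero, lowerRight_zero, lowerLeft_succ, lowerRight_succ, map_add, map_zero,
      map_zsmul, hf, hg, TensorProduct.zero_tmul, TensorProduct.tmul_zero, smul_zero,
      add_zero, zero_add] <;>
    first
    | rfl
    | (rw [← add_smul, pow_succ, mul_neg_one, neg_add_cancel, zero_smul])

end Graded

/-- The tensor product of mixed complexes. -/
noncomputable def MixedComplex.tensor {k : Type w} [CommRing k] (C C' : MixedComplex.{u, w} k) :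
    MixedComplex.{u, w} k where
  X n := Tens k C.X C'.X 0 n
  b n := tensD C.b C'.b 0 n
  B n := raiseLeft C.B 0 n + raiseRight C'.B 0 n
  b_b n := tensD_tensD C.b C'.b C.b_b C'.b_b 0 n
  B_B n z := by
    suffices h : (raiseLeft C.B 0 (n + 1) + raiseRight C'.B 0 (n + 1)) ∘ₗ
        (raiseLeft C.B 0 n + raiseRight C'.B 0 n) = 0 from congrArg (fun e => e z) h
    refine tens_ext fun i j _ x y => ?_
    simp only [LinearMap.comp_apply, LinearMap.zero_apply, LinearMap.add_apply, raiseLeft_tin,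
      raiseRight_tin, map_add, map_zsmul, C.B_B, C'.B_B, TensorProduct.zero_tmul,
      TensorProduct.tmul_zero, smul_zero, add_zero, zero_add, map_zero]
    rw [← add_smul, pow_succ, mul_neg_one, neg_add_cancel, zero_smul]
  b_B_zero z := by
    suffices h : tensD C.b C'.b 0 0 ∘ₗ (raiseLeft C.B 0 0 + raiseRight C'.B 0 0) = 0 from
      congrArg (fun e => e z) h
    refine tens_ext fun i j h x y => ?_
    obtain rfl : i = 0 := by omega
    obtain rfl : j = 0 := by omega
    simp only [LinearMap.comp_apply, LinearMap.zero_apply, LinearMap.add_apply, raiseLeft_tin,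
      raiseRight_tin, map_add, map_zsmul, tensD, lowerLeft_succ, lowerLeft_zero, lowerRight_succ,
      lowerRight_zero, C.b_B_zero, C'.b_B_zero, TensorProduct.zero_tmul, TensorProduct.tmul_zero,
      smul_zero, add_zero, map_zero]
  b_B n z := by
    suffices h : tensD C.b C'.b 0 (n + 1) ∘ₗ (raiseLeft C.B 0 (n + 1) + raiseRight C'.B 0 (n + 1)) +
        (raiseLeft C.B 0 n + raiseRight C'.B 0 n) ∘ₗ tensD C.b C'.b 0 n = 0 from
      congrArg (fun e => e z) h
    have hl : ∀ n x, C.b (n + 1) (C.B (n + 1) x) = - C.B n (C.b n x) := fun n x =>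
      eq_neg_of_add_eq_zero_left (C.b_B n x)
    have hr : ∀ n x, C'.b (n + 1) (C'.B (n + 1) x) = - C'.B n (C'.b n x) := fun n x =>
      eq_neg_of_add_eq_zero_left (C'.b_B n x)
    refine tens_ext fun i j _ x y => ?_
    simp only [LinearMap.comp_apply, LinearMap.zero_apply, LinearMap.add_apply, tensD]
    rcases i with _ | i <;> rcases j with _ | j <;>
      simp only [lowerLeft_zero, lowerRight_zero, lowerLeft_succ, lowerRight_succ, raiseLeft_tin,
        raiseRight_tin, map_add, map_zero, map_zsmul, C.b_B_zero, C'.b_B_zero, hl, hr, smul_smul,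
        TensorProduct.zero_tmul, TensorProduct.tmul_zero, TensorProduct.neg_tmul,
        TensorProduct.tmul_neg, map_neg, smul_zero, add_zero, zero_add] <;>
      module

/-! ### The total complex -/

namespace MixedComplex

variable {k : Type w} [CommRing k] (C : MixedComplex.{u, w} k)

/-- The degree `n` part of `k[u] ⊗ C`, with `u` in degree `2`. -/
abbrev Tot (n : ℕ) : Type u := ⨁ p : {p : ℕ × ℕ // 2 * p.1 + p.2 = n}, C.X p.1.2

open Classical in
/-- The map `x ↦ u^r x` from `C_q` to degree `n`, by convention zero unless `2 r + q = n`. -/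
noncomputable def totIn (n r q : ℕ) : C.X q →ₗ[k] C.Tot n :=
  if h : 2 * r + q = n then
    DirectSum.lof k {p : ℕ × ℕ // 2 * p.1 + p.2 = n} (fun p => C.X p.1.2) ⟨(r, q), h⟩
  else 0

open Classical in
/-- The linear map out of the degree `n` part with given components. -/
noncomputable def totDesc {P : Type*} [AddCommGroup P] [Module k P] (n : ℕ)
    (f : ∀ r q : ℕ, C.X q →ₗ[k] P) : C.Tot n →ₗ[k] P :=
  DirectSum.toModule k _ P fun p => f p.1.1 p.1.2

theorem totDesc_totIn {P : Type*} [AddCommGroup P] [Module k P] {n r q : ℕ} (h : 2 * r + q = n)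
    (f : ∀ r q : ℕ, C.X q →ₗ[k] P) (x : C.X q) :
    C.totDesc n f (C.totIn n r q x) = f r q x := by
  classical
  rw [totIn, dif_pos h, totDesc]
  exact DirectSum.toModule_lof k (φ := fun p : {p : ℕ × ℕ // 2 * p.1 + p.2 = n} => f p.1.1 p.1.2)
    ⟨(r, q), h⟩ x

theorem totIn_of_ne {n r q : ℕ} (h : 2 * r + q ≠ n) (x : C.X q) : C.totIn n r q x = 0 := by
  rw [totIn, dif_neg h]; rfl

theorem tot_ext {P : Type*} [AddCommGroup P] [Module k P] {n : ℕ} {f g : C.Tot n →ₗ[k] P}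
    (h : ∀ r q, 2 * r + q = n → ∀ x, f (C.totIn n r q x) = g (C.totIn n r q x)) : f = g := by
  classical
  refine DirectSum.linearMap_ext k fun p => LinearMap.ext fun x => ?_
  have := h p.1.1 p.1.2 p.2 x
  rw [totIn, dif_pos p.2] at this
  exact this

/-- `u^r x ↦ u^r b x`. -/
noncomputable def totb (n : ℕ) : C.Tot (n + 1) →ₗ[k] C.Tot n :=
  C.totDesc (n + 1) fun r q => match q with
    | 0 => 0
    | q + 1 => C.totIn n r q ∘ₗ C.b q

/-- `u^r x ↦ u^(r-1) B x`. -/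
noncomputable def totB (n : ℕ) : C.Tot (n + 1) →ₗ[k] C.Tot n :=
  C.totDesc (n + 1) fun r q => match r with
    | 0 => 0
    | r + 1 => C.totIn n r (q + 1) ∘ₗ C.B q

/-- The differential of the total complex. -/
noncomputable def totD (n : ℕ) : C.Tot (n + 1) →ₗ[k] C.Tot n := C.totb n + C.totB n

/-- The periodicity operator `u^r x ↦ u^(r-1) x`. -/
noncomputable def totS (n : ℕ) : C.Tot (n + 2) →ₗ[k] C.Tot n :=
  C.totDesc (n + 2) fun r q => match r with
    | 0 => 0
    | r + 1 => C.totIn n r q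

theorem totb_zero (n r : ℕ) (x : C.X 0) : C.totb n (C.totIn (n + 1) r 0 x) = 0 := by
  by_cases h : 2 * r + 0 = n + 1
  · rw [totb, totDesc_totIn C h]; rfl
  · rw [totIn_of_ne C h, map_zero]

theorem totb_succ (n r q : ℕ) (x : C.X (q + 1)) :
    C.totb n (C.totIn (n + 1) r (q + 1) x) = C.totIn n r q (C.b q x) := by
  by_cases h : 2 * r + (q + 1) = n + 1
  · rw [totb, totDesc_totIn C h]; rfl
  · rw [totIn_of_ne C h, map_zero, totIn_of_ne C (by omega)]

theorem totB_zero (n q : ℕ) (x : C.X q) : C.totB n (C.totIn (n + 1) 0 q x) = 0 := by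
  by_cases h : 2 * 0 + q = n + 1
  · rw [totB, totDesc_totIn C h]; rfl
  · rw [totIn_of_ne C h, map_zero]

theorem totB_succ (n r q : ℕ) (x : C.X q) :
    C.totB n (C.totIn (n + 1) (r + 1) q x) = C.totIn n r (q + 1) (C.B q x) := by
  by_cases h : 2 * (r + 1) + q = n + 1
  · rw [totB, totDesc_totIn C h]; rfl
  · rw [totIn_of_ne C h, map_zero, totIn_of_ne C (by omega)]

theorem totS_zero (n q : ℕ) (x : C.X q) : C.totS n (C.totIn (n + 2) 0 q x) = 0 := by
  by_cases h : 2 * 0 + q = n + 2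
  · rw [totS, totDesc_totIn C h]; rfl
  · rw [totIn_of_ne C h, map_zero]

theorem totS_succ (n r q : ℕ) (x : C.X q) :
    C.totS n (C.totIn (n + 2) (r + 1) q x) = C.totIn n r q x := by
  by_cases h : 2 * (r + 1) + q = n + 2
  · rw [totS, totDesc_totIn C h]
  · rw [totIn_of_ne C h, map_zero, totIn_of_ne C (by omega)]

theorem totD_totD (n : ℕ) (z : C.Tot (n + 2)) : C.totD n (C.totD (n + 1) z) = 0 := by
  suffices h : C.totD n ∘ₗ C.totD (n + 1) = 0 from congrArg (fun e => e z) h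
  refine C.tot_ext fun r q _ x => ?_
  simp only [LinearMap.comp_apply, LinearMap.zero_apply, totD, LinearMap.add_apply]
  have hb : ∀ n x, C.b (n + 1) (C.B (n + 1) x) = - C.B n (C.b n x) := fun n x =>
    eq_neg_of_add_eq_zero_left (C.b_B n x)
  rcases q with _ | _ | q <;> rcases r with _ | _ | r <;>
    simp only [totb_zero, totB_zero, totb_succ, totB_succ, map_add, map_zero, add_zero, zero_add,
      C.b_b, C.B_B, C.b_B_zero, hb, map_neg] <;> abel

theorem totS_totD (n : ℕ) (z : C.Tot (n + 3)) :
    C.totS n (C.totD (n + 2) z) = C.totD n (C.totS (n + 1) z) := by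
  suffices h : C.totS n ∘ₗ C.totD (n + 2) = C.totD n ∘ₗ C.totS (n + 1) from
    congrArg (fun e => e z) h
  refine C.tot_ext fun r q _ x => ?_
  simp only [LinearMap.comp_apply, totD, LinearMap.add_apply]
  rcases q with _ | q <;> rcases r with _ | _ | r <;>
    simp only [totb_zero, totB_zero, totb_succ, totB_succ, totS_zero, totS_succ, map_add,
      map_zero, add_zero, zero_add]

/-- The total complex `k[u] ⊗ C`, with differential `u^r x ↦ u^r b x + u^(r-1) B x`; its homology
is the cyclic homology of `C`. -/
noncomputable def total : ChainComplex (ModuleCat.{u} k) ℕ :=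
  ChainComplex.of (fun n => ModuleCat.of k (C.Tot n)) (fun n => ModuleCat.ofHom (C.totD n))
    (fun n => by ext1; exact LinearMap.ext fun x => C.totD_totD n x)

end MixedComplex
end HopfCyclic

namespace HopfCyclic

open CategoryTheory

namespace MixedComplex

variable {k : Type w} [CommRing k] (C C' : MixedComplex.{u, w} k)

/-- The tensor product of the total complexes of `C` and `C'`, shifted up by `c`. Its differential
is `d ⊗ 1 + (-1)^i 1 ⊗ d` on the summand with left factor of degree `i`. -/
noncomputable def totTens (c : ℕ) : ChainComplex (ModuleCat.{u} k) ℕ :=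
  ChainComplex.of (fun n => ModuleCat.of k (Tens k C.Tot C'.Tot c n))
    (fun n => ModuleCat.ofHom (tensD C.totD C'.totD c n))
    (fun n => by
      ext1
      exact LinearMap.ext fun x =>
        tensD_tensD C.totD C'.totD C.totD_totD C'.totD_totD c n x)

/-- The element `u^r x ⊗ u^s y`, in degree `n` of the tensor product shifted up by `c`. -/
noncomputable def bi (c n r p s q : ℕ) : C.X p ⊗[k] C'.X q →ₗ[k] Tens k C.Tot C'.Tot c n :=
  tin c n (2 * r + p) (2 * s + q) ∘ₗ
    TensorProduct.map (C.totIn (2 * r + p) r p) (C'.totIn (2 * s + q) s q)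

variable {C C'} in
theorem bi_ext {P : Type*} [AddCommGroup P] [Module k P] {c n : ℕ}
    {f g : Tens k C.Tot C'.Tot c n →ₗ[k] P}
    (h : ∀ r p s q, (2 * r + p) + (2 * s + q) + c = n → ∀ (x : C.X p) (y : C'.X q),
      f (C.bi C' c n r p s q (x ⊗ₜ y)) = g (C.bi C' c n r p s q (x ⊗ₜ y))) : f = g := by
  refine tens_ext fun i j hij x y => ?_
  have key : ((TensorProduct.mk k (C.Tot i) (C'.Tot j)).compr₂ (f ∘ₗ tin c n i j)) =
      ((TensorProduct.mk k (C.Tot i) (C'.Tot j)).compr₂ (g ∘ₗ tin c n i j)) := by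
    refine C.tot_ext fun r p hp x' => C'.tot_ext fun s q hq y' => ?_
    subst hp hq
    exact h r p s q hij x' y'
  exact congrArg (fun e => e x y) key

/-- The inclusion of `C_i ⊗ C'_j` in degree `n`, by convention zero unless `i + j = n`. -/
noncomputable def tensIn (n i j : ℕ) : C.X i ⊗[k] C'.X j →ₗ[k] (C.tensor C').X n :=
  (tin 0 n i j : C.X i ⊗[k] C'.X j →ₗ[k] Tens k C.X C'.X 0 n)

/-- The linear map out of the degree `n` part with given components. -/
noncomputable def tensorDesc {P : Type*} [AddCommGroup P] [Module k P] (n : ℕ)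
    (f : ∀ i j : ℕ, C.X i ⊗[k] C'.X j →ₗ[k] P) : (C.tensor C').X n →ₗ[k] P :=
  (tensDesc 0 n f : Tens k C.X C'.X 0 n →ₗ[k] P)

variable {C C'} in
theorem tensorDesc_tensIn {P : Type*} [AddCommGroup P] [Module k P] {n i j : ℕ}
    (h : i + j = n) (f : ∀ i j : ℕ, C.X i ⊗[k] C'.X j →ₗ[k] P) (z : C.X i ⊗[k] C'.X j) :
    C.tensorDesc C' n f (C.tensIn C' n i j z) = f i j z :=
  tensDesc_tin (show i + j + 0 = n from h) f z

variable {C C'} in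
theorem tensor_ext {P : Type*} [AddCommGroup P] [Module k P] {n : ℕ}
    {f g : (C.tensor C').X n →ₗ[k] P}
    (h : ∀ i j, i + j = n → ∀ (x : C.X i) (y : C'.X j),
      f (C.tensIn C' n i j (x ⊗ₜ y)) = g (C.tensIn C' n i j (x ⊗ₜ y))) : f = g :=
  tens_ext (X := C.X) (Y := C'.X) (c := 0) h

/-- The map `v^m (x ⊗ y) ↦ ∑ u^a x ⊗ u'^b y` over `a + b = m`. -/
noncomputable def kuennethI (n : ℕ) : (C.tensor C').Tot n →ₗ[k] Tens k C.Tot C'.Tot 0 n :=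
  (C.tensor C').totDesc n fun m q => C.tensorDesc C' q fun i j =>
    ∑ ab ∈ Finset.HasAntidiagonal.antidiagonal m, C.bi C' 0 n ab.1 i ab.2 j

/-- The map `S ⊗ 1`. -/
noncomputable def leftS (n : ℕ) : Tens k C.Tot C'.Tot 0 n →ₗ[k] Tens k C.Tot C'.Tot 2 n :=
  tensDesc 0 n fun i j => match i with
    | 0 => 0
    | 1 => 0
    | i + 2 => tin 2 n i j ∘ₗ LinearMap.rTensor (C'.Tot j) (C.totS i)

/-- The map `1 ⊗ S`. -/
noncomputable def rightS (n : ℕ) : Tens k C.Tot C'.Tot 0 n →ₗ[k] Tens k C.Tot C'.Tot 2 n :=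
  tensDesc 0 n fun i j => match j with
    | 0 => 0
    | 1 => 0
    | j + 2 => tin 2 n i j ∘ₗ LinearMap.lTensor (C.Tot i) (C'.totS j)

/-- The map `S ⊗ 1 - 1 ⊗ S`. -/
noncomputable def kuennethJ (n : ℕ) : Tens k C.Tot C'.Tot 0 n →ₗ[k] Tens k C.Tot C'.Tot 2 n :=
  C.leftS C' n - C.rightS C' n

/-- The linear map out of the degree `n` part with given components. -/
noncomputable def biDesc {P : Type*} [AddCommGroup P] [Module k P] (c n : ℕ)
    (f : ∀ r p s q : ℕ, C.X p ⊗[k] C'.X q →ₗ[k] P) : Tens k C.Tot C'.Tot c n →ₗ[k] P :=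
  tensDesc c n fun i j => TensorProduct.lift
    (C.totDesc (P := C'.Tot j →ₗ[k] P) i fun r p =>
      (C'.totDesc (P := C.X p →ₗ[k] P) j fun s q =>
        ((TensorProduct.mk k (C.X p) (C'.X q)).compr₂ (f r p s q)).flip).flip)

/-- A retraction of the Künneth inclusion in each degree. -/
noncomputable def kuennethR (n : ℕ) : Tens k C.Tot C'.Tot 0 n →ₗ[k] (C.tensor C').Tot n :=
  C.biDesc C' 0 n fun r p s q => match r with
    | 0 => (C.tensor C').totIn n s (p + q) ∘ₗ C.tensIn C' (p + q) p q
    | _ + 1 => 0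

/-- A section of the Künneth projection in each degree. -/
noncomputable def kuennethT (n : ℕ) : Tens k C.Tot C'.Tot 2 n →ₗ[k] Tens k C.Tot C'.Tot 0 n :=
  C.biDesc C' 2 n fun r p s q =>
    ∑ ab ∈ Finset.HasAntidiagonal.antidiagonal s, C.bi C' 0 n (r + ab.1 + 1) p ab.2 q

variable {C C'}

theorem bi_of_ne {c n r p s q : ℕ} (h : (2 * r + p) + (2 * s + q) + c ≠ n) (z : C.X p ⊗[k] C'.X q) :
    C.bi C' c n r p s q z = 0 := by
  rw [bi, LinearMap.comp_apply, tin_of_ne h]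

theorem tin_totIn (c n i j r p s q : ℕ) (hi : 2 * r + p = i) (hj : 2 * s + q = j)
    (x : C.X p) (y : C'.X q) :
    tin c n i j (C.totIn i r p x ⊗ₜ C'.totIn j s q y) = C.bi C' c n r p s q (x ⊗ₜ y) := by
  subst hi hj
  rfl

theorem bi_tmul (c n r p s q : ℕ) (x : C.X p) (y : C'.X q) :
    C.bi C' c n r p s q (x ⊗ₜ y) = tin c n (2 * r + p) (2 * s + q)
      (C.totIn (2 * r + p) r p x ⊗ₜ C'.totIn (2 * s + q) s q y) := rfl

theorem biDesc_bi {P : Type*} [AddCommGroup P] [Module k P] {c n r p s q : ℕ}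
    (h : (2 * r + p) + (2 * s + q) + c = n)
    (f : ∀ r p s q : ℕ, C.X p ⊗[k] C'.X q →ₗ[k] P) (x : C.X p) (y : C'.X q) :
    C.biDesc C' c n f (C.bi C' c n r p s q (x ⊗ₜ y)) = f r p s q (x ⊗ₜ y) := by
  rw [bi_tmul, biDesc, tensDesc_tin h, TensorProduct.lift.tmul, totDesc_totIn _ rfl,
    LinearMap.flip_apply, totDesc_totIn _ rfl]
  rfl

theorem kuennethI_totIn (n m q i j : ℕ) (hm : 2 * m + q = n) (h : i + j = q)
    (x : C.X i) (y : C'.X j) :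
    C.kuennethI C' n ((C.tensor C').totIn n m q (C.tensIn C' q i j (x ⊗ₜ y))) =
      ∑ ab ∈ Finset.HasAntidiagonal.antidiagonal m, C.bi C' 0 n ab.1 i ab.2 j (x ⊗ₜ y) := by
  rw [kuennethI, totDesc_totIn _ hm, tensorDesc_tensIn h, LinearMap.sum_apply]

theorem leftS_zero (n p s q : ℕ) (x : C.X p) (y : C'.X q) :
    C.leftS C' n (C.bi C' 0 n 0 p s q (x ⊗ₜ y)) = 0 := by
  by_cases h : (2 * 0 + p) + (2 * s + q) + 0 = n
  · rw [bi_tmul, leftS, tensDesc_tin h]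
    generalize hi : 2 * 0 + p = i
    rcases i with _ | _ | i
    · rfl
    · rfl
    · dsimp only
      rw [LinearMap.comp_apply, LinearMap.rTensor_tmul, totS_zero, TensorProduct.zero_tmul,
        map_zero]
  · rw [bi_of_ne h, map_zero]

theorem leftS_succ (n r p s q : ℕ) (x : C.X p) (y : C'.X q) :
    C.leftS C' n (C.bi C' 0 n (r + 1) p s q (x ⊗ₜ y)) = C.bi C' 2 n r p s q (x ⊗ₜ y) := by
  by_cases h : (2 * (r + 1) + p) + (2 * s + q) + 0 = n
  · rw [bi_tmul, leftS, tensDesc_tin h]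
    generalize hi : 2 * (r + 1) + p = i
    rcases i with _ | _ | i
    · omega
    · omega
    · dsimp only
      rw [LinearMap.comp_apply, LinearMap.rTensor_tmul, totS_succ,
        tin_totIn _ _ _ _ _ _ _ _ (by omega) rfl]
  · rw [bi_of_ne h, map_zero, bi_of_ne (by omega)]

theorem rightS_zero (n r p q : ℕ) (x : C.X p) (y : C'.X q) :
    C.rightS C' n (C.bi C' 0 n r p 0 q (x ⊗ₜ y)) = 0 := by
  by_cases h : (2 * r + p) + (2 * 0 + q) + 0 = n
  · rw [bi_tmul, rightS, tensDesc_tin h]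
    generalize hi : 2 * 0 + q = i
    rcases i with _ | _ | i
    · rfl
    · rfl
    · dsimp only
      rw [LinearMap.comp_apply, LinearMap.lTensor_tmul, totS_zero, TensorProduct.tmul_zero,
        map_zero]
  · rw [bi_of_ne h, map_zero]

theorem rightS_succ (n r p s q : ℕ) (x : C.X p) (y : C'.X q) :
    C.rightS C' n (C.bi C' 0 n r p (s + 1) q (x ⊗ₜ y)) = C.bi C' 2 n r p s q (x ⊗ₜ y) := by
  by_cases h : (2 * r + p) + (2 * (s + 1) + q) + 0 = n
  · rw [bi_tmul, rightS, tensDesc_tin h]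
    generalize hi : 2 * (s + 1) + q = i
    rcases i with _ | _ | i
    · omega
    · omega
    · dsimp only
      rw [LinearMap.comp_apply, LinearMap.lTensor_tmul, totS_succ,
        tin_totIn _ _ _ _ _ _ _ _ rfl (by omega)]
  · rw [bi_of_ne h, map_zero, bi_of_ne (by omega)]

theorem kuennethR_zero (n p s q : ℕ) (x : C.X p) (y : C'.X q) :
    C.kuennethR C' n (C.bi C' 0 n 0 p s q (x ⊗ₜ y)) =
      (C.tensor C').totIn n s (p + q) (C.tensIn C' (p + q) p q (x ⊗ₜ y)) := by
  by_cases h : (2 * 0 + p) + (2 * s + q) + 0 = n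
  · rw [kuennethR, biDesc_bi h]
    rfl
  · rw [bi_of_ne h, map_zero, totIn_of_ne _ (by omega)]

theorem kuennethR_succ (n r p s q : ℕ) (x : C.X p) (y : C'.X q) :
    C.kuennethR C' n (C.bi C' 0 n (r + 1) p s q (x ⊗ₜ y)) = 0 := by
  by_cases h : (2 * (r + 1) + p) + (2 * s + q) + 0 = n
  · rw [kuennethR, biDesc_bi h]
    rfl
  · rw [bi_of_ne h, map_zero]

theorem kuennethT_bi (n r p s q : ℕ) (x : C.X p) (y : C'.X q) :
    C.kuennethT C' n (C.bi C' 2 n r p s q (x ⊗ₜ y)) =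
      ∑ ab ∈ Finset.HasAntidiagonal.antidiagonal s,
        C.bi C' 0 n (r + ab.1 + 1) p ab.2 q (x ⊗ₜ y) := by
  by_cases h : (2 * r + p) + (2 * s + q) + 2 = n
  · rw [kuennethT, biDesc_bi h, LinearMap.sum_apply]
  · rw [bi_of_ne h, map_zero]
    refine (Finset.sum_eq_zero fun ab hab => bi_of_ne ?_ _).symm
    have := Finset.HasAntidiagonal.mem_antidiagonal.1 hab
    omega

theorem kuennethR_I (n : ℕ) (z : (C.tensor C').Tot n) :
    C.kuennethR C' n (C.kuennethI C' n z) = z := by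
  suffices h : C.kuennethR C' n ∘ₗ C.kuennethI C' n = LinearMap.id from congrArg (fun e => e z) h
  refine (C.tensor C').tot_ext fun m l hm w => ?_
  have key : (C.kuennethR C' n ∘ₗ C.kuennethI C' n) ∘ₗ (C.tensor C').totIn n m l =
      (C.tensor C').totIn n m l := by
    refine tensor_ext fun i j h x y => ?_
    simp only [LinearMap.comp_apply]
    rw [kuennethI_totIn n m l i j hm h, map_sum]
    subst h
    rcases m with _ | m
    · rw [Finset.Nat.antidiagonal_zero, Finset.sum_singleton, kuennethR_zero]
    · rw [Finset.Nat.sum_antidiagonal_succ, kuennethR_zero]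
      simp only [kuennethR_succ, Finset.sum_const_zero, add_zero]
  exact congrArg (fun e => e w) key

theorem kuennethJ_T (n : ℕ) (z : Tens k C.Tot C'.Tot 2 n) :
    C.kuennethJ C' n (C.kuennethT C' n z) = z := by
  suffices h : C.kuennethJ C' n ∘ₗ C.kuennethT C' n = LinearMap.id from congrArg (fun e => e z) h
  refine bi_ext fun r p s q h x y => ?_
  rw [LinearMap.comp_apply, LinearMap.id_apply, kuennethT_bi, map_sum]
  simp only [kuennethJ, LinearMap.sub_apply, leftS_succ, Finset.sum_sub_distrib]
  rcases s with _ | s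
  · rw [Finset.Nat.antidiagonal_zero, Finset.sum_singleton, Finset.sum_singleton, rightS_zero,
      sub_zero, add_zero]
  · rw [Finset.Nat.sum_antidiagonal_succ, Finset.Nat.sum_antidiagonal_succ', rightS_zero]
    simp only [rightS_succ, add_zero, zero_add]
    refine sub_eq_iff_eq_add.2 (congrArg _ (Finset.sum_congr rfl fun ab _ => ?_))
    rw [add_assoc]

theorem kuenneth_split (n : ℕ) (z : Tens k C.Tot C'.Tot 0 n) :
    C.kuennethI C' n (C.kuennethR C' n z) + C.kuennethT C' n (C.kuennethJ C' n z) = z := by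
  suffices h : C.kuennethI C' n ∘ₗ C.kuennethR C' n + C.kuennethT C' n ∘ₗ C.kuennethJ C' n =
    LinearMap.id from congrArg (fun e => e z) h
  refine bi_ext fun r p s q h x y => ?_
  simp only [kuennethJ, LinearMap.add_apply, LinearMap.comp_apply, LinearMap.id_apply,
    LinearMap.sub_apply]
  rcases r with _ | r
  · rw [kuennethR_zero, kuennethI_totIn _ _ _ _ _ (by omega) rfl, leftS_zero]
    rcases s with _ | s
    · rw [rightS_zero, Finset.Nat.antidiagonal_zero, Finset.sum_singleton, sub_zero, map_zero,
        add_zero]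
    · rw [rightS_succ, zero_sub, map_neg, kuennethT_bi, Finset.Nat.sum_antidiagonal_succ]
      simp only [zero_add, add_neg_cancel_right]
  · rw [kuennethR_succ, leftS_succ, map_zero, zero_add, map_sub, kuennethT_bi]
    rcases s with _ | s
    · rw [rightS_zero, Finset.Nat.antidiagonal_zero, Finset.sum_singleton, map_zero, sub_zero,
        add_zero]
    · rw [rightS_succ, kuennethT_bi, Finset.Nat.sum_antidiagonal_succ, add_zero, add_sub_assoc,
        sub_eq_zero.2, add_zero]
      refine Finset.sum_congr rfl fun ab _ => ?_
      rw [show r + (ab.1 + 1) + 1 = r + 1 + ab.1 + 1 by omega]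

end MixedComplex
end HopfCyclic

namespace HopfCyclic

open CategoryTheory

namespace MixedComplex

variable {k : Type w} [CommRing k] {C C' : MixedComplex.{u, w} k}

theorem lowerLeft_totb_zero (c n r s q : ℕ) (x : C.X 0) (y : C'.X q) :
    lowerLeft C.totb c n (C.bi C' c (n + 1) r 0 s q (x ⊗ₜ y)) = 0 := by
  rw [bi_tmul]
  generalize 2 * r + 0 = i
  rcases i with _ | i
  · rw [lowerLeft_zero]
  · rw [lowerLeft_succ, totb_zero, TensorProduct.zero_tmul, map_zero]

theorem lowerLeft_totb_succ (c n r p s q : ℕ) (x : C.X (p + 1)) (y : C'.X q) :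
    lowerLeft C.totb c n (C.bi C' c (n + 1) r (p + 1) s q (x ⊗ₜ y)) =
      C.bi C' c n r p s q (C.b p x ⊗ₜ y) := by
  rw [bi_tmul]
  change lowerLeft C.totb c n (tin c (n + 1) (2 * r + p + 1) (2 * s + q)
    (C.totIn (2 * r + p + 1) r (p + 1) x ⊗ₜ C'.totIn (2 * s + q) s q y)) = _
  rw [lowerLeft_succ, totb_succ, bi_tmul]

theorem lowerLeft_totB_zero (c n p s q : ℕ) (x : C.X p) (y : C'.X q) :
    lowerLeft C.totB c n (C.bi C' c (n + 1) 0 p s q (x ⊗ₜ y)) = 0 := by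
  rw [bi_tmul]
  generalize 2 * 0 + p = i
  rcases i with _ | i
  · rw [lowerLeft_zero]
  · rw [lowerLeft_succ, totB_zero, TensorProduct.zero_tmul, map_zero]

theorem lowerLeft_totB_succ (c n r p s q : ℕ) (x : C.X p) (y : C'.X q) :
    lowerLeft C.totB c n (C.bi C' c (n + 1) (r + 1) p s q (x ⊗ₜ y)) =
      C.bi C' c n r (p + 1) s q (C.B p x ⊗ₜ y) := by
  rw [bi_tmul]
  generalize hi : 2 * (r + 1) + p = i
  obtain ⟨i, rfl⟩ : ∃ l, i = l + 1 := ⟨i - 1, by omega⟩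
  rw [lowerLeft_succ, totB_succ, tin_totIn _ _ _ _ _ _ _ _ (by omega) rfl]

theorem neg_one_pow_two_mul (r p : ℕ) : (-1 : ℤ) ^ (2 * r + p) = (-1) ^ p := by
  rw [pow_add, pow_mul, neg_one_sq, one_pow, one_mul]

theorem lowerRight_totb_zero (c n r p s : ℕ) (x : C.X p) (y : C'.X 0) :
    lowerRight C'.totb c n (C.bi C' c (n + 1) r p s 0 (x ⊗ₜ y)) = 0 := by
  rw [bi_tmul]
  generalize 2 * s + 0 = i
  rcases i with _ | i
  · rw [lowerRight_zero]
  · rw [lowerRight_succ, totb_zero, TensorProduct.tmul_zero, map_zero, smul_zero]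

theorem lowerRight_totb_succ (c n r p s q : ℕ) (x : C.X p) (y : C'.X (q + 1)) :
    lowerRight C'.totb c n (C.bi C' c (n + 1) r p s (q + 1) (x ⊗ₜ y)) =
      (-1 : ℤ) ^ p • C.bi C' c n r p s q (x ⊗ₜ C'.b q y) := by
  rw [bi_tmul]
  change lowerRight C'.totb c n (tin c (n + 1) (2 * r + p) (2 * s + q + 1)
    (C.totIn (2 * r + p) r p x ⊗ₜ C'.totIn (2 * s + q + 1) s (q + 1) y)) = _
  rw [lowerRight_succ, totb_succ, bi_tmul, neg_one_pow_two_mul]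

theorem lowerRight_totB_zero (c n r p q : ℕ) (x : C.X p) (y : C'.X q) :
    lowerRight C'.totB c n (C.bi C' c (n + 1) r p 0 q (x ⊗ₜ y)) = 0 := by
  rw [bi_tmul]
  generalize 2 * 0 + q = i
  rcases i with _ | i
  · rw [lowerRight_zero]
  · rw [lowerRight_succ, totB_zero, TensorProduct.tmul_zero, map_zero, smul_zero]

theorem lowerRight_totB_succ (c n r p s q : ℕ) (x : C.X p) (y : C'.X q) :
    lowerRight C'.totB c n (C.bi C' c (n + 1) r p (s + 1) q (x ⊗ₜ y)) =
      (-1 : ℤ) ^ p • C.bi C' c n r p s (q + 1) (x ⊗ₜ C'.B q y) := by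
  rw [bi_tmul]
  generalize hi : 2 * (s + 1) + q = i
  obtain ⟨i, rfl⟩ : ∃ l, i = l + 1 := ⟨i - 1, by omega⟩
  rw [lowerRight_succ, totB_succ, tin_totIn _ _ _ _ _ _ _ _ rfl (by omega), neg_one_pow_two_mul]

theorem tensD_totD (c n : ℕ) (z : Tens k C.Tot C'.Tot c (n + 1)) :
    tensD C.totD C'.totD c n z = (lowerLeft C.totb c n z + lowerLeft C.totB c n z) +
      (lowerRight C'.totb c n z + lowerRight C'.totB c n z) := by
  suffices h : tensD C.totD C'.totD c n = (lowerLeft C.totb c n + lowerLeft C.totB c n) +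
      (lowerRight C'.totb c n + lowerRight C'.totB c n) from congrArg (fun e => e z) h
  refine tens_ext fun i j _ x y => ?_
  simp only [tensD, LinearMap.add_apply]
  rcases i with _ | i <;> rcases j with _ | j <;>
    simp only [lowerLeft_zero, lowerLeft_succ, lowerRight_zero, lowerRight_succ, totD,
      LinearMap.add_apply, TensorProduct.add_tmul, TensorProduct.tmul_add, map_add, smul_add,
      add_zero]

theorem tensor_b_tensIn (n i j : ℕ) (x : C.X i) (y : C'.X j) :
    (C.tensor C').b n (C.tensIn C' (n + 1) i j (x ⊗ₜ y)) =
      (lowerLeft C.b 0 n (tin 0 (n + 1) i j (x ⊗ₜ y)) +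
        lowerRight C'.b 0 n (tin 0 (n + 1) i j (x ⊗ₜ y)) : Tens k C.X C'.X 0 n) := rfl

theorem tensor_b_zero_zero (n : ℕ) (x : C.X 0) (y : C'.X 0) :
    (C.tensor C').b n (C.tensIn C' (n + 1) 0 0 (x ⊗ₜ y)) = 0 := by
  rw [tensor_b_tensIn, lowerLeft_zero, lowerRight_zero, add_zero]; rfl

theorem tensor_b_succ_zero (n i : ℕ) (x : C.X (i + 1)) (y : C'.X 0) :
    (C.tensor C').b n (C.tensIn C' (n + 1) (i + 1) 0 (x ⊗ₜ y)) =
      C.tensIn C' n i 0 (C.b i x ⊗ₜ y) := by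
  rw [tensor_b_tensIn, lowerLeft_succ, lowerRight_zero, add_zero]; rfl

theorem tensor_b_zero_succ (n j : ℕ) (x : C.X 0) (y : C'.X (j + 1)) :
    (C.tensor C').b n (C.tensIn C' (n + 1) 0 (j + 1) (x ⊗ₜ y)) =
      C.tensIn C' n 0 j (x ⊗ₜ C'.b j y) := by
  rw [tensor_b_tensIn, lowerLeft_zero, lowerRight_succ, zero_add, pow_zero, one_smul]; rfl

theorem tensor_b_succ_succ (n i j : ℕ) (x : C.X (i + 1)) (y : C'.X (j + 1)) :
    (C.tensor C').b n (C.tensIn C' (n + 1) (i + 1) (j + 1) (x ⊗ₜ y)) =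
      C.tensIn C' n i (j + 1) (C.b i x ⊗ₜ y) +
        (-1 : ℤ) ^ (i + 1) • C.tensIn C' n (i + 1) j (x ⊗ₜ C'.b j y) := by
  rw [tensor_b_tensIn, lowerLeft_succ, lowerRight_succ]; rfl

theorem tensor_B_tensIn (n i j : ℕ) (x : C.X i) (y : C'.X j) :
    (C.tensor C').B n (C.tensIn C' n i j (x ⊗ₜ y)) =
      C.tensIn C' (n + 1) (i + 1) j (C.B i x ⊗ₜ y) +
        (-1 : ℤ) ^ i • C.tensIn C' (n + 1) i (j + 1) (x ⊗ₜ C'.B j y) := by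
  change (raiseLeft C.B 0 n (tin 0 n i j (x ⊗ₜ y)) + raiseRight C'.B 0 n (tin 0 n i j (x ⊗ₜ y)) :
    Tens k C.X C'.X 0 (n + 1)) = _
  rw [raiseLeft_tin, raiseRight_tin]; rfl

theorem kuennethI_totb (n : ℕ) (z : (C.tensor C').Tot (n + 1)) :
    C.kuennethI C' n ((C.tensor C').totb n z) =
      lowerLeft C.totb 0 n (C.kuennethI C' (n + 1) z) +
        lowerRight C'.totb 0 n (C.kuennethI C' (n + 1) z) := by
  suffices h : C.kuennethI C' n ∘ₗ (C.tensor C').totb n =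
      lowerLeft C.totb 0 n ∘ₗ C.kuennethI C' (n + 1) +
        lowerRight C'.totb 0 n ∘ₗ C.kuennethI C' (n + 1) from congrArg (fun e => e z) h
  refine (C.tensor C').tot_ext fun m l hm w => ?_
  have key : (C.kuennethI C' n ∘ₗ (C.tensor C').totb n) ∘ₗ (C.tensor C').totIn (n + 1) m l =
      (lowerLeft C.totb 0 n ∘ₗ C.kuennethI C' (n + 1) +
        lowerRight C'.totb 0 n ∘ₗ C.kuennethI C' (n + 1)) ∘ₗ
          (C.tensor C').totIn (n + 1) m l := by
    refine tensor_ext fun i j h x y => ?_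
    simp only [LinearMap.comp_apply, LinearMap.add_apply]
    rw [kuennethI_totIn (n + 1) m l i j hm h, map_sum, map_sum]
    rcases l with _ | l
    · obtain rfl : i = 0 := by omega
      obtain rfl : j = 0 := by omega
      simp only [totb_zero, map_zero, lowerLeft_totb_zero, lowerRight_totb_zero,
        Finset.sum_const_zero, add_zero]
    · rw [totb_succ]
      rcases i with _ | i <;> rcases j with _ | j
      · omega
      · rw [tensor_b_zero_succ, kuennethI_totIn _ _ _ _ _ (by omega) (by omega)]
        simp only [lowerLeft_totb_zero, lowerRight_totb_succ, Finset.sum_const_zero, zero_add,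
          pow_zero, one_smul]
      · rw [tensor_b_succ_zero, kuennethI_totIn _ _ _ _ _ (by omega) (by omega)]
        simp only [lowerLeft_totb_succ, lowerRight_totb_zero, Finset.sum_const_zero, add_zero]
      · rw [tensor_b_succ_succ, map_add, map_add, map_zsmul, map_zsmul,
          kuennethI_totIn _ _ _ _ _ (by omega) (by omega),
          kuennethI_totIn _ _ _ _ _ (by omega) (by omega)]
        simp only [lowerLeft_totb_succ, lowerRight_totb_succ, Finset.smul_sum]
  exact congrArg (fun e => e w) key

theorem kuennethI_totB (n : ℕ) (z : (C.tensor C').Tot (n + 1)) :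
    C.kuennethI C' n ((C.tensor C').totB n z) =
      lowerLeft C.totB 0 n (C.kuennethI C' (n + 1) z) +
        lowerRight C'.totB 0 n (C.kuennethI C' (n + 1) z) := by
  suffices h : C.kuennethI C' n ∘ₗ (C.tensor C').totB n =
      lowerLeft C.totB 0 n ∘ₗ C.kuennethI C' (n + 1) +
        lowerRight C'.totB 0 n ∘ₗ C.kuennethI C' (n + 1) from congrArg (fun e => e z) h
  refine (C.tensor C').tot_ext fun m l hm w => ?_
  have key : (C.kuennethI C' n ∘ₗ (C.tensor C').totB n) ∘ₗ (C.tensor C').totIn (n + 1) m l =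
      (lowerLeft C.totB 0 n ∘ₗ C.kuennethI C' (n + 1) +
        lowerRight C'.totB 0 n ∘ₗ C.kuennethI C' (n + 1)) ∘ₗ
          (C.tensor C').totIn (n + 1) m l := by
    refine tensor_ext fun i j h x y => ?_
    simp only [LinearMap.comp_apply, LinearMap.add_apply]
    rw [kuennethI_totIn (n + 1) m l i j hm h, map_sum, map_sum]
    rcases m with _ | m
    · simp only [totB_zero, map_zero, lowerLeft_totB_zero, lowerRight_totB_zero,
        Finset.Nat.antidiagonal_zero, Finset.sum_singleton, add_zero]
    · rw [totB_succ, tensor_B_tensIn, map_add, map_add, map_zsmul, map_zsmul,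
        kuennethI_totIn _ _ _ _ _ (by omega) (by omega),
        kuennethI_totIn _ _ _ _ _ (by omega) (by omega), Finset.Nat.sum_antidiagonal_succ,
        Finset.Nat.sum_antidiagonal_succ']
      simp only [lowerLeft_totB_zero, lowerLeft_totB_succ, lowerRight_totB_zero,
        lowerRight_totB_succ, Finset.smul_sum, zero_add, add_zero]
  exact congrArg (fun e => e w) key

theorem kuennethI_totD (n : ℕ) (z : (C.tensor C').Tot (n + 1)) :
    C.kuennethI C' n ((C.tensor C').totD n z) =
      tensD C.totD C'.totD 0 n (C.kuennethI C' (n + 1) z) := by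
  rw [totD, LinearMap.add_apply, map_add, kuennethI_totb, kuennethI_totB, tensD_totD]
  abel

theorem leftS_tensD (n : ℕ) (z : Tens k C.Tot C'.Tot 0 (n + 1)) :
    C.leftS C' n (tensD C.totD C'.totD 0 n z) =
      tensD C.totD C'.totD 2 n (C.leftS C' (n + 1) z) := by
  suffices h : C.leftS C' n ∘ₗ tensD C.totD C'.totD 0 n =
      tensD C.totD C'.totD 2 n ∘ₗ C.leftS C' (n + 1) from congrArg (fun e => e z) h
  refine bi_ext fun r p s q _ x y => ?_
  simp only [LinearMap.comp_apply, tensD_totD]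
  rcases r with _ | _ | r <;> rcases p with _ | p <;> rcases s with _ | s <;> rcases q with _ | q <;>
    simp only [lowerLeft_totb_zero, lowerLeft_totb_succ, lowerLeft_totB_zero, lowerLeft_totB_succ,
      lowerRight_totb_zero, lowerRight_totb_succ, lowerRight_totB_zero, lowerRight_totB_succ,
      leftS_zero, leftS_succ, map_add, map_zero, map_zsmul, smul_zero, add_zero, zero_add]

theorem rightS_tensD (n : ℕ) (z : Tens k C.Tot C'.Tot 0 (n + 1)) :
    C.rightS C' n (tensD C.totD C'.totD 0 n z) =
      tensD C.totD C'.totD 2 n (C.rightS C' (n + 1) z) := by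
  suffices h : C.rightS C' n ∘ₗ tensD C.totD C'.totD 0 n =
      tensD C.totD C'.totD 2 n ∘ₗ C.rightS C' (n + 1) from congrArg (fun e => e z) h
  refine bi_ext fun r p s q _ x y => ?_
  simp only [LinearMap.comp_apply, tensD_totD]
  rcases r with _ | r <;> rcases p with _ | p <;> rcases s with _ | _ | s <;> rcases q with _ | q <;>
    simp only [lowerLeft_totb_zero, lowerLeft_totb_succ, lowerLeft_totB_zero, lowerLeft_totB_succ,
      lowerRight_totb_zero, lowerRight_totb_succ, lowerRight_totB_zero, lowerRight_totB_succ,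
      rightS_zero, rightS_succ, map_add, map_zero, map_zsmul, smul_zero, add_zero, zero_add]

theorem kuennethJ_tensD (n : ℕ) (z : Tens k C.Tot C'.Tot 0 (n + 1)) :
    C.kuennethJ C' n (tensD C.totD C'.totD 0 n z) =
      tensD C.totD C'.totD 2 n (C.kuennethJ C' (n + 1) z) := by
  rw [kuennethJ, kuennethJ, LinearMap.sub_apply, LinearMap.sub_apply, map_sub, leftS_tensD,
    rightS_tensD]

theorem kuennethJ_I (n : ℕ) (z : (C.tensor C').Tot n) :
    C.kuennethJ C' n (C.kuennethI C' n z) = 0 := by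
  have h := kuenneth_split n (C.kuennethI C' n z)
  rw [kuennethR_I, add_eq_left] at h
  rw [← kuennethJ_T n (C.kuennethJ C' n (C.kuennethI C' n z)), h, map_zero]

variable (C C')

theorem total_d (n : ℕ) : C.total.d (n + 1) n = ModuleCat.ofHom (C.totD n) :=
  ChainComplex.of_d (fun n => ModuleCat.of k (C.Tot n)) (fun n => ModuleCat.ofHom (C.totD n)) n

theorem totTens_d (c n : ℕ) :
    (C.totTens C' c).d (n + 1) n = ModuleCat.ofHom (tensD C.totD C'.totD c n) :=
  ChainComplex.of_d (fun n => ModuleCat.of k (Tens k C.Tot C'.Tot c n))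
    (fun n => ModuleCat.ofHom (tensD C.totD C'.totD c n)) n

/-- The sequence `0 → Tot (C ⊗ C') → Tot C ⊗ Tot C' → (Tot C ⊗ Tot C')[2] → 0` with second map
`S ⊗ 1 - 1 ⊗ S`. -/
noncomputable def kuennethSequence : ShortComplex (ChainComplex (ModuleCat.{u} k) ℕ) where
  X₁ := (C.tensor C').total
  X₂ := C.totTens C' 0
  X₃ := C.totTens C' 2
  f := ChainComplex.ofHom (fun n => ModuleCat.ofHom (C.kuennethI C' n)) (fun n => by
    rw [total_d, totTens_d]
    ext1
    exact LinearMap.ext fun z => (kuennethI_totD n z).symm)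
  g := ChainComplex.ofHom (fun n => ModuleCat.ofHom (C.kuennethJ C' n)) (fun n => by
    rw [totTens_d, totTens_d]
    ext1
    exact LinearMap.ext fun z => (kuennethJ_tensD n z).symm)
  zero := by
    ext n : 2
    exact LinearMap.ext fun z => kuennethJ_I n z

theorem kuennethSequence_shortExact : (C.kuennethSequence C').ShortExact := by
  refine HomologicalComplex.shortExact_of_degreewise_shortExact _ fun n => ?_
  refine ShortComplex.Splitting.shortExact
    { r := ModuleCat.ofHom (C.kuennethR C' n)
      s := ModuleCat.ofHom (C.kuennethT C' n)
      f_r := ?_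
      s_g := ?_
      id := ?_ }
  · ext1
    exact LinearMap.ext fun z => kuennethR_I n z
  · ext1
    exact LinearMap.ext fun z => kuennethJ_T n z
  · ext1
    exact LinearMap.ext fun z => kuenneth_split n z

end MixedComplex
end HopfCyclic

namespace HopfCyclic

open CategoryTheory

section Homology

variable {k : Type w} [CommRing k] (P : ChainComplex (ModuleCat.{u} k) ℕ)

theorem homologyClass_surjective (n : ℕ) :
    Function.Surjective (P.homologyπ n).hom :=
  (ModuleCat.epi_iff_surjective _).1 inferInstance

theorem exists_toCycles {n : ℕ} {z : P.cycles n} (hz : (P.homologyπ n).hom z = 0) :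
    ∃ y : P.X (n + 1), (P.toCycles (n + 1) n).hom y = z := by
  have h := (ShortComplex.mk _ _ (P.toCycles_comp_homologyπ (n + 1) n)).exact_of_g_is_cokernel
    (P.homologyIsCokernel (n + 1) n ((ComplexShape.down ℕ).prev_eq' rfl))
  exact (ShortComplex.moduleCat_exact_iff _).1 h z hz

theorem homologyClass_eq_zero {n : ℕ} {z : P.cycles n} {y : P.X (n + 1)}
    (h : (P.iCycles n).hom z = (P.d (n + 1) n).hom y) : (P.homologyπ n).hom z = 0 := by
  have h1 : z = (P.toCycles (n + 1) n).hom y := by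
    refine (ModuleCat.mono_iff_injective (P.iCycles n)).1 inferInstance ?_
    refine h.trans ?_
    exact congrArg (fun e => e.hom y) (P.toCycles_i (n + 1) n).symm
  rw [h1]
  exact congrArg (fun e => e.hom y) (P.toCycles_comp_homologyπ (n + 1) n)

/-- The homology class of a cycle is `a`. -/
def Represents {n : ℕ} (x : P.X n) (a : P.homology n) : Prop :=
  ∃ z : P.cycles n, (P.iCycles n).hom z = x ∧ (P.homologyπ n).hom z = a

/-- The linear map on homology induced by a linear map on cycles that kills boundaries. -/
noncomputable def homologyLift {Q : Type*} [AddCommGroup Q] [Module k Q] (n : ℕ)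
    (f : P.cycles n →ₗ[k] Q) (hf : ∀ y, f ((P.toCycles (n + 1) n).hom y) = 0) :
    P.homology n →ₗ[k] Q :=
  (LinearMap.ker (P.homologyπ n).hom).liftQ f (fun z hz => by
      obtain ⟨y, rfl⟩ := exists_toCycles P hz
      exact hf y) ∘ₗ
    ((P.homologyπ n).hom.quotKerEquivOfSurjective (homologyClass_surjective P n)).symm.toLinearMap

theorem homologyLift_class {Q : Type*} [AddCommGroup Q] [Module k Q] (n : ℕ)
    (f : P.cycles n →ₗ[k] Q) (hf : ∀ y, f ((P.toCycles (n + 1) n).hom y) = 0) (z : P.cycles n) :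
    homologyLift P n f hf ((P.homologyπ n).hom z) = f z := by
  have h : ((P.homologyπ n).hom.quotKerEquivOfSurjective (homologyClass_surjective P n)).symm
      ((P.homologyπ n).hom z) = Submodule.Quotient.mk z := by
    rw [LinearEquiv.symm_apply_eq]
    rfl
  rw [homologyLift, LinearMap.comp_apply, LinearEquiv.coe_coe, h, Submodule.liftQ_apply]

end Homology

namespace MixedComplex

variable {k : Type w} [CommRing k] (C C' : MixedComplex.{u, w} k)

/-- Cyclic homology. -/
noncomputable abbrev HC (n : ℕ) : ModuleCat.{u} k := C.total.homology n

/-- The inclusion of the cycles of the total complex. -/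
noncomputable def cyc (n : ℕ) : C.total.cycles n →ₗ[k] C.Tot n := (C.total.iCycles n).hom

theorem totD_cyc (n : ℕ) (z : C.total.cycles (n + 1)) : C.totD n (C.cyc (n + 1) z) = 0 := by
  have h := congrArg (fun e => e.hom z) (C.total.iCycles_d (n + 1) n)
  rw [total_d] at h
  exact h

theorem cyc_toCycles (n : ℕ) (y : C.Tot (n + 1)) :
    C.cyc n ((C.total.toCycles (n + 1) n).hom y) = C.totD n y := by
  have h := congrArg (fun e => e.hom y) (C.total.toCycles_i (n + 1) n)
  rw [total_d] at h
  exact h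

theorem tensD_cyc (c n p q : ℕ) (z : C.total.cycles p) (z' : C'.total.cycles q) :
    tensD C.totD C'.totD c n (tin c (n + 1) p q (C.cyc p z ⊗ₜ C'.cyc q z')) = 0 := by
  rw [tensD, LinearMap.add_apply]
  rcases p with _ | p <;> rcases q with _ | q <;>
    simp only [lowerLeft_zero, lowerLeft_succ, lowerRight_zero, lowerRight_succ, totD_cyc,
      TensorProduct.zero_tmul, TensorProduct.tmul_zero, map_zero, smul_zero, add_zero]

theorem tensD_toCycles_left (c n p q : ℕ) (y : C.Tot (p + 1)) (z' : C'.total.cycles q) :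
    tensD C.totD C'.totD c n (tin c (n + 1) (p + 1) q (y ⊗ₜ C'.cyc q z')) =
      tin c n p q (C.totD p y ⊗ₜ C'.cyc q z') := by
  rw [tensD, LinearMap.add_apply]
  rcases q with _ | q <;>
    simp only [lowerLeft_succ, lowerRight_zero, lowerRight_succ, totD_cyc,
      TensorProduct.tmul_zero, map_zero, smul_zero, add_zero]

theorem tensD_toCycles_right (c n p q : ℕ) (z : C.total.cycles p) (y : C'.Tot (q + 1)) :
    tensD C.totD C'.totD c n ((-1 : ℤ) ^ p • tin c (n + 1) p (q + 1) (C.cyc p z ⊗ₜ y)) =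
      tin c n p q (C.cyc p z ⊗ₜ C'.totD q y) := by
  rw [tensD, LinearMap.add_apply]
  rcases p with _ | p <;>
    simp only [lowerLeft_zero, lowerLeft_succ, lowerRight_succ, totD_cyc, map_zsmul,
      TensorProduct.zero_tmul, map_zero, smul_zero, zero_add, smul_smul, ← pow_add, ← two_mul,
      pow_mul, neg_one_sq, one_pow, one_smul]

/-- The map `z ⊗ z' ↦ z ⊗ z'` from cycles of `Tot C` and `Tot C'` to cycles of their tensor
product, shifted up by `c + 1`. -/
noncomputable def crossCycle (c n p q : ℕ) :
    C.total.cycles p ⊗[k] C'.total.cycles q →ₗ[k] (C.totTens C' c).cycles (n + 1) :=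
  ((C.totTens C' c).liftCycles
    (ModuleCat.ofHom (X := C.total.cycles p ⊗[k] C'.total.cycles q)
      (tin c (n + 1) p q ∘ₗ TensorProduct.map (C.cyc p) (C'.cyc q)))
    n ((ComplexShape.down ℕ).next_eq' rfl) (by
      rw [totTens_d]
      ext1
      refine TensorProduct.ext' fun z z' => ?_
      exact tensD_cyc C C' c n p q z z')).hom

theorem iCycles_crossCycle (c n p q : ℕ) (z : C.total.cycles p) (z' : C'.total.cycles q) :
    ((C.totTens C' c).iCycles (n + 1)).hom (C.crossCycle C' c n p q (z ⊗ₜ z')) =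
      (tin c (n + 1) p q (C.cyc p z ⊗ₜ C'.cyc q z') : Tens k C.Tot C'.Tot c (n + 1)) := by
  have h := (C.totTens C' c).liftCycles_i
    (ModuleCat.ofHom (X := C.total.cycles p ⊗[k] C'.total.cycles q)
      (tin c (n + 1) p q ∘ₗ TensorProduct.map (C.cyc p) (C'.cyc q)))
    n ((ComplexShape.down ℕ).next_eq' rfl) (by
      rw [totTens_d]
      ext1
      refine TensorProduct.ext' fun z z' => ?_
      exact tensD_cyc C C' c n p q z z')
  exact congrArg (fun e => e.hom (z ⊗ₜ[k] z')) h

/-- The class of `z ⊗ z'`, for cycles `z` and `z'`. -/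
noncomputable def crossClass (n p q : ℕ) : C.total.cycles p →ₗ[k] C'.total.cycles q →ₗ[k]
    (C.totTens C' 2).homology (n + 1) :=
  (TensorProduct.mk k (C.total.cycles p) (C'.total.cycles q)).compr₂
    (((C.totTens C' 2).homologyπ (n + 1)).hom ∘ₗ C.crossCycle C' 2 n p q)

theorem crossClass_eq_zero (n p q : ℕ) (z : C.total.cycles p) (z' : C'.total.cycles q)
    (y : Tens k C.Tot C'.Tot 2 (n + 2))
    (h : tensD C.totD C'.totD 2 (n + 1) y = tin 2 (n + 1) p q (C.cyc p z ⊗ₜ C'.cyc q z')) :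
    C.crossClass C' n p q z z' = 0 := by
  refine homologyClass_eq_zero (C.totTens C' 2) (y := (y : Tens k C.Tot C'.Tot 2 (n + 2))) ?_
  rw [totTens_d]
  exact (iCycles_crossCycle C C' 2 n p q z z').trans h.symm

theorem crossClass_toCycles_left (n p q : ℕ) (y : C.Tot (p + 1)) (z' : C'.total.cycles q) :
    C.crossClass C' n p q ((C.total.toCycles (p + 1) p).hom y) z' = 0 := by
  refine crossClass_eq_zero C C' n p q _ z' (y := tin 2 (n + 2) (p + 1) q (y ⊗ₜ C'.cyc q z')) ?_
  rw [cyc_toCycles]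
  exact tensD_toCycles_left C C' 2 (n + 1) p q y z'

theorem crossClass_toCycles_right (n p q : ℕ) (z : C.total.cycles p) (y : C'.Tot (q + 1)) :
    C.crossClass C' n p q z ((C'.total.toCycles (q + 1) q).hom y) = 0 := by
  refine crossClass_eq_zero C C' n p q  z _ (y := (-1 : ℤ) ^ p • tin 2 (n + 2) p (q + 1) (C.cyc p z ⊗ₜ y)) ?_
  rw [cyc_toCycles]
  exact tensD_toCycles_right C C' 2 (n + 1) p q z y

/-- The homology cross product `[z] ⊗ [z'] ↦ [z ⊗ z']` into the homology of the tensor product of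
the total complexes, shifted up by `2`. -/
noncomputable def cross (n p q : ℕ) :
    C.HC p →ₗ[k] C'.HC q →ₗ[k] (C.totTens C' 2).homology (n + 1) :=
  (homologyLift C'.total q
    (homologyLift C.total p (C.crossClass C' n p q) (fun y => by
      exact LinearMap.ext fun z' => crossClass_toCycles_left C C' n p q y z')).flip (fun y => by
      refine LinearMap.ext fun a => ?_
      obtain ⟨z, rfl⟩ := homologyClass_surjective C.total p a
      rw [LinearMap.flip_apply, homologyLift_class, LinearMap.zero_apply]
      exact crossClass_toCycles_right C C' n p q z y)).flip

theorem cross_class (n p q : ℕ) (z : C.total.cycles p) (z' : C'.total.cycles q) :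
    C.cross C' n p q ((C.total.homologyπ p).hom z) ((C'.total.homologyπ q).hom z') =
      C.crossClass C' n p q z z' := by
  rw [cross, LinearMap.flip_apply, homologyLift_class, LinearMap.flip_apply, homologyLift_class]

end MixedComplex
end HopfCyclic

namespace HopfCyclic

/-! ### Shuffle maps -/

/-- `σ` is a `(p, q)`-shuffle: it is increasing on the first `p` and on the last `q` elements. -/
def IsShuffle {p q : ℕ} (σ : Equiv.Perm (Fin (p + q))) : Prop :=
  StrictMono (fun i : Fin p => σ (Fin.castAdd q i)) ∧
    StrictMono (fun j : Fin q => σ (Fin.natAdd p j))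

namespace CyclicModule

variable {k : Type w} [CommRing k] (C C' : CyclicModule.{u, w} k)

/-- The identification of `C_m` with `C_n` for `m = n`. -/
def castX {m n : ℕ} : m = n → (C.X m →ₗ[k] C.X n)
  | rfl => LinearMap.id

/-- The composite `s_{f(q-1)} ⋯ s_{f(1)} s_{f(0)}`. -/
def degs : ∀ (q p : ℕ), (Fin q → ℕ) → (C.X p →ₗ[k] C.X (p + q))
  | 0, _, _ => LinearMap.id
  | q + 1, p, f => C.s (p + q) (f (Fin.last q)) ∘ₗ degs q p (fun j => f j.castSucc)

theorem castX_mem {m n l : ℕ} (h : m = n) {x : C.X m} (hx : x ∈ C.degenAt m l) :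
    C.castX h x ∈ C.degenAt n l := by
  subst h
  exact hx

theorem s_mem_degenAt (n j l : ℕ) (hj : j ≤ n) (hl : l < n) {x : C.X n} (hx : x ∈ C.degenAt n l) :
    C.s n j x ∈ C.degenAt (n + 1) (if l < j then l else l + 1) := by
  rcases n with _ | n
  · omega
  obtain ⟨y, rfl⟩ := hx
  split_ifs with h
  · obtain ⟨j, rfl⟩ : ∃ i, j = i + 1 := ⟨j - 1, by omega⟩
    exact ⟨C.s n j y, C.s_s n l j (by omega) (by omega) y⟩
  · exact ⟨C.s n j y, (C.s_s n j l (by omega) (by omega) y).symm⟩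

theorem degs_degenAt (q p : ℕ) (f : Fin q → ℕ) (hf : StrictMono f) (hb : ∀ j, f j ≤ p + j)
    (l : ℕ) (hl : l < p) (x : C.X p) (hx : x ∈ C.degenAt p l) :
    ∃ m, m < p + q ∧ (∀ j, f j ≠ m) ∧ C.degs q p f x ∈ C.degenAt (p + q) m := by
  induction q with
  | zero => exact ⟨l, hl, fun j => j.elim0, hx⟩
  | succ q ih =>
    obtain ⟨m, hm, hne, hmem⟩ := ih (fun j => f j.castSucc)
      (fun a b h => hf (Fin.castSucc_lt_castSucc_iff.2 h)) (fun j => hb j.castSucc)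
    have hlast : f (Fin.last q) ≤ p + q := hb (Fin.last q)
    refine ⟨_, ?_, fun j => ?_, C.s_mem_degenAt (p + q) _ m hlast hm hmem⟩
    · split_ifs <;> omega
    · refine Fin.lastCases ?_ (fun j => ?_) j
      · split_ifs <;> omega
      · have h1 := hne j
        have h2 : f j.castSucc < f (Fin.last q) := hf (Fin.castSucc_lt_last j)
        split_ifs <;> omega

theorem degs_mem_range (q p : ℕ) (f : Fin q → ℕ) (hf : StrictMono f) (hb : ∀ j, f j ≤ p + j)
    (j : Fin q) (x : C.X p) : C.degs q p f x ∈ C.degenAt (p + q) (f j) := by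
  induction q with
  | zero => exact j.elim0
  | succ q ih =>
    refine Fin.lastCases ?_ (fun j => ?_) j
    · exact ⟨C.degs q p (fun j => f j.castSucc) x, rfl⟩
    · have hm := ih (fun j => f j.castSucc)
        (fun a b h => hf (Fin.castSucc_lt_castSucc_iff.2 h)) (fun j => hb j.castSucc) j
      have h2 : f j.castSucc < f (Fin.last q) := hf (Fin.castSucc_lt_last j)
      have hlast : f (Fin.last q) ≤ p + q := hb (Fin.last q)
      have h3 := C.s_mem_degenAt (p + q) _ _ hlast (by omega) hm
      rw [if_pos h2] at h3
      exact h3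

theorem tmul_mem (n l : ℕ) (hl : l < n) {x : C.X n} {y : C'.X n} (hx : x ∈ C.degenAt n l)
    (hy : y ∈ C'.degenAt n l) : (x ⊗ₜ[k] y : (C.diag C').X n) ∈ (C.diag C').degenerate n := by
  rcases n with _ | n
  · omega
  obtain ⟨x, rfl⟩ := hx
  obtain ⟨y, rfl⟩ := hy
  exact (C.diag C').s_mem n l (by omega) (x ⊗ₜ[k] y)

theorem le_of_strictMono_bound (P q : ℕ) (f : Fin q → ℕ) (hf : StrictMono f)
    (hb : ∀ j, f j < P + q) (j : Fin q) : f j ≤ P + j := by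
  induction q with
  | zero => exact j.elim0
  | succ q ih =>
    have hlast := hb (Fin.last q)
    refine Fin.lastCases ?_ (fun j => ?_) j
    · rw [Fin.val_last]; omega
    · exact ih (fun j => f j.castSucc) (fun a b h => hf (Fin.castSucc_lt_castSucc_iff.2 h))
        (fun j => by
          have : f j.castSucc < f (Fin.last q) := hf (Fin.castSucc_lt_last j)
          omega) j

/-- The term of the shuffle map of the permutation `σ`. With `σ` taking values in
`0, …, p + q - 1`, it is `x ⊗ y ↦ s_{σ(p+q)} ⋯ s_{σ(p+1)} x ⊗ s_{σ(p)} ⋯ s_{σ(1)} y`. -/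
noncomputable def shuffleTerm {p q n : ℕ} (h : p + q = n) (σ : Equiv.Perm (Fin (p + q))) :
    C.X p →ₗ[k] C'.X q →ₗ[k] (C.diag C').X n :=
  (TensorProduct.mk k (C.X n) (C'.X n)).compl₁₂
    (C.castX h ∘ₗ C.degs q p fun j => σ (Fin.natAdd p j))
    (C'.castX ((Nat.add_comm q p).trans h) ∘ₗ C'.degs p q fun i => σ (Fin.castAdd q i))

theorem shuffleTerm_mem_left {p q n : ℕ} (h : p + q = n) {σ : Equiv.Perm (Fin (p + q))}
    (hσ : IsShuffle σ) {x : C.X p} (hx : x ∈ C.degenerate p) (y : C'.X q) :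
    C.shuffleTerm C' h σ x y ∈ (C.diag C').degenerate n := by
  suffices hle : C.degenerate p ≤
      ((C.diag C').degenerate n).comap ((C.shuffleTerm C' h σ).flip y) from hle hx
  refine iSup_le fun l x hx => ?_
  obtain ⟨m, hm, hne, hmem⟩ := C.degs_degenAt q p (fun j => σ (Fin.natAdd p j)) hσ.2
    (le_of_strictMono_bound p q (fun j => σ (Fin.natAdd p j)) hσ.2 fun j => (σ _).2) l l.2 x hx
  have hy : C'.degs p q (fun i => σ (Fin.castAdd q i)) y ∈ C'.degenAt (q + p) m := by
    obtain ⟨r, hr⟩ := σ.surjective ⟨m, hm⟩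
    induction r using Fin.addCases with
    | left i =>
      have h1 := C'.degs_mem_range p q (fun i => σ (Fin.castAdd q i)) hσ.1
        (le_of_strictMono_bound q p (fun i => σ (Fin.castAdd q i)) hσ.1 fun i => by
          have := (σ (Fin.castAdd q i)).2
          omega) i y
      simp only [hr] at h1
      exact h1
    | right j => exact absurd (congrArg Fin.val hr) (hne j)
  exact tmul_mem C C' n m (by omega) (C.castX_mem h hmem)
    (C'.castX_mem ((Nat.add_comm q p).trans h) hy)

theorem shuffleTerm_mem_right {p q n : ℕ} (h : p + q = n) {σ : Equiv.Perm (Fin (p + q))}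
    (hσ : IsShuffle σ) (x : C.X p) {y : C'.X q} (hy : y ∈ C'.degenerate q) :
    C.shuffleTerm C' h σ x y ∈ (C.diag C').degenerate n := by
  suffices hle : C'.degenerate q ≤
      ((C.diag C').degenerate n).comap (C.shuffleTerm C' h σ x) from hle hy
  refine iSup_le fun l y hy => ?_
  obtain ⟨m, hm, hne, hmem⟩ := C'.degs_degenAt p q (fun i => σ (Fin.castAdd q i)) hσ.1
    (le_of_strictMono_bound q p (fun i => σ (Fin.castAdd q i)) hσ.1 fun i => by
      have := (σ (Fin.castAdd q i)).2
      omega) l l.2 y hy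
  have hx : C.degs q p (fun j => σ (Fin.natAdd p j)) x ∈ C.degenAt (p + q) m := by
    obtain ⟨r, hr⟩ := σ.surjective ⟨m, by omega⟩
    induction r using Fin.addCases with
    | left i => exact absurd (congrArg Fin.val hr) (hne i)
    | right j =>
      have h1 := C.degs_mem_range q p (fun j => σ (Fin.natAdd p j)) hσ.2
        (le_of_strictMono_bound p q (fun j => σ (Fin.natAdd p j)) hσ.2 fun j => (σ _).2) j x
      simp only [hr] at h1
      exact h1
  exact tmul_mem C C' n m (by omega) (C.castX_mem h hx)
    (C'.castX_mem ((Nat.add_comm q p).trans h) hmem)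

/-- The projection onto the normalized complex. -/
def cls (n : ℕ) : C.X n →ₗ[k] C.normalized.X n := (C.degenerate n).mkQ

theorem cls_eq_zero {n : ℕ} {x : C.X n} (hx : x ∈ C.degenerate n) : C.cls n x = 0 :=
  (Submodule.Quotient.mk_eq_zero _).2 hx

theorem cls_surjective (n : ℕ) : Function.Surjective (C.cls n) := Submodule.mkQ_surjective _

open Classical in
/-- The sum of `sign(σ)` times the shuffle term of `σ`, over the `(p, q)`-shuffles `σ` that satisfy
`A`, with values in the normalized complex of `C × C'`. -/
noncomputable def shuffleSum {p q n : ℕ} (h : p + q = n) (A : Equiv.Perm (Fin (p + q)) → Prop) :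
    C.X p →ₗ[k] C'.X q →ₗ[k] (C.diag C').normalized.X n :=
  ∑ σ : Equiv.Perm (Fin (p + q)), if IsShuffle σ ∧ A σ then
    (Equiv.Perm.sign σ : ℤ) • (C.shuffleTerm C' h σ).compr₂ ((C.diag C').cls n) else 0

theorem shuffleSum_left {p q n : ℕ} (h : p + q = n) (A : Equiv.Perm (Fin (p + q)) → Prop)
    {x : C.X p} (hx : x ∈ C.degenerate p) (y : C'.X q) : C.shuffleSum C' h A x y = 0 := by
  classical
  rw [shuffleSum, LinearMap.sum_apply, LinearMap.sum_apply]
  refine Finset.sum_eq_zero fun σ _ => ?_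
  by_cases hσ : IsShuffle σ ∧ A σ
  · rw [if_pos hσ]
    have h0 : (C.diag C').cls n (C.shuffleTerm C' h σ x y) = 0 :=
      (C.diag C').cls_eq_zero (C.shuffleTerm_mem_left C' h hσ.1 hx y)
    change (Equiv.Perm.sign σ : ℤ) • (C.diag C').cls n (C.shuffleTerm C' h σ x y) = 0
    rw [h0, smul_zero]
  · rw [if_neg hσ]
    rfl

theorem shuffleSum_right {p q n : ℕ} (h : p + q = n) (A : Equiv.Perm (Fin (p + q)) → Prop)
    (x : C.X p) {y : C'.X q} (hy : y ∈ C'.degenerate q) : C.shuffleSum C' h A x y = 0 := by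
  classical
  rw [shuffleSum, LinearMap.sum_apply, LinearMap.sum_apply]
  refine Finset.sum_eq_zero fun σ _ => ?_
  by_cases hσ : IsShuffle σ ∧ A σ
  · rw [if_pos hσ]
    have h0 : (C.diag C').cls n (C.shuffleTerm C' h σ x y) = 0 :=
      (C.diag C').cls_eq_zero (C.shuffleTerm_mem_right C' h hσ.1 x hy)
    change (Equiv.Perm.sign σ : ℤ) • (C.diag C').cls n (C.shuffleTerm C' h σ x y) = 0
    rw [h0, smul_zero]
  · rw [if_neg hσ]
    rfl

/-- The map on normalized complexes induced by a bilinear map. -/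
noncomputable def normDesc {Q : Type*} [AddCommGroup Q] [Module k Q] {p q : ℕ}
    (f : C.X p →ₗ[k] C'.X q →ₗ[k] Q) (hl : ∀ x ∈ C.degenerate p, ∀ y, f x y = 0)
    (hr : ∀ x, ∀ y ∈ C'.degenerate q, f x y = 0) :
    C.normalized.X p ⊗[k] C'.normalized.X q →ₗ[k] Q :=
  TensorProduct.lift (((C'.degenerate q).liftQ
    ((C.degenerate p).liftQ f fun x hx => LinearMap.ext fun y => hl x hx y).flip fun y hy =>
      LinearMap.ext fun x => by
        obtain ⟨x, rfl⟩ := Submodule.mkQ_surjective _ x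
        exact hr x y hy).flip)

theorem normDesc_tmul {Q : Type*} [AddCommGroup Q] [Module k Q] {p q : ℕ}
    (f : C.X p →ₗ[k] C'.X q →ₗ[k] Q) (hl : ∀ x ∈ C.degenerate p, ∀ y, f x y = 0)
    (hr : ∀ x, ∀ y ∈ C'.degenerate q, f x y = 0) (x : C.X p) (y : C'.X q) :
    C.normDesc C' f hl hr (C.cls p x ⊗ₜ C'.cls q y) = f x y := rfl

/-- The shuffle map `sh_{p,q}` on normalized complexes. -/
noncomputable def sh {p q n : ℕ} (h : p + q = n) :
    C.normalized.X p ⊗[k] C'.normalized.X q →ₗ[k] (C.diag C').normalized.X n :=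
  C.normDesc C' (C.shuffleSum C' h fun _ => True)
    (fun _ hx y => C.shuffleSum_left C' h _ hx y) (fun x _ hy => C.shuffleSum_right C' h _ x hy)

/-- The cyclic shuffle map `sh'_{p,q}` on normalized complexes. It is the sum over `i ≤ p` and
`j ≤ q` of the signed `(p+1, q+1)`-shuffles of `s_{-1} tⁱ x` and `s_{-1} tʲ y` in which the `0`-th
vertex of `x` (number `i` in `tⁱ x`) comes before the `0`-th vertex of `y` (number `j` in `tʲ y`). -/
noncomputable def sh' {p q n : ℕ} (h : p + q + 2 = n) :
    C.normalized.X p ⊗[k] C'.normalized.X q →ₗ[k] (C.diag C').normalized.X n :=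
  (-1 : ℤ) ^ p • ∑ i : Fin (p + 1), ∑ j : Fin (q + 1), (-1 : ℤ) ^ (p * i + q * j : ℕ) •
    C.normDesc C' ((C.shuffleSum C' (show (p + 1) + (q + 1) = n by omega)
        fun σ => σ (Fin.castAdd (q + 1) i) < σ (Fin.natAdd (p + 1) j)).compl₁₂
        (C.extRot p i) (C'.extRot q j))
      (fun _ hx y => C.shuffleSum_left C' _ _ (C.extRot_mem p i hx) _)
      (fun x _ hy => C.shuffleSum_right C' _ _ _ (C'.extRot_mem q j hy))

/-- The map `S̃h : Tot (C ⊗ C') → Tot (C × C')` in degree `n`: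
`v^m (x ⊗ y) ↦ v^m sh (x ⊗ y) + v^(m-1) sh' (x ⊗ y)`. -/
noncomputable def shTot (n : ℕ) :
    (C.normalized.tensor C'.normalized).Tot n →ₗ[k] (C.diag C').normalized.Tot n :=
  (C.normalized.tensor C'.normalized).totDesc n fun m q =>
    C.normalized.tensorDesc C'.normalized q fun i j =>
      (C.diag C').normalized.totIn n m (i + j) ∘ₗ C.sh C' rfl +
        match m with
        | 0 => 0
        | m + 1 => (C.diag C').normalized.totIn n m (i + j + 2) ∘ₗ C.sh' C' rfl

/-- The product `(x_p, x_{p-2}, …) ⋆ (y_q, y_{q-2}, …) = (B x_p × y_q, B x_p × y_{q-2}, …)`, where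
`×` is the shuffle map and `x_{p-2r}` is the coefficient of `u^r`. -/
noncomputable def starTot (p q : ℕ) : C.normalized.Tot p →ₗ[k] C'.normalized.Tot q →ₗ[k]
    (C.diag C').normalized.Tot (p + q + 1) :=
  C.normalized.totDesc (P := C'.normalized.Tot q →ₗ[k] (C.diag C').normalized.Tot (p + q + 1)) p
    fun r i => match r with
    | 0 => (C'.normalized.totDesc
        (P := C.normalized.X i →ₗ[k] (C.diag C').normalized.Tot (p + q + 1)) q fun s j =>
        (((TensorProduct.mk k (C.normalized.X (i + 1)) (C'.normalized.X j)).compr₂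
          ((C.diag C').normalized.totIn (p + q + 1) s (i + 1 + j) ∘ₗ C.sh C' rfl)) ∘ₗ
            C.normalized.B i).flip).flip
    | _ + 1 => 0

/-- The map on normalized total complexes in degree `n` induced by maps that preserve
degenerate elements. -/
noncomputable def totMap {C C' : CyclicModule.{u, w} k} (f : ∀ m, C.X m →ₗ[k] C'.X m)
    (hf : ∀ m i x, f (m + 1) (C.s m i x) = C'.s m i (f m x)) (n : ℕ) :
    C.normalized.Tot n →ₗ[k] C'.normalized.Tot n :=
  C.normalized.totDesc n fun r m => C'.normalized.totIn n r m ∘ₗ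
    Submodule.mapQ (C.degenerate m) (C'.degenerate m) (f m) (by
      rcases m with _ | m
      · rw [degenerate_zero]; exact bot_le
      · refine C.degenerate_le fun i hi x => ?_
        rw [Submodule.mem_comap, hf]
        exact C'.s_mem m i hi _)

end CyclicModule
end HopfCyclic

namespace HopfCyclic

open CategoryTheory

/-- The connecting homomorphism of the Künneth sequence, on
`⨁_{i+j=n} HC_i(C) ⊗ HC_j(C') = H_{n+2}((Tot C ⊗ Tot C')[2])`. -/
noncomputable def MixedComplex.kuennethConnecting {k : Type w} [CommRing k]
    (C C' : MixedComplex.{u, w} k) (n : ℕ) :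
    Tens k (fun i => C.HC i) (fun j => C'.HC j) 0 n →ₗ[k] (C.tensor C').HC (n + 1) :=
  ((C.kuennethSequence_shortExact C').δ (n + 2) (n + 1) rfl).hom ∘ₗ
    tensDesc 0 n fun p q => TensorProduct.lift (C.cross C' (n + 1) p q)

section Main

variable {k : Type w} [Field k] {H K : Type u} [Ring H] [HopfAlgebra k H] [Ring K]
  [HopfAlgebra k K] {M N : Type u} [AddCommGroup M] [Module k M] [AddCommGroup N] [Module k N]
  {hS : Function.Bijective (HopfAlgebra.antipode k (A := H))}
  {hT : Function.Bijective (HopfAlgebra.antipode k (A := K))}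

/-- The normalized mixed complex of `C̃(H, M)`. -/
noncomputable abbrev SAYD.mixed (A : SAYD k H M hS) : MixedComplex.{u, w} k :=
  (hopfCyclic A).normalized

/-- The normalized mixed complex of `C̃(H, M) × C̃(K, N)`. -/
noncomputable abbrev SAYD.diagMixed (A : SAYD k H M hS) (B : SAYD k K N hT) :
    MixedComplex.{u, w} k :=
  ((hopfCyclic A).diag (hopfCyclic B)).normalized

/-- The map `Tot(C̃(H, M) × C̃(K, N)) → Tot(C̃(H ⊗ K, M ⊗ N))` induced by the inverse of `Ω`, in
degree `n`. -/
noncomputable def omegaInvTot (A : SAYD k H M hS) (B : SAYD k K N hT) (n : ℕ) :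
    (A.diagMixed B).Tot n →ₗ[k] (A.tensor B).mixed.Tot n :=
  CyclicModule.totMap (C := (hopfCyclic A).diag (hopfCyclic B)) (C' := hopfCyclic (A.tensor B))
    (omegaInv A B) (fun m i x => omegaInv_s A B m i x) n

/-- The boundary map of the Künneth long exact sequence,
`⨁_{i+j=n} H̃C_i(H, M) ⊗ H̃C_j(K, N) → H̃C_{n+1}(H ⊗ K, M ⊗ N)`: the connecting homomorphism,
followed by the maps induced by `S̃h` and by the inverse of `Ω`. -/
noncomputable def kuennethBoundary (A : SAYD k H M hS) (B : SAYD k K N hT)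
    (Sh : (A.mixed.tensor B.mixed).total ⟶ (A.diagMixed B).total)
    (Om : (A.diagMixed B).total ⟶ (A.tensor B).mixed.total) (n : ℕ) :
    Tens k (fun i => A.mixed.HC i) (fun j => B.mixed.HC j) 0 n →ₗ[k]
      (A.tensor B).mixed.HC (n + 1) :=
  (HomologicalComplex.homologyMap Om (n + 1)).hom ∘ₗ
    (HomologicalComplex.homologyMap Sh (n + 1)).hom ∘ₗ
      A.mixed.kuennethConnecting B.mixed n

/-- The chain level product `⋆`, with values in `Tot(C̃(H ⊗ K, M ⊗ N))`. -/
noncomputable def starProduct (A : SAYD k H M hS) (B : SAYD k K N hT) (p q : ℕ) :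
    A.mixed.Tot p →ₗ[k] B.mixed.Tot q →ₗ[k] (A.tensor B).mixed.Tot (p + q + 1) :=
  ((hopfCyclic A).starTot (hopfCyclic B) p q).compr₂ (omegaInvTot A B (p + q + 1))

end Main
end HopfCyclic

/-! ### Degeneracies along words: operators on graded elements -/

namespace HopfCyclic

/-! The boundary map is computed on chains, from the splitting of the Künneth sequence. The section
`kuennethT` sends `u^r x ⊗ u'^s y` to `∑_{a+b=s} u^(r+a+1) x ⊗ u'^b y`, and the retraction
`kuennethR` kills every positive power of `u` on the left. In the differential of such a lift the
only part that lowers the power of `u` is `B` on the left factor, so the retraction leaves something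
only for `r = a = 0`, namely `v^s (B x ⊗ y)` (`connect_zero`, `connect_succ`). For cycles `(x_p,
x_{p-2}, …)` and `(y_q, y_{q-2}, …)` the class under the connecting homomorphism is therefore
represented by `∑_s v^s (B x_p ⊗ y_{q-2s})` (`represents_kuennethConnecting`). The map `S̃h` turns
this into `∑_s v^s (B x_p × y_{q-2s})`: its second component `sh' (B x ⊗ y)` is zero, because
`s_{-1} t^c s_{-1}` is degenerate (`extRot_extRot`, `sh'_B_left`). So `S̃h` after `connect` is the
formula for `⋆` already on chains (`shTot_connect`). Consequently `⋆` takes cycles to cycles, its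
class depends only on the two classes, and it equals the boundary map.

The longer part is that `S̃h` is a chain map on normalized complexes. Comparing powers of `v`, this
amounts to `b sh = sh b`, `b sh' + B sh = sh' b + sh B` and `B sh' = sh' B`; in the last relation
both sides vanish.

A shuffle is encoded as a word in two letters: `true` is a step of the first factor and a degeneracy
of the second, `false` the reverse. A face meets two neighbouring letters. If they are equal, it is
a face of one factor. If they differ, it cancels the degeneracy in each factor, and the two words
that differ by exchanging these letters have the same face. In `sh` the two have opposite signs and
cancel (`b_shuffle`). In `sh'` the condition that the `i`-th `true` comes before the `j`-th `false`
distinguishes the two words exactly when the exchanged letters are those two (`precedes_swap`), so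
for each place one pair `(i, j)` survives. The surviving terms are those of `-B sh`, because `B`
cuts a word in two and exchanges the parts around a new step common to both factors (`B_shev`,
`mixed_faces`).

The first and last faces of `sh'` telescope in the rotation index, since `d_0 s_{-1} tⁱ = tⁱ` and
`d_{p+1} s_{-1} tⁱ = tⁱ⁺¹`; the ends that remain are `sh (x ⊗ B y)` and `sh (B x ⊗ y)` with their
signs. The faces inside one factor, moved past the rotations, form `sh' b`. All this is `b_csh`.
That `B sh'` vanishes is `B_csh`: both factors acquire a degeneracy, and along the rotated word the
two have the same index.

The computations use families `∀ n, C.X n` in place of elements of a fixed degree, and operators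
that are zero out of range, so that no degree has to be transported. Words with the wrong number of
letters then contribute zero, and sums may run over all words of a given length. The last ingredient
is elementary: the rearrangement commutes with faces, degeneracies and rotation, because product,
coproduct and action of `H ⊗ K` are componentwise. -/

theorem count_true_add_count_false (u : List Bool) : u.count true + u.count false = u.length := by
  induction u with
  | nil => rfl
  | cons a u ih => cases a <;> simp <;> omega

namespace CyclicModule

variable {k : Type w} [CommRing k] (C : CyclicModule.{u, w} k)

/-- The degeneracy `s_j` on graded elements, zero where it is not meaningful. -/
def gS (j : ℕ) (z : ∀ n, C.X n) : ∀ n, C.X n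
  | 0 => 0
  | n + 1 => if j ≤ n then C.s n j (z n) else 0

/-- The face `d_i` on graded elements, zero where it is not meaningful. -/
def gD (i : ℕ) (z : ∀ n, C.X n) : ∀ n, C.X n :=
  fun n => if i ≤ n + 1 then C.d n i (z (n + 1)) else 0

/-- The cyclic operator on graded elements. -/
def gT (z : ∀ n, C.X n) : ∀ n, C.X n := fun n => C.t n (z n)

/-- The extra degeneracy on graded elements. -/
def gE (z : ∀ n, C.X n) : ∀ n, C.X n
  | 0 => 0
  | n + 1 => C.sExt n (z n)

/-- The default zeros fit the simplicial identity: when the indices leave the range, both sides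
vanish, so it holds in every degree. -/
theorem gS_gS (i j : ℕ) (h : i ≤ j) (z : ∀ n, C.X n) :
    C.gS i (C.gS j z) = C.gS (j + 1) (C.gS i z) := by
  funext n
  rcases n with _ | _ | n
  · rfl
  · simp [gS]
  · simp only [gS]
    by_cases hj : j ≤ n
    · rw [if_pos (by omega), if_pos hj, if_pos (by omega), if_pos (by omega), C.s_s n i j h hj]
    · rw [if_neg hj, if_neg (show ¬ j + 1 ≤ n + 1 by omega), map_zero, ite_self]

theorem gD_gS_lt (i j : ℕ) (h : i ≤ j) (z : ∀ n, C.X n) :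
    C.gD i (C.gS (j + 1) z) = C.gS j (C.gD i z) := by
  funext n
  rcases n with _ | n
  · simp [gS, gD]
  · simp only [gS, gD]
    by_cases hj : j ≤ n
    · rw [if_pos (by omega), if_pos (by omega), if_pos hj, if_pos (by omega),
        C.d_s_lt n i j h hj]
    · rw [if_neg hj, if_neg (show ¬ j + 1 ≤ n + 1 by omega), map_zero, ite_self]

theorem gD_gS_gt (i j : ℕ) (h : j < i) (z : ∀ n, C.X n) :
    C.gD (i + 1) (C.gS j z) = C.gS j (C.gD i z) := by
  funext n
  rcases n with _ | n
  · simp only [gS, gD]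
    rw [if_neg (by omega)]
  · simp only [gS, gD]
    by_cases hj : i ≤ n + 1
    · rw [if_pos (by omega), if_pos (by omega), if_pos (by omega), if_pos hj,
        C.d_s_gt n i j h hj]
    · rw [if_neg hj, if_neg (show ¬ i + 1 ≤ n + 1 + 1 by omega), map_zero, ite_self]

/-- Only a degreewise statement: for `n < i` the degeneracy has its default value zero and nothing
is recovered. -/
theorem gD_gS_self (i n : ℕ) (h : i ≤ n) (z : ∀ n, C.X n) : C.gD i (C.gS i z) n = z n := by
  simp only [gS, gD]
  rw [if_pos (by omega), if_pos h, C.d_s_self n i h]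

theorem gD_gS_succ (i n : ℕ) (h : i ≤ n) (z : ∀ n, C.X n) : C.gD (i + 1) (C.gS i z) n = z n := by
  simp only [gS, gD]
  rw [if_pos (by omega), if_pos h, C.d_s_succ n i h]

theorem gT_gS (j n : ℕ) (h : j < n) (z : ∀ n, C.X n) :
    C.gT (C.gS j z) (n + 1) = C.gS (j + 1) (C.gT z) (n + 1) := by
  simp only [gS, gT]
  rw [if_pos h.le, if_pos (by omega), C.s_t_succ n j h]

theorem gT_gS_last (n : ℕ) (z : ∀ n, C.X n) :
    C.gT (C.gS n z) (n + 1) = C.gE z (n + 1) := by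
  simp only [gS, gT, gE]
  rw [if_pos le_rfl]
  rfl

theorem gT_gE (z : ∀ n, C.X n) : C.gT (C.gE z) = C.gS 0 (C.gT z) := by
  funext n
  rcases n with _ | n
  · simp [gS, gT, gE]
  · simp only [gS, gT, gE]
    rw [if_pos (Nat.zero_le n), C.t_sExt]

theorem gE_gE (z : ∀ n, C.X n) : C.gE (C.gE z) = C.gS 0 (C.gE z) := by
  funext n
  rcases n with _ | _ | n
  · rfl
  · simp [gS, gE]
  · simp only [gS, gE]
    rw [if_pos (Nat.zero_le _), C.sExt_sExt]

theorem gE_gS (i : ℕ) (z : ∀ n, C.X n) : C.gE (C.gS i z) = C.gS (i + 1) (C.gE z) := by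
  funext n
  rcases n with _ | _ | n
  · rfl
  · simp [gS, gE]
  · simp only [gS, gE]
    by_cases h : i ≤ n
    · rw [if_pos h, if_pos (by omega), C.sExt_s n i h]
    · rw [if_neg h, if_neg (by omega), map_zero]

/-- The composite of the degeneracies that insert units at the places of the letters `false` of a
word, whose letters are numbered from `m`. -/
def act : ℕ → List Bool → (∀ n, C.X n) → (∀ n, C.X n)
  | _, [], z => z
  | m, true :: w, z => act (m + 1) w z
  | m, false :: w, z => act (m + 1) w (C.gS m z)

theorem act_append (m : ℕ) (u v : List Bool) (z : ∀ n, C.X n) :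
    C.act m (u ++ v) z = C.act (m + u.length) v (C.act m u z) := by
  induction u generalizing m z with
  | nil => rfl
  | cons a u ih =>
    rw [List.length_cons, show m + (u.length + 1) = m + 1 + u.length by omega]
    cases a <;> exact ih _ _

/-- Cancellations such as `gD_gS_self` hold only from some degree on; this carries them through the
letters that follow. A degeneracy `s_m` reads only degrees from `m` on and is zero elsewhere. -/
theorem act_congr (m l : ℕ) (hl : l ≤ m) (w : List Bool) {z z' : ∀ n, C.X n}
    (h : ∀ n, l ≤ n → z n = z' n) : ∀ n, l ≤ n → C.act m w z n = C.act m w z' n := by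
  induction w generalizing m z z' with
  | nil => exact h
  | cons a w ih =>
    cases a
    · refine ih (m + 1) (by omega) fun n hn => ?_
      rcases n with _ | n
      · rfl
      · simp only [gS]
        by_cases hm : m ≤ n
        · rw [if_pos hm, if_pos hm, h n (by omega)]
        · rw [if_neg hm, if_neg hm]
    · exact ih (m + 1) (by omega) h

/-- A face below all letters passes every degeneracy and lowers its index by one, which renumbers
the word. -/
theorem gD_act_low (i j : ℕ) (h : i ≤ j) (w : List Bool) (z : ∀ n, C.X n) :
    C.gD i (C.act (j + 1) w z) = C.act j w (C.gD i z) := by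
  induction w generalizing j z with
  | nil => rfl
  | cons a w ih =>
    cases a
    · change C.gD i (C.act (j + 2) w (C.gS (j + 1) z)) = C.act (j + 1) w (C.gS j (C.gD i z))
      rw [ih (j + 1) (by omega), C.gD_gS_lt i j h]
    · exact ih (j + 1) (by omega) z

/-- A face beyond all letters loses one from its index at each degeneracy, that is at each `false`.
The bound makes `gD_gS_gt` applicable at every letter. -/
theorem gD_act_high (m i : ℕ) (u : List Bool) (h : m + u.count true < i) (z : ∀ n, C.X n) :
    C.gD (i + u.count false) (C.act m u z) = C.act m u (C.gD i z) := by
  induction u generalizing m i z with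
  | nil => rfl
  | cons a u ih =>
    cases a
    · simp only [List.count_cons_of_ne (show false ≠ true by decide), List.count_cons_self] at h ⊢
      change C.gD _ (C.act (m + 1) u (C.gS m z)) = C.act (m + 1) u (C.gS m (C.gD i z))
      rw [show i + (u.count false + 1) = i + 1 + u.count false by omega, ih (m + 1) (i + 1)
        (by omega), C.gD_gS_gt i m (by omega)]
    · simp only [List.count_cons_of_ne (show true ≠ false by decide), List.count_cons_self] at h ⊢
      exact ih (m + 1) i (by omega) z

/-- With at least one `false` among the two letters, `d_{m+1}` cancels `s_m` or `s_{m+1}`; a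
degeneracy remains exactly when both letters are `false`. -/
theorem gD_act_merge (u v : List Bool) (a b : Bool) (hab : (a && b) = false) (z : ∀ n, C.X n)
    (n : ℕ) (hn : u.length + v.length + 1 = n) :
    C.gD (u.length + 1) (C.act 0 (u ++ a :: b :: v) z) n = C.act 0 (u ++ (a || b) :: v) z n := by
  rw [act_append, act_append, Nat.zero_add]
  generalize C.act 0 u z = z
  generalize u.length = m at *
  cases a <;> cases b
  · change C.gD (m + 1) (C.act (m + 2) v (C.gS (m + 1) (C.gS m z))) n = C.act (m + 1) v (C.gS m z) n
    rw [C.gD_act_low _ _ le_rfl]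
    exact C.act_congr _ (m + 1) le_rfl v (fun l hl => C.gD_gS_self _ _ hl _) n (by omega)
  · change C.gD (m + 1) (C.act (m + 2) v (C.gS m z)) n = C.act (m + 1) v z n
    rw [C.gD_act_low _ _ le_rfl]
    exact C.act_congr _ (m + 1) le_rfl v (fun l hl => C.gD_gS_succ _ _ (by omega) _) n (by omega)
  · change C.gD (m + 1) (C.act (m + 2) v (C.gS (m + 1) z)) n = C.act (m + 1) v z n
    rw [C.gD_act_low _ _ le_rfl]
    exact C.act_congr _ (m + 1) le_rfl v (fun l hl => C.gD_gS_self _ _ hl _) n (by omega)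
  · exact absurd hab (by decide)

/-- Between two letters `true` there is no degeneracy to cancel. The face passes `v` from below and
`u` from above, and reaches the coefficient with its index reduced by the number of `false` in `u`.
-/
theorem gD_act_true_true (u v : List Bool) (z : ∀ n, C.X n) :
    C.gD (u.length + 1) (C.act 0 (u ++ true :: true :: v) z) =
      C.act 0 (u ++ true :: v) (C.gD (u.count true + 1) z) := by
  rw [act_append, act_append, Nat.zero_add]
  change C.gD _ (C.act (u.length + 2) v _) = C.act (u.length + 1) v _
  rw [C.gD_act_low _ _ le_rfl, ← C.gD_act_high 0 _ u (by omega), add_right_comm,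
    count_true_add_count_false]

theorem gD_act_first_true (v : List Bool) (z : ∀ n, C.X n) :
    C.gD 0 (C.act 0 (true :: v) z) = C.act 0 v (C.gD 0 z) :=
  C.gD_act_low 0 0 le_rfl v z

theorem gD_act_first_false (v : List Bool) (z : ∀ n, C.X n) :
    C.gD 0 (C.act 0 (false :: v) z) = C.act 0 v z := by
  refine (C.gD_act_low 0 0 le_rfl v _).trans (congrArg _ ?_)
  funext n
  exact C.gD_gS_self 0 n (Nat.zero_le n) z

theorem gD_act_last_true (u : List Bool) (z : ∀ n, C.X n) :
    C.gD (u.length + 1) (C.act 0 (u ++ [true]) z) = C.act 0 u (C.gD (u.count true + 1) z) := by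
  rw [act_append, Nat.zero_add]
  change C.gD _ (C.act 0 u z) = _
  rw [← C.gD_act_high 0 _ u (by omega), add_right_comm, count_true_add_count_false]

theorem gD_act_last_false (u : List Bool) (z : ∀ n, C.X n) (n : ℕ) (hn : u.length = n) :
    C.gD (u.length + 1) (C.act 0 (u ++ [false]) z) n = C.act 0 u z n := by
  rw [act_append, Nat.zero_add]
  exact C.gD_gS_succ _ _ (by omega) _

theorem gE_act (m : ℕ) (w : List Bool) (z : ∀ n, C.X n) :
    C.gE (C.act m w z) = C.act (m + 1) w (C.gE z) := by
  induction w generalizing m z with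
  | nil => rfl
  | cons a w ih =>
    cases a
    · change C.gE (C.act (m + 1) w (C.gS m z)) = C.act (m + 2) w (C.gS (m + 1) (C.gE z))
      rw [ih, gE_gS]
    · exact ih (m + 1) z

/-- The degree condition excludes the top degeneracy `s_{n-1}` into degree `n`, which `t` turns into
`s_{-1}` (`gT_gS_last`). -/
theorem gT_act (m : ℕ) (w : List Bool) (z : ∀ n, C.X n) (n : ℕ) (hn : m + w.length < n) :
    C.gT (C.act m w z) n = C.act (m + 1) w (C.gT z) n := by
  induction w generalizing m z with
  | nil => rfl
  | cons a w ih =>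
    rw [List.length_cons] at hn
    cases a
    · refine (ih (m + 1) (C.gS m z) (by omega)).trans ?_
      refine C.act_congr (m + 2) (m + 2) le_rfl w (fun l hl => ?_) n (by omega)
      obtain ⟨l, rfl⟩ : ∃ i, l = i + 1 := ⟨l - 1, by omega⟩
      exact C.gT_gS m l (by omega) z
    · exact ih (m + 1) z (by omega)

/-- `T^r` on graded elements. -/
def gTpow (r : ℕ) (z : ∀ n, C.X n) : ∀ n, C.X n := fun n => (C.t n ^ r) (z n)

theorem gTpow_zero (z : ∀ n, C.X n) : C.gTpow 0 z = z := by
  funext n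
  simp only [gTpow, pow_zero, Module.End.one_apply]

theorem gTpow_succ (r : ℕ) (z : ∀ n, C.X n) : C.gTpow (r + 1) z = C.gT (C.gTpow r z) := by
  funext n
  simp only [gTpow, gT, pow_succ', Module.End.mul_apply]

theorem gTpow_succ_apply (r n : ℕ) (z : ∀ n, C.X n) :
    C.gTpow (r + 1) z n = C.t n (C.gTpow r z n) := by
  rw [gTpow_succ]; rfl

/-- The effect on the coefficient slot of a rotation that ends in the letter `a`. -/
def gHead : Bool → (∀ n, C.X n) → (∀ n, C.X n)
  | true, z => z
  | false, z => C.gE z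

theorem gT_gHead (a : Bool) (z : ∀ n, C.X n) : C.gT (C.gHead a z) = C.act 0 [a] (C.gT z) := by
  cases a
  · exact C.gT_gE z
  · rfl

theorem gE_gHead (a : Bool) (z : ∀ n, C.X n) : C.gE (C.gHead a z) = C.act 0 [a] (C.gE z) := by
  cases a
  · exact C.gE_gE z
  · rfl

/-- The letters are the edges of a path, closed to a cycle by one more edge that is nondegenerate in
both factors. Rotating by `|u| + 1` cuts the cycle at `a`: the old closing edge becomes the `true`
between `u` and `v`, and `a` becomes the closing edge. If `a` is `false`, the new closing edge is
degenerate, which the `s_{-1}` in `gHead` records. Every `true` that is passed rotates the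
coefficient once. -/
theorem gTpow_act (a : Bool) (u v : List Bool) (z : ∀ n, C.X n) (n : ℕ)
    (hn : v.length + u.length + 1 = n) :
    C.gTpow (u.length + 1) (C.act 0 (v ++ a :: u) z) n =
      C.act 0 (u ++ true :: v) (C.gHead a (C.gTpow ((a :: u).count true) z)) n := by
  induction u generalizing a v with
  | nil =>
    rw [List.length_nil, gTpow_succ_apply]
    change C.t n (C.act 0 (v ++ [a]) z n) = C.act 1 v _ n
    rw [act_append]
    cases a
    · have hl : C.gT (C.gS v.length (C.act 0 v z)) (v.length + 1) =
        C.gE (C.act 0 v z) (v.length + 1) := C.gT_gS_last _ _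
      rw [gE_act] at hl
      simp only [List.length_nil, Nat.add_zero] at hn
      subst hn
      rw [Nat.zero_add, List.count_cons_of_ne (by decide), List.count_nil, gTpow_zero]
      exact hl
    · refine (C.gT_act 0 v z n (by simp only [List.length_nil] at hn; omega)).trans ?_
      rw [List.count_cons_self, List.count_nil, gTpow_succ, gTpow_zero]
      rfl
  | cons b u ih =>
    rw [List.length_cons] at hn ⊢
    -- The first `|u| + 1` rotations cut at `b`. The last one takes the final letter `a` to the
    -- closing edge and brings `b` back to the front.
    have h1 : v ++ a :: b :: u = (v ++ [a]) ++ b :: u := by simp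
    rw [gTpow_succ_apply, h1, ih b (v ++ [a]) (by simp; omega)]
    have h2 : u ++ true :: (v ++ [a]) = (u ++ true :: v) ++ [a] := by simp
    rw [h2, act_append]
    generalize hz : C.gHead b (C.gTpow ((b :: u).count true) z) = z'
    have hlen : (u ++ true :: v).length = n - 1 := by simp; omega
    cases a
    · have hl : C.gT (C.gS (n - 1) (C.act 0 (u ++ true :: v) z')) (n - 1 + 1) =
        C.gE (C.act 0 (u ++ true :: v) z') (n - 1 + 1) := C.gT_gS_last _ _
      rw [show n - 1 + 1 = n by omega, gE_act, ← hz, gE_gHead, ← hlen] at hl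
      rw [← hz]
      rw [Nat.zero_add]
      refine hl.trans ?_
      rw [List.count_cons_of_ne (show false ≠ true by decide)]
      cases b <;> rfl
    · refine (C.gT_act 0 (u ++ true :: v) z' n (by omega)).trans ?_
      rw [← hz, gT_gHead, ← gTpow_succ, List.count_cons_self]
      cases b <;> rfl

/-- One term of `B` on a word. The letter at the cut, which `gTpow_act` removes, is restored by
`s_{-1}`; so the word is cut between two letters and the parts are exchanged around a new `true`. -/
theorem gE_gTpow_act (u v : List Bool) (z : ∀ n, C.X n) (n : ℕ) (hn : v.length + u.length = n) :
    C.gE (C.gTpow u.length (C.act 0 (v ++ u) z)) (n + 1) =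
      C.act 0 (u ++ true :: v) (C.gE (C.gTpow (u.count true) z)) (n + 1) := by
  rcases u with _ | ⟨a, u⟩
  · simp only [List.length_nil, List.count_nil, gTpow_zero, List.append_nil, List.nil_append]
    exact congrFun (C.gE_act 0 v z) (n + 1)
  · rw [List.length_cons] at hn ⊢
    refine (congrArg (C.sExt n) (C.gTpow_act a u v z n (by omega))).trans ?_
    change C.gE (C.act 0 (u ++ true :: v) _) (n + 1) = _
    rw [gE_act, gE_gHead]
    cases a <;> rfl

/-- Degree count that makes words with the wrong number of letters drop out, so that sums can run
over all words of a length. -/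
theorem act_single_eq_zero (w : List Bool) (p : ℕ) (z : ∀ n, C.X n) (hz : ∀ n, n ≠ p → z n = 0)
    (m n : ℕ) (h : n ≠ p + w.count false) : C.act m w z n = 0 := by
  induction w generalizing m p z with
  | nil => exact hz n h
  | cons a w ih =>
    cases a
    · refine ih (p + 1) (C.gS m z) (fun l hl => ?_) (m + 1) (by
        rw [List.count_cons_self] at h; omega)
      rcases l with _ | l
      · rfl
      · simp only [gS]
        rw [hz l (by omega), map_zero, ite_self]
    · exact ih p z hz (m + 1) (by rwa [List.count_cons_of_ne (by decide)] at h)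

end CyclicModule
end HopfCyclic

namespace HopfCyclic

/-! ### Words in two letters -/

/-- The sign of the shuffle given by a word: `true` are the places of the first factor. -/
def wordSign : List Bool → ℤ
  | [] => 1
  | true :: w => wordSign w
  | false :: w => (-1) ^ w.count true * wordSign w

/-- The sign counts the pairs of a `false` before a `true`; the last factor accounts for the pairs
across the junction. -/
theorem wordSign_append (u v : List Bool) :
    wordSign (u ++ v) = wordSign u * wordSign v * (-1) ^ (u.count false * v.count true) := by
  induction u with
  | nil => simp [wordSign]
  | cons a u ih =>
    cases a
    · simp only [List.cons_append, wordSign, ih, List.count_append, List.count_cons_self]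
      ring
    · simp only [List.cons_append, wordSign, ih, List.count_cons_of_ne (show true ≠ false by decide)]

/-- The `i`-th letter `true` of a word comes before the `j`-th letter `false`. -/
def precedes : ℕ → ℕ → List Bool → Bool
  | _, _, [] => false
  | 0, _, true :: _ => true
  | i + 1, j, true :: w => precedes i j w
  | _, 0, false :: _ => false
  | i, j + 1, false :: w => precedes i j w

theorem precedes_true_cons_zero (j : ℕ) (w : List Bool) : precedes 0 j (true :: w) = true := by
  simp [precedes]

theorem precedes_true_cons_succ (i j : ℕ) (w : List Bool) :
    precedes (i + 1) j (true :: w) = precedes i j w := by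
  simp [precedes]

theorem precedes_false_cons_zero (i : ℕ) (w : List Bool) : precedes i 0 (false :: w) = false := by
  simp [precedes]

theorem precedes_false_cons_succ (i j : ℕ) (w : List Bool) :
    precedes i (j + 1) (false :: w) = precedes i j w := by
  simp [precedes]

/-- Whichever of the two letters comes first decides the comparison, so it suffices that one of them
lies in `u`. -/
theorem precedes_append_left (i j : ℕ) (u v : List Bool)
    (h : i < u.count true ∨ j < u.count false) :
    precedes i j (u ++ v) = precedes i j u := by
  induction u generalizing i j with
  | nil => simp at h
  | cons a u ih =>
    cases a
    · rw [List.count_cons_self, List.count_cons_of_ne (by decide)] at h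
      rcases j with _ | j
      · rw [List.cons_append, precedes_false_cons_zero, precedes_false_cons_zero]
      · rw [List.cons_append, precedes_false_cons_succ, precedes_false_cons_succ,
          ih _ _ (by omega)]
    · rw [List.count_cons_self, List.count_cons_of_ne (by decide)] at h
      rcases i with _ | i
      · rw [List.cons_append, precedes_true_cons_zero, precedes_true_cons_zero]
      · rw [List.cons_append, precedes_true_cons_succ, precedes_true_cons_succ,
          ih _ _ (by omega)]

/-! ### Sums over words, cut words and words with a marked letter -/

section Sums

variable {A : Type*} [AddCommGroup A]

/-- The sum over the words of length `n`. -/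
def wsum : ℕ → (List Bool → A) → A
  | 0, f => f []
  | n + 1, f => wsum n (fun w => f (true :: w)) + wsum n (fun w => f (false :: w))

theorem wsum_congr (n : ℕ) {f g : List Bool → A} (h : ∀ w, w.length = n → f w = g w) :
    wsum n f = wsum n g := by
  induction n generalizing f g with
  | zero => exact h [] rfl
  | succ n ih =>
    rw [wsum, wsum, ih fun w hw => h (true :: w) (by simp [hw]),
      ih fun w hw => h (false :: w) (by simp [hw])]

theorem wsum_add (n : ℕ) (f g : List Bool → A) :
    wsum n (fun w => f w + g w) = wsum n f + wsum n g := by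
  induction n generalizing f g with
  | zero => rfl
  | succ n ih => rw [wsum, wsum, wsum, ih, ih]; abel

theorem wsum_zero (n : ℕ) : wsum n (fun _ => (0 : A)) = 0 := by
  induction n with
  | zero => rfl
  | succ n ih => rw [wsum, ih, add_zero]

theorem map_wsum {A' : Type*} [AddCommGroup A'] (φ : A →+ A') (n : ℕ) (f : List Bool → A) :
    φ (wsum n f) = wsum n (fun w => φ (f w)) := by
  induction n generalizing f with
  | zero => rfl
  | succ n ih => rw [wsum, wsum, map_add, ih, ih]

theorem wsum_smul (c : ℤ) (n : ℕ) (f : List Bool → A) :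
    wsum n (fun w => c • f w) = c • wsum n f :=
  (map_wsum (zsmulAddGroupHom (α := A) c) n f).symm

theorem wsum_sum {ι : Type*} (s : Finset ι) (n : ℕ) (f : ι → List Bool → A) :
    wsum n (fun w => ∑ i ∈ s, f i w) = ∑ i ∈ s, wsum n (f i) := by
  classical
  induction s using Finset.induction_on with
  | empty => simp only [Finset.sum_empty, wsum_zero]
  | insert a s ha ih => simp only [Finset.sum_insert ha, wsum_add, ih]

theorem wsum_comm (m n : ℕ) (f : List Bool → List Bool → A) :
    wsum m (fun u => wsum n (f u)) = wsum n (fun v => wsum m (fun u => f u v)) := by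
  induction m generalizing f with
  | zero => rfl
  | succ m ih => simp only [wsum, ih, wsum_add]

theorem wsum_last (n : ℕ) (f : List Bool → A) :
    wsum (n + 1) f = wsum n (fun w => f (w ++ [true])) + wsum n (fun w => f (w ++ [false])) := by
  induction n generalizing f with
  | zero => rfl
  | succ n ih =>
    rw [wsum, ih, ih, wsum, wsum]
    simp only [List.cons_append]
    abel

/-- The sum over the pairs of words whose lengths add up to `n`. -/
def csum (n : ℕ) (f : List Bool → List Bool → A) : A :=
  ∑ p ∈ Finset.HasAntidiagonal.antidiagonal n, wsum p.1 (fun u => wsum p.2 (f u))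

theorem csum_congr (n : ℕ) {f g : List Bool → List Bool → A}
    (h : ∀ u v, u.length + v.length = n → f u v = g u v) : csum n f = csum n g := by
  refine Finset.sum_congr rfl fun p hp => wsum_congr _ fun u hu => wsum_congr _ fun v hv => h u v ?_
  rw [hu, hv]
  exact Finset.HasAntidiagonal.mem_antidiagonal.1 hp

theorem csum_add (n : ℕ) (f g : List Bool → List Bool → A) :
    csum n (fun u v => f u v + g u v) = csum n f + csum n g := by
  simp only [csum, wsum_add, Finset.sum_add_distrib]

theorem map_csum {A' : Type*} [AddCommGroup A'] (φ : A →+ A') (n : ℕ)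
    (f : List Bool → List Bool → A) : φ (csum n f) = csum n (fun u v => φ (f u v)) := by
  simp only [csum, map_sum, map_wsum]

theorem csum_smul (c : ℤ) (n : ℕ) (f : List Bool → List Bool → A) :
    csum n (fun u v => c • f u v) = c • csum n f :=
  (map_csum (zsmulAddGroupHom (α := A) c) n f).symm

theorem csum_sum {ι : Type*} (s : Finset ι) (n : ℕ) (f : ι → List Bool → List Bool → A) :
    csum n (fun u v => ∑ i ∈ s, f i u v) = ∑ i ∈ s, csum n (f i) := by
  simp only [csum, wsum_sum]
  exact Finset.sum_comm

theorem csum_swap (n : ℕ) (f : List Bool → List Bool → A) :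
    csum n (fun u v => f v u) = csum n f := by
  rw [csum, csum, ← Finset.Nat.sum_antidiagonal_swap]
  refine Finset.sum_congr rfl fun p _ => ?_
  exact wsum_comm _ _ _

theorem csum_zero (f : List Bool → List Bool → A) : csum 0 f = f [] [] := by
  simp [csum, wsum]

theorem csum_succ (n : ℕ) (f : List Bool → List Bool → A) :
    csum (n + 1) f = wsum (n + 1) (f []) +
      (csum n (fun u v => f (true :: u) v) + csum n (fun u v => f (false :: u) v)) := by
  rw [csum, Finset.Nat.sum_antidiagonal_succ, csum, csum, ← Finset.sum_add_distrib]
  rfl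

/-- A place between neighbouring letters writes the word as `u`, two letters, `v`, with `m = |u|`.
The four terms are the choices of the two letters, the equal pairs kept apart from the mixed ones
because faces treat them differently. -/
theorem sum_wsum_split (n : ℕ) (f : ℕ → List Bool → A) :
    ∑ m ∈ Finset.range (n + 1), wsum (n + 2) (f m) =
      csum n (fun u v => (f u.length (u ++ true :: true :: v) +
        f u.length (u ++ false :: false :: v)) + (f u.length (u ++ true :: false :: v) +
        f u.length (u ++ false :: true :: v))) := by
  induction n generalizing f with
  | zero =>
    simp only [Nat.zero_add, Finset.sum_range_one, csum_zero, wsum, List.length_nil, List.nil_append]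
    abel
  | succ n ih =>
    rw [Finset.sum_range_succ', csum_succ]
    have h : ∀ m, wsum (n + 1 + 2) (f (m + 1)) =
        wsum (n + 2) (fun w => f (m + 1) (true :: w)) +
          wsum (n + 2) (fun w => f (m + 1) (false :: w)) := fun m => rfl
    simp only [h, Finset.sum_add_distrib]
    rw [ih (fun m w => f (m + 1) (true :: w)), ih (fun m w => f (m + 1) (false :: w)), add_comm]
    congr 1
    change (wsum (n + 1) _ + wsum (n + 1) _) + (wsum (n + 1) _ + wsum (n + 1) _) = _
    simp only [wsum_add, List.length_nil, List.nil_append]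
    abel

/-- A word with one of its letters `a` marked is the pair of words before and after the mark, and
the number of the marked letter is the number of `a` before it. -/
theorem wsum_marked (a : Bool) (n : ℕ) (G : ℕ → List Bool → A) :
    wsum (n + 1) (fun w => ∑ c ∈ Finset.range (w.count a), G c w) =
      csum n (fun u v => G (u.count a) (u ++ a :: v)) := by
  induction n generalizing G with
  | zero =>
    rw [csum_zero]
    cases a <;> simp [wsum]
  | succ n ih =>
    rw [csum_succ, wsum]
    cases a
    · simp only [List.count_cons_self, List.count_cons_of_ne (show true ≠ false by decide),
        Finset.sum_range_succ', wsum_add]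
      rw [ih (fun c w => G c (true :: w)), ih (fun c w => G (c + 1) (false :: w))]
      simp only [List.count_nil, List.nil_append, List.cons_append]
      abel
    · simp only [List.count_cons_self, List.count_cons_of_ne (show false ≠ true by decide),
        Finset.sum_range_succ', wsum_add]
      rw [ih (fun c w => G c (false :: w)), ih (fun c w => G (c + 1) (true :: w))]
      simp only [List.count_nil, List.nil_append, List.cons_append]
      abel

/-- A word with one of the `n + 1` places where it can be cut is a pair of words. -/
theorem wsum_cut (n : ℕ) (F : List Bool → List Bool → A) :
    wsum n (fun w => ∑ r ∈ Finset.range (n + 1), F (w.take r) (w.drop r)) = csum n F := by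
  induction n generalizing F with
  | zero => simp [wsum, csum_zero]
  | succ n ih =>
    rw [csum_succ, ← ih, ← ih, wsum, wsum]
    simp only [Finset.sum_range_succ' _ (n + 1), wsum_add, List.take_succ_cons,
      List.drop_succ_cons, List.take_zero, List.drop_zero]
    abel

/-- The sum over the pairs of words that are left when one letter of a word of length `n` is
removed. -/
def msum : ℕ → (List Bool → List Bool → A) → A
  | 0, _ => 0
  | n + 1, f => csum n f

theorem msum_congr (n : ℕ) {f g : List Bool → List Bool → A}
    (h : ∀ u v, u.length + v.length + 1 = n → f u v = g u v) : msum n f = msum n g := by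
  rcases n with _ | n
  · rfl
  · exact csum_congr n fun u v huv => h u v (by omega)

theorem msum_add (n : ℕ) (f g : List Bool → List Bool → A) :
    msum n (fun u v => f u v + g u v) = msum n f + msum n g := by
  rcases n with _ | n
  · exact (add_zero 0).symm
  · exact csum_add n f g

theorem msum_eq_zero (n : ℕ) {f : List Bool → List Bool → A}
    (h : ∀ u v, u.length + v.length + 1 = n → f u v = 0) : msum n f = 0 := by
  rcases n with _ | n
  · rfl
  · refine (csum_congr n (g := fun _ _ => 0) fun u v huv => h u v (by omega)).trans ?_
    simp only [csum, wsum_zero, Finset.sum_const_zero]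

theorem sum_wsum_split' (n : ℕ) (f : ℕ → List Bool → A) :
    ∑ m ∈ Finset.range n, wsum (n + 1) (f m) =
      msum n (fun u v => (f u.length (u ++ true :: true :: v) +
        f u.length (u ++ false :: false :: v)) + (f u.length (u ++ true :: false :: v) +
        f u.length (u ++ false :: true :: v))) := by
  rcases n with _ | n
  · rfl
  · exact sum_wsum_split n f

theorem wsum_marked' (a : Bool) (n : ℕ) (G : ℕ → List Bool → A) :
    wsum n (fun w => ∑ c ∈ Finset.range (w.count a), G c w) =
      msum n (fun u v => G (u.count a) (u ++ a :: v)) := by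
  rcases n with _ | n
  · simp [wsum, msum]
  · exact wsum_marked a n G

/-- The faces that touch one of the two factors, collected by their numbers. -/
theorem wsum_faces (a : Bool) (n P : ℕ) (G : ℕ → List Bool → A)
    (hG : ∀ c w, w.length = n → w.count a + 1 ≠ P → G c w = 0) :
    wsum n (G 0) + wsum n (fun u => G (u.count a + 1) u) +
      msum n (fun u v => G (u.count a + 1) (u ++ a :: v)) =
        ∑ c ∈ Finset.range (P + 1), wsum n (G c) := by
  rw [← wsum_marked' a n (fun c w => G (c + 1) w), ← wsum_add, ← wsum_add, ← wsum_sum]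
  -- If `w` has `P - 1` letters `a`, the three sums supply the faces `0`, then `P`, then `1, …, P -
  -- 1`; for every other word all terms vanish by `hG`.
  refine wsum_congr n fun w hw => ?_
  by_cases h : w.count a + 1 = P
  · subst h
    rw [Finset.sum_range_succ' _ (w.count a + 1), Finset.sum_range_succ]
    abel
  · rw [hG _ _ hw h, hG _ _ hw h, Finset.sum_eq_zero fun c _ => hG _ _ hw h,
      Finset.sum_eq_zero fun c _ => hG _ _ hw h, add_zero, add_zero]

end Sums

/-- The word with the two letters exchanged. -/
def wflip (w : List Bool) : List Bool := w.map not

theorem wflip_append (u v : List Bool) : wflip (u ++ v) = wflip u ++ wflip v := List.map_append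

theorem wflip_cons (a : Bool) (v : List Bool) : wflip (a :: v) = (!a) :: wflip v := rfl

theorem length_wflip (w : List Bool) : (wflip w).length = w.length := List.length_map _

theorem count_true_wflip (w : List Bool) : (wflip w).count true = w.count false := by
  induction w with
  | nil => rfl
  | cons a w ih => cases a <;> simp [wflip_cons, ih]

theorem count_false_wflip (w : List Bool) : (wflip w).count false = w.count true := by
  induction w with
  | nil => rfl
  | cons a w ih => cases a <;> simp [wflip_cons, ih]

end HopfCyclic

/-! ### Faces of a shuffle and the boundary of a weighted sum of shuffles -/

namespace HopfCyclic
namespace CyclicModule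

variable {k : Type w} [CommRing k] (C C' : CyclicModule.{u, w} k)

/-- The class of the product of two elements of the same degree. -/
noncomputable def pr (n : ℕ) : C.X n →ₗ[k] C'.X n →ₗ[k] (C.diag C').normalized.X n :=
  (TensorProduct.mk k (C.X n) (C'.X n)).compr₂ ((C.diag C').cls n)

/-- The class of the product of two graded elements, along two words. -/
noncomputable def ev (n : ℕ) (w w' : List Bool) (z : ∀ n, C.X n) (z' : ∀ n, C'.X n) :
    (C.diag C').normalized.X n :=
  C.pr C' n (C.act 0 w z n) (C'.act 0 w' z' n)

/-- The term of the shuffle product given by a word. -/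
noncomputable def shev (n : ℕ) (w : List Bool) (z : ∀ n, C.X n) (z' : ∀ n, C'.X n) :
    (C.diag C').normalized.X n := C.ev C' n w (wflip w) z z'

theorem shev_eq_zero_left (n : ℕ) (w : List Bool) (hw : w.length = n) (p : ℕ) (z : ∀ n, C.X n)
    (z' : ∀ n, C'.X n) (hz : ∀ n, n ≠ p → z n = 0) (h : w.count true ≠ p) :
    C.shev C' n w z z' = 0 := by
  have := count_true_add_count_false w
  rw [shev, ev, C.act_single_eq_zero w p z hz 0 n (by omega), map_zero, LinearMap.zero_apply]

theorem shev_eq_zero_right (n : ℕ) (w : List Bool) (hw : w.length = n) (q : ℕ) (z : ∀ n, C.X n)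
    (z' : ∀ n, C'.X n) (hz : ∀ n, n ≠ q → z' n = 0) (h : w.count false ≠ q) :
    C.shev C' n w z z' = 0 := by
  have := count_true_add_count_false w
  rw [shev, ev, C'.act_single_eq_zero (wflip w) q z' hz 0 n (by rw [count_false_wflip]; omega),
    map_zero]

/-- The face `d_m` of a product of graded elements. -/
noncomputable def evFace (n m : ℕ) (w : List Bool) (z : ∀ n, C.X n) (z' : ∀ n, C'.X n) :
    (C.diag C').normalized.X n :=
  C.pr C' n (C.gD m (C.act 0 w z) n) (C'.gD m (C'.act 0 (wflip w) z') n)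

theorem b_pr (n : ℕ) (x : C.X (n + 1)) (y : C'.X (n + 1)) :
    (C.diag C').normalized.b n (C.pr C' (n + 1) x y) =
      ∑ m ∈ Finset.range (n + 2), (-1 : ℤ) ^ m • C.pr C' n (C.d n m x) (C'.d n m y) :=
  (congrArg ((C.diag C').cls n) ((C.diag C').b_apply n _)).trans
    ((map_sum _ _ _).trans (Finset.sum_congr rfl fun _ _ => map_zsmul _ _ _))

theorem b_shev (n : ℕ) (w : List Bool) (z : ∀ n, C.X n) (z' : ∀ n, C'.X n) :
    (C.diag C').normalized.b n (C.shev C' (n + 1) w z z') =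
      ∑ m ∈ Finset.range (n + 2), (-1 : ℤ) ^ m • C.evFace C' n m w z z' := by
  refine (b_pr C C' n _ _).trans (Finset.sum_congr rfl fun m hm => ?_)
  have hm' : m ≤ n + 1 := by have := Finset.mem_range.1 hm; omega
  simp only [evFace, gD]
  rw [if_pos hm', if_pos hm']

theorem evFace_first_true (n : ℕ) (v : List Bool) (z : ∀ n, C.X n) (z' : ∀ n, C'.X n) :
    C.evFace C' n 0 (true :: v) z z' = C.shev C' n v (C.gD 0 z) z' := by
  rw [evFace, gD_act_first_true, wflip_cons, Bool.not_true, gD_act_first_false]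
  rfl

theorem evFace_first_false (n : ℕ) (v : List Bool) (z : ∀ n, C.X n) (z' : ∀ n, C'.X n) :
    C.evFace C' n 0 (false :: v) z z' = C.shev C' n v z (C'.gD 0 z') := by
  rw [evFace, gD_act_first_false, wflip_cons, Bool.not_false, gD_act_first_true]
  rfl

theorem evFace_last_true (n : ℕ) (u : List Bool) (hu : u.length = n) (z : ∀ n, C.X n)
    (z' : ∀ n, C'.X n) : C.evFace C' n (n + 1) (u ++ [true]) z z' =
      C.shev C' n u (C.gD (u.count true + 1) z) z' := by
  subst hu
  have h := C'.gD_act_last_false (wflip u) z' u.length (length_wflip u)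
  rw [length_wflip] at h
  rw [evFace, gD_act_last_true, wflip_append]
  exact congrArg (fun y => C.pr C' _ _ y) h

theorem evFace_last_false (n : ℕ) (u : List Bool) (hu : u.length = n) (z : ∀ n, C.X n)
    (z' : ∀ n, C'.X n) : C.evFace C' n (n + 1) (u ++ [false]) z z' =
      C.shev C' n u z (C'.gD (u.count false + 1) z') := by
  subst hu
  have h := C'.gD_act_last_true (wflip u) z'
  rw [length_wflip, count_true_wflip] at h
  rw [evFace, gD_act_last_false C u z _ rfl, wflip_append]
  exact congrArg (fun y => C.pr C' _ _ (y u.length)) h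

/-- Between equal letters the face is a genuine face of one factor; in the other factor both letters
are degeneracies and it cancels one of them. -/
theorem evFace_true_true (n : ℕ) (u v : List Bool) (h : u.length + v.length + 1 = n)
    (z : ∀ n, C.X n) (z' : ∀ n, C'.X n) :
    C.evFace C' n (u.length + 1) (u ++ true :: true :: v) z z' =
      C.shev C' n (u ++ true :: v) (C.gD (u.count true + 1) z) z' := by
  have h1 := C'.gD_act_merge (wflip u) (wflip v) false false rfl z' n
    (by rw [length_wflip, length_wflip]; exact h)
  rw [length_wflip] at h1
  rw [evFace, gD_act_true_true, shev, ev, wflip_append, wflip_append]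
  exact congrArg (fun y => C.pr C' _ _ y) h1

theorem evFace_false_false (n : ℕ) (u v : List Bool) (h : u.length + v.length + 1 = n)
    (z : ∀ n, C.X n) (z' : ∀ n, C'.X n) :
    C.evFace C' n (u.length + 1) (u ++ false :: false :: v) z z' =
      C.shev C' n (u ++ false :: v) z (C'.gD (u.count false + 1) z') := by
  have h1 := C'.gD_act_true_true (wflip u) (wflip v) z'
  rw [length_wflip, count_true_wflip] at h1
  rw [evFace, gD_act_merge C u v false false rfl z n h, shev, ev, wflip_append, wflip_append]
  exact congrArg (fun y => C.pr C' _ _ (y n)) h1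

/-- Between different letters each factor has one degeneracy, which the face cancels. The result
does not see the order of the two letters. It has a `true` for both factors at that place, so it is
no longer a shuffle and needs two separate words. -/
theorem evFace_mixed (n : ℕ) (u v : List Bool) (a b : Bool) (hab : b = !a) (h : u.length + v.length + 1 = n)
    (z : ∀ n, C.X n) (z' : ∀ n, C'.X n) :
    C.evFace C' n (u.length + 1) (u ++ a :: b :: v) z z' =
      C.ev C' n (u ++ true :: v) (wflip u ++ true :: wflip v) z z' := by
  subst hab
  have h1 := C'.gD_act_merge (wflip u) (wflip v) (!a) a (by cases a <;> rfl) z' n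
    (by rw [length_wflip, length_wflip]; exact h)
  rw [length_wflip] at h1
  rw [evFace, gD_act_merge C u v a (!a) (by cases a <;> rfl) z n h, ev, wflip_append, wflip_cons,
    wflip_cons, Bool.not_not, h1]
  cases a <;> rfl

/-- The boundary of a weighted sum of shuffles. -/
theorem b_wsum (n : ℕ) (ω : List Bool → ℤ) (z : ∀ n, C.X n) (z' : ∀ n, C'.X n) :
    (C.diag C').normalized.b n (wsum (n + 1) fun w => ω w • C.shev C' (n + 1) w z z') =
      (wsum n (fun v => ω (true :: v) • C.shev C' n v (C.gD 0 z) z') +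
        wsum n (fun u => ((-1) ^ (n + 1) * ω (u ++ [true])) •
          C.shev C' n u (C.gD (u.count true + 1) z) z') +
        msum n (fun u v => ((-1) ^ (u.length + 1) * ω (u ++ true :: true :: v)) •
          C.shev C' n (u ++ true :: v) (C.gD (u.count true + 1) z) z')) +
      (wsum n (fun v => ω (false :: v) • C.shev C' n v z (C'.gD 0 z')) +
        wsum n (fun u => ((-1) ^ (n + 1) * ω (u ++ [false])) •
          C.shev C' n u z (C'.gD (u.count false + 1) z')) +
        msum n (fun u v => ((-1) ^ (u.length + 1) * ω (u ++ false :: false :: v)) •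
          C.shev C' n (u ++ false :: v) z (C'.gD (u.count false + 1) z'))) +
      msum n (fun u v => ((-1) ^ (u.length + 1) *
          (ω (u ++ true :: false :: v) + ω (u ++ false :: true :: v))) •
        C.ev C' n (u ++ true :: v) (wflip u ++ true :: wflip v) z z') := by
  have h1 : (C.diag C').normalized.b n (wsum (n + 1) fun w => ω w • C.shev C' (n + 1) w z z') =
      ∑ m ∈ Finset.range (n + 2), wsum (n + 1) fun w =>
        ((-1) ^ m * ω w) • C.evFace C' n m w z z' := by
    refine (map_wsum ((C.diag C').normalized.b n).toAddMonoidHom _ _).trans ?_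
    rw [← wsum_sum]
    refine wsum_congr _ fun w _ => ?_
    change (C.diag C').normalized.b n (ω w • C.shev C' (n + 1) w z z') = _
    rw [map_zsmul, b_shev, Finset.smul_sum]
    refine Finset.sum_congr rfl fun m _ => ?_
    rw [smul_smul, mul_comm]
  -- Face `n + 1` sees only the last letter and face `0` only the first. A face `m + 1` with `m < n`
  -- sees the letters `m` and `m + 1`, which is the situation of `sum_wsum_split'`.
  rw [h1, Finset.sum_range_succ, Finset.sum_range_succ', wsum_last n (fun w => ((-1) ^ (n + 1) * ω w) •
    C.evFace C' n (n + 1) w z z'), wsum]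
  rw [sum_wsum_split' n fun m w => ((-1) ^ (m + 1) * ω w) • C.evFace C' n (m + 1) w z z']
  rw [msum_congr n (g := fun u v =>
    (((-1) ^ (u.length + 1) * ω (u ++ true :: true :: v)) •
        C.shev C' n (u ++ true :: v) (C.gD (u.count true + 1) z) z' +
      ((-1) ^ (u.length + 1) * ω (u ++ false :: false :: v)) •
        C.shev C' n (u ++ false :: v) z (C'.gD (u.count false + 1) z')) +
      ((-1) ^ (u.length + 1) *
          (ω (u ++ true :: false :: v) + ω (u ++ false :: true :: v))) •
        C.ev C' n (u ++ true :: v) (wflip u ++ true :: wflip v) z z') fun u v h => by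
      rw [C.evFace_true_true C' n u v h, C.evFace_false_false C' n u v h,
        C.evFace_mixed C' n u v true false rfl h,
        C.evFace_mixed C' n u v false true rfl h, mul_add, add_smul]]
  rw [msum_add, msum_add]
  rw [wsum_congr n (f := fun w => ((-1) ^ (n + 1) * ω (w ++ [true])) •
      C.evFace C' n (n + 1) (w ++ [true]) z z') fun u hu => by rw [C.evFace_last_true C' n u hu],
    wsum_congr n (f := fun w => ((-1) ^ (n + 1) * ω (w ++ [false])) •
      C.evFace C' n (n + 1) (w ++ [false]) z z') fun u hu => by rw [C.evFace_last_false C' n u hu]]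
  simp only [evFace_first_true, evFace_first_false, pow_zero, one_mul]
  abel

end CyclicModule
end HopfCyclic

namespace HopfCyclic

/-! ### Signs and conditions along words -/

theorem neg_one_pow_eq_of_even {a b : ℕ} (h : Even (a + b)) : (-1 : ℤ) ^ a = (-1) ^ b := by
  exact neg_one_pow_congr (Nat.even_add.1 h)

/-- Trades the number `|u| + 1` of the face in the product for its number `count true u + 1` in the
left factor: deleting one `true` changes the sign by the number of `false` before it. -/
theorem wordSign_true_true (u v : List Bool) :
    (-1) ^ (u.length + 1) * wordSign (u ++ true :: true :: v) =
      (-1) ^ (u.count true + 1) * wordSign (u ++ true :: v) := by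
  rw [← count_true_add_count_false, wordSign_append, wordSign_append]
  simp only [wordSign, List.count_cons_self]
  have h : (-1 : ℤ) ^ (u.count true + u.count false + 1) *
      (-1) ^ (u.count false * (v.count true + 1 + 1)) =
      (-1) ^ (u.count true + 1) * (-1) ^ (u.count false * (v.count true + 1)) := by
    rw [← pow_add, ← pow_add]
    exact neg_one_pow_eq_of_even ⟨u.count true + u.count false + 1 +
      u.count false * (v.count true + 1), by ring⟩
  linear_combination (wordSign u * wordSign v) * h

/-- As for two letters `true`, but the deleted `false` also takes with it its pairs with the later
`true`. The total correction counts all letters `true`, that is the degree of the left factor: the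
Koszul sign. -/
theorem wordSign_false_false (u v : List Bool) :
    (-1) ^ (u.length + 1) * wordSign (u ++ false :: false :: v) =
      (-1) ^ (u.count true + v.count true) *
        ((-1) ^ (u.count false + 1) * wordSign (u ++ false :: v)) := by
  rw [← count_true_add_count_false, wordSign_append, wordSign_append]
  simp only [wordSign, List.count_cons_of_ne (show false ≠ true by decide)]
  ring

/-- Exactly one pair of letters changes its order. -/
theorem wordSign_swap (u v : List Bool) :
    wordSign (u ++ false :: true :: v) = - wordSign (u ++ true :: false :: v) := by
  rw [wordSign_append, wordSign_append]
  simp only [wordSign, List.count_cons_of_ne (show false ≠ true by decide), List.count_cons_self]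
  ring

theorem wordSign_last_true (u : List Bool) :
    wordSign (u ++ [true]) = (-1) ^ u.count false * wordSign u := by
  rw [wordSign_append]
  simp [wordSign]
  ring

theorem wordSign_last_false (u : List Bool) : wordSign (u ++ [false]) = wordSign u := by
  rw [wordSign_append]
  simp [wordSign]

/-- The number of the vertex `i` after the edge `c` is contracted. -/
def collapse (i c : ℕ) : ℕ := if i ≤ c then i else i - 1

theorem collapse_succ_succ (i c : ℕ) : collapse (i + 1) (c + 1) = collapse i c + 1 := by
  simp only [collapse]
  split_ifs <;> omega

/-- No `false` lies between the two neighbours, so both compare in the same way with every `false`;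
`collapse` identifies them and renumbers the later letters `true`. -/
theorem precedes_true_true (i j : ℕ) (u v : List Bool) :
    precedes i j (u ++ true :: true :: v) =
      precedes (collapse i (u.count true)) j (u ++ true :: v) := by
  induction u generalizing i j with
  | nil => rcases i with _ | _ | i <;> simp [collapse, precedes]
  | cons a u ih =>
    cases a
    · rw [List.count_cons_of_ne (by decide)]
      rcases j with _ | j
      · simp only [List.cons_append, precedes_false_cons_zero]
      · simp only [List.cons_append, precedes_false_cons_succ, ih]
    · rw [List.count_cons_self]
      rcases i with _ | i
      · simp [collapse, precedes]
      · simp only [List.cons_append, collapse_succ_succ, precedes_true_cons_succ, ih]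

theorem precedes_false_false (i j : ℕ) (u v : List Bool) :
    precedes i j (u ++ false :: false :: v) =
      precedes i (collapse j (u.count false)) (u ++ false :: v) := by
  induction u generalizing i j with
  | nil => rcases j with _ | _ | j <;> simp [collapse, precedes]
  | cons a u ih =>
    cases a
    · rw [List.count_cons_self]
      rcases j with _ | j
      · simp [collapse, precedes]
      · simp only [List.cons_append, collapse_succ_succ, precedes_false_cons_succ, ih]
    · rw [List.count_cons_of_ne (by decide)]
      rcases i with _ | i
      · simp only [List.cons_append, precedes_true_cons_zero]
      · simp only [List.cons_append, precedes_true_cons_succ, ih]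

/-- Exchanging neighbours reverses the order of this one pair and of no other. This selects the
single rotation pair that survives among the mixed faces of `sh'`. -/
theorem precedes_swap (i j : ℕ) (u v : List Bool) :
    (if precedes i j (u ++ true :: false :: v) then (1 : ℤ) else 0) -
      (if precedes i j (u ++ false :: true :: v) then 1 else 0) =
        if i = u.count true ∧ j = u.count false then 1 else 0 := by
  induction u generalizing i j with
  | nil => rcases i with _ | i <;> rcases j with _ | j <;> simp [precedes]
  | cons a u ih =>
    cases a
    · rw [List.count_cons_self, List.count_cons_of_ne (by decide)]
      rcases j with _ | j
      · simp [precedes_false_cons_zero]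
      · simp [precedes_false_cons_succ, ih]
    · rw [List.count_cons_self, List.count_cons_of_ne (by decide)]
      rcases i with _ | i
      · simp [precedes_true_cons_zero]
      · simp [precedes_true_cons_succ, ih]

theorem precedes_last_true (i j : ℕ) (u : List Bool) (hi : i < u.count true) :
    precedes i j (u ++ [true]) = precedes i j u :=
  precedes_append_left i j u _ (Or.inl hi)

theorem precedes_last_true_self (j : ℕ) (u : List Bool) (hj : j < u.count false) :
    precedes (u.count true) j (u ++ [true]) = false := by
  rw [precedes_append_left _ j u _ (Or.inr hj)]
  induction u generalizing j with
  | nil => rfl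
  | cons a u ih =>
    cases a
    · rw [List.count_cons_self] at hj
      rw [List.count_cons_of_ne (by decide)]
      rcases j with _ | j
      · exact precedes_false_cons_zero _ _
      · rw [precedes_false_cons_succ, ih j (by omega)]
    · rw [List.count_cons_of_ne (by decide)] at hj
      rw [List.count_cons_self, precedes_true_cons_succ, ih j hj]

theorem precedes_last_false (i j : ℕ) (u : List Bool) (hj : j < u.count false) :
    precedes i j (u ++ [false]) = precedes i j u :=
  precedes_append_left i j u _ (Or.inr hj)

theorem precedes_last_false_self (i : ℕ) (u : List Bool) (hi : i < u.count true) :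
    precedes i (u.count false) (u ++ [false]) = true := by
  rw [precedes_append_left i _ u _ (Or.inl hi)]
  induction u generalizing i with
  | nil => simp at hi
  | cons a u ih =>
    cases a
    · rw [List.count_cons_of_ne (by decide)] at hi
      rw [List.count_cons_self, precedes_false_cons_succ, ih i hi]
    · rw [List.count_cons_self] at hi
      rw [List.count_cons_of_ne (by decide)]
      rcases i with _ | i
      · exact precedes_true_cons_zero _ _
      · rw [precedes_true_cons_succ, ih i (by omega)]

/-- The pairs of a rotation by `i` and a face `c + 1`, in terms of a face followed by a rotation. -/
theorem sum_rotation_face {A : Type*} [AddCommGroup A] (p : ℕ) (K K' : ℕ → ℕ → A)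
    (h : ∀ i c, i < p + 2 → c < p + 1 →
      K' i c = K (collapse i c) (if i ≤ c then c - i else p + 2 - i + c)) :
    ∑ i ∈ Finset.range (p + 2), ∑ c ∈ Finset.range (p + 1), K' i c =
      ∑ i ∈ Finset.range (p + 1), ∑ a ∈ Finset.range (p + 2), K i a := by
  rw [← Finset.sum_product', ← Finset.sum_product']
  -- The forward map is read off from `d_c tⁱ = tⁱ d_{c-i}` for `i ≤ c` and `d_c tⁱ = tⁱ⁻¹
  -- d_{p+2-i+c}` for `c < i`. For the inverse, the two cases are told apart by whether rotation and
  -- face numbers add up to at most `p`.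
  refine Finset.sum_nbij'
    (fun x => (collapse x.1 x.2, if x.1 ≤ x.2 then x.2 - x.1 else p + 2 - x.1 + x.2))
    (fun x => if x.1 + x.2 ≤ p then (x.1, x.1 + x.2) else (x.1 + 1, x.1 + x.2 - (p + 1)))
    ?_ ?_ ?_ ?_ ?_
  · rintro ⟨i, c⟩ hx
    simp only [Finset.mem_product, Finset.mem_range, collapse] at hx ⊢
    split_ifs <;> omega
  · rintro ⟨i, c⟩ hx
    simp only [Finset.mem_product, Finset.mem_range] at hx ⊢
    split_ifs <;> simp only <;> omega
  · rintro ⟨i, c⟩ hx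
    simp only [Finset.mem_product, Finset.mem_range, collapse] at hx ⊢
    by_cases h : i ≤ c
    · simp only [if_pos h]
      rw [if_pos (by omega), Prod.mk.injEq]
      omega
    · simp only [if_neg h]
      rw [if_neg (by omega), Prod.mk.injEq]
      omega
  · rintro ⟨i, c⟩ hx
    simp only [Finset.mem_product, Finset.mem_range, collapse] at hx ⊢
    by_cases h : i + c ≤ p
    · simp only [if_pos h]
      rw [if_pos (by omega), if_pos (by omega), Prod.mk.injEq]
      omega
    · simp only [if_neg h]
      rw [if_neg (by omega), if_neg (by omega), Prod.mk.injEq]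
      omega
  · rintro ⟨i, c⟩ hx
    simp only [Finset.mem_product, Finset.mem_range] at hx
    exact h i c hx.1 hx.2

theorem sum_telescope {A : Type*} [AddCommGroup A] (p : ℕ) (a b : ℕ → ℤ) (e : ℕ → A)
    (h : ∀ i < p, a (i + 1) + b i = 0) :
    ∑ i ∈ Finset.range (p + 1), (a i • e i + b i • e (i + 1)) = a 0 • e 0 + b p • e (p + 1) := by
  rw [Finset.sum_add_distrib, Finset.sum_range_succ', Finset.sum_range_succ _ p]
  have h1 : ∑ i ∈ Finset.range p, a (i + 1) • e (i + 1) + ∑ i ∈ Finset.range p, b i • e (i + 1) =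
      0 := by
    rw [← Finset.sum_add_distrib]
    refine Finset.sum_eq_zero fun i hi => ?_
    rw [← add_smul, h i (Finset.mem_range.1 hi), zero_smul]
  rw [add_right_comm, ← add_assoc, h1]
  abel

/-! ### Homogeneous elements and the boundary of the shuffle product -/

namespace CyclicModule

variable {k : Type w} [CommRing k] (C C' : CyclicModule.{u, w} k)

/-- The graded element with the only component `x`. -/
def hom (p : ℕ) (x : C.X p) : ∀ n, C.X n := Pi.single p x

theorem hom_of_ne {p n : ℕ} (h : n ≠ p) (x : C.X p) : C.hom p x n = 0 := Pi.single_eq_of_ne h x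

theorem hom_self (p : ℕ) (x : C.X p) : C.hom p x p = x := Pi.single_eq_same p x

theorem hom_ext {p : ℕ} {z : ∀ n, C.X n} {x : C.X p} (h : ∀ n, n ≠ p → z n = 0) (hp : z p = x) :
    z = C.hom p x := by
  funext n
  by_cases hn : n = p
  · subst hn
    rw [hom_self, hp]
  · rw [hom_of_ne C hn, h n hn]

theorem gD_eq_zero {P : ℕ} {z : ∀ n, C.X n} (hz : ∀ n, n ≠ P → z n = 0) (c n : ℕ)
    (h : n + 1 ≠ P) : C.gD c z n = 0 := by
  rw [gD, hz _ h, map_zero, ite_self]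

theorem gD_hom (p c : ℕ) (hc : c ≤ p + 1) (x : C.X (p + 1)) :
    C.gD c (C.hom (p + 1) x) = C.hom p (C.d p c x) := by
  refine C.hom_ext (fun n hn => C.gD_eq_zero (fun _ h => C.hom_of_ne h x) c n (by omega)) ?_
  rw [gD, if_pos hc, hom_self]

theorem gE_gTpow_hom (p i : ℕ) (x : C.X p) :
    C.gE (C.gTpow i (C.hom p x)) = C.hom (p + 1) (C.extRot p i x) := by
  refine C.hom_ext (fun n hn => ?_) ?_
  · rcases n with _ | n
    · rfl
    · rw [gE, gTpow, hom_of_ne C (by omega), map_zero, map_zero]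
  · rw [gE, gTpow, hom_self]
    rfl

theorem d_extRot_zero (p i : ℕ) (x : C.X p) : C.d p 0 (C.extRot p i x) = (C.t p ^ i) x := by
  change C.d p 0 (C.t (p + 1) (C.s p p _)) = _
  rw [C.d_t_zero, C.d_s_succ p p le_rfl]

theorem d_extRot_last (p i : ℕ) (x : C.X p) :
    C.d p (p + 1) (C.extRot p i x) = (C.t p ^ (i + 1)) x := by
  change C.d p (p + 1) (C.t (p + 1) (C.s p p _)) = _
  rw [C.d_t_succ p p le_rfl, C.d_s_self p p le_rfl, pow_succ', Module.End.mul_apply]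

theorem t_pow_succ_eq (p : ℕ) (x : C.X p) : (C.t p ^ (p + 1)) x = x := by
  rw [C.t_pow]
  rfl

theorem d_t_pow_le (p i c : ℕ) (h : i ≤ c) (hc : c ≤ p + 1) (x : C.X (p + 1)) :
    C.d p c ((C.t (p + 1) ^ i) x) = (C.t p ^ i) (C.d p (c - i) x) := by
  induction i generalizing c with
  | zero => rfl
  | succ i ih =>
    obtain ⟨c, rfl⟩ : ∃ l, c = l + 1 := ⟨c - 1, by omega⟩
    rw [pow_succ', Module.End.mul_apply, C.d_t_succ p c (by omega), ih c (by omega) (by omega),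
      pow_succ', Module.End.mul_apply, Nat.add_sub_add_right]

/-- After `c` rotations the face has become `d_0`. There `d_0 t = d_{p+1}` uses up one rotation, and
the remaining ones move the last face down. -/
theorem d_t_pow_gt (p i c : ℕ) (h : c < i) (hi : i ≤ p + 1) (x : C.X (p + 1)) :
    C.d p c ((C.t (p + 1) ^ i) x) = (C.t p ^ (i - 1)) (C.d p (p + 2 - i + c) x) := by
  obtain ⟨l, rfl⟩ : ∃ l, i = c + (l + 1) := ⟨i - c - 1, by omega⟩
  rw [pow_add, Module.End.mul_apply, C.d_t_pow_le p c c le_rfl (by omega), Nat.sub_self, pow_succ',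
    Module.End.mul_apply, C.d_t_zero, C.d_t_pow_le p l (p + 1) (by omega) le_rfl, ← Module.End.mul_apply,
    ← pow_add, show p + 2 - (c + (l + 1)) + c = p + 1 - l by omega]
  rfl

theorem d_succ_extRot (p i c : ℕ) (hi : i ≤ p + 1) (hc : c ≤ p) (x : C.X (p + 1)) :
    C.d (p + 1) (c + 1) (C.extRot (p + 1) i x) =
      C.extRot p (collapse i c) (C.d p (if i ≤ c then c - i else p + 2 - i + c) x) := by
  change C.d (p + 1) (c + 1) (C.t (p + 2) (C.s (p + 1) (p + 1) ((C.t (p + 1) ^ i) x))) =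
    C.t (p + 1) (C.s p p ((C.t p ^ collapse i c) (C.d p _ x)))
  rw [C.d_t_succ (p + 1) c (by omega), C.d_s_lt p c p hc le_rfl]
  by_cases h : i ≤ c
  · rw [if_pos h, collapse, if_pos h, C.d_t_pow_le p i c h (by omega)]
  · rw [if_neg h, collapse, if_neg h, C.d_t_pow_gt p i c (by omega) hi]

theorem shev_gD_left_eq_zero (n : ℕ) (w : List Bool) (hw : w.length = n) (P c : ℕ)
    {z : ∀ n, C.X n} (z' : ∀ n, C'.X n) (hz : ∀ n, n ≠ P → z n = 0) (h : w.count true + 1 ≠ P) :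
    C.shev C' n w (C.gD c z) z' = 0 := by
  -- For `P = 0` the face vanishes in all degrees, so any degree other than `count true w` can be
  -- named.
  rcases P with _ | P
  · exact C.shev_eq_zero_left C' n w hw (w.count true + 1) _ _
      (fun l _ => C.gD_eq_zero hz c l (by omega)) (by omega)
  · exact C.shev_eq_zero_left C' n w hw P _ _ (fun l _ => C.gD_eq_zero hz c l (by omega))
      (by omega)

theorem shev_gD_right_eq_zero (n : ℕ) (w : List Bool) (hw : w.length = n) (Q c : ℕ)
    (z : ∀ n, C.X n) {z' : ∀ n, C'.X n} (hz : ∀ n, n ≠ Q → z' n = 0)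
    (h : w.count false + 1 ≠ Q) : C.shev C' n w z (C'.gD c z') = 0 := by
  rcases Q with _ | Q
  · exact C.shev_eq_zero_right C' n w hw (w.count false + 1) _ _
      (fun l _ => C'.gD_eq_zero hz c l (by omega)) (by omega)
  · exact C.shev_eq_zero_right C' n w hw Q _ _ (fun l _ => C'.gD_eq_zero hz c l (by omega))
      (by omega)

/-- The boundary of a shuffle product. -/
theorem b_shuffle (n P Q : ℕ) {z : ∀ n, C.X n} {z' : ∀ n, C'.X n}
    (hz : ∀ n, n ≠ P → z n = 0) (hz' : ∀ n, n ≠ Q → z' n = 0) :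
    (C.diag C').normalized.b n (wsum (n + 1) fun w => wordSign w • C.shev C' (n + 1) w z z') =
      ∑ c ∈ Finset.range (P + 1), (-1 : ℤ) ^ c •
        wsum n (fun w => wordSign w • C.shev C' n w (C.gD c z) z') +
      (-1 : ℤ) ^ P • ∑ c ∈ Finset.range (Q + 1), (-1 : ℤ) ^ c •
        wsum n (fun w => wordSign w • C.shev C' n w z (C'.gD c z')) := by
  -- The mixed faces cancel in pairs, since the two words have the same face and opposite signs.
  rw [b_wsum, msum_eq_zero (f := fun u v => ((-1) ^ (u.length + 1) *
      (wordSign (u ++ true :: false :: v) + wordSign (u ++ false :: true :: v))) •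
        C.ev C' n (u ++ true :: v) (wflip u ++ true :: wflip v) z z') n fun u v _ => by
      rw [wordSign_swap, add_neg_cancel, mul_zero, zero_smul], add_zero]
  rw [Finset.smul_sum]
  simp only [← wsum_smul, smul_smul]
  rw [← wsum_faces true n P (fun c w => ((-1) ^ c * wordSign w) • C.shev C' n w (C.gD c z) z')
      fun c w hw h => by rw [C.shev_gD_left_eq_zero C' n w hw P c z' hz h, smul_zero],
    ← wsum_faces false n Q
      (fun c w => ((-1) ^ P * ((-1) ^ c * wordSign w)) • C.shev C' n w z (C'.gD c z'))
      fun c w hw h => by rw [C.shev_gD_right_eq_zero C' n w hw Q c z hz' h, smul_zero]]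
  -- Signs need to agree only on words with `P` letters `true`; on the others the shuffle term is
  -- zero. This is where the exponent `P` of the Koszul sign comes from.
  have hP : ∀ (w : List Bool) (hw : w.length = n) (c : ℕ) (a b : ℤ), (w.count true = P → a = b) →
      a • C.shev C' n w z (C'.gD c z') = b • C.shev C' n w z (C'.gD c z') := by
    intro w hw c a b hab
    by_cases h : w.count true = P
    · rw [hab h]
    · rw [C.shev_eq_zero_left C' n w hw P z _ hz h, smul_zero, smul_zero]
  congr 1
  · congr 1
    · congr 1
      · exact wsum_congr n fun w _ => by rw [pow_zero, one_mul, wordSign]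
      · refine wsum_congr n fun w hw => ?_
        congr 1
        rw [← hw, ← count_true_add_count_false, wordSign_last_true]
        rw [← mul_assoc, ← pow_add]
        congr 1
        exact neg_one_pow_eq_of_even ⟨w.count true + w.count false + 1, by ring⟩
    · exact msum_congr n fun u v _ => by rw [wordSign_true_true]
  · congr 1
    · congr 1
      · refine wsum_congr n fun w hw => hP w hw _ _ _ fun h => ?_
        rw [pow_zero, one_mul, wordSign, h]
      · refine wsum_congr n fun w hw => hP w hw _ _ _ fun h => ?_
        rw [← hw, ← count_true_add_count_false, wordSign_last_false, h]
        ring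
    · refine msum_congr n fun u v huv => hP _ (by simp; omega) _ _ _ fun h => ?_
      rw [wordSign_false_false, ← h, List.count_append, List.count_cons_of_ne (by decide)]

end CyclicModule
end HopfCyclic

/-! ### Outer and inner faces of the cyclic shuffle -/

namespace HopfCyclic

/-- The sign of a word in which the `i`-th letter `true` comes before the `j`-th letter `false`. -/
def condSign (i j : ℕ) (w : List Bool) : ℤ := if precedes i j w then wordSign w else 0

namespace CyclicModule

variable {k : Type w} [CommRing k] (C C' : CyclicModule.{u, w} k)

/-- The shuffle product of graded elements in degree `n`. -/
noncomputable def fsh (n : ℕ) (z : ∀ n, C.X n) (z' : ∀ n, C'.X n) : (C.diag C').normalized.X n :=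
  wsum n fun w => wordSign w • C.shev C' n w z z'

/-- The part of the shuffle product in which the place `i` comes before the place `j`. -/
noncomputable def psh (i j n : ℕ) (z : ∀ n, C.X n) (z' : ∀ n, C'.X n) :
    (C.diag C').normalized.X n :=
  wsum n fun w => condSign i j w • C.shev C' n w z z'

/-- The graded element `s_{-1} tⁱ x`. -/
def ext (p i : ℕ) (x : C.X p) : ∀ n, C.X n := C.hom (p + 1) (C.extRot p i x)

theorem ext_of_ne {p i n : ℕ} (x : C.X p) (h : n ≠ p + 1) : C.ext p i x n = 0 := C.hom_of_ne h _

theorem gD_ext_last (p i : ℕ) (x : C.X p) :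
    C.gD (p + 1) (C.ext p i x) = C.hom p ((C.t p ^ (i + 1)) x) := by
  rw [ext, gD_hom C p (p + 1) le_rfl, d_extRot_last]

theorem gD_ext_zero (p i : ℕ) (x : C.X p) : C.gD 0 (C.ext p i x) = C.hom p ((C.t p ^ i) x) := by
  rw [ext, gD_hom C p 0 (Nat.zero_le _), d_extRot_zero]

/-- The first face of `s_{-1} tⁱ⁺¹ x` and the last face of `s_{-1} tⁱ x` are both `tⁱ⁺¹ x`; the
conditions on the words agree and the signs are opposite. Only the first face for `i = 0` is left.
Summed over `j` with `z'` equal to `s_{-1} tʲ y`, this is the term `sh (x ⊗ B y)`. -/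
theorem telescope_left (p q n j : ℕ) (hj : j ≤ q) (hn : n = p + q + 1) (x : C.X p)
    (z' : ∀ n, C'.X n) :
    ∑ i ∈ Finset.range (p + 1), (-1 : ℤ) ^ (p * i) •
      (wsum n (fun v => condSign i j (true :: v) • C.shev C' n v (C.gD 0 (C.ext p i x)) z') +
        wsum n (fun u => ((-1) ^ (n + 1) * condSign i j (u ++ [true])) •
          C.shev C' n u (C.gD (u.count true + 1) (C.ext p i x)) z')) =
      C.fsh C' n (C.hom p x) z' := by
  simp only [← wsum_add, ← wsum_smul, ← wsum_sum, fsh]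
  refine wsum_congr n fun w hw => ?_
  have hlen := count_true_add_count_false w
  by_cases h : w.count true = p
  · have hf : w.count false = q + 1 := by omega
    refine ((Finset.sum_congr rfl fun i _ => ?_).trans (sum_telescope p
      (fun i => (-1) ^ (p * i) * condSign i j (true :: w))
      (fun i => (-1) ^ (p * i) * ((-1) ^ (n + 1) * condSign i j (w ++ [true])))
      (fun i => C.shev C' n w (C.hom p ((C.t p ^ i) x)) z') fun i hi => ?_)).trans ?_
    · rw [h, gD_ext_last, gD_ext_zero, smul_add, smul_smul, smul_smul]
    · simp only [condSign]
      rw [precedes_true_cons_succ, precedes_last_true i j w (by omega), wordSign_last_true, hf, hn,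
        wordSign]
      split_ifs
      · ring_nf
        simp
      · simp
    -- For `i = 0` the leading `true` comes before every `false`, so the condition is void. For `i =
    -- p` the marked letter is the final `true`, after every `false`, and the other end of the
    -- telescope is zero.
    · have h0 : precedes p j (w ++ [true]) = false := by
        rw [← h]
        exact precedes_last_true_self j w (by omega)
      simp [condSign, precedes_true_cons_zero, h0, wordSign]
  · rw [C.shev_eq_zero_left C' n w hw p _ _ (fun l hl => C.hom_of_ne hl x) h, smul_zero]
    refine Finset.sum_eq_zero fun i _ => ?_
    rw [C.shev_gD_left_eq_zero C' n w hw (p + 1) _ _ (fun l hl => C.ext_of_ne x hl) (by omega),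
      C.shev_gD_left_eq_zero C' n w hw (p + 1) _ _ (fun l hl => C.ext_of_ne x hl) (by omega)]
    simp

/-- The same cancellation in `j`, with the opposite end surviving: a leading `false` has no `true`
before it, while the final `false` has all of them before it. The end that is left is `j = q`, where
`t^(q+1) = 1`; it leads to `sh (B x ⊗ y)`. -/
theorem telescope_right (p q n i : ℕ) (hi : i ≤ p) (hn : n = p + q + 1) (y : C'.X q)
    (z : ∀ n, C.X n) :
    ∑ j ∈ Finset.range (q + 1), (-1 : ℤ) ^ (q * j) •
      (wsum n (fun v => condSign i j (false :: v) • C.shev C' n v z (C'.gD 0 (C'.ext q j y))) +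
        wsum n (fun u => ((-1) ^ (n + 1) * condSign i j (u ++ [false])) •
          C.shev C' n u z (C'.gD (u.count false + 1) (C'.ext q j y)))) =
      (-1 : ℤ) ^ p • C.fsh C' n z (C'.hom q y) := by
  simp only [← wsum_add, ← wsum_smul, ← wsum_sum, fsh]
  refine wsum_congr n fun w hw => ?_
  have hlen := count_true_add_count_false w
  by_cases h : w.count false = q
  · have ht : w.count true = p + 1 := by omega
    refine ((Finset.sum_congr rfl fun j _ => ?_).trans (sum_telescope q
      (fun j => (-1) ^ (q * j) * condSign i j (false :: w))
      (fun j => (-1) ^ (q * j) * ((-1) ^ (n + 1) * condSign i j (w ++ [false])))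
      (fun j => C.shev C' n w z (C'.hom q ((C'.t q ^ j) y))) fun j hj => ?_)).trans ?_
    · rw [h, gD_ext_last, gD_ext_zero, smul_add, smul_smul, smul_smul]
    · simp only [condSign]
      rw [precedes_false_cons_succ, precedes_last_false i j w (by omega), wordSign_last_false, hn,
        wordSign, ht]
      split_ifs
      · ring_nf
      · simp
    · have h0 : precedes i q (w ++ [false]) = true := by
        rw [← h]
        exact precedes_last_false_self i w (by omega)
      rw [t_pow_succ_eq]
      simp only [condSign, precedes_false_cons_zero, h0, if_true, wordSign_last_false, smul_smul]
      -- Since `n = p + q + 1` and `q * q + q` is even, only the parity of `p` remains.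
      have hs : (-1 : ℤ) ^ (q * q) * ((-1) ^ (n + 1) * wordSign w) = (-1) ^ p * wordSign w := by
        rw [← mul_assoc, ← pow_add]
        congr 1
        refine neg_one_pow_congr ?_
        rw [hn]
        simp only [Nat.even_add, Nat.even_mul, Nat.even_add_one]
        tauto
      rw [hs]
      simp
  · rw [C.shev_eq_zero_right C' n w hw q _ _ (fun l hl => C'.hom_of_ne hl y) h, smul_zero,
      smul_zero]
    refine Finset.sum_eq_zero fun j _ => ?_
    rw [C.shev_gD_right_eq_zero C' n w hw (q + 1) _ _ (fun l hl => C'.ext_of_ne y hl) (by omega),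
      C.shev_gD_right_eq_zero C' n w hw (q + 1) _ _ (fun l hl => C'.ext_of_ne y hl) (by omega)]
    simp

/-- Here `s_{-1} tⁱ x` has degree `1` and its faces degree `0`, while the word that is left still
contains a `true`. -/
theorem inner_left_zero (n i j : ℕ) (x : C.X 0) (z' : ∀ n, C'.X n) :
    msum n (fun u v => ((-1) ^ (u.length + 1) * condSign i j (u ++ true :: true :: v)) •
      C.shev C' n (u ++ true :: v) (C.gD (u.count true + 1) (C.ext 0 i x)) z') = 0 := by
  refine msum_eq_zero n fun u v h => ?_
  rw [C.shev_gD_left_eq_zero C' n _ (by simp; omega) 1 _ _ (fun l hl => C.ext_of_ne x hl) (by simp),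
    smul_zero]

theorem inner_right_zero (n i j : ℕ) (y : C'.X 0) (z : ∀ n, C.X n) :
    msum n (fun u v => ((-1) ^ (u.length + 1) * condSign i j (u ++ false :: false :: v)) •
      C.shev C' n (u ++ false :: v) z (C'.gD (u.count false + 1) (C'.ext 0 j y))) = 0 := by
  refine msum_eq_zero n fun u v h => ?_
  rw [C.shev_gD_right_eq_zero C' n _ (by simp; omega) 1 _ _ (fun l hl => C'.ext_of_ne y hl)
    (by simp), smul_zero]

theorem gD_ext_succ (p i c : ℕ) (hi : i ≤ p + 1) (hc : c ≤ p) (x : C.X (p + 1)) :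
    C.gD (c + 1) (C.ext (p + 1) i x) =
      C.ext p (collapse i c) (C.d p (if i ≤ c then c - i else p + 2 - i + c) x) := by
  rw [ext, gD_hom C (p + 1) (c + 1) (by omega), d_succ_extRot C p i c hi hc]
  rfl

/-- With the signed operators `(-1)ⁿ t` and `(-1)^c d_c`, a face passes rotations without a sign
(`sd_lam_succ`, `sd_lam_zero`); the minus sign comes from passing `s_{-1}` (`sd_sExt_succ`). -/
theorem rotation_face_sign (p i c : ℕ) (hi : i < p + 2) :
    (-1 : ℤ) ^ ((p + 1) * i) * (-1) ^ (c + 1) =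
      - ((-1) ^ (p * collapse i c) * (-1) ^ (if i ≤ c then c - i else p + 2 - i + c)) := by
  have hneg : ∀ m : ℕ, -((-1 : ℤ) ^ m) = (-1) ^ (m + 1) := fun m => by ring
  rw [← pow_add, ← pow_add, hneg]
  refine neg_one_pow_eq_of_even ?_
  by_cases h : i ≤ c
  · obtain ⟨d, rfl⟩ : ∃ d, c = i + d := ⟨c - i, by omega⟩
    rw [collapse, if_pos h, if_pos h, Nat.add_sub_cancel_left]
    exact ⟨p * i + i + d + 1, by ring⟩
  · obtain ⟨i, rfl⟩ : ∃ l, i = l + 1 := ⟨i - 1, by omega⟩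
    obtain ⟨d, hd⟩ : ∃ d, p + 2 - (i + 1) = d := ⟨_, rfl⟩
    have hp : p + 1 = i + d := by omega
    rw [collapse, if_neg h, if_neg h, Nat.add_sub_cancel, hd]
    exact ⟨p * i + c + p + 2, by linarith⟩

/-- The faces between two letters `true` are the inner faces of `s_{-1} tⁱ x`. Moved past the
rotation they run through all faces of `x`, and the marked vertex `i` becomes `collapse i c`, in the
rotation and in the condition on the word alike. So partial shuffles of `b x` appear. -/
theorem inner_left_succ (p n j : ℕ) (x : C.X (p + 1)) (z' : ∀ n, C'.X n) :
    ∑ i ∈ Finset.range (p + 2), (-1 : ℤ) ^ ((p + 1) * i) •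
      msum n (fun u v => ((-1) ^ (u.length + 1) * condSign i j (u ++ true :: true :: v)) •
        C.shev C' n (u ++ true :: v) (C.gD (u.count true + 1) (C.ext (p + 1) i x)) z') =
      (-1 : ℤ) • ∑ i ∈ Finset.range (p + 1), ∑ a ∈ Finset.range (p + 2),
        ((-1 : ℤ) ^ (p * i) * (-1) ^ a) • C.psh C' i j n (C.ext p i (C.d p a x)) z' := by
  have h1 : ∀ i, msum n (fun u v =>
      ((-1) ^ (u.length + 1) * condSign i j (u ++ true :: true :: v)) •
        C.shev C' n (u ++ true :: v) (C.gD (u.count true + 1) (C.ext (p + 1) i x)) z') =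
      wsum n (fun w => ∑ c ∈ Finset.range (w.count true),
        ((-1) ^ (c + 1) * condSign (collapse i c) j w) •
          C.shev C' n w (C.gD (c + 1) (C.ext (p + 1) i x)) z') := fun i => by
    rw [wsum_marked' true n (fun c w => ((-1) ^ (c + 1) * condSign (collapse i c) j w) •
          C.shev C' n w (C.gD (c + 1) (C.ext (p + 1) i x)) z')]
    refine msum_congr n fun u v _ => ?_
    congr 1
    simp only [condSign]
    rw [precedes_true_true]
    split_ifs
    · exact wordSign_true_true u v
    · rw [mul_zero, mul_zero]
  simp only [h1, psh, ← wsum_smul, ← wsum_sum]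
  refine wsum_congr n fun w hw => ?_
  simp only [Finset.smul_sum, smul_smul]
  -- On all other words both sides vanish by degree. On these the faces `c + 1` run through `1, …, p
  -- + 1`, as the reindexing requires.
  by_cases h : w.count true = p + 1
  · rw [h]
    refine sum_rotation_face p (fun i a => _) _ fun i c hi hc => ?_
    rw [gD_ext_succ C p i c (by omega) (by omega), ← mul_assoc, rotation_face_sign p i c hi]
    congr 1
    ring
  · rw [Finset.sum_eq_zero, Finset.sum_eq_zero]
    · intro i _
      refine Finset.sum_eq_zero fun a _ => ?_
      rw [C.shev_eq_zero_left C' n w hw (p + 1) _ _ (fun l hl => C.ext_of_ne _ hl) h, smul_zero]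
    · intro i _
      refine Finset.sum_eq_zero fun a _ => ?_
      rw [C.shev_gD_left_eq_zero C' n w hw (p + 2) _ _ (fun l hl => C.ext_of_ne _ hl) (by omega),
        smul_zero]

/-- As on the left, except that a face of the right factor has to cross the left factor of degree `p
+ 1`; together with the minus sign from `s_{-1}` this makes `(-1) ^ p`. -/
theorem inner_right_succ (p q n i : ℕ) (y : C'.X (q + 1)) {z : ∀ n, C.X n}
    (hz : ∀ n, n ≠ p + 1 → z n = 0) :
    ∑ j ∈ Finset.range (q + 2), (-1 : ℤ) ^ ((q + 1) * j) •
      msum n (fun u v => ((-1) ^ (u.length + 1) * condSign i j (u ++ false :: false :: v)) •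
        C.shev C' n (u ++ false :: v) z (C'.gD (u.count false + 1) (C'.ext (q + 1) j y))) =
      (-1 : ℤ) ^ p • ∑ j ∈ Finset.range (q + 1), ∑ a ∈ Finset.range (q + 2),
        ((-1 : ℤ) ^ (q * j) * (-1) ^ a) • C.psh C' i j n z (C'.ext q j (C'.d q a y)) := by
  have h1 : ∀ j, msum n (fun u v =>
      ((-1) ^ (u.length + 1) * condSign i j (u ++ false :: false :: v)) •
        C.shev C' n (u ++ false :: v) z (C'.gD (u.count false + 1) (C'.ext (q + 1) j y))) =
      wsum n (fun w => ∑ c ∈ Finset.range (w.count false),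
        ((-1) ^ (p + 1) * ((-1) ^ (c + 1) * condSign i (collapse j c) w)) •
          C.shev C' n w z (C'.gD (c + 1) (C'.ext (q + 1) j y))) := fun j => by
    rw [wsum_marked' false n (fun c w =>
      ((-1) ^ (p + 1) * ((-1) ^ (c + 1) * condSign i (collapse j c) w)) •
          C.shev C' n w z (C'.gD (c + 1) (C'.ext (q + 1) j y)))]
    refine msum_congr n fun u v huv => ?_
    by_cases h : u.count true + v.count true = p + 1
    · congr 1
      simp only [condSign]
      rw [precedes_false_false]
      split_ifs
      · rw [wordSign_false_false, h]
      · simp only [mul_zero]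
    · rw [C.shev_eq_zero_left C' n _ (by simp; omega) (p + 1) _ _ hz (by simpa using h), smul_zero,
        smul_zero]
  simp only [h1, psh, ← wsum_smul, ← wsum_sum]
  refine wsum_congr n fun w hw => ?_
  simp only [Finset.smul_sum, smul_smul]
  by_cases h : w.count false = q + 1
  · rw [h]
    refine sum_rotation_face q (fun j a => _) _ fun j c hj hc => ?_
    rw [gD_ext_succ C' q j c (by omega) (by omega)]
    congr 1
    have := rotation_face_sign q j c hj
    rw [mul_left_comm, ← mul_assoc ((-1 : ℤ) ^ ((q + 1) * j)), this]
    ring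
  · rw [Finset.sum_eq_zero, Finset.sum_eq_zero]
    · intro i _
      refine Finset.sum_eq_zero fun a _ => ?_
      rw [C.shev_eq_zero_right C' n w hw (q + 1) _ _ (fun l hl => C'.ext_of_ne _ hl) h, smul_zero]
    · intro i _
      refine Finset.sum_eq_zero fun a _ => ?_
      rw [C.shev_gD_right_eq_zero C' n w hw (q + 2) _ _ (fun l hl => C'.ext_of_ne _ hl) (by omega),
        smul_zero]

end CyclicModule
end HopfCyclic

/-! ### Connes' operator on shuffles and the boundary of the cyclic shuffle -/

namespace HopfCyclic
namespace CyclicModule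

variable {k : Type w} [CommRing k] (C C' : CyclicModule.{u, w} k)

/-- Since `t s_{-1} = s_0 t`, the summand `λ s_{-1} N` is degenerate, and only `s_{-1} N` survives
normalization. -/
theorem B_cls (n : ℕ) (x : C.X n) :
    C.normalized.B n (C.cls n x) =
      ∑ r ∈ Finset.range (n + 1), (-1 : ℤ) ^ (n * r) • C.cls (n + 1) (C.extRot n r x) := by
  have h : C.normalized.B n (C.cls n x) = C.cls (n + 1) (C.B n x) := rfl
  rw [h, B_apply, lam_apply, t_sExt, map_sub, map_zsmul,
    C.cls_eq_zero (C.s_mem n 0 (Nat.zero_le n) _), smul_zero, sub_zero, norm_apply, map_sum, map_sum]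
  refine Finset.sum_congr rfl fun r _ => ?_
  rw [lam_pow_apply, map_zsmul, map_zsmul, ← pow_mul]
  rfl

theorem diag_t_pow (n r : ℕ) (x : C.X n) (y : C'.X n) :
    ((C.diag C').t n ^ r) (x ⊗ₜ[k] y : C.X n ⊗[k] C'.X n) =
      ((C.t n ^ r) x ⊗ₜ[k] (C'.t n ^ r) y : C.X n ⊗[k] C'.X n) := by
  induction r with
  | zero => rfl
  | succ r ih =>
    rw [pow_succ', pow_succ', pow_succ']
    exact congrArg ((C.diag C').t n) ih

theorem B_pr (n : ℕ) (x : C.X n) (y : C'.X n) :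
    (C.diag C').normalized.B n (C.pr C' n x y) =
      ∑ r ∈ Finset.range (n + 1),
        (-1 : ℤ) ^ (n * r) • C.pr C' (n + 1) (C.extRot n r x) (C'.extRot n r y) := by
  refine ((C.diag C').B_cls n (x ⊗ₜ[k] y)).trans (Finset.sum_congr rfl fun r _ => ?_)
  congr 1
  exact congrArg (fun z => (C.diag C').cls (n + 1) ((C.diag C').sExt n z)) (C.diag_t_pow C' n r x y)

/-- The operator `B` on a term of the shuffle product: the word is cut in two parts, which are
exchanged. -/
theorem B_shev (n : ℕ) (w : List Bool) (hw : w.length = n) (z : ∀ n, C.X n) (z' : ∀ n, C'.X n) :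
    (C.diag C').normalized.B n (C.shev C' n w z z') =
      ∑ r ∈ Finset.range (n + 1), (-1 : ℤ) ^ (n * (w.drop r).length) •
        C.ev C' (n + 1) (w.drop r ++ true :: w.take r) (wflip (w.drop r) ++ true :: wflip (w.take r))
          (C.gE (C.gTpow ((w.drop r).count true) z)) (C'.gE (C'.gTpow ((w.drop r).count false) z')) := by
  refine (C.B_pr C' n _ _).trans ?_
  -- The rotation by `r` cuts off the last `r` letters; after the reversal `r` is the length of the
  -- part that stays on the left.
  rw [← Finset.sum_range_reflect]
  refine Finset.sum_congr rfl fun r hr => ?_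
  have hr' := Finset.mem_range.1 hr
  have hl : (w.drop r).length = n + 1 - 1 - r := by rw [List.length_drop, hw]; omega
  have hl' : (w.take r).length = r := by rw [List.length_take]; omega
  rw [← hl]
  generalize hu : w.drop r = u at *
  generalize hv : w.take r = v at *
  have hvu : v ++ u = w := by rw [← hu, ← hv, List.take_append_drop]
  congr 1
  have h1 := C.gE_gTpow_act u v z n (by omega)
  have h2 := C'.gE_gTpow_act (wflip u) (wflip v) z' n (by rw [length_wflip, length_wflip]; omega)
  rw [length_wflip, count_true_wflip, ← wflip_append, hvu] at h2
  rw [hvu] at h1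
  rw [ev, ← h1, ← h2]
  rfl

/-- Compares a mixed face of `sh'` at the place between `u` and `v` with the term of `B sh` obtained
by cutting `v ++ u`. The minus sign is that of `-B sh` in `b_csh`. -/
theorem rotated_word_sign (u v : List Bool) (p q : ℕ) (hp : u.count true + v.count true = p)
    (hq : u.count false + v.count false = q) :
    (-1 : ℤ) ^ p * ((-1) ^ (p * u.count true + q * u.count false) *
      ((-1) ^ (u.length + 1) * wordSign (u ++ true :: false :: v))) =
      - ((-1) ^ ((p + q) * u.length) * wordSign (v ++ u)) := by
  rw [wordSign_append, wordSign_append, wordSign, wordSign, ← count_true_add_count_false u,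
    List.count_cons_self, List.count_cons_of_ne (by decide), ← hp, ← hq]
  generalize u.count true = i
  generalize u.count false = j
  generalize v.count true = a
  generalize v.count false = b
  generalize wordSign u = s
  generalize wordSign v = t
  have h : (-1 : ℤ) ^ ((i + a) + ((i + a) * i + (j + b) * j) + (i + j + 1) + a + j * (a + 1)) =
      (-1) ^ ((i + a + (j + b)) * (i + j) + b * i + 1) :=
    neg_one_pow_eq_of_even
      ⟨a + i + a * i + i * i + b * j + j * j + j + 1 + a * j + i * j + b * i, by ring⟩
  rw [pow_add, pow_add, pow_add, pow_add, pow_add _ _ 1, pow_add, pow_one] at h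
  linear_combination (s * t) * h

theorem ev_ext_eq_zero (n : ℕ) (u v : List Bool) (hn : u.length + v.length = n) (p i : ℕ) (x : C.X p)
    (z' : ∀ n, C'.X n) (w' : List Bool) (h : u.count true + v.count true ≠ p) :
    C.ev C' (n + 1) (u ++ true :: v) w' (C.ext p i x) z' = 0 := by
  have h1 := count_true_add_count_false u
  have h2 := count_true_add_count_false v
  rw [ev, C.act_single_eq_zero _ (p + 1) _ (fun l hl => C.ext_of_ne x hl) 0 (n + 1), map_zero,
    LinearMap.zero_apply]
  rw [List.count_append, List.count_cons_of_ne (by decide)]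
  omega

/-- For a fixed place, `wordSign_swap` and `precedes_swap` leave only `i = count true u` and `j =
count false u`. These are precisely the rotations of the two coefficients that `B` produces when it
cuts the word `v ++ u` before `u` and exchanges the parts. -/
theorem mixed_faces (p q : ℕ) (x : C.X p) (y : C'.X q) :
    (-1 : ℤ) ^ p • ∑ i ∈ Finset.range (p + 1), ∑ j ∈ Finset.range (q + 1),
      (-1 : ℤ) ^ (p * i + q * j) • msum (p + q + 1) (fun u v => ((-1) ^ (u.length + 1) *
          (condSign i j (u ++ true :: false :: v) + condSign i j (u ++ false :: true :: v))) •
        C.ev C' (p + q + 1) (u ++ true :: v) (wflip u ++ true :: wflip v)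
          (C.ext p i x) (C'.ext q j y)) =
      - (C.diag C').normalized.B (p + q) (C.fsh C' (p + q) (C.hom p x) (C'.hom q y)) := by
  have hB : (C.diag C').normalized.B (p + q) (C.fsh C' (p + q) (C.hom p x) (C'.hom q y)) =
      csum (p + q) fun u v => ((-1 : ℤ) ^ ((p + q) * u.length) * wordSign (v ++ u)) •
        C.ev C' (p + q + 1) (u ++ true :: v) (wflip u ++ true :: wflip v)
          (C.ext p (u.count true) x) (C'.ext q (u.count false) y) := by
    refine (map_wsum ((C.diag C').normalized.B (p + q)).toAddMonoidHom _ _).trans ?_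
    -- The uncut word is `v ++ u`, so `take` yields `v` and `drop` yields `u`, in the order opposite
    -- to that of the sum.
    rw [← csum_swap, ← wsum_cut]
    refine wsum_congr _ fun w hw => ?_
    change (C.diag C').normalized.B (p + q) (wordSign w • C.shev C' (p + q) w _ _) = _
    rw [map_zsmul, B_shev C C' _ w hw, Finset.smul_sum]
    refine Finset.sum_congr rfl fun r _ => ?_
    rw [smul_smul, List.take_append_drop, mul_comm, gE_gTpow_hom, gE_gTpow_hom]
    rfl
  rw [hB]
  have hs : ∀ i j, (-1 : ℤ) ^ (p * i + q * j) • msum (p + q + 1) (fun u v => ((-1) ^ (u.length + 1) *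
          (condSign i j (u ++ true :: false :: v) + condSign i j (u ++ false :: true :: v))) •
        C.ev C' (p + q + 1) (u ++ true :: v) (wflip u ++ true :: wflip v)
          (C.ext p i x) (C'.ext q j y)) =
      csum (p + q) (fun u v => (-1 : ℤ) ^ (p * i + q * j) • ((-1) ^ (u.length + 1) *
          (condSign i j (u ++ true :: false :: v) + condSign i j (u ++ false :: true :: v))) •
        C.ev C' (p + q + 1) (u ++ true :: v) (wflip u ++ true :: wflip v)
          (C.ext p i x) (C'.ext q j y)) := fun i j => (csum_smul _ _ _).symm
  simp only [hs, ← csum_sum, ← csum_smul]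
  refine Eq.trans ?_ (neg_one_zsmul _)
  rw [← csum_smul]
  refine csum_congr _ fun u v huv => ?_
  have h1 := count_true_add_count_false u
  have h2 := count_true_add_count_false v
  by_cases hp : u.count true + v.count true = p
  · have hq : u.count false + v.count false = q := by omega
    have hc : ∀ i j, condSign i j (u ++ true :: false :: v) + condSign i j (u ++ false :: true :: v) =
        if i = u.count true ∧ j = u.count false then wordSign (u ++ true :: false :: v) else 0 := by
      intro i j
      have h3 := precedes_swap i j u v
      have h4 := wordSign_swap u v
      simp only [condSign, h4]
      split_ifs at h3 ⊢ <;> simp_all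
    rw [Finset.sum_eq_single (u.count true), Finset.sum_eq_single (u.count false)]
    · rw [hc, if_pos ⟨rfl, rfl⟩, smul_smul, smul_smul, smul_smul, mul_assoc,
        rotated_word_sign u v p q hp hq, neg_one_mul]
    · intro j _ hj
      rw [hc, if_neg (fun h => hj h.2), mul_zero, zero_smul, smul_zero]
    · intro h
      exact absurd (Finset.mem_range.2 (by omega)) h
    · intro i _ hi
      refine Finset.sum_eq_zero fun j _ => ?_
      rw [hc, if_neg (fun h => hi h.1), mul_zero, zero_smul, smul_zero]
    · intro h
      exact absurd (Finset.mem_range.2 (by omega)) h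
  · rw [C.ev_ext_eq_zero C' (p + q) u v huv p _ x _ _ hp, Finset.sum_eq_zero, smul_zero, smul_zero,
      smul_zero]
    intro i _
    refine Finset.sum_eq_zero fun j _ => ?_
    rw [C.ev_ext_eq_zero C' (p + q) u v huv p _ x _ _ hp, smul_zero, smul_zero]

/-- The cyclic shuffle product of homogeneous elements, in terms of words. -/
noncomputable def csh (n p q : ℕ) (x : C.X p) (y : C'.X q) : (C.diag C').normalized.X n :=
  (-1 : ℤ) ^ p • ∑ i ∈ Finset.range (p + 1), ∑ j ∈ Finset.range (q + 1),
    (-1 : ℤ) ^ (p * i + q * j) • C.psh C' i j n (C.ext p i x) (C'.ext q j y)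

/-- The inner faces of the cyclic shuffle product that touch the left factor. -/
noncomputable def innerLeft (n p q : ℕ) (x : C.X p) (y : C'.X q) :
    (C.diag C').normalized.X n :=
  (-1 : ℤ) ^ p • ∑ j ∈ Finset.range (q + 1), (-1 : ℤ) ^ (q * j) •
    ∑ i ∈ Finset.range (p + 1), (-1 : ℤ) ^ (p * i) • msum n (fun u v =>
      ((-1) ^ (u.length + 1) * condSign i j (u ++ true :: true :: v)) •
        C.shev C' n (u ++ true :: v) (C.gD (u.count true + 1) (C.ext p i x)) (C'.ext q j y))

/-- The inner faces of the cyclic shuffle product that touch the right factor. -/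
noncomputable def innerRight (n p q : ℕ) (x : C.X p) (y : C'.X q) :
    (C.diag C').normalized.X n :=
  (-1 : ℤ) ^ p • ∑ i ∈ Finset.range (p + 1), (-1 : ℤ) ^ (p * i) •
    ∑ j ∈ Finset.range (q + 1), (-1 : ℤ) ^ (q * j) • msum n (fun u v =>
      ((-1) ^ (u.length + 1) * condSign i j (u ++ false :: false :: v)) •
        C.shev C' n (u ++ false :: v) (C.ext p i x)
          (C'.gD (u.count false + 1) (C'.ext q j y)))

/-- The outer faces telescope to `sh (x ⊗ B y)` and `sh (B x ⊗ y)`, the faces between equal letters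
form `innerLeft` and `innerRight`, and the mixed faces give `-B sh`. -/
theorem b_csh (p q n : ℕ) (hn : p + q = n) (x : C.X p) (y : C'.X q) :
    (C.diag C').normalized.b (n + 1) (C.csh C' (n + 2) p q x y) =
      ((-1 : ℤ) ^ p • ∑ j ∈ Finset.range (q + 1), (-1 : ℤ) ^ (q * j) •
          C.fsh C' (n + 1) (C.hom p x) (C'.ext q j y) + C.innerLeft C' (n + 1) p q x y) +
      (∑ i ∈ Finset.range (p + 1), (-1 : ℤ) ^ (p * i) •
          C.fsh C' (n + 1) (C.ext p i x) (C'.hom q y) + C.innerRight C' (n + 1) p q x y) -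
      (C.diag C').normalized.B n (C.fsh C' n (C.hom p x) (C'.hom q y)) := by
  subst hn
  have hpp : (-1 : ℤ) ^ p * (-1) ^ p = 1 := by rw [← pow_add, Even.neg_one_pow ⟨p, rfl⟩]
  have hl : (-1 : ℤ) ^ p • ∑ j ∈ Finset.range (q + 1), (-1 : ℤ) ^ (q * j) •
          C.fsh C' (p + q + 1) (C.hom p x) (C'.ext q j y) =
      (-1 : ℤ) ^ p • ∑ i ∈ Finset.range (p + 1), ∑ j ∈ Finset.range (q + 1),
        (-1 : ℤ) ^ (p * i + q * j) •
        (wsum (p + q + 1) (fun v => condSign i j (true :: v) •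
            C.shev C' (p + q + 1) v (C.gD 0 (C.ext p i x)) (C'.ext q j y)) +
          wsum (p + q + 1) (fun u => ((-1) ^ (p + q + 1 + 1) * condSign i j (u ++ [true])) •
            C.shev C' (p + q + 1) u (C.gD (u.count true + 1) (C.ext p i x)) (C'.ext q j y))) := by
    rw [Finset.sum_comm]
    congr 1
    refine Finset.sum_congr rfl fun j hj => ?_
    rw [← C.telescope_left C' p q (p + q + 1) j (by have := Finset.mem_range.1 hj; omega) rfl x,
      Finset.smul_sum]
    refine Finset.sum_congr rfl fun i _ => ?_
    rw [smul_smul, pow_add _ (p * i), mul_comm]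
  have hr : ∑ i ∈ Finset.range (p + 1), (-1 : ℤ) ^ (p * i) •
          C.fsh C' (p + q + 1) (C.ext p i x) (C'.hom q y) =
      (-1 : ℤ) ^ p • ∑ i ∈ Finset.range (p + 1), ∑ j ∈ Finset.range (q + 1),
        (-1 : ℤ) ^ (p * i + q * j) •
        (wsum (p + q + 1) (fun v => condSign i j (false :: v) •
            C.shev C' (p + q + 1) v (C.ext p i x) (C'.gD 0 (C'.ext q j y))) +
          wsum (p + q + 1) (fun u => ((-1) ^ (p + q + 1 + 1) * condSign i j (u ++ [false])) •
            C.shev C' (p + q + 1) u (C.ext p i x) (C'.gD (u.count false + 1) (C'.ext q j y)))) := by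
    rw [Finset.smul_sum]
    refine Finset.sum_congr rfl fun i hi => ?_
    have := C.telescope_right C' p q (p + q + 1) i (by have := Finset.mem_range.1 hi; omega) rfl y
      (C.ext p i x)
    -- The factor `(-1) ^ p` in front of `sh'` meets the one produced by `telescope_right`, and the
    -- term `sh (B x ⊗ y)` ends up without a sign.
    have h2 : C.fsh C' (p + q + 1) (C.ext p i x) (C'.hom q y) =
        (-1 : ℤ) ^ p • (-1 : ℤ) ^ p • C.fsh C' (p + q + 1) (C.ext p i x) (C'.hom q y) := by
      rw [smul_smul, hpp, one_smul]
    rw [h2, ← this, smul_comm, Finset.smul_sum]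
    congr 1
    refine Finset.sum_congr rfl fun j _ => ?_
    rw [smul_smul, pow_add _ (p * i)]
  have hil : C.innerLeft C' (p + q + 1) p q x y = (-1 : ℤ) ^ p • ∑ i ∈ Finset.range (p + 1),
      ∑ j ∈ Finset.range (q + 1), (-1 : ℤ) ^ (p * i + q * j) • msum (p + q + 1) (fun u v =>
        ((-1) ^ (u.length + 1) * condSign i j (u ++ true :: true :: v)) •
        C.shev C' (p + q + 1) (u ++ true :: v) (C.gD (u.count true + 1) (C.ext p i x))
          (C'.ext q j y)) := by
    rw [innerLeft, Finset.sum_comm]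
    congr 1
    refine Finset.sum_congr rfl fun j _ => ?_
    rw [Finset.smul_sum]
    refine Finset.sum_congr rfl fun i _ => ?_
    rw [smul_smul, pow_add _ (p * i), mul_comm]
  have hir : C.innerRight C' (p + q + 1) p q x y = (-1 : ℤ) ^ p • ∑ i ∈ Finset.range (p + 1),
      ∑ j ∈ Finset.range (q + 1), (-1 : ℤ) ^ (p * i + q * j) • msum (p + q + 1) (fun u v =>
        ((-1) ^ (u.length + 1) * condSign i j (u ++ false :: false :: v)) •
        C.shev C' (p + q + 1) (u ++ false :: v) (C.ext p i x)
          (C'.gD (u.count false + 1) (C'.ext q j y))) := by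
    rw [innerRight]
    congr 1
    refine Finset.sum_congr rfl fun i _ => ?_
    rw [Finset.smul_sum]
    refine Finset.sum_congr rfl fun j _ => ?_
    rw [smul_smul, pow_add _ (p * i)]
  rw [hl, hr, hil, hir, sub_eq_add_neg, ← mixed_faces, ← smul_add, ← smul_add, ← smul_add,
    ← smul_add, csh, map_zsmul, map_sum]
  congr 1
  simp only [← Finset.sum_add_distrib]
  refine Finset.sum_congr rfl fun i _ => ?_
  rw [map_sum]
  refine Finset.sum_congr rfl fun j _ => ?_
  rw [map_zsmul, psh, b_wsum]
  simp only [← smul_add]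

theorem innerLeft_zero (n q : ℕ) (x : C.X 0) (y : C'.X q) : C.innerLeft C' n 0 q x y = 0 := by
  simp only [innerLeft, inner_left_zero, smul_zero, Finset.sum_const_zero]

theorem innerRight_zero (n p : ℕ) (x : C.X p) (y : C'.X 0) : C.innerRight C' n p 0 x y = 0 := by
  simp only [innerRight, inner_right_zero, smul_zero, Finset.sum_const_zero]

/-- The minus sign of `inner_left_succ` turns the prefactor `(-1) ^ (p + 1)` of `sh'` on `x` into
the prefactor `(-1) ^ p` on its faces. -/
theorem innerLeft_succ (n p q : ℕ) (x : C.X (p + 1)) (y : C'.X q) :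
    C.innerLeft C' n (p + 1) q x y =
      ∑ a ∈ Finset.range (p + 2), (-1 : ℤ) ^ a • C.csh C' n p q (C.d p a x) y := by
  simp only [innerLeft, inner_left_succ, csh, Finset.smul_sum, smul_smul]
  rw [Finset.sum_congr rfl fun j _ => Finset.sum_comm, Finset.sum_comm]
  refine Finset.sum_congr rfl fun a _ => ?_
  rw [Finset.sum_comm]
  refine Finset.sum_congr rfl fun i _ => Finset.sum_congr rfl fun j _ => ?_
  congr 1
  ring

/-- The prefactor of `sh'` depends on the degree of `x` alone and does not change, so the sign of
`inner_right_succ` stays as the Koszul sign. -/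
theorem innerRight_succ (n p q : ℕ) (x : C.X p) (y : C'.X (q + 1)) :
    C.innerRight C' n p (q + 1) x y =
      (-1 : ℤ) ^ p • ∑ a ∈ Finset.range (q + 2), (-1 : ℤ) ^ a • C.csh C' n p q x (C'.d q a y) := by
  simp only [innerRight, C.inner_right_succ C' p q n _ y (fun l hl => C.ext_of_ne x hl), csh,
    Finset.smul_sum, smul_smul]
  rw [Finset.sum_congr rfl fun i _ => Finset.sum_comm, Finset.sum_comm]
  refine Finset.sum_congr rfl fun a _ => Finset.sum_congr rfl fun i _ =>
    Finset.sum_congr rfl fun j _ => ?_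
  congr 1
  ring

/-! ### Vanishing of `B` on cyclic shuffles -/

theorem act_gS_low (a b : ℕ) (h : a ≤ b) (w : List Bool) (z : ∀ n, C.X n) :
    C.act (b + 1) w (C.gS a z) = C.gS a (C.act b w z) := by
  induction w generalizing b z with
  | nil => rfl
  | cons c w ih =>
    cases c
    · change C.act (b + 2) w (C.gS (b + 1) (C.gS a z)) = C.gS a (C.act (b + 1) w (C.gS b z))
      rw [← C.gS_gS a b h, ih (b + 1) (by omega)]
    · exact ih (b + 1) (by omega) z

theorem act_gS_high (m : ℕ) (w : List Bool) (z : ∀ n, C.X n) :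
    C.act m w (C.gS (m + w.count true) z) = C.gS (m + w.length) (C.act m w z) := by
  induction w generalizing m z with
  | nil => rfl
  | cons c w ih =>
    rw [List.length_cons]
    cases c
    · change C.act (m + 1) w (C.gS m (C.gS (m + _) z)) = C.gS _ (C.act (m + 1) w (C.gS m z))
      rw [C.gS_gS m _ (by omega), List.count_cons_of_ne (by decide), add_right_comm, ih,
        add_right_comm, add_assoc]
    · change C.act (m + 1) w (C.gS (m + _) z) = C.gS _ (C.act (m + 1) w z)
      rw [List.count_cons_self, add_comm (w.count true), ← add_assoc, ih, add_right_comm, add_assoc]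

/-- Crossing `u` raises the index by the number of `false` in `u`, so it becomes `|u|`. This depends
only on the place of the cut and is the same for `u` and `wflip u`: degeneracies of the two factors
become one common degeneracy. -/
theorem act_gS_box (u v : List Bool) (z : ∀ n, C.X n) :
    C.act 0 (u ++ true :: v) (C.gS (u.count true) z) = C.gS u.length (C.act 0 (u ++ v) z) := by
  have h := C.act_gS_high 0 u z
  rw [Nat.zero_add, Nat.zero_add] at h
  rw [act_append, h, act_append, Nat.zero_add]
  exact C.act_gS_low _ _ le_rfl v _

/-- Rotation carries `s_{-1}` to `s_0` and then further up: `t^c s_{-1} = s_{c-1} t^c` for `c ≥ 1`,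
and `s_{-1} s_{c-1} = s_c s_{-1}`. For `c = 0` it is `s_{-1} s_{-1} = s_0 s_{-1}`. Both `B sh' = 0`
and `sh' B = 0` rest on this; for the former the exact index `c` matters. -/
theorem extRot_extRot (p c i : ℕ) (hc : c ≤ p + 1) (x : C.X p) :
    ∃ x', C.extRot (p + 1) c (C.extRot p i x) = C.s (p + 1) c x' := by
  suffices h : ∀ c ≤ p, ∀ y : C.X p, (C.t (p + 1) ^ (c + 1)) (C.sExt p y) =
      C.s p c ((C.t p ^ (c + 1)) y) by
    rcases c with _ | c
    · exact ⟨_, C.sExt_sExt p _⟩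
    · refine ⟨C.sExt p ((C.t p ^ (c + 1)) ((C.t p ^ i) x)),
        (congrArg (C.sExt (p + 1)) (h c (by omega) _)).trans ?_⟩
      exact C.sExt_s p c (by omega) _
  intro c hc y
  induction c with
  | zero =>
    rw [zero_add, pow_one, pow_one]
    exact C.t_sExt p y
  | succ c ih =>
    rw [pow_succ', Module.End.mul_apply, ih (by omega), ← C.s_t_succ p c (by omega),
      pow_succ' _ (c + 1), Module.End.mul_apply]

theorem pr_gS (n m : ℕ) (h : m ≤ n) (z : ∀ n, C.X n) (z' : ∀ n, C'.X n) :
    C.pr C' (n + 1) (C.gS m z (n + 1)) (C'.gS m z' (n + 1)) = 0 := by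
  refine (C.diag C').cls_eq_zero ?_
  simp only [gS]
  rw [if_pos h, if_pos h]
  exact (C.diag C').s_mem n m h (z n ⊗ₜ[k] z' n)

theorem gE_gTpow_ext (p c i : ℕ) (hc : c ≤ p + 1) (x : C.X p) :
    ∃ z, C.gE (C.gTpow c (C.ext p i x)) = C.gS c z := by
  obtain ⟨x', h⟩ := C.extRot_extRot p c i hc x
  refine ⟨C.hom (p + 1) x', ?_⟩
  rw [ext, gE_gTpow_hom, h]
  symm
  refine C.hom_ext (fun n hn => ?_) ?_
  · rcases n with _ | n
    · rfl
    · simp only [gS]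
      rw [C.hom_of_ne (by omega), map_zero, ite_self]
  · simp only [gS]
    rw [hom_self, if_pos hc]

/-- Cutting off a part `u` of the word replaces the coefficients by `s_{-1} t^c s_{-1} tⁱ x` and its
analogue for `y`, with `c` the number of letters of the factor in `u`. So they are images of `s_c`,
and along the rotated words both degeneracies come out with the index `|u|`; the product is
degenerate. -/
theorem B_csh (p q : ℕ) (x : C.X p) (y : C'.X q) :
    (C.diag C').normalized.B (p + q + 2) (C.csh C' (p + q + 2) p q x y) = 0 := by
  rw [csh, map_zsmul, map_sum, Finset.sum_eq_zero, smul_zero]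
  intro i _
  rw [map_sum]
  refine Finset.sum_eq_zero fun j _ => ?_
  rw [map_zsmul, psh]
  refine (congrArg _ ((map_wsum ((C.diag C').normalized.B (p + q + 2)).toAddMonoidHom _ _).trans
    ((wsum_congr _ fun w hw => ?_).trans (wsum_zero _)))).trans (smul_zero _)
  change (C.diag C').normalized.B (p + q + 2) (condSign i j w • C.shev C' (p + q + 2) w _ _) = 0
  rw [map_zsmul]
  have hlen := count_true_add_count_false w
  by_cases h : w.count true = p + 1
  · rw [B_shev C C' _ w hw, Finset.sum_eq_zero, smul_zero]
    intro r hr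
    have h1 : (w.drop r).count true ≤ w.count true := (List.drop_sublist r w).count_le true
    have h2 : (w.drop r).count false ≤ w.count false := (List.drop_sublist r w).count_le false
    obtain ⟨z, hz⟩ := C.gE_gTpow_ext p ((w.drop r).count true) i (by omega) x
    obtain ⟨z', hz'⟩ := C'.gE_gTpow_ext q ((w.drop r).count false) j (by omega) y
    -- On the right the letters are flipped: the steps of this factor in the part cut off are its
    -- letters `false`.
    have h3 := C'.act_gS_box (wflip (w.drop r)) (wflip (w.take r)) z'
    rw [count_true_wflip, length_wflip] at h3
    rw [hz, hz', ev, act_gS_box, h3, pr_gS C C' _ _ (by rw [List.length_drop]; omega), smul_zero]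
  · rw [C.shev_eq_zero_left C' _ w hw (p + 1) _ _ (fun l hl => C.ext_of_ne x hl) h, map_zero,
      smul_zero]

end CyclicModule
end HopfCyclic

/-! ### Shuffle permutations as words -/

namespace HopfCyclic

/-- The positions of the letter `a` in a word, the first letter having the position `m`. -/
def positions (a : Bool) : ℕ → List Bool → List ℕ
  | _, [] => []
  | m, b :: w => if b = a then m :: positions a (m + 1) w else positions a (m + 1) w

theorem mem_positions {a : Bool} {m x : ℕ} {w : List Bool} :
    x ∈ positions a m w ↔ ∃ i, w[i]? = some a ∧ x = m + i := by
  induction w generalizing m with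
  | nil => simp [positions]
  | cons b w ih =>
    have h : (∃ i, (b :: w)[i]? = some a ∧ x = m + i) ↔
        (b = a ∧ x = m) ∨ ∃ i, w[i]? = some a ∧ x = m + 1 + i := by
      constructor
      · rintro ⟨_ | i, h1, h2⟩
        · exact Or.inl ⟨by simpa using h1, h2⟩
        · exact Or.inr ⟨i, by simpa using h1, by omega⟩
      · rintro (⟨h1, h2⟩ | ⟨i, h1, h2⟩)
        · exact ⟨0, by simpa using h1, h2⟩
        · exact ⟨i + 1, by simpa using h1, by omega⟩
    rw [h, positions]
    split_ifs with hb <;> simp [ih, hb]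

theorem positions_pairwise (a : Bool) (m : ℕ) (w : List Bool) :
    (positions a m w).Pairwise (· < ·) := by
  induction w generalizing m with
  | nil => exact List.Pairwise.nil
  | cons b w ih =>
    rw [positions]
    split_ifs
    · refine List.pairwise_cons.2 ⟨fun x hx => ?_, ih (m + 1)⟩
      obtain ⟨i, _, rfl⟩ := mem_positions.1 hx
      omega
    · exact ih (m + 1)

theorem length_positions (a : Bool) (m : ℕ) (w : List Bool) :
    (positions a m w).length = w.count a := by
  induction w generalizing m with
  | nil => rfl
  | cons b w ih =>
    rw [positions]
    split_ifs with h
    · rw [h, List.count_cons_self, List.length_cons, ih]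
    · rw [List.count_cons_of_ne h, ih]

theorem positions_wflip (a : Bool) (m : ℕ) (w : List Bool) :
    positions a m (wflip w) = positions (!a) m w := by
  induction w generalizing m with
  | nil => rfl
  | cons b w ih =>
    rw [wflip_cons, positions, positions, ih]
    cases a <;> cases b <;> rfl

/-- Identifies the recursive condition, suited to induction on words, with the inequality between
values of the permutation that defines the cyclic shuffle. -/
theorem precedes_eq_positions (i j m : ℕ) (w : List Bool) (hi : i < w.count true)
    (hj : j < w.count false) :
    precedes i j w = decide ((positions true m w)[i]'(by rwa [length_positions]) <
      (positions false m w)[j]'(by rwa [length_positions])) := by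
  induction w generalizing i j m with
  | nil => simp at hi
  | cons b w ih =>
    cases b
    · rw [List.count_cons_of_ne (by decide)] at hi
      rw [List.count_cons_self] at hj
      have hlt : m < (positions true (m + 1) w)[i]'(by rwa [length_positions]) := by
        obtain ⟨l, _, h⟩ := mem_positions.1 (List.getElem_mem (l := positions true (m + 1) w)
          (n := i) (by rwa [length_positions]))
        omega
      rcases j with _ | j
      · rw [precedes_false_cons_zero]
        simp only [positions, Bool.false_eq_true, if_false, if_true, List.getElem_cons_zero]
        simp only [false_eq_decide_iff]
        omega
      · rw [precedes_false_cons_succ, ih i j (m + 1) hi (by omega)]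
        simp only [positions, Bool.false_eq_true, if_false, if_true, List.getElem_cons_succ]
    · rw [List.count_cons_of_ne (by decide)] at hj
      rw [List.count_cons_self] at hi
      have hlt : m < (positions false (m + 1) w)[j]'(by rwa [length_positions]) := by
        obtain ⟨l, _, h⟩ := mem_positions.1 (List.getElem_mem (l := positions false (m + 1) w)
          (n := j) (by rwa [length_positions]))
        omega
      rcases i with _ | i
      · rw [precedes_true_cons_zero]
        simp only [positions, Bool.true_eq_false, if_false, if_true, List.getElem_cons_zero]
        simp only [true_eq_decide_iff]
        omega
      · rw [precedes_true_cons_succ, ih i j (m + 1) (by omega) hj]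
        simp only [positions, Bool.true_eq_false, if_false, if_true, List.getElem_cons_succ]

/-- Brings the sign into the form of a product over pairs, in which it can be compared with the sign
of a permutation. -/
theorem wordSign_eq_positions (m : ℕ) (w : List Bool) :
    wordSign w = ((positions false m w).map fun b =>
      ((positions true m w).map fun a => if a < b then (1 : ℤ) else -1).prod).prod := by
  induction w generalizing m with
  | nil => rfl
  | cons c w ih =>
    cases c
    · simp only [positions, Bool.false_eq_true, if_false, if_true, List.map_cons, List.prod_cons,
        wordSign, ih (m + 1)]
      congr 1
      rw [List.map_congr_left (g := fun _ => (-1 : ℤ)), List.map_const', List.prod_replicate,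
        length_positions]
      intro a ha
      obtain ⟨l, _, rfl⟩ := mem_positions.1 ha
      rw [if_neg (by omega)]
    · simp only [positions, Bool.true_eq_false, if_false, if_true, List.map_cons, List.prod_cons,
        wordSign, ih (m + 1)]
      congr 1
      refine List.map_congr_left fun b hb => ?_
      obtain ⟨l, _, rfl⟩ := mem_positions.1 hb
      rw [if_pos (by omega), one_mul]

theorem wsum_eq_sum {A : Type*} [AddCommGroup A] (n : ℕ) (f : List Bool → A) :
    wsum n f = ∑ g : Fin n → Bool, f (List.ofFn g) := by
  induction n generalizing f with
  | zero => simp [wsum]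
  | succ n ih =>
    rw [wsum, ih, ih, ← (Fin.consEquiv fun _ : Fin (n + 1) => Bool).sum_comp, Fintype.sum_prod_type,
      Fintype.sum_bool]
    simp [Fin.consEquiv, List.ofFn_succ]

theorem count_ofFn (a : Bool) (n : ℕ) (g : Fin n → Bool) :
    (List.ofFn g).count a = (Finset.univ.filter fun i => g i = a).card := by
  induction n with
  | zero => rfl
  | succ n ih =>
    rw [List.ofFn_succ, List.count_cons, ih, Finset.card_filter, Finset.card_filter,
      Fin.sum_univ_succ, add_comm]
    simp

/-- The letters of the word of a permutation of `p + q` elements: the positions of the images of the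
first `p` elements are marked `true`. -/
def shuffleLetters {p q : ℕ} (σ : Equiv.Perm (Fin (p + q))) (m : Fin (p + q)) : Bool :=
  decide ((σ.symm m : ℕ) < p)

theorem shuffleLetters_eq_true {p q : ℕ} (σ : Equiv.Perm (Fin (p + q))) (m : Fin (p + q)) :
    shuffleLetters σ m = true ↔ ∃ i, σ (Fin.castAdd q i) = m := by
  rw [shuffleLetters, decide_eq_true_iff]
  constructor
  · intro h
    refine ⟨⟨σ.symm m, h⟩, ?_⟩
    rw [← Equiv.eq_symm_apply]
    rfl
  · rintro ⟨i, rfl⟩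
    rw [Equiv.symm_apply_apply]
    exact i.2

theorem shuffleLetters_eq_false {p q : ℕ} (σ : Equiv.Perm (Fin (p + q))) (m : Fin (p + q)) :
    shuffleLetters σ m = false ↔ ∃ j, σ (Fin.natAdd p j) = m := by
  rw [shuffleLetters, decide_eq_false_iff_not]
  constructor
  · intro h
    refine ⟨⟨σ.symm m - p, by omega⟩, ?_⟩
    rw [← Equiv.eq_symm_apply]
    exact Fin.ext (by simp; omega)
  · rintro ⟨j, rfl⟩
    rw [Equiv.symm_apply_apply, Fin.val_natAdd]
    omega

/-- A strictly increasing list is determined by its members; here both lists consist of the images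
of the first `p` elements. -/
theorem ofFn_left {p q : ℕ} {σ : Equiv.Perm (Fin (p + q))} (hσ : IsShuffle σ) :
    List.ofFn (fun i : Fin p => (σ (Fin.castAdd q i) : ℕ)) =
      positions true 0 (List.ofFn (shuffleLetters σ)) := by
  refine List.Pairwise.eq_of_mem_iff (r := (· < ·)) (List.pairwise_ofFn.2 fun i j h => hσ.1 h)
    (positions_pairwise _ _ _) fun x => ?_
  rw [List.mem_ofFn, mem_positions]
  constructor
  · rintro ⟨i, rfl⟩
    refine ⟨σ (Fin.castAdd q i), ?_, by simp⟩
    rw [List.getElem?_ofFn, dif_pos (σ (Fin.castAdd q i)).2]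
    exact congrArg some ((shuffleLetters_eq_true σ _).2 ⟨i, rfl⟩)
  · rintro ⟨m, h, rfl⟩
    rw [List.getElem?_ofFn] at h
    split_ifs at h with hm
    obtain ⟨i, hi⟩ := (shuffleLetters_eq_true σ _).1 (Option.some.inj h)
    exact ⟨i, by simp [hi]⟩

theorem ofFn_right {p q : ℕ} {σ : Equiv.Perm (Fin (p + q))} (hσ : IsShuffle σ) :
    List.ofFn (fun j : Fin q => (σ (Fin.natAdd p j) : ℕ)) =
      positions false 0 (List.ofFn (shuffleLetters σ)) := by
  refine List.Pairwise.eq_of_mem_iff (r := (· < ·)) (List.pairwise_ofFn.2 fun i j h => hσ.2 h)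
    (positions_pairwise _ _ _) fun x => ?_
  rw [List.mem_ofFn, mem_positions]
  constructor
  · rintro ⟨i, rfl⟩
    refine ⟨σ (Fin.natAdd p i), ?_, by simp⟩
    rw [List.getElem?_ofFn, dif_pos (σ (Fin.natAdd p i)).2]
    exact congrArg some ((shuffleLetters_eq_false σ _).2 ⟨i, rfl⟩)
  · rintro ⟨m, h, rfl⟩
    rw [List.getElem?_ofFn] at h
    split_ifs at h with hm
    obtain ⟨i, hi⟩ := (shuffleLetters_eq_false σ _).1 (Option.some.inj h)
    exact ⟨i, by simp [hi]⟩

theorem count_shuffleLetters {p q : ℕ} {σ : Equiv.Perm (Fin (p + q))} (hσ : IsShuffle σ) :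
    (List.ofFn (shuffleLetters σ)).count true = p := by
  rw [← length_positions true 0, ← ofFn_left hσ, List.length_ofFn]

/-- A shuffle is increasing on each block, so an inversion pairs one of the first `p` elements with
one of the last `q`: a `true` standing after a `false`. -/
theorem sign_shuffle {p q : ℕ} {σ : Equiv.Perm (Fin (p + q))} (hσ : IsShuffle σ) :
    (Equiv.Perm.sign σ : ℤ) = wordSign (List.ofFn (shuffleLetters σ)) := by
  have h1 : (Equiv.Perm.sign σ : ℤ) = ∏ j, ∏ i, if i < j ∧ ¬ σ i < σ j then (-1 : ℤ) else 1 := by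
    rw [Equiv.Perm.sign_eq_prod_prod_Iio, Units.coe_prod]
    refine Finset.prod_congr rfl fun j _ => ?_
    rw [Units.coe_prod, ← Finset.prod_subset (Finset.subset_univ (Finset.Iio j))]
    · refine Finset.prod_congr rfl fun i hi => ?_
      have := Finset.mem_Iio.1 hi
      by_cases h : σ i < σ j <;> simp [h, this]
    · intro i _ hi
      rw [Finset.mem_Iio] at hi
      rw [if_neg (fun h => hi h.1)]
  rw [h1, wordSign_eq_positions 0, ← ofFn_left hσ, ← ofFn_right hσ, List.map_ofFn, List.prod_ofFn,
    Fin.prod_univ_add, Finset.prod_eq_one, one_mul]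
  · refine Finset.prod_congr rfl fun j _ => ?_
    rw [Function.comp_apply, List.map_ofFn, List.prod_ofFn, Fin.prod_univ_add, mul_comm,
      Finset.prod_eq_one, one_mul]
    · refine Finset.prod_congr rfl fun i _ => ?_
      have h : Fin.castAdd q i < Fin.natAdd p j := by
        rw [Fin.lt_def, Fin.val_castAdd, Fin.val_natAdd]
        omega
      simp only [Function.comp_apply, Fin.val_fin_lt]
      by_cases h2 : σ (Fin.castAdd q i) < σ (Fin.natAdd p j) <;> simp [h, h2]
    · intro i _
      rw [if_neg]
      rintro ⟨h, h2⟩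
      exact h2 (hσ.2 ((Fin.natAdd_lt_natAdd_iff p).1 h))
  · intro j _
    rw [Fin.prod_univ_add, Finset.prod_eq_one, Finset.prod_eq_one, one_mul]
    · intro i _
      rw [if_neg]
      rintro ⟨h, _⟩
      rw [Fin.lt_def, Fin.val_castAdd, Fin.val_natAdd] at h
      omega
    · intro i _
      rw [if_neg]
      rintro ⟨h, h2⟩
      exact h2 (hσ.1 h)

theorem shuffleLetters_injOn {p q : ℕ} {σ τ : Equiv.Perm (Fin (p + q))} (hσ : IsShuffle σ)
    (hτ : IsShuffle τ) (h : shuffleLetters σ = shuffleLetters τ) : σ = τ := by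
  have h1 := (ofFn_left hσ).trans ((congrArg _ (congrArg _ h)).trans (ofFn_left hτ).symm)
  have h2 := (ofFn_right hσ).trans ((congrArg _ (congrArg _ h)).trans (ofFn_right hτ).symm)
  refine Equiv.ext fun m => Fin.ext ?_
  induction m using Fin.addCases with
  | left i => exact congrFun (List.ofFn_injective h1) i
  | right j => exact congrFun (List.ofFn_injective h2) j

/-- The increasing enumerations of the places of `true` and of `false` are the two blocks of the
permutation. -/
theorem exists_shuffle {p q : ℕ} (g : Fin (p + q) → Bool) (hg : (List.ofFn g).count true = p) :
    ∃ σ : Equiv.Perm (Fin (p + q)), IsShuffle σ ∧ shuffleLetters σ = g := by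
  let s : Finset (Fin (p + q)) := Finset.univ.filter fun i => g i = true
  have hs : s.card = p := (count_ofFn true _ g).symm.trans hg
  have hs' : sᶜ.card = q := by rw [Finset.card_compl, hs, Fintype.card_fin]; omega
  let σ : Equiv.Perm (Fin (p + q)) := finSumFinEquiv.symm.trans (finSumEquivOfFinset hs hs')
  have hl : ∀ i, σ (Fin.castAdd q i) = s.orderEmbOfFin hs i := fun i => by
    simp only [σ, Equiv.trans_apply, finSumFinEquiv_symm_apply_castAdd, finSumEquivOfFinset_inl]
  have hr : ∀ j, σ (Fin.natAdd p j) = sᶜ.orderEmbOfFin hs' j := fun j => by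
    simp only [σ, Equiv.trans_apply, finSumFinEquiv_symm_apply_natAdd, finSumEquivOfFinset_inr]
  refine ⟨σ, ⟨fun i j h => ?_, fun i j h => ?_⟩, ?_⟩
  · simp only [hl]
    exact (s.orderEmbOfFin hs).strictMono h
  · simp only [hr]
    exact (sᶜ.orderEmbOfFin hs').strictMono h
  · funext m
    obtain ⟨l, rfl⟩ := σ.surjective m
    induction l using Fin.addCases with
    | left i =>
      rw [(shuffleLetters_eq_true σ _).2 ⟨i, rfl⟩, hl]
      exact (Finset.mem_filter.1 (s.orderEmbOfFin_mem hs i)).2.symm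
    | right j =>
      rw [(shuffleLetters_eq_false σ _).2 ⟨j, rfl⟩, hr]
      have h := Finset.mem_compl.1 (sᶜ.orderEmbOfFin_mem hs' j)
      rw [Finset.mem_filter] at h
      symm
      simpa using h

namespace CyclicModule

variable {k : Type w} [CommRing k] (C C' : CyclicModule.{u, w} k)

theorem act_eq_foldl (m : ℕ) (w : List Bool) (z : ∀ n, C.X n) :
    C.act m w z = (positions false m w).foldl (fun z j => C.gS j z) z := by
  induction w generalizing m z with
  | nil => rfl
  | cons a w ih =>
    cases a
    · exact ih (m + 1) (C.gS m z)
    · exact ih (m + 1) z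

theorem gS_hom (n j : ℕ) (hj : j ≤ n) (x : C.X n) :
    C.gS j (C.hom n x) = C.hom (n + 1) (C.s n j x) := by
  refine C.hom_ext (fun l hl => ?_) ?_
  · rcases l with _ | l
    · rfl
    · simp only [gS]
      rw [C.hom_of_ne (by omega), map_zero, ite_self]
  · simp only [gS]
    rw [hom_self, if_pos hj]

theorem foldl_hom (q p : ℕ) (f : Fin q → ℕ) (hb : ∀ j, f j ≤ p + j) (x : C.X p) :
    (List.ofFn f).foldl (fun z j => C.gS j z) (C.hom p x) = C.hom (p + q) (C.degs q p f x) := by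
  induction q with
  | zero => rfl
  | succ q ih =>
    rw [List.ofFn_succ', List.concat_eq_append, List.foldl_append, ih _ fun j => hb j.castSucc]
    exact C.gS_hom (p + q) (f (Fin.last q)) (hb (Fin.last q)) _

theorem hom_castX {m n : ℕ} (h : m = n) (x : C.X m) : C.hom m x n = C.castX h x := by
  subst h
  exact C.hom_self m x

/-- The images of the last `q` elements are the places of `false`, where the first factor is
degenerate; the images of the first `p` are the places of `true`, where the second factor is. -/
theorem shuffleTerm_eq {p q n : ℕ} (h : p + q = n) {σ : Equiv.Perm (Fin (p + q))}
    (hσ : IsShuffle σ) (x : C.X p) (y : C'.X q) :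
    (C.diag C').cls n (C.shuffleTerm C' h σ x y) =
      C.shev C' n (List.ofFn (shuffleLetters σ)) (C.hom p x) (C'.hom q y) := by
  have hx : C.act 0 (List.ofFn (shuffleLetters σ)) (C.hom p x) n =
      C.castX h (C.degs q p (fun j => σ (Fin.natAdd p j)) x) := by
    rw [act_eq_foldl, ← ofFn_right hσ, C.foldl_hom q p (fun j => σ (Fin.natAdd p j))
      (le_of_strictMono_bound p q (fun j => σ (Fin.natAdd p j)) hσ.2 fun j => (σ _).2), C.hom_castX h]
  have hy : C'.act 0 (wflip (List.ofFn (shuffleLetters σ))) (C'.hom q y) n =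
      C'.castX ((Nat.add_comm q p).trans h) (C'.degs p q (fun i => σ (Fin.castAdd q i)) y) := by
    rw [act_eq_foldl, positions_wflip, Bool.not_false, ← ofFn_left hσ,
      C'.foldl_hom p q (fun i => σ (Fin.castAdd q i))
      (le_of_strictMono_bound q p (fun i => σ (Fin.castAdd q i)) hσ.1 fun i => by
        have := (σ (Fin.castAdd q i)).2
        omega), C'.hom_castX ((Nat.add_comm q p).trans h)]
  rw [shev, ev, hx, hy]
  rfl

/-- The shuffle product as a sum over words. -/
theorem shuffleSum_eq {p q n : ℕ} (h : p + q = n) (A : Equiv.Perm (Fin (p + q)) → Prop)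
    (c : List Bool → ℤ)
    (hc : ∀ σ, IsShuffle σ → c (List.ofFn (shuffleLetters σ)) = open Classical in
      if A σ then wordSign (List.ofFn (shuffleLetters σ)) else 0) (x : C.X p) (y : C'.X q) :
    C.shuffleSum C' h A x y = wsum n fun w => c w • C.shev C' n w (C.hom p x) (C'.hom q y) := by
  classical
  have h1 : C.shuffleSum C' h A x y = ∑ σ ∈ Finset.univ.filter (fun σ : Equiv.Perm (Fin (p + q)) =>
      IsShuffle σ),
      c (List.ofFn (shuffleLetters σ)) •
        C.shev C' n (List.ofFn (shuffleLetters σ)) (C.hom p x) (C'.hom q y) := by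
    rw [shuffleSum, LinearMap.sum_apply, LinearMap.sum_apply, Finset.sum_filter]
    refine Finset.sum_congr rfl fun σ _ => ?_
    by_cases hσ : IsShuffle σ
    · rw [if_pos hσ, hc σ hσ]
      by_cases hA : A σ
      · rw [if_pos ⟨hσ, hA⟩, if_pos hA, ← sign_shuffle hσ, ← C.shuffleTerm_eq C' h hσ]
        rfl
      · rw [if_neg (fun h => hA h.2), if_neg hA, zero_smul]
        rfl
    · rw [if_neg (fun h => hσ h.1), if_neg hσ]
      rfl
  rw [h1, wsum_eq_sum]
  subst h
  -- Words with exactly `p` letters `true` correspond to shuffles; the others are added for free, as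
  -- their shuffle terms are zero.
  rw [← Finset.sum_subset (Finset.subset_univ
    (Finset.univ.filter fun g : Fin (p + q) → Bool => (List.ofFn g).count true = p))]
  · refine Finset.sum_nbij shuffleLetters (fun σ hσ => ?_) (fun σ hσ τ hτ h => ?_) (fun g hg => ?_)
      fun _ _ => rfl
    · exact Finset.mem_filter.2 ⟨Finset.mem_univ _,
        count_shuffleLetters (Finset.mem_filter.1 hσ).2⟩
    · exact shuffleLetters_injOn (Finset.mem_filter.1 hσ).2 (Finset.mem_filter.1 hτ).2 h
    · obtain ⟨σ, hσ, rfl⟩ := exists_shuffle g (Finset.mem_filter.1 hg).2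
      exact ⟨σ, Finset.mem_filter.2 ⟨Finset.mem_univ _, hσ⟩, rfl⟩
  · intro g _ hg
    have hg' : (List.ofFn g).count true ≠ p := fun h => hg (Finset.mem_filter.2 ⟨Finset.mem_univ _, h⟩)
    rw [C.shev_eq_zero_left C' _ _ (List.length_ofFn) p _ _ (fun l hl => C.hom_of_ne hl x) hg',
      smul_zero]

theorem sh_cls {p q n : ℕ} (h : p + q = n) (x : C.X p) (y : C'.X q) :
    C.sh C' h (C.cls p x ⊗ₜ C'.cls q y) = C.fsh C' n (C.hom p x) (C'.hom q y) := by
  refine (C.normDesc_tmul C' _ _ _ x y).trans ?_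
  exact C.shuffleSum_eq C' h _ wordSign (fun σ _ => by simp) x y

theorem shuffleSum_lt {p q n : ℕ} (h : p + q = n) (i : Fin p) (j : Fin q) (x : C.X p) (y : C'.X q) :
    C.shuffleSum C' h (fun σ => σ (Fin.castAdd q i) < σ (Fin.natAdd p j)) x y =
      C.psh C' i j n (C.hom p x) (C'.hom q y) := by
  refine C.shuffleSum_eq C' h _ (condSign i j) (fun σ hσ => ?_) x y
  have hl := List.length_ofFn (f := shuffleLetters σ)
  have h1 := count_true_add_count_false (List.ofFn (shuffleLetters σ))
  have h2 := count_shuffleLetters hσ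
  rw [condSign, precedes_eq_positions i j 0 _ (by omega) (by omega)]
  simp only [← ofFn_left hσ, ← ofFn_right hσ, List.getElem_ofFn, decide_eq_true_eq]
  simp only [Fin.eta, Fin.val_fin_lt]
  split_ifs <;> rfl

theorem sh'_cls {p q n : ℕ} (h : p + q + 2 = n) (x : C.X p) (y : C'.X q) :
    C.sh' C' h (C.cls p x ⊗ₜ C'.cls q y) = C.csh C' n p q x y := by
  rw [sh', LinearMap.smul_apply, LinearMap.sum_apply, csh, Finset.sum_range]
  congr 1
  refine Finset.sum_congr rfl fun i _ => ?_
  rw [LinearMap.sum_apply, Finset.sum_range]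
  refine Finset.sum_congr rfl fun j _ => ?_
  rw [LinearMap.smul_apply]
  refine congrArg _ ((C.normDesc_tmul C' _ _ _ x y).trans ?_)
  exact C.shuffleSum_lt C' _ i j _ _

end CyclicModule
end HopfCyclic

/-! ### The shuffle map of total complexes is a chain map -/

namespace HopfCyclic
namespace CyclicModule

variable {k : Type w} [CommRing k] (C C' : CyclicModule.{u, w} k)

theorem b_cls (n : ℕ) (x : C.X (n + 1)) :
    C.normalized.b n (C.cls (n + 1) x) =
      ∑ a ∈ Finset.range (n + 2), (-1 : ℤ) ^ a • C.cls n (C.d n a x) := by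
  have h : C.normalized.b n (C.cls (n + 1) x) = C.cls n (C.b n x) := rfl
  rw [h, b_apply, map_sum]
  exact Finset.sum_congr rfl fun a _ => map_zsmul _ _ _

section Linear

variable {P Q R : Type*} [AddCommGroup P] [Module k P] [AddCommGroup Q] [Module k Q]
  [AddCommGroup R] [Module k R] (φ : P ⊗[k] Q →ₗ[k] R)

theorem map_sum_smul_tmul (s : Finset ℕ) (c : ℕ → ℤ) (f : ℕ → P) (y : Q) :
    φ ((∑ a ∈ s, c a • f a) ⊗ₜ y) = ∑ a ∈ s, c a • φ (f a ⊗ₜ y) := by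
  rw [TensorProduct.sum_tmul, map_sum]
  exact Finset.sum_congr rfl fun a _ => map_zsmul (φ ∘ₗ (TensorProduct.mk k P Q).flip y) _ _

theorem map_tmul_sum_smul (s : Finset ℕ) (c : ℕ → ℤ) (x : P) (f : ℕ → Q) :
    φ (x ⊗ₜ ∑ a ∈ s, c a • f a) = ∑ a ∈ s, c a • φ (x ⊗ₜ f a) := by
  rw [TensorProduct.tmul_sum, map_sum]
  exact Finset.sum_congr rfl fun a _ => map_zsmul (φ ∘ₗ TensorProduct.mk k P Q x) _ _

end Linear

theorem sh_b_left {p q n : ℕ} (h : p + q = n) (x : C.X (p + 1)) (y : C'.X q) :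
    C.sh C' h (C.normalized.b p (C.cls (p + 1) x) ⊗ₜ C'.cls q y) =
      ∑ a ∈ Finset.range (p + 2), (-1 : ℤ) ^ a •
        C.fsh C' n (C.hom p (C.d p a x)) (C'.hom q y) := by
  simp only [b_cls, map_sum_smul_tmul, sh_cls]

theorem sh_b_right {p q n : ℕ} (h : p + q = n) (x : C.X p) (y : C'.X (q + 1)) :
    C.sh C' h (C.cls p x ⊗ₜ C'.normalized.b q (C'.cls (q + 1) y)) =
      ∑ a ∈ Finset.range (q + 2), (-1 : ℤ) ^ a •
        C.fsh C' n (C.hom p x) (C'.hom q (C'.d q a y)) := by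
  simp only [b_cls, map_tmul_sum_smul, sh_cls]

theorem sh_B_left {p q n : ℕ} (h : p + 1 + q = n) (x : C.X p) (y : C'.X q) :
    C.sh C' h (C.normalized.B p (C.cls p x) ⊗ₜ C'.cls q y) =
      ∑ i ∈ Finset.range (p + 1), (-1 : ℤ) ^ (p * i) •
        C.fsh C' n (C.ext p i x) (C'.hom q y) := by
  simp only [B_cls, map_sum_smul_tmul, sh_cls, ext]

theorem sh_B_right {p q n : ℕ} (h : p + (q + 1) = n) (x : C.X p) (y : C'.X q) :
    C.sh C' h (C.cls p x ⊗ₜ C'.normalized.B q (C'.cls q y)) =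
      ∑ j ∈ Finset.range (q + 1), (-1 : ℤ) ^ (q * j) •
        C.fsh C' n (C.hom p x) (C'.ext q j y) := by
  simp only [B_cls, map_tmul_sum_smul, sh_cls, ext]

theorem sh'_b_left {p q n : ℕ} (h : p + q + 2 = n) (x : C.X (p + 1)) (y : C'.X q) :
    C.sh' C' h (C.normalized.b p (C.cls (p + 1) x) ⊗ₜ C'.cls q y) =
      C.innerLeft C' n (p + 1) q x y := by
  simp only [b_cls, map_sum_smul_tmul, sh'_cls, innerLeft_succ]

theorem sh'_b_right {p q n : ℕ} (h : p + q + 2 = n) (x : C.X p) (y : C'.X (q + 1)) :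
    (-1 : ℤ) ^ p • C.sh' C' h (C.cls p x ⊗ₜ C'.normalized.b q (C'.cls (q + 1) y)) =
      C.innerRight C' n p (q + 1) x y := by
  simp only [b_cls, map_tmul_sum_smul, sh'_cls, innerRight_succ]

theorem b_sh {p q n : ℕ} (h : p + q = n + 1) (x : C.X p) (y : C'.X q) :
    (C.diag C').normalized.b n (C.sh C' h (C.cls p x ⊗ₜ C'.cls q y)) =
      ∑ c ∈ Finset.range (p + 1), (-1 : ℤ) ^ c • C.fsh C' n (C.gD c (C.hom p x)) (C'.hom q y) +
      (-1 : ℤ) ^ p • ∑ c ∈ Finset.range (q + 1), (-1 : ℤ) ^ c •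
        C.fsh C' n (C.hom p x) (C'.gD c (C'.hom q y)) := by
  rw [sh_cls]
  exact C.b_shuffle C' n p q (fun l hl => C.hom_of_ne hl x) (fun l hl => C'.hom_of_ne hl y)

theorem fsh_zero_left (n : ℕ) (z' : ∀ n, C'.X n) : C.fsh C' n 0 z' = 0 := by
  rw [fsh, wsum_congr (g := fun _ => 0), wsum_zero]
  intro w hw
  have h := count_true_add_count_false w
  -- The zero element counts as concentrated in degree `n + 1`, and no word of length `n` has `n +
  -- 1` letters `true`.
  rw [C.shev_eq_zero_left C' n w hw (n + 1) 0 z' (fun _ _ => rfl) (by omega), smul_zero]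

theorem fsh_zero_right (n : ℕ) (z : ∀ n, C.X n) : C.fsh C' n z 0 = 0 := by
  rw [fsh, wsum_congr (g := fun _ => 0), wsum_zero]
  intro w hw
  have h := count_true_add_count_false w
  rw [C.shev_eq_zero_right C' n w hw (n + 1) z 0 (fun _ _ => rfl) (by omega), smul_zero]

theorem gD_hom_zero (c : ℕ) (x : C.X 0) : C.gD c (C.hom 0 x) = 0 :=
  funext fun n => C.gD_eq_zero (fun _ hl => C.hom_of_ne hl x) c n (by omega)

theorem sum_gD_left (p n : ℕ) (x : C.X (p + 1)) (z' : ∀ n, C'.X n) :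
    ∑ c ∈ Finset.range (p + 1 + 1), (-1 : ℤ) ^ c • C.fsh C' n (C.gD c (C.hom (p + 1) x)) z' =
      ∑ c ∈ Finset.range (p + 2), (-1 : ℤ) ^ c • C.fsh C' n (C.hom p (C.d p c x)) z' :=
  Finset.sum_congr rfl fun c hc => by
    rw [gD_hom C p c (by have := Finset.mem_range.1 hc; omega)]

theorem sum_gD_right (q n : ℕ) (z : ∀ n, C.X n) (y : C'.X (q + 1)) :
    ∑ c ∈ Finset.range (q + 1 + 1), (-1 : ℤ) ^ c • C.fsh C' n z (C'.gD c (C'.hom (q + 1) y)) =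
      ∑ c ∈ Finset.range (q + 2), (-1 : ℤ) ^ c • C.fsh C' n z (C'.hom q (C'.d q c y)) :=
  Finset.sum_congr rfl fun c hc => by
    rw [gD_hom C' q c (by have := Finset.mem_range.1 hc; omega)]

/-- The shuffle maps, on the tensor product of the normalized complexes. -/
noncomputable def shAll (n : ℕ) :
    (C.normalized.tensor C'.normalized).X n →ₗ[k] (C.diag C').normalized.X n :=
  C.normalized.tensorDesc C'.normalized n fun i j => if h : i + j = n then C.sh C' h else 0

/-- The cyclic shuffle maps, on the tensor product of the normalized complexes. -/
noncomputable def shAll' (n : ℕ) :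
    (C.normalized.tensor C'.normalized).X n →ₗ[k] (C.diag C').normalized.X (n + 2) :=
  C.normalized.tensorDesc C'.normalized n fun i j =>
    if h : i + j + 2 = n + 2 then C.sh' C' h else 0

theorem shAll_tensIn {n i j : ℕ} (h : i + j = n) (z : C.normalized.X i ⊗[k] C'.normalized.X j) :
    C.shAll C' n (C.normalized.tensIn C'.normalized n i j z) = C.sh C' h z := by
  rw [shAll, MixedComplex.tensorDesc_tensIn h, dif_pos h]

theorem shAll'_tensIn {n i j : ℕ} (h : i + j + 2 = n + 2)
    (z : C.normalized.X i ⊗[k] C'.normalized.X j) :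
    C.shAll' C' n (C.normalized.tensIn C'.normalized n i j z) = C.sh' C' h z := by
  rw [shAll', MixedComplex.tensorDesc_tensIn (show i + j = n by omega), dif_pos h]

theorem tensor_ext_cls {P : Type*} [AddCommGroup P] [Module k P] {n : ℕ}
    {f g : (C.normalized.tensor C'.normalized).X n →ₗ[k] P}
    (h : ∀ i j, i + j = n → ∀ (x : C.X i) (y : C'.X j),
      f (C.normalized.tensIn C'.normalized n i j (C.cls i x ⊗ₜ C'.cls j y)) =
        g (C.normalized.tensIn C'.normalized n i j (C.cls i x ⊗ₜ C'.cls j y)))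
    (z : (C.normalized.tensor C'.normalized).X n) : f z = g z := by
  refine congrArg (fun e : (C.normalized.tensor C'.normalized).X n →ₗ[k] P => e z)
    (MixedComplex.tensor_ext fun i j hij x y => ?_)
  obtain ⟨x, rfl⟩ := C.cls_surjective i x
  obtain ⟨y, rfl⟩ := C'.cls_surjective j y
  exact h i j hij x y

/-- This is `b_shuffle` in terms of the tensor product. The cases with a factor of degree `0` are
separate because the tensor boundary has no component there, which the default zero of the face
matches. -/
theorem b_shAll (n : ℕ) (z : (C.normalized.tensor C'.normalized).X (n + 1)) :
    (C.diag C').normalized.b n (C.shAll C' (n + 1) z) =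
      C.shAll C' n ((C.normalized.tensor C'.normalized).b n z) := by
  refine tensor_ext_cls C C' (f := (C.diag C').normalized.b n ∘ₗ C.shAll C' (n + 1))
    (g := C.shAll C' n ∘ₗ (C.normalized.tensor C'.normalized).b n) (fun i j hij x y => ?_) z
  rw [LinearMap.comp_apply, LinearMap.comp_apply, shAll_tensIn C C' hij, b_sh]
  rcases i with _ | i <;> rcases j with _ | j
  · omega
  · rw [MixedComplex.tensor_b_zero_succ, shAll_tensIn C C' (by omega), sh_b_right, sum_gD_right,
      Finset.sum_range_one, gD_hom_zero, fsh_zero_left, smul_zero, zero_add, pow_zero, one_smul]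
  · rw [MixedComplex.tensor_b_succ_zero, shAll_tensIn C C' (by omega), sh_b_left, sum_gD_left,
      Finset.sum_range_one, gD_hom_zero, fsh_zero_right, smul_zero, smul_zero, add_zero]
  · rw [MixedComplex.tensor_b_succ_succ, map_add, map_zsmul, shAll_tensIn C C' (by omega),
      shAll_tensIn C C' (by omega), sh_b_left, sh_b_right, sum_gD_left, sum_gD_right]

/-- The lowest degree of the next relation, in which `sh' b` has no source. -/
theorem b_shAll'_zero (z : (C.normalized.tensor C'.normalized).X 0) :
    (C.diag C').normalized.b 1 (C.shAll' C' 0 z) + (C.diag C').normalized.B 0 (C.shAll C' 0 z) =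
      C.shAll C' 1 ((C.normalized.tensor C'.normalized).B 0 z) := by
  refine tensor_ext_cls C C'
    (f := (C.diag C').normalized.b 1 ∘ₗ C.shAll' C' 0 + (C.diag C').normalized.B 0 ∘ₗ C.shAll C' 0)
    (g := C.shAll C' 1 ∘ₗ (C.normalized.tensor C'.normalized).B 0) (fun i j hij x y => ?_) z
  simp only [LinearMap.comp_apply, LinearMap.add_apply]
  rw [shAll_tensIn C C' hij, shAll'_tensIn C C' (by omega), sh_cls, sh'_cls, b_csh C C' i j 0 hij,
    MixedComplex.tensor_B_tensIn, map_add, map_zsmul, shAll_tensIn C C' (by omega),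
    shAll_tensIn C C' (by omega), sh_B_left, sh_B_right]
  obtain rfl : i = 0 := by omega
  obtain rfl : j = 0 := by omega
  rw [innerLeft_zero, innerRight_zero]
  abel

/-- The coefficient of `v^(m-1)` in the chain map condition on `v^m z`. It is `b_csh` with the four
groups of faces named as `sh B` and `sh' b`. -/
theorem b_shAll' (n : ℕ) (z : (C.normalized.tensor C'.normalized).X (n + 1)) :
    (C.diag C').normalized.b (n + 2) (C.shAll' C' (n + 1) z) +
        (C.diag C').normalized.B (n + 1) (C.shAll C' (n + 1) z) =
      C.shAll' C' n ((C.normalized.tensor C'.normalized).b n z) +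
        C.shAll C' (n + 2) ((C.normalized.tensor C'.normalized).B (n + 1) z) := by
  refine tensor_ext_cls C C'
    (f := (C.diag C').normalized.b (n + 2) ∘ₗ C.shAll' C' (n + 1) +
      (C.diag C').normalized.B (n + 1) ∘ₗ C.shAll C' (n + 1))
    (g := C.shAll' C' n ∘ₗ (C.normalized.tensor C'.normalized).b n +
      C.shAll C' (n + 2) ∘ₗ (C.normalized.tensor C'.normalized).B (n + 1)) (fun i j hij x y => ?_) z
  simp only [LinearMap.comp_apply, LinearMap.add_apply]
  rw [shAll_tensIn C C' hij, shAll'_tensIn C C' (by omega), sh_cls, sh'_cls,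
    b_csh C C' i j (n + 1) hij,
    MixedComplex.tensor_B_tensIn, map_add, map_zsmul, shAll_tensIn C C' (by omega),
    shAll_tensIn C C' (by omega), sh_B_left, sh_B_right]
  rcases i with _ | i <;> rcases j with _ | j
  · omega
  · rw [MixedComplex.tensor_b_zero_succ, shAll'_tensIn C C' (by omega), innerLeft_zero,
      ← sh'_b_right C C' (by omega), pow_zero, one_smul, one_smul]
    abel
  · rw [MixedComplex.tensor_b_succ_zero, shAll'_tensIn C C' (by omega), innerRight_zero, sh'_b_left]
    abel
  · rw [MixedComplex.tensor_b_succ_succ, map_add, map_zsmul, shAll'_tensIn C C' (by omega),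
      shAll'_tensIn C C' (by omega), ← sh'_b_right C C' (by omega), sh'_b_left]
    abel

/-- Together with `shAll'_B` this settles the coefficient of `v^(m-2)`, where `B sh'` has to equal
`sh' B`. -/
theorem B_shAll' (n : ℕ) (z : (C.normalized.tensor C'.normalized).X n) :
    (C.diag C').normalized.B (n + 2) (C.shAll' C' n z) = 0 := by
  refine tensor_ext_cls C C' (f := (C.diag C').normalized.B (n + 2) ∘ₗ C.shAll' C' n) (g := 0)
    (fun i j hij x y => ?_) z
  subst hij
  rw [LinearMap.comp_apply, shAll'_tensIn C C' rfl, sh'_cls, B_csh, LinearMap.zero_apply]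

theorem extRot_extRot_mem (p c i : ℕ) (hc : c ≤ p + 1) (x : C.X p) :
    C.extRot (p + 1) c (C.extRot p i x) ∈ C.degenerate (p + 2) := by
  obtain ⟨x', h⟩ := C.extRot_extRot p c i hc x
  rw [h]
  exact C.s_mem _ _ hc _

/-- Every partial shuffle in the sum has first argument `s_{-1} t^c s_{-1} tⁱ x`, which is
degenerate. -/
theorem csh_extRot_left (p q n i : ℕ) (h : p + 1 + q + 2 = n) (x : C.X p) (y : C'.X q) :
    C.csh C' n (p + 1) q (C.extRot p i x) y = 0 := by
  rw [csh, Finset.sum_eq_zero, smul_zero]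
  intro c hc
  refine Finset.sum_eq_zero fun j hj => ?_
  -- Back from words to permutations, where partial shuffle sums are known to vanish on degenerate
  -- arguments.
  have hs := C.shuffleSum_lt C' (show p + 1 + 1 + (q + 1) = n by omega)
    ⟨c, Finset.mem_range.1 hc⟩ ⟨j, Finset.mem_range.1 hj⟩ (C.extRot (p + 1) c (C.extRot p i x))
    (C'.extRot q j y)
  rw [C.shuffleSum_left C' _ _ (C.extRot_extRot_mem p c i
    (by have := Finset.mem_range.1 hc; omega) x)] at hs
  exact (congrArg _ hs.symm).trans (smul_zero _)

theorem csh_extRot_right (p q n i : ℕ) (h : p + (q + 1) + 2 = n) (x : C.X p) (y : C'.X q) :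
    C.csh C' n p (q + 1) x (C'.extRot q i y) = 0 := by
  rw [csh, Finset.sum_eq_zero, smul_zero]
  intro c hc
  refine Finset.sum_eq_zero fun j hj => ?_
  have hs := C.shuffleSum_lt C' (show p + 1 + (q + 1 + 1) = n by omega)
    ⟨c, Finset.mem_range.1 hc⟩ ⟨j, Finset.mem_range.1 hj⟩ (C.extRot p c x)
    (C'.extRot (q + 1) j (C'.extRot q i y))
  rw [C.shuffleSum_right C' _ _ _ (C'.extRot_extRot_mem q j i
    (by have := Finset.mem_range.1 hj; omega) y)] at hs
  exact (congrArg _ hs.symm).trans (smul_zero _)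

/-- Besides the chain map property, this removes the second component of `S̃h` from the image of the
connecting homomorphism. -/
theorem sh'_B_left {p q n : ℕ} (h : p + 1 + q + 2 = n) (x : C.normalized.X p)
    (y : C'.normalized.X q) : C.sh' C' h (C.normalized.B p x ⊗ₜ y) = 0 := by
  obtain ⟨x, rfl⟩ := C.cls_surjective p x
  obtain ⟨y, rfl⟩ := C'.cls_surjective q y
  simp only [B_cls, map_sum_smul_tmul, sh'_cls, C.csh_extRot_left C' p q n _ h, smul_zero,
    Finset.sum_const_zero]

theorem sh'_B_right {p q n : ℕ} (h : p + (q + 1) + 2 = n) (x : C.normalized.X p)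
    (y : C'.normalized.X q) : C.sh' C' h (x ⊗ₜ C'.normalized.B q y) = 0 := by
  obtain ⟨x, rfl⟩ := C.cls_surjective p x
  obtain ⟨y, rfl⟩ := C'.cls_surjective q y
  simp only [B_cls, map_tmul_sum_smul, sh'_cls, C.csh_extRot_right C' p q n _ h, smul_zero,
    Finset.sum_const_zero]

theorem shAll'_B (n : ℕ) (z : (C.normalized.tensor C'.normalized).X n) :
    C.shAll' C' (n + 1) ((C.normalized.tensor C'.normalized).B n z) = 0 := by
  refine tensor_ext_cls C C' (f := C.shAll' C' (n + 1) ∘ₗ (C.normalized.tensor C'.normalized).B n)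
    (g := 0) (fun i j hij x y => ?_) z
  rw [LinearMap.comp_apply, MixedComplex.tensor_B_tensIn, map_add, map_zsmul,
    shAll'_tensIn C C' (by omega), shAll'_tensIn C C' (by omega), sh'_B_left, sh'_B_right,
    smul_zero, add_zero, LinearMap.zero_apply]

theorem shTot_zero (n Q : ℕ) (z : (C.normalized.tensor C'.normalized).X Q) :
    C.shTot C' n ((C.normalized.tensor C'.normalized).totIn n 0 Q z) =
      (C.diag C').normalized.totIn n 0 Q (C.shAll C' Q z) := by
  by_cases h : 2 * 0 + Q = n
  · rw [shTot, MixedComplex.totDesc_totIn _ h]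
    refine tensor_ext_cls C C' (g := (C.diag C').normalized.totIn n 0 Q ∘ₗ C.shAll C' Q)
      (fun i j hij x y => ?_) z
    subst hij
    rw [MixedComplex.tensorDesc_tensIn rfl, LinearMap.comp_apply, shAll_tensIn C C' rfl]
    exact add_zero _
  · rw [MixedComplex.totIn_of_ne _ h, MixedComplex.totIn_of_ne _ h, map_zero]

theorem shTot_succ (n m Q : ℕ) (z : (C.normalized.tensor C'.normalized).X Q) :
    C.shTot C' n ((C.normalized.tensor C'.normalized).totIn n (m + 1) Q z) =
      (C.diag C').normalized.totIn n (m + 1) Q (C.shAll C' Q z) +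
        (C.diag C').normalized.totIn n m (Q + 2) (C.shAll' C' Q z) := by
  by_cases h : 2 * (m + 1) + Q = n
  · rw [shTot, MixedComplex.totDesc_totIn _ h]
    refine tensor_ext_cls C C' (g := (C.diag C').normalized.totIn n (m + 1) Q ∘ₗ C.shAll C' Q +
        (C.diag C').normalized.totIn n m (Q + 2) ∘ₗ C.shAll' C' Q)
      (fun i j hij x y => ?_) z
    subst hij
    rw [MixedComplex.tensorDesc_tensIn rfl]
    change _ = (C.diag C').normalized.totIn n (m + 1) (i + j) (C.shAll C' (i + j) _) +
      (C.diag C').normalized.totIn n m (i + j + 2) (C.shAll' C' (i + j) _)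
    rw [shAll_tensIn C C' rfl, shAll'_tensIn C C' rfl]
    rfl
  · rw [MixedComplex.totIn_of_ne _ h, MixedComplex.totIn_of_ne _ h,
      MixedComplex.totIn_of_ne _ (by omega), map_zero, add_zero]

/-- The shuffle map of total complexes is a chain map. -/
theorem totD_shTot (n : ℕ) (z : (C.normalized.tensor C'.normalized).Tot (n + 1)) :
    (C.diag C').normalized.totD n (C.shTot C' (n + 1) z) =
      C.shTot C' n ((C.normalized.tensor C'.normalized).totD n z) := by
  suffices h : (C.diag C').normalized.totD n ∘ₗ C.shTot C' (n + 1) =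
      C.shTot C' n ∘ₗ (C.normalized.tensor C'.normalized).totD n from congrArg (fun e => e z) h
  refine MixedComplex.tot_ext _ fun r Q _ x => ?_
  simp only [LinearMap.comp_apply, MixedComplex.totD, LinearMap.add_apply]
  -- The relations are solved for `b sh'`, so that they rewrite in one direction; the cases `r = 0`
  -- and `r = 1` lose the terms with a negative power of `v`.
  have hz (x) := eq_sub_of_add_eq (C.b_shAll'_zero C' x)
  have hs (Q x) := eq_sub_of_add_eq (C.b_shAll' C' Q x)
  rcases Q with _ | Q <;> rcases r with _ | _ | r <;>
    simp only [MixedComplex.totb_zero, MixedComplex.totB_zero, MixedComplex.totb_succ,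
      MixedComplex.totB_succ, shTot_zero, shTot_succ, map_add, map_sub, map_zero, add_zero,
      zero_add, b_shAll, B_shAll', shAll'_B, hz, hs] <;> try abel

end CyclicModule
end HopfCyclic

/-! ### The rearrangement as a map of cyclic modules -/

namespace HopfCyclic

section Tensor

variable {k : Type w} [Field k] {H K : Type u} [Ring H] [HopfAlgebra k H] [Ring K]
  [HopfAlgebra k K] {M N : Type u} [AddCommGroup M] [Module k M] [AddCommGroup N] [Module k N]

theorem mergeWords_mulFst (n : ℕ) (x : words k H M (n + 2)) (y : words k K N (n + 2)) :
    mergeWords (n + 1) (mulFst n x ⊗ₜ mulFst n y) = mulFst n (mergeWords (n + 2) (x ⊗ₜ y)) := by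
  refine words_ext_two ((TensorProduct.mk k _ _).flip (mulFst n y) |>.comp (mulFst n) |>
      (mergeWords (n + 1)).comp)
    (mulFst n ∘ₗ mergeWords (n + 2) ∘ₗ (TensorProduct.mk k _ _).flip y) (fun h₁ h₂ x => ?_) x
  refine words_ext_two (mergeWords (n + 1) ∘ₗ TensorProduct.mk k _ _ (mulFst n _) ∘ₗ mulFst n)
    (mulFst n ∘ₗ mergeWords (n + 2) ∘ₗ TensorProduct.mk k _ _ _) (fun g₁ g₂ y => ?_) y
  change mergeWords (n + 1) (mulFst n (cons (n + 1) h₁ (cons n h₂ x)) ⊗ₜ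
    mulFst n (cons (n + 1) g₁ (cons n g₂ y))) = mulFst n (mergeWords (n + 2)
      (cons (n + 1) h₁ (cons n h₂ x) ⊗ₜ cons (n + 1) g₁ (cons n g₂ y)))
  rw [mulFst_cons, mulFst_cons, mergeWords_cons, mergeWords_cons, mergeWords_cons, mulFst_cons,
    Algebra.TensorProduct.tmul_mul_tmul]

theorem mergeWords_swp (n : ℕ) (x : words k H M (n + 2)) (y : words k K N (n + 2)) :
    mergeWords (n + 2) (swp n x ⊗ₜ swp n y) = swp n (mergeWords (n + 2) (x ⊗ₜ y)) := by
  refine words_ext_two (mergeWords (n + 2) ∘ₗ (TensorProduct.mk k _ _).flip (swp n y) ∘ₗ swp n)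
    (swp n ∘ₗ mergeWords (n + 2) ∘ₗ (TensorProduct.mk k _ _).flip y) (fun h₁ h₂ x => ?_) x
  refine words_ext_two (mergeWords (n + 2) ∘ₗ TensorProduct.mk k _ _ (swp n _) ∘ₗ swp n)
    (swp n ∘ₗ mergeWords (n + 2) ∘ₗ TensorProduct.mk k _ _ _) (fun g₁ g₂ y => ?_) y
  change mergeWords (n + 2) (swp n (cons (n + 1) h₁ (cons n h₂ x)) ⊗ₜ
    swp n (cons (n + 1) g₁ (cons n g₂ y))) = swp n (mergeWords (n + 2)
      (cons (n + 1) h₁ (cons n h₂ x) ⊗ₜ cons (n + 1) g₁ (cons n g₂ y)))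
  simp only [swp_cons, mergeWords_cons]

theorem mergeWords_innerFace (n i : ℕ) (x : words k H M (n + 2)) (y : words k K N (n + 2)) :
    mergeWords (n + 1) (innerFace n i x ⊗ₜ innerFace n i y) =
      innerFace n i (mergeWords (n + 2) (x ⊗ₜ y)) := by
  rcases i with _ | i
  · simp only [innerFace_zero, mergeWords_mulFst]
  induction n generalizing i with
  | zero => simp [innerFace]
  | succ n ih =>
    induction x using words_induction with
    | h0 => simp
    | ha p q hp hq => simp only [map_add, TensorProduct.add_tmul, hp, hq]
    | hc h x =>
    induction y using words_induction with
    | h0 => simp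
    | ha p q hp hq => simp only [map_add, TensorProduct.tmul_add, hp, hq]
    | hc g y =>
      rw [innerFace_cons, innerFace_cons, mergeWords_cons, mergeWords_cons, innerFace_cons]
      rcases i with _ | i
      · simp only [innerFace_zero, mergeWords_mulFst]
      · rw [ih]

/-- The case of a single letter in `mergeWords_rot`: coproduct and action are both componentwise.
The outer `map id id` is what `mergeWords 1` unfolds to. -/
theorem map_tensorAct (a : H →ₐ[k] Module.End k M) (b : K →ₐ[k] Module.End k N)
    (p : H ⊗[k] H) (q : K ⊗[k] K) (m : M) (n : N) :
    TensorProduct.map LinearMap.id LinearMap.id (TensorProduct.tensorTensorTensorComm k H M K N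
      (TensorProduct.map LinearMap.id (TensorProduct.lift a.toLinearMap)
          (TensorProduct.assoc k H H M (p ⊗ₜ m)) ⊗ₜ
        TensorProduct.map LinearMap.id (TensorProduct.lift b.toLinearMap)
          (TensorProduct.assoc k K K N (q ⊗ₜ n)))) =
      TensorProduct.map LinearMap.id (TensorProduct.lift (tensorAct a b).toLinearMap)
        (TensorProduct.assoc k (H ⊗[k] K) (H ⊗[k] K) (M ⊗[k] N)
          (TensorProduct.tensorTensorTensorComm k H H K K (p ⊗ₜ q) ⊗ₜ[k] (m ⊗ₜ n))) := by
  induction p with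
  | zero => simp
  | add p q hp hq => simp only [map_add, TensorProduct.add_tmul, hp, hq]
  | tmul c d =>
    induction q with
    | zero => simp
    | add p q hp hq => simp only [map_add, TensorProduct.add_tmul, TensorProduct.tmul_add, hp, hq]
    | tmul e f => rfl

theorem mergeWords_rot (a : H →ₐ[k] Module.End k M) (b : K →ₐ[k] Module.End k N) (n : ℕ)
    (x : words k H M (n + 1)) (y : words k K N (n + 1)) :
    mergeWords (n + 1) (rot a n x ⊗ₜ rot b n y) =
      rot (tensorAct a b) n (mergeWords (n + 1) (x ⊗ₜ y)) := by
  induction n with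
  | zero =>
    induction x using words_induction with
    | h0 => simp
    | ha p q hp hq => simp only [map_add, TensorProduct.add_tmul, hp, hq]
    | hc h x =>
    induction y using words_induction with
    | h0 => simp
    | ha p q hp hq => simp only [map_add, TensorProduct.tmul_add, hp, hq]
    | hc g y =>
      exact map_tensorAct a b (Coalgebra.comul h) (Coalgebra.comul g) x y
  | succ n ih =>
    induction x using words_induction with
    | h0 => simp
    | ha p q hp hq => simp only [map_add, TensorProduct.add_tmul, hp, hq]
    | hc h x =>
    induction y using words_induction with
    | h0 => simp
    | ha p q hp hq => simp only [map_add, TensorProduct.tmul_add, hp, hq]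
    | hc g y =>
      rw [rot_cons, rot_cons, mergeWords_swp, mergeWords_cons, mergeWords_cons, rot_cons, ih]

theorem mergeWords_face (a : H →ₐ[k] Module.End k M) (b : K →ₐ[k] Module.End k N) (n i : ℕ)
    (x : words k H M (n + 2)) (y : words k K N (n + 2)) :
    mergeWords (n + 1) (face a n i x ⊗ₜ face b n i y) =
      face (tensorAct a b) n i (mergeWords (n + 2) (x ⊗ₜ y)) := by
  by_cases h : i ≤ n
  · simp only [face_of_le _ h, mergeWords_innerFace]
  · simp only [face, if_neg h, LinearMap.comp_apply, mergeWords_mulFst, mergeWords_rot]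

variable {hS : Function.Bijective (HopfAlgebra.antipode k (A := H))}
  {hT : Function.Bijective (HopfAlgebra.antipode k (A := K))}

theorem omegaInv_d (A : SAYD k H M hS) (B : SAYD k K N hT) (n i : ℕ)
    (q : (hopfCyclic A).X (n + 1) ⊗[k] (hopfCyclic B).X (n + 1)) :
    omegaInv A B n (TensorProduct.map ((hopfCyclic A).d n i) ((hopfCyclic B).d n i) q) =
      (hopfCyclic (A.tensor B)).d n i (omegaInv A B (n + 1) q) := by
  induction q with
  | zero => simp
  | add p q hp hq => simp only [map_add, hp, hq]
  | tmul x y => exact Subtype.ext (mergeWords_face A.act B.act n i x.1 y.1)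

theorem omegaInv_t (A : SAYD k H M hS) (B : SAYD k K N hT) (n : ℕ)
    (q : (hopfCyclic A).X n ⊗[k] (hopfCyclic B).X n) :
    omegaInv A B n (TensorProduct.map ((hopfCyclic A).t n) ((hopfCyclic B).t n) q) =
      (hopfCyclic (A.tensor B)).t n (omegaInv A B n q) := by
  induction q with
  | zero => simp
  | add p q hp hq => simp only [map_add, hp, hq]
  | tmul x y => exact Subtype.ext (mergeWords_rot A.act B.act n x.1 y.1)

end Tensor

namespace CyclicModule

variable {k : Type w} [CommRing k] {C C' : CyclicModule.{u, w} k}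

theorem map_b (f : ∀ m, C.X m →ₗ[k] C'.X m)
    (hd : ∀ m i x, f m (C.d m i x) = C'.d m i (f (m + 1) x)) (n : ℕ) (x : C.X (n + 1)) :
    f n (C.b n x) = C'.b n (f (n + 1) x) := by
  simp only [b_apply, sd_apply, map_sum, map_zsmul, hd]

theorem map_lam (f : ∀ m, C.X m →ₗ[k] C'.X m) (ht : ∀ m x, f m (C.t m x) = C'.t m (f m x))
    (n : ℕ) (x : C.X n) : f n (C.lam n x) = C'.lam n (f n x) := by
  rw [lam_apply, lam_apply, map_zsmul, ht]

theorem map_lam_pow (f : ∀ m, C.X m →ₗ[k] C'.X m) (ht : ∀ m x, f m (C.t m x) = C'.t m (f m x))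
    (n i : ℕ) (x : C.X n) : f n ((C.lam n ^ i) x) = (C'.lam n ^ i) (f n x) := by
  induction i with
  | zero => rfl
  | succ i ih =>
    rw [pow_succ', pow_succ', Module.End.mul_apply, Module.End.mul_apply, map_lam f ht, ih]

theorem map_B (f : ∀ m, C.X m →ₗ[k] C'.X m)
    (hs : ∀ m i x, f (m + 1) (C.s m i x) = C'.s m i (f m x))
    (ht : ∀ m x, f m (C.t m x) = C'.t m (f m x)) (n : ℕ) (x : C.X n) :
    f (n + 1) (C.B n x) = C'.B n (f n x) := by
  simp only [B_apply, map_sub, map_lam f ht, sExt, LinearMap.comp_apply, ht, hs, norm_apply,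
    map_sum, map_lam_pow f ht]

section TotMap

variable (f : ∀ m, C.X m →ₗ[k] C'.X m)
  (hs : ∀ m i x, f (m + 1) (C.s m i x) = C'.s m i (f m x))

theorem totMap_totIn (n r m : ℕ) (x : C.X m) :
    totMap f hs n (C.normalized.totIn n r m (C.cls m x)) =
      C'.normalized.totIn n r m (C'.cls m (f m x)) := by
  by_cases h : 2 * r + m = n
  · rw [totMap, MixedComplex.totDesc_totIn _ h]
    rfl
  · rw [MixedComplex.totIn_of_ne _ h, MixedComplex.totIn_of_ne _ h, map_zero]

theorem totD_totMap (hd : ∀ m i x, f m (C.d m i x) = C'.d m i (f (m + 1) x))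
    (ht : ∀ m x, f m (C.t m x) = C'.t m (f m x)) (n : ℕ) (z : C.normalized.Tot (n + 1)) :
    C'.normalized.totD n (totMap f hs (n + 1) z) = totMap f hs n (C.normalized.totD n z) := by
  suffices h : C'.normalized.totD n ∘ₗ totMap f hs (n + 1) =
      totMap f hs n ∘ₗ C.normalized.totD n from congrArg (fun e => e z) h
  have hb (D : CyclicModule.{u, w} k) (m) (x : D.X (m + 1)) :
      D.normalized.b m (D.cls (m + 1) x) = D.cls m (D.b m x) := rfl
  have hB (D : CyclicModule.{u, w} k) (m) (x : D.X m) :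
      D.normalized.B m (D.cls m x) = D.cls (m + 1) (D.B m x) := rfl
  refine MixedComplex.tot_ext _ fun r m _ x => ?_
  obtain ⟨x, rfl⟩ := C.cls_surjective m x
  simp only [LinearMap.comp_apply, MixedComplex.totD, LinearMap.add_apply]
  rcases m with _ | m <;> rcases r with _ | r <;>
    simp only [totMap_totIn, MixedComplex.totb_zero, MixedComplex.totB_zero,
      MixedComplex.totb_succ, MixedComplex.totB_succ, hb, hB, map_b f hd, map_B f hs ht, map_add,
      map_zero]

end TotMap
end CyclicModule

/-! ### The Künneth connecting homomorphism on chains -/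

open CategoryTheory

section Homology

variable {k : Type w} [CommRing k]

theorem Represents.map {P Q : ChainComplex (ModuleCat.{u} k) ℕ} (f : P ⟶ Q) {n : ℕ} {x : P.X n}
    {a : P.homology n} (h : Represents P x a) :
    Represents Q ((f.f n).hom x) ((HomologicalComplex.homologyMap f n).hom a) := by
  obtain ⟨z, rfl, rfl⟩ := h
  refine ⟨(HomologicalComplex.cyclesMap f n).hom z, ?_, ?_⟩
  · exact congrArg (fun e => e.hom z) (HomologicalComplex.cyclesMap_i f n)
  · exact (congrArg (fun e => e.hom z) (HomologicalComplex.homologyπ_naturality f n)).symm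

/-- The connecting homomorphism of a short exact sequence, on the class of a cycle `z`: if `z` is
the image of `y` and `d y` is the image of `x`, it is the class of `x`. -/
theorem represents_δ {S : ShortComplex (ChainComplex (ModuleCat.{u} k) ℕ)} (hS : S.ShortExact)
    (n : ℕ) (z : S.X₃.cycles (n + 1)) (y : S.X₂.X (n + 1)) (x : S.X₁.X n)
    (hy : (S.g.f (n + 1)).hom y = (S.X₃.iCycles (n + 1)).hom z)
    (hx : (S.f.f n).hom x = (S.X₂.d (n + 1) n).hom y) :
    Represents S.X₁ x ((hS.δ (n + 1) n rfl).hom ((S.X₃.homologyπ (n + 1)).hom z)) := by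
  -- `x` is a cycle, because its image is a boundary and the first map is a monomorphism.
  have hx0 := hS.d_eq_zero_of_f_eq_d_apply (n + 1) n y x hx ((ComplexShape.down ℕ).next n)
  obtain ⟨v, rfl⟩ : ∃ v : S.X₁.cycles n, (S.X₁.iCycles n).hom v = x :=
    ⟨S.X₁.cyclesMk x _ rfl hx0, S.X₁.i_cyclesMk x _ rfl hx0⟩
  -- `δ_apply'` asks for an opcycle of the middle complex over the class of `z`; that of `y` serves,
  -- as `y` lifts `z`.
  refine ⟨v, rfl, (hS.δ_apply' (n + 1) n rfl _ ((S.X₂.pOpcycles (n + 1)).hom y) v ?_ ?_).symm⟩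
  · refine (congrArg (fun e => e.hom y) (HomologicalComplex.p_opcyclesMap S.g (n + 1))).trans ?_
    refine (congrArg (S.X₃.pOpcycles (n + 1)).hom hy).trans ?_
    exact congrArg (fun e => e.hom z) (S.X₃.homology_π_ι (n + 1)).symm
  · refine (ModuleCat.mono_iff_injective (S.X₂.iCycles n)).1 inferInstance ?_
    refine (congrArg (fun e => e.hom v) (HomologicalComplex.cyclesMap_i S.f n)).trans
      (hx.trans ?_)
    exact (congrArg (fun e => e.hom y) ((S.X₂.pOpcycles_opcyclesToCycles_assoc (n + 1) n _).trans
      (S.X₂.toCycles_i (n + 1) n))).symm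

end Homology

namespace MixedComplex

variable {k : Type w} [CommRing k] {C C' : MixedComplex.{u, w} k}

/-- The retraction kills positive powers of `u` on the left, and `B` on the left factor is the only
part of the differential that lowers this power. -/
theorem kuennethR_tensD_bi (n r p s q : ℕ) (x : C.X p) (y : C'.X q) :
    C.kuennethR C' n (tensD C.totD C'.totD 0 n (C.bi C' 0 (n + 1) (r + 1) p s q (x ⊗ₜ y))) =
      C.kuennethR C' n (C.bi C' 0 n r (p + 1) s q (C.B p x ⊗ₜ y)) := by
  rw [tensD_totD]
  rcases p with _ | p <;> rcases q with _ | q <;> rcases s with _ | s <;>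
    simp only [lowerLeft_totb_zero, lowerLeft_totb_succ, lowerLeft_totB_succ, lowerRight_totB_zero,
      lowerRight_totb_zero, lowerRight_totb_succ, lowerRight_totB_succ, kuennethR_succ, map_add,
      map_zsmul, smul_zero, add_zero, zero_add]

variable (C C') in
/-- The connecting homomorphism of the Künneth sequence on chains, given by its splitting. -/
noncomputable def connect (n : ℕ) :
    Tens k C.Tot C'.Tot 2 (n + 1) →ₗ[k] (C.tensor C').Tot n :=
  C.kuennethR C' n ∘ₗ tensD C.totD C'.totD 0 n ∘ₗ C.kuennethT C' (n + 1)

/-- In the lift `∑ u^(a+1) x ⊗ u'^b y` only the term with `a = 0` reaches `u^0`; it has all of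
`u'^s` still on the right, and `B` has been applied to `x`. -/
theorem connect_zero (n p s q : ℕ) (x : C.X p) (y : C'.X q) :
    C.connect C' n (C.bi C' 2 (n + 1) 0 p s q (x ⊗ₜ y)) =
      (C.tensor C').totIn n s (p + 1 + q) (C.tensIn C' (p + 1 + q) (p + 1) q (C.B p x ⊗ₜ y)) := by
  simp only [connect, LinearMap.comp_apply, kuennethT_bi, map_sum, kuennethR_tensD_bi, zero_add]
  rcases s with _ | s
  · rw [Finset.Nat.antidiagonal_zero, Finset.sum_singleton, kuennethR_zero]
  · rw [Finset.Nat.sum_antidiagonal_succ, kuennethR_zero]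
    simp only [kuennethR_succ, Finset.sum_const_zero, add_zero]

/-- All terms of the lift contain at least `u²` on the left, and the differential removes at most
one `u`. -/
theorem connect_succ (n r p s q : ℕ) (x : C.X p) (y : C'.X q) :
    C.connect C' n (C.bi C' 2 (n + 1) (r + 1) p s q (x ⊗ₜ y)) = 0 := by
  simp only [connect, LinearMap.comp_apply, kuennethT_bi, map_sum, kuennethR_tensD_bi, add_right_comm r 1, kuennethR_succ,
    Finset.sum_const_zero]

/-- The boundary of the lift of a cycle is sent by `kuennethJ` to the boundary of that cycle, which
is zero; hence it lies in the image of `kuennethI`, and the retraction finds its preimage. -/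
theorem kuennethI_connect (n : ℕ) (z : Tens k C.Tot C'.Tot 2 (n + 1))
    (hz : tensD C.totD C'.totD 2 n z = 0) : C.kuennethI C' n (C.connect C' n z) =
      tensD C.totD C'.totD 0 n (C.kuennethT C' (n + 1) z) := by
  have h := kuenneth_split n (tensD C.totD C'.totD 0 n (C.kuennethT C' (n + 1) z))
  rwa [kuennethJ_tensD, kuennethJ_T, hz, map_zero, add_zero] at h

/-- The connecting homomorphism of the Künneth sequence on the classes of cycles. -/
theorem represents_kuennethConnecting (p q : ℕ) (x : C.Tot p) (y : C'.Tot q) (a : C.HC p)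
    (b : C'.HC q) (hx : Represents C.total x a) (hy : Represents C'.total y b) :
    Represents (C.tensor C').total
      (C.connect C' (p + q + 1) (tin 2 (p + q + 2) p q (x ⊗ₜ y)))
      (C.kuennethConnecting C' (p + q) (tin 0 (p + q) p q (a ⊗ₜ[k] b))) := by
  obtain ⟨x, rfl, rfl⟩ := hx
  obtain ⟨y, rfl, rfl⟩ := hy
  have hc : C.kuennethConnecting C' (p + q) (tin 0 (p + q) p q
      ((C.total.homologyπ p).hom x ⊗ₜ[k] (C'.total.homologyπ q).hom y)) =
      ((C.kuennethSequence_shortExact C').δ (p + q + 2) (p + q + 1) rfl).hom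
        (((C.totTens C' 2).homologyπ (p + q + 2)).hom
          (C.crossCycle C' 2 (p + q + 1) p q (x ⊗ₜ y))) := by
    refine (congrArg ((C.kuennethSequence_shortExact C').δ (p + q + 2) (p + q + 1) rfl).hom
      (tensDesc_tin (X := fun i => C.HC i) (Y := fun j => C'.HC j) (c := 0) (by omega)
        (fun i j => TensorProduct.lift (C.cross C' (p + q + 1) i j)) _)).trans ?_
    exact congrArg _ (cross_class C C' (p + q + 1) p q x y)
  rw [hc]
  -- The lift of `x ⊗ y` is its image under the section, and the preimage of the boundary of this
  -- lift is `connect`.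
  refine represents_δ (C.kuennethSequence_shortExact C') (p + q + 1) _
    (C.kuennethT C' (p + q + 2) (tin 2 (p + q + 2) p q (C.cyc p x ⊗ₜ C'.cyc q y))) _ ?_ ?_
  · exact (kuennethJ_T _ _).trans (iCycles_crossCycle C C' 2 (p + q + 1) p q x y).symm
  · refine Eq.trans ?_ (congrArg (fun e => e.hom (C.kuennethT C' (p + q + 2)
      (tin 2 (p + q + 2) p q (C.cyc p x ⊗ₜ C'.cyc q y)))) (totTens_d C C' 0 (p + q + 1))).symm
    exact kuennethI_connect (p + q + 1) _ (tensD_cyc C C' 2 (p + q + 1) p q x y)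

end MixedComplex

end HopfCyclic

/-! ### The product as the boundary map -/

namespace HopfCyclic
open CategoryTheory

namespace CyclicModule

variable {k : Type w} [CommRing k] (C C' : CyclicModule.{u, w} k)

theorem starTot_zero (p q i s j : ℕ) (hi : 2 * 0 + i = p) (hj : 2 * s + j = q)
    (x : C.normalized.X i) (y : C'.normalized.X j) :
    C.starTot C' p q (C.normalized.totIn p 0 i x) (C'.normalized.totIn q s j y) =
      (C.diag C').normalized.totIn (p + q + 1) s (i + 1 + j)
        (C.sh C' rfl (C.normalized.B i x ⊗ₜ y)) := by
  rw [starTot, MixedComplex.totDesc_totIn _ hi, LinearMap.flip_apply,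
    MixedComplex.totDesc_totIn _ hj]
  rfl

theorem starTot_succ (p q r i : ℕ) (hi : 2 * (r + 1) + i = p) (x : C.normalized.X i) :
    C.starTot C' p q (C.normalized.totIn p (r + 1) i x) = 0 := by
  rw [starTot, MixedComplex.totDesc_totIn _ hi]
  rfl

/-- For `s > 0` the map `S̃h` also has the component `sh' (B x ⊗ y)`, which is zero by `sh'_B_left`.
-/
theorem shTot_connect_zero (n i s j : ℕ) (x : C.normalized.X i) (y : C'.normalized.X j) :
    C.shTot C' n (C.normalized.connect C'.normalized n
      (C.normalized.bi C'.normalized 2 (n + 1) 0 i s j (x ⊗ₜ y))) =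
      (C.diag C').normalized.totIn n s (i + 1 + j) (C.sh C' rfl (C.normalized.B i x ⊗ₜ y)) := by
  rw [MixedComplex.connect_zero]
  rcases s with _ | s
  · rw [shTot_zero, shAll_tensIn C C' rfl]
  · rw [shTot_succ, shAll_tensIn C C' rfl, shAll'_tensIn C C' rfl, sh'_B_left, map_zero, add_zero]

/-- An identity between chains, with no cycle condition; it carries the comparison of the product
with the boundary map. -/
theorem shTot_connect (p q : ℕ) (x : C.normalized.Tot p) (y : C'.normalized.Tot q) :
    C.shTot C' (p + q + 1) (C.normalized.connect C'.normalized (p + q + 1)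
      (tin 2 (p + q + 1 + 1) p q (x ⊗ₜ y))) = C.starTot C' p q x y := by
  suffices h : (TensorProduct.mk k (C.normalized.Tot p) (C'.normalized.Tot q)).compr₂
      (C.shTot C' (p + q + 1) ∘ₗ C.normalized.connect C'.normalized (p + q + 1) ∘ₗ
        tin 2 (p + q + 1 + 1) p q) = C.starTot C' p q from congrArg (fun e => e x y) h
  refine MixedComplex.tot_ext _ fun r i hi x => MixedComplex.tot_ext _ fun s j hj y => ?_
  simp only [LinearMap.compr₂_apply, TensorProduct.mk_apply, LinearMap.comp_apply]
  rw [MixedComplex.tin_totIn _ _ _ _ _ _ _ _ hi hj]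
  rcases r with _ | r
  · rw [shTot_connect_zero, starTot_zero C C' p q i s j hi hj]
  · rw [MixedComplex.connect_succ, map_zero, starTot_succ C C' p q r i hi, LinearMap.zero_apply]

/-- The shuffle map of total complexes. -/
noncomputable def shHom :
    (C.normalized.tensor C'.normalized).total ⟶ (C.diag C').normalized.total :=
  ChainComplex.ofHom (fun n => ModuleCat.ofHom (C.shTot C' n)) (fun n => by
    rw [MixedComplex.total_d, MixedComplex.total_d]
    ext1
    exact LinearMap.ext fun z => C.totD_shTot C' n z)

theorem represents_starTot (p q : ℕ) (x : C.normalized.Tot p) (y : C'.normalized.Tot q)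
    (a : C.normalized.HC p) (b : C'.normalized.HC q) (hx : Represents C.normalized.total x a)
    (hy : Represents C'.normalized.total y b) :
    Represents (C.diag C').normalized.total (C.starTot C' p q x y)
      ((HomologicalComplex.homologyMap (C.shHom C') (p + q + 1)).hom
        (C.normalized.kuennethConnecting C'.normalized (p + q)
          (tin 0 (p + q) p q (a ⊗ₜ[k] b)))) := by
  rw [← shTot_connect]
  exact (MixedComplex.represents_kuennethConnecting p q x y a b hx hy).map (C.shHom C')

end CyclicModule

section Main

variable {k : Type w} [Field k] {H K : Type u} [Ring H] [HopfAlgebra k H] [Ring K]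
  [HopfAlgebra k K] {M N : Type u} [AddCommGroup M] [Module k M] [AddCommGroup N] [Module k N]
  {hS : Function.Bijective (HopfAlgebra.antipode k (A := H))}
  {hT : Function.Bijective (HopfAlgebra.antipode k (A := K))}

theorem totD_omegaInvTot (A : SAYD k H M hS) (B : SAYD k K N hT) (n : ℕ)
    (z : (A.diagMixed B).Tot (n + 1)) :
    (A.tensor B).mixed.totD n (omegaInvTot A B (n + 1) z) =
      omegaInvTot A B n ((A.diagMixed B).totD n z) := by
  refine CyclicModule.totD_totMap (C := (hopfCyclic A).diag (hopfCyclic B))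
    (C' := hopfCyclic (A.tensor B)) (omegaInv A B) (fun m i x => omegaInv_s A B m i x) ?_ ?_ n z
  · exact fun m i x => omegaInv_d A B m i x
  · exact fun m x => omegaInv_t A B m x

/-- The map of total complexes induced by the inverse of `Ω`. -/
noncomputable def omegaInvHom (A : SAYD k H M hS) (B : SAYD k K N hT) :
    (A.diagMixed B).total ⟶ (A.tensor B).mixed.total :=
  ChainComplex.ofHom (fun n => ModuleCat.ofHom (omegaInvTot A B n)) (fun n => by
    rw [MixedComplex.total_d, MixedComplex.total_d]
    ext1
    exact LinearMap.ext fun z => totD_omegaInvTot A B n z)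

/-- The product `⋆` on cyclic homology. -/
noncomputable def starHom (A : SAYD k H M hS) (B : SAYD k K N hT) (p q : ℕ) :
    A.mixed.HC p →ₗ[k] B.mixed.HC q →ₗ[k] (A.tensor B).mixed.HC (p + q + 1) :=
  (TensorProduct.mk k (A.mixed.HC p) (B.mixed.HC q)).compr₂
    (kuennethBoundary A B ((hopfCyclic A).shHom (hopfCyclic B)) (omegaInvHom A B) (p + q) ∘ₗ
      tin (X := fun i => A.mixed.HC i) (Y := fun j => B.mixed.HC j) 0 (p + q) p q)

/-- Since `starHom` is the boundary map itself, this says that the boundary class has the chain `⋆`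
as a representing cycle. In particular `⋆` of two cycles is a cycle, and its class depends only on
their classes. -/
theorem represents_starHom (A : SAYD k H M hS) (B : SAYD k K N hT) (p q : ℕ) (x : A.mixed.Tot p)
    (y : B.mixed.Tot q) (a : A.mixed.HC p) (b : B.mixed.HC q)
    (hx : Represents A.mixed.total x a) (hy : Represents B.mixed.total y b) :
    Represents (A.tensor B).mixed.total (starProduct A B p q x y) (starHom A B p q a b) :=
  ((hopfCyclic A).represents_starTot (hopfCyclic B) p q x y a b hx hy).map (omegaInvHom A B)

end Main
end HopfCyclic

theorem mainTheorem12 {k : Type w} [Field k] [CharZero k] {H K M N : Type u}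
    [Ring H] [HopfAlgebra k H] [Ring K] [HopfAlgebra k K]
    [AddCommGroup M] [Module k M] [AddCommGroup N] [Module k N]
    (hS : Function.Bijective (HopfAlgebra.antipode k (A := H)))
    (hT : Function.Bijective (HopfAlgebra.antipode k (A := K)))
    (A : HopfCyclic.SAYD k H M hS) (B : HopfCyclic.SAYD k K N hT) :
    ∃ (Sh : (A.mixed.tensor B.mixed).total ⟶ (A.diagMixed B).total)
      (Om : (A.diagMixed B).total ⟶ (A.tensor B).mixed.total)
      (star : ∀ p q : ℕ, A.mixed.HC p →ₗ[k] B.mixed.HC q →ₗ[k] (A.tensor B).mixed.HC (p + q + 1)),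
      (∀ n, (Sh.f n).hom =
        (HopfCyclic.hopfCyclic A).shTot (HopfCyclic.hopfCyclic B) n) ∧
      (∀ n, (Om.f n).hom = HopfCyclic.omegaInvTot A B n) ∧
      (∀ (p q : ℕ) (x : A.mixed.Tot p) (y : B.mixed.Tot q) (a : A.mixed.HC p) (b : B.mixed.HC q),
        HopfCyclic.Represents A.mixed.total x a → HopfCyclic.Represents B.mixed.total y b →
        HopfCyclic.Represents (A.tensor B).mixed.total (HopfCyclic.starProduct A B p q x y)
          (star p q a b)) ∧
      ∀ (p q : ℕ) (a : A.mixed.HC p) (b : B.mixed.HC q),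
        HopfCyclic.kuennethBoundary A B Sh Om (p + q) (HopfCyclic.tin 0 (p + q) p q (a ⊗ₜ[k] b)) =
          star p q a b := by
  refine ⟨(HopfCyclic.hopfCyclic A).shHom (HopfCyclic.hopfCyclic B), HopfCyclic.omegaInvHom A B,
    fun p q => HopfCyclic.starHom A B p q, fun n => rfl, fun n => rfl,
    fun p q x y a b hx hy => HopfCyclic.represents_starHom A B p q x y a b hx hy,
    -- The product on homology is defined as the boundary map, so the equality is definitional; the
    -- preceding component identifies this product with the one induced by the chain formula.
    fun p q a b => rfl⟩
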